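/- **Setting.** Let $s,d\ge 1$. A point of $\mathsf{EMD}_s(\{0,1\}^d)$ is an $s$-tuple $x=(x_1,\dots,x_s)$ of elements of $\{0,1\}^d$, and $\mathsf{EMD}(x,y)=\min_\pi\sum_{i=1}^s\|x_i-y_{\pi(i)}\|_1$ over bijections $\pi:[s]\to[s]$. Fix an integer $\kappa\ge 2$ and put $L=\kappa\lceil\log_2 d\rceil$. *Local density.* For $\tau>0$ and $\ell\ge 0$ a draw $h\sim\mathcal H(\tau,\ell)$ takes $2^\ell$ independent uniform coordinates $i_1,\dots,i_{2^\ell}\in[d]$, lets $\varphi(a)=(a_{i_1},\dots,a_{i_{2^\ell}})$, takes independent $C_{u,k}\sim\mathrm{Ber}(\min\{1,d/(\tau2^{\ell+1})\})$ for $u\in\{0,1\}^{2^\ell}$, $k\in[s]$, and sets $h(x)=(C_{u,k}\cdot\mathbf 1\{\text{at least }k\text{ elements }a\text{ of }x\text{ have }\varphi(a)=u\})_{u,k}$. A point $x$ is $(\alpha,\tau)$-locally-dense with respect to a distribution $\mu$ on points if $\Pr_{u\sim\mu,\,h\sim\mathcal H(\tau,\ell)}[h(x)=h(u)]\ge\alpha$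 for all $\ell\in\{0,\dots,L\}$. *The hash family.* $\textsc{SampleTree}(\mu,m)$ with scale $\xi$ takes $y_1,\dots,y_m\sim\mu$ independently, lets $\hat\Omega$ be the set of elements of $\{0,1\}^d$ at $\ell_1$-distance at most $1$ from some element of some $y_i$, and builds the rooted tree $T$ of depth $L+1$ in which the depth-$\ell$ node on the path of $a\in\{0,1\}^d$ is given by $(\varphi_0(a),\dots,\varphi_{\ell-1}(a))$; here $\varphi_\ell$ for $\ell<L$ is the projection to $2^\ell$ independent uniform coordinates and $\varphi_L$ is the identity. An edge from $v$ at depth $\ell$ to a child $v'$ has weight $\mathbb E\|c-c'\|_1$, for independent uniform $c,c'$ among the elements of $\hat\Omega$ below $v$, $v'$ respectively, if there is an element of $\hat\Omega$ below $v'$, and weight $\xi d/2^\ell$ otherwise. The map $\psi_T$ sends $x$ to the vector with coordinates (weight of $e$)$\,\cdot\,\#\{i: x_i\text{ below }e\}$, over the edges $e$ of $T$. For $\gamma>0$ the $\ell_1$ locality-sensitive hash is the randomly shifted grid $z\mapsto(\lfloor z_e/\gamma+u_e\rfloor)_e$ with independent $u_e$ uniform in $[0,1]$. Let $\mathcal H(\mu,m,\xi,\gamma)$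 be the family of maps $x\mapsto(\lfloor\psi_T(x)_e/\gamma+u_e\rfloor)_e$. **Lemma.** There are constants $C_0,C_1,C_2,C_3$ depending only on $\kappa$, a function $m=m(s,d,\alpha)\in\mathbb N$, and two fixed programs for a randomized real RAM, such that the following holds for all $s,d\ge1$, every distribution $\mu$ on $\mathsf{EMD}_s(\{0,1\}^d)$, and all $\alpha,\tau,\gamma>0$ and $\delta\in(0,1)$. Put $\mathcal H=\mathcal H(\mu,\tau,\gamma,\delta)=\mathcal H(\mu,m,\xi,\gamma)$ with $\xi=C_0\log(msd/\delta)$, and $$\lambda=C_1\log z\,(\log\log z)^{C_2},\qquad z=\max\Big\{\frac{sd}{\delta\alpha},16\Big\}.$$ * **Close points collide.** For all points $x,y$, if $x$ is $(\alpha,\tau)$-locally-dense with respect to $\mu$, then $$\Pr_{h\sim\mathcal H}[h(x)\ne h(y)]\le\frac{\mathsf{EMD}(x,y)}{\gamma}\cdot\lambda\cdot\Big(1+\log\Big(\frac{\tau+s}{\mathsf{EMD}(x,y)}+1\Big)\Big),$$ where the right-hand side is read as $0$ if $\mathsf{EMD}(x,y)=0$. * **Far points separate.** For all points $x,y$, $\Pr_{h\sim\mathcal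 H}[h(x)=h(y)]\le\exp(-\mathsf{EMD}(x,y)/\gamma)+\delta$. * **Data structure.** Given $s,d,\alpha,\tau,\gamma,\delta$ and $\mu$ as a list of $n$ points with their probabilities, the first program initializes, and the second answers queries of, a data structure that maintains a draw $h\sim\mathcal H$. Almost surely the initialization takes time at most $n\cdot C_3\,(sd/\min\{\alpha,1\})^{C_3}$, and every query $x$, after any finite sequence of earlier queries, is answered in time at most $C_3(sd)^{C_3}$ by a name of $h(x)$; for each draw $h$, different hash values have different names. The randomized real RAM has arrays of natural numbers (addition, truncated subtraction, comparison, indirect addressing), arrays of real numbers (addition, subtraction, multiplication, division, logarithm, comparison; no rounding), and read-only arrays of independent uniform random numbers in $[0,1]$, which stand for random numbers generated on demand and stored. Each elementary operation costs one time unit. -/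

import Mathlib

open MeasureTheory ProbabilityTheory

noncomputable section

/-! ### Points and the Earth Mover's Distance -/

/-- The hypercube `{0,1}^d`; its `ℓ₁` metric is `hammingDist`. -/
abbrev Cube (d : ℕ) : Type := Fin d → Bool

/-- Points of `EMD_s({0,1}^d)`: size-`s` tuples of elements of the hypercube. -/
abbrev Point (s d : ℕ) : Type := Fin s → Cube d

/-- `EMD(x, y) = min_π ∑ i, ‖x_i - y_{π(i)}‖₁` over the bijections `π` of `[s]`. -/
def emd {s d : ℕ} (x y : Point s d) : ℝ :=
  ⨅ π : Equiv.Perm (Fin s), ∑ i, (hammingDist (x i) (y (π i)) : ℝ)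

/-! ### Hash families -/

/-- A hash family: a distribution over maps `X → U`, given as a random seed
together with the map determined by each value of the seed. -/
structure HashFamily (X U : Type) where
  /-- the values of the seed -/
  Seed : Type
  [seedSpace : MeasurableSpace Seed]
  /-- the distribution of the seed -/
  law : Measure Seed
  [prob : IsProbabilityMeasure law]
  /-- the map that belongs to a seed -/
  hash : Seed → X → U

attribute [instance] HashFamily.seedSpace HashFamily.prob

/-- `Pr_h[h(x) = h(y)]`. -/
def HashFamily.collide {X U : Type} (H : HashFamily X U) (x y : X) : ℝ :=
  H.law.real {ω | H.hash ω x = H.hash ω y}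

/-- `Pr_h[h(x) ≠ h(y)]`. -/
def HashFamily.separate {X U : Type} (H : HashFamily X U) (x y : X) : ℝ :=
  H.law.real {ω | H.hash ω x ≠ H.hash ω y}

/-- The uniform distribution on `[d]`. -/
def unifCoord (d : ℕ) [NeZero d] : Measure (Fin d) := (PMF.uniformOfFintype (Fin d)).toMeasure

instance (d : ℕ) [NeZero d] : IsProbabilityMeasure (unifCoord d) := by
  unfold unifCoord; infer_instance

/-! ### The data-independent hash families and local density -/

/-- `χ(x, u, k)`: at least `k` elements `a` of `x` satisfy `φ(a) = u`, where `φ` is the projection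
to the coordinates `i`. The index `k : Fin s` stands for the number `k + 1 ∈ {1, …, s}`. -/
def chi {s d t : ℕ} (i : Fin t → Fin d) (x : Point s d) (u : Fin t → Bool) (k : Fin s) : Bool :=
  decide ((k : ℕ) + 1 ≤ (Finset.univ.filter fun p : Fin s => (fun q => x p (i q)) = u).card)

/-- The success probability `d / (τ 2^{ℓ+1})`, cut off at `1`. -/
def levelProb (d : ℕ) (τ : ℝ) (ℓ : ℕ) : unitInterval :=
  Set.projIcc 0 1 zero_le_one ((d : ℝ) / (τ * 2 ^ (ℓ + 1)))

/-- The hash family `H(τ, ℓ)`. A seed consists of `2^ℓ` coordinates, which are independent and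
uniform in `[d]`, and of independent Bernoulli variables `C_{u,k}`; the hash value of `x` is
`(C_{u,k} · χ(x, u, k))_{u,k}`. -/
def levelFamily (s d : ℕ) [NeZero d] (τ : ℝ) (ℓ : ℕ) :
    HashFamily (Point s d) ((Fin (2 ^ ℓ) → Bool) × Fin s → Bool) where
  Seed := (Fin (2 ^ ℓ) → Fin d) × ((Fin (2 ^ ℓ) → Bool) × Fin s → Bool)
  law := (Measure.pi fun _ => unifCoord d).prod
    (Measure.pi fun _ => bernoulliMeasure true false (levelProb d τ ℓ))
  hash := fun ω x p => ω.2 p && chi ω.1 x p.1 p.2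

/-- `x` is `(α, τ)`-locally-dense with respect to `μ`, with the levels `0, …, L`: for every level,
`Pr[h(x) = h(u)] ≥ α` over independent `u ∼ μ` and `h ∼ H(τ, ℓ)`. -/
def LocallyDense {s d : ℕ} [NeZero d] (L : ℕ) (μ : PMF (Point s d)) (α τ : ℝ)
    (x : Point s d) : Prop :=
  ∀ ℓ ≤ L, α ≤ (μ.toMeasure.prod (levelFamily s d τ ℓ).law).real
    {p | (levelFamily s d τ ℓ).hash p.2 x = (levelFamily s d τ ℓ).hash p.2 p.1}

/-! ### The tree `SampleTree(μ, m)`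

The coordinates `j` define the projections `φ_0, …, φ_{L-1}`, where `φ_ℓ` reads `2^ℓ` coordinates;
`φ_L` is the identity. A node at depth `ℓ` is named by the labels `φ_0(a), …, φ_{ℓ-1}(a)` on the
path from the root to it. -/

/-- The coordinates that define `φ_0, …, φ_{L-1}`. -/
abbrev Coords (L d : ℕ) : Type := (ℓ : Fin L) → Fin (2 ^ (ℓ : ℕ)) → Fin d

/-- `φ_ℓ(a)`, for `ℓ ≤ L`. -/
def label {L d : ℕ} (j : Coords L d) (a : Cube d) (ℓ : ℕ) : List Bool :=
  if h : ℓ < L then List.ofFn fun k => a (j ⟨ℓ, h⟩ k) else List.ofFn a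

/-- Names of the nodes of the tree. -/
abbrev Node : Type := List (List Bool)

/-- The node `v_ℓ(a)` at depth `ℓ ≤ L + 1` on the path from the root to the leaf of `a`. -/
def nodeAt {L d : ℕ} (j : Coords L d) (a : Cube d) (ℓ : ℕ) : Node :=
  (List.range ℓ).map (label j a)

/-- `Elms(v)`: the elements whose path to their leaf passes through `v`. -/
def elms {L d : ℕ} (j : Coords L d) (v : Node) : Finset (Cube d) :=
  Finset.univ.filter fun b => nodeAt j b v.length = v

/-- `Nbr(y_1 ∪ … ∪ y_m)`: the elements at distance at most `1` from an element of a `y_i`. -/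
def sampleNbr {m s d : ℕ} (y : Fin m → Point s d) : Finset (Cube d) :=
  Finset.univ.filter fun b' => ∃ i k, hammingDist (y i k) b' ≤ 1

/-- The mean of `‖c - c'‖₁` over independent uniform `c ∈ A` and `c' ∈ B`. -/
def avgDist {d : ℕ} (A B : Finset (Cube d)) : ℝ :=
  (∑ c ∈ A, ∑ c' ∈ B, (hammingDist c c' : ℝ)) / ((A.card : ℝ) * (B.card : ℝ))

/-- The weight of the edge from the parent `v.dropLast`, at depth `v.length - 1`, to `v`. -/
def edgeWeight {L d : ℕ} (j : Coords L d) (W : Finset (Cube d)) (ξ : ℝ) (v : Node) : ℝ :=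
  if (elms j v ∩ W).Nonempty then avgDist (elms j v.dropLast ∩ W) (elms j v ∩ W)
  else (d : ℝ) / 2 ^ (v.length - 1) * ξ

/-- The embedding `ψ_T` of `EMD_s(T)` into `ℓ₁`, with one coordinate for each edge of `T`, named by
the lower end of the edge: the weight of the edge times the number of elements of `x` below it. -/
def treeEmbed {L s d : ℕ} (j : Coords L d) (W : Finset (Cube d)) (ξ : ℝ) (x : Point s d)
    (v : Node) : ℝ :=
  if 1 ≤ v.length ∧ v.length ≤ L + 1 then
    edgeWeight j W ξ v * ((Finset.univ.filter fun p : Fin s => x p ∈ elms j v).card : ℝ)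
  else 0

/-- The locality-sensitive hash of `ℓ₁` by a randomly shifted grid of cells of side `γ`:
the coordinate `z_v` is mapped to `⌊z_v / γ + u_v⌋`, where the `u_v` are uniform in `[0,1]`. -/
def gridHash (γ : ℝ) (u : Node → unitInterval) (z : Node → ℝ) : Node → ℤ :=
  fun v => ⌊z v / γ + (u v : ℝ)⌋

/-- The hash family that takes samples `y_1, …, y_m ∼ μ`, runs `QuadTree(Nbr(y_1 ∪ … ∪ y_m), ξ)`
with depth `L + 1`, embeds the tree into `ℓ₁`, and applies the grid hash with parameter `γ`. -/
def sampleTreeFamily {s d : ℕ} [NeZero d] (L : ℕ) (μ : PMF (Point s d)) (m : ℕ) (ξ γ : ℝ) :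
    HashFamily (Point s d) (Node → ℤ) where
  Seed := (Fin m → Point s d) × Coords L d × (Node → unitInterval)
  law := (Measure.pi fun _ => μ.toMeasure).prod
    ((Measure.pi fun _ => Measure.pi fun _ => unifCoord d).prod
      (Measure.infinitePi fun _ => (volume : Measure unitInterval)))
  hash := fun ω x => gridHash γ ω.2.2 (treeEmbed ω.2.1 (sampleNbr ω.1) ξ x)

/-- `C₁ log z (log log z)^{C₂}`, where `z` is replaced by `16` if it is smaller
(so that `log log z ≥ 1`). -/
def quasiLog (C₁ : ℝ) (C₂ : ℕ) (z : ℝ) : ℝ :=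
  C₁ * Real.log (max z 16) * Real.log (Real.log (max z 16)) ^ C₂

/-! ### The machine model: a randomized real RAM

The machine has arrays of natural numbers and arrays of real numbers, with three indices each, and
read-only arrays of independent uniform random numbers in `[0,1]`. Natural numbers can be added,
subtracted and compared; real numbers can be added, subtracted, multiplied, divided and compared,
and a logarithm can be taken. There is no rounding of real numbers and no multiplication of natural
numbers. Every elementary operation costs one time unit. A program is a finite text that does not
depend on the input. -/

/-- The random arrays. -/
abbrev Tape : Type := ℕ × ℕ × ℕ → unitInterval

/-- The entries of the random arrays are independent and uniform in `[0,1]`. -/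
def tapeLaw : Measure Tape := Measure.infinitePi fun _ => (volume : Measure unitInterval)

/-- The memory: `nat (A, i, j, k)` is the entry `i, j, k` of the array `A`. -/
structure Memory where
  nat : ℕ × ℕ × ℕ × ℕ → ℕ
  real : ℕ × ℕ × ℕ × ℕ → ℝ

/-- Expressions for natural numbers. -/
inductive NatExpr where
  | const (c : ℕ)
  | read (A : ℕ) (i j k : NatExpr)
  | add (e f : NatExpr)
  | sub (e f : NatExpr)

/-- The value of an expression; subtraction is cut off at `0`. -/
def NatExpr.eval (σ : Memory) : NatExpr → ℕ
  | const c => c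
  | read A i j k => σ.nat (A, i.eval σ, j.eval σ, k.eval σ)
  | add e f => e.eval σ + f.eval σ
  | sub e f => e.eval σ - f.eval σ

/-- The number of operations in an expression. -/
def NatExpr.cost : NatExpr → ℕ
  | const _ => 1
  | read _ i j k => 1 + i.cost + j.cost + k.cost
  | add e f => 1 + e.cost + f.cost
  | sub e f => 1 + e.cost + f.cost

/-- Expressions for real numbers; `rand` reads an entry of the random arrays. -/
inductive RealExpr where
  | cast (e : NatExpr)
  | read (A : ℕ) (i j k : NatExpr)
  | rand (i j k : NatExpr)
  | add (e f : RealExpr)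
  | sub (e f : RealExpr)
  | mul (e f : RealExpr)
  | div (e f : RealExpr)
  | log (e : RealExpr)

/-- The value of an expression. -/
def RealExpr.eval (ω : Tape) (σ : Memory) : RealExpr → ℝ
  | cast e => (e.eval σ : ℝ)
  | read A i j k => σ.real (A, i.eval σ, j.eval σ, k.eval σ)
  | rand i j k => (ω (i.eval σ, j.eval σ, k.eval σ) : ℝ)
  | add e f => e.eval ω σ + f.eval ω σ
  | sub e f => e.eval ω σ - f.eval ω σ
  | mul e f => e.eval ω σ * f.eval ω σ
  | div e f => e.eval ω σ / f.eval ω σ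
  | log e => Real.log (e.eval ω σ)

/-- The number of operations in an expression. -/
def RealExpr.cost : RealExpr → ℕ
  | cast e => 1 + e.cost
  | read _ i j k => 1 + i.cost + j.cost + k.cost
  | rand i j k => 1 + i.cost + j.cost + k.cost
  | add e f => 1 + e.cost + f.cost
  | sub e f => 1 + e.cost + f.cost
  | mul e f => 1 + e.cost + f.cost
  | div e f => 1 + e.cost + f.cost
  | log e => 1 + e.cost

/-- Comparisons. -/
inductive Test where
  | natLe (e f : NatExpr)
  | realLe (e f : RealExpr)

/-- The outcome of a comparison. -/
def Test.holds (ω : Tape) (σ : Memory) : Test → Prop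
  | natLe e f => e.eval σ ≤ f.eval σ
  | realLe e f => e.eval ω σ ≤ f.eval ω σ

/-- The number of operations in a comparison. -/
def Test.cost : Test → ℕ
  | natLe e f => 1 + e.cost + f.cost
  | realLe e f => 1 + e.cost + f.cost

/-- Programs. -/
inductive Prog where
  | skip
  | setNat (A : ℕ) (i j k e : NatExpr)
  | setReal (A : ℕ) (i j k : NatExpr) (e : RealExpr)
  | seq (P Q : Prog)
  | ite (b : Test) (P Q : Prog)
  | loop (b : Test) (P : Prog)

/-- `Exec ω P σ t σ'`: with the random arrays `ω`, the program `P`, started in the memory `σ`,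
halts after exactly `t` time units in the memory `σ'`. `loop b P` repeats `P` while `b` holds. -/
inductive Exec (ω : Tape) : Prog → Memory → ℕ → Memory → Prop where
  | skip (σ : Memory) : Exec ω Prog.skip σ 1 σ
  | setNat (σ : Memory) (A : ℕ) (i j k e : NatExpr) :
      Exec ω (Prog.setNat A i j k e) σ (1 + i.cost + j.cost + k.cost + e.cost)
        { σ with
          nat := Function.update σ.nat (A, i.eval σ, j.eval σ, k.eval σ) (e.eval σ) }
  | setReal (σ : Memory) (A : ℕ) (i j k : NatExpr) (e : RealExpr) :
      Exec ω (Prog.setReal A i j k e) σ (1 + i.cost + j.cost + k.cost + e.cost)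
        { σ with
          real := Function.update σ.real (A, i.eval σ, j.eval σ, k.eval σ) (e.eval ω σ) }
  | seq {P Q : Prog} {σ σ' σ'' : Memory} {t t' : ℕ} :
      Exec ω P σ t σ' → Exec ω Q σ' t' σ'' → Exec ω (Prog.seq P Q) σ (t + t') σ''
  | ite_true {b : Test} {P Q : Prog} {σ σ' : Memory} {t : ℕ} :
      b.holds ω σ → Exec ω P σ t σ' → Exec ω (Prog.ite b P Q) σ (b.cost + t) σ'
  | ite_false {b : Test} {P Q : Prog} {σ σ' : Memory} {t : ℕ} :
      ¬ b.holds ω σ → Exec ω Q σ t σ' → Exec ω (Prog.ite b P Q) σ (b.cost + t) σ'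
  | loop_done {b : Test} {P : Prog} {σ : Memory} :
      ¬ b.holds ω σ → Exec ω (Prog.loop b P) σ b.cost σ
  | loop_step {b : Test} {P : Prog} {σ σ' σ'' : Memory} {t t' : ℕ} :
      b.holds ω σ → Exec ω P σ t σ' → Exec ω (Prog.loop b P) σ' t' σ'' →
        Exec ω (Prog.loop b P) σ (b.cost + t + t') σ''

/-! ### Data structures that maintain a hash function -/

/-- The input of the initialization: `s, d, n` in the array `0` of natural numbers, the bits of the
`n` listed points in the array `1`; `α, τ, γ, δ` in the array `0` of real numbers and the
probabilities of the listed points in the array `1`. All other entries are `0`. -/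
def inputMemory {s d n : ℕ} (pts : Fin n → Point s d) (wt : Fin n → ℝ) (α τ γ δ : ℝ) : Memory where
  nat := fun q =>
    if q = (0, 0, 0, 0) then s
    else if q = (0, 1, 0, 0) then d
    else if q = (0, 2, 0, 0) then n
    else if h : q.1 = 1 ∧ q.2.1 < n ∧ q.2.2.1 < s ∧ q.2.2.2 < d then
      (pts ⟨q.2.1, h.2.1⟩ ⟨q.2.2.1, h.2.2.1⟩ ⟨q.2.2.2, h.2.2.2⟩).toNat
    else 0
  real := fun q =>
    if q = (0, 0, 0, 0) then α
    else if q = (0, 1, 0, 0) then τ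
    else if q = (0, 2, 0, 0) then γ
    else if q = (0, 3, 0, 0) then δ
    else if h : q.1 = 1 ∧ q.2.1 < n ∧ q.2.2 = (0, 0) then wt ⟨q.2.1, h.2.1⟩
    else 0

/-- The bits of the query `x` are written into the array `2`; all else is left as it is. -/
def loadQuery {s d : ℕ} (x : Point s d) (σ : Memory) : Memory :=
  { σ with
    nat := fun q =>
      if h : q.1 = 2 ∧ q.2.1 < s ∧ q.2.2.1 < d ∧ q.2.2.2 = 0 then
        (x ⟨q.2.1, h.2.1⟩ ⟨q.2.2.1, h.2.2.1⟩).toNat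
      else σ.nat q }

/-- The output of a query: a list of natural numbers in the array `3`, its length first. -/
def Memory.output (σ : Memory) : List ℕ :=
  (List.range (σ.nat (3, 0, 0, 0))).map fun k => σ.nat (3, k + 1, 0, 0)

/-- `Served ω query σ σ'`: finitely many queries, answered one after the other by the program
`query`, lead from the memory `σ` to the memory `σ'`. -/
inductive Served {s d : ℕ} (ω : Tape) (query : Prog) (σ : Memory) : Memory → Prop where
  | none : Served ω query σ σ
  | next {σ' σ'' : Memory} {t : ℕ} (x : Point s d) :
      Served ω query σ σ' → Exec ω query (loadQuery x σ') t σ'' → Served ω query σ σ''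

/-- The programs `init` and `query` maintain a draw `h ∼ H`, with initialization time at most
`Tinit` and query time at most `Tquery`, when the input is `σ₀`. The random arrays `ω` determine a
seed `Θ ω`, distributed as the seeds of `H`. Almost surely, `init` halts in time, and afterwards
every query `x`, whatever queries came before it, is answered in time by the name of the bucket
`h(x)`, where `h` is the hash function with seed `Θ ω` and different buckets have different
names. -/
def Maintains {s d : ℕ} {U : Type} (init query : Prog) (σ₀ : Memory)
    (H : HashFamily (Point s d) U) (Tinit Tquery : ℝ) : Prop :=
  ∃ Θ : Tape → H.Seed, MeasurePreserving Θ tapeLaw H.law ∧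
    ∀ᵐ ω ∂tapeLaw, ∃ (t : ℕ) (σ : Memory) (name : U → List ℕ),
      Exec ω init σ₀ t σ ∧ (t : ℝ) ≤ Tinit ∧
      Set.InjOn name (Set.range (H.hash (Θ ω))) ∧
      ∀ σ', Served (s := s) (d := d) ω query σ σ' → ∀ x : Point s d, ∃ (t' : ℕ) (σ'' : Memory),
        Exec ω query (loadQuery x σ') t' σ'' ∧ (t' : ℝ) ≤ Tquery ∧
        σ''.output = name (H.hash (Θ ω) x)

end

/-! The grid turns everything into a statement about the tree embedding. For one coordinate, the two
floors differ by an integer whose mean over the shift is the difference of the two numbers. Hence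
cells differ with probability at most that difference, and agree with probability at most the
exponential of its negative (`grid_cell_bounds`). Over all edges this gives a union bound and a
product bound in terms of `‖ψ(x) - ψ(y)‖₁ / γ`. That norm is the earth mover's distance in the tree
metric: any matching bounds it from above (`sum_abs_treeEmbed_le`), and a matching that maximizes
the total depth of common ancestors attains it (`exists_sum_treeDist_le`).

Far points. Call a tree controlled if elements with a common node at depth `p` have distance at most
`ξ d / 2^p`. Elements at larger distance agree on the `2^p - 1` coordinates above that node with
probability at most `exp(-ξ/2)`, so for `ξ` of order `log(msd/δ)` the tree is controlled outside an
event of probability `δ`. In a controlled tree the tree metric dominates the Hamming metric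
(`hammingDist_le_treeDist`): the mean distance from `a` to its cell is at most the sum of the edge
weights below, by the triangle inequality for averages, and where a cell has no sample the default
weight exceeds the distance.

Close points. The task is to bound the expected tree distance of `a` and `b`, with `D = ‖a - b‖₁`
and `R` the distance from `a` to a nearest sampled element `c`. Levels with `d/2^ℓ ≤ D` form a
geometric sum. On levels with `D < d/2^ℓ ≤ D + R` the separation probability times the controlled
weight is `O(ξ D)`, and there are about `log(1 + R/D)` of them. On coarser levels, either two
coordinates hit the differences among `a, b, c`, which is rare, or exactly one coordinate `q`
separates `a` from `b`, and then `c` with its coordinate `q` changed to that of `a` or of `b` lies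
in the respective cell (`levelDist_le_near`). This is why the neighbours of the samples belong to
the tree. The weight is then bounded by the mean distance from that element to its cell, whose
expectation at scale `r = d/2^p` is `r` times the logarithm of a ratio of ball sizes plus a constant
(`integral_slot_avgTo_le`). Those logarithms telescope over the levels, so their total cost is about
`log |W|` times the number `2 lam` of levels by which the radii are shifted; `lam` is of order `log
log z`, which is the source of the `log log` factor.

Local density gives the total of the `R`'s. If many elements of `x` are far from `u` at level `ℓ`,
the hashes of `x` and `u` differ with high probability; so a random `u` has few far elements with
probability at least `α/2` (`LocallyDense.measure_near_ge`), and `m` samples contain such a `u` for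
every level. Summing over dyadic scales bounds the total distance to the sample
(`sum_sampleDist_le`), and concavity of the logarithm (`sum_mul_log_le`) moves this total inside one
logarithm.

Data structure. The programs list the neighbours of the samples, accumulate sums and counts of
distances per edge, and answer a query from the nodes on the paths of its elements only. Floors may
be too large to compute by counting, but on multiples `c n` of one weight the truncation `min n ⌊c n
+ u⌋` distinguishes exactly what the floor does (`shrink_eq_iff`). Nodes are numbered injectively,
so a list of marked node numbers names the hash value (`hashOut_eq_iff`). The seed is read off three
disjoint planes of the random array, by inversion of distribution functions
(`tape_measurePreserving`). -/

noncomputable section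

/-! ### A program logic for the machine -/

/-- Write one entry of the arrays of natural numbers. -/
def Memory.setNat (σ : Memory) (q : ℕ × ℕ × ℕ × ℕ) (c : ℕ) : Memory :=
  { σ with nat := Function.update σ.nat q c }

/-- Write one entry of the arrays of real numbers. -/
def Memory.setReal (σ : Memory) (q : ℕ × ℕ × ℕ × ℕ) (c : ℝ) : Memory :=
  { σ with real := Function.update σ.real q c }

@[simp] theorem Memory.setNat_nat (σ : Memory) (q q' : ℕ × ℕ × ℕ × ℕ) (c : ℕ) :
    (σ.setNat q c).nat q' = if q' = q then c else σ.nat q' := by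
  simp [Memory.setNat, Function.update_apply]

@[simp] theorem Memory.setNat_real (σ : Memory) (q : ℕ × ℕ × ℕ × ℕ) (c : ℕ) :
    (σ.setNat q c).real = σ.real := rfl

@[simp] theorem Memory.setReal_real (σ : Memory) (q q' : ℕ × ℕ × ℕ × ℕ) (c : ℝ) :
    (σ.setReal q c).real q' = if q' = q then c else σ.real q' := by
  simp [Memory.setReal, Function.update_apply]

@[simp] theorem Memory.setReal_nat (σ : Memory) (q : ℕ × ℕ × ℕ × ℕ) (c : ℝ) :
    (σ.setReal q c).nat = σ.nat := rfl

/-- Execution is deterministic. -/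
theorem Exec.det {ω : Tape} {P : Prog} {σ σ₁ σ₂ : Memory} {t₁ t₂ : ℕ}
    (h₁ : Exec ω P σ t₁ σ₁) (h₂ : Exec ω P σ t₂ σ₂) : t₁ = t₂ ∧ σ₁ = σ₂ := by
  induction h₁ generalizing t₂ σ₂ with
  | skip => cases h₂; exact ⟨rfl, rfl⟩
  | setNat => cases h₂; exact ⟨rfl, rfl⟩
  | setReal => cases h₂; exact ⟨rfl, rfl⟩
  | seq _ _ ih ih' =>
    cases h₂ with
    | seq a b =>
      obtain ⟨rfl, rfl⟩ := ih a
      obtain ⟨rfl, rfl⟩ := ih' b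
      exact ⟨rfl, rfl⟩
  | ite_true hb _ ih =>
    cases h₂ with
    | ite_true _ a => obtain ⟨rfl, rfl⟩ := ih a; exact ⟨rfl, rfl⟩
    | ite_false hn _ => exact absurd hb hn
  | ite_false hb _ ih =>
    cases h₂ with
    | ite_true hn _ => exact absurd hn hb
    | ite_false _ a => obtain ⟨rfl, rfl⟩ := ih a; exact ⟨rfl, rfl⟩
  | loop_done hb =>
    cases h₂ with
    | loop_done => exact ⟨rfl, rfl⟩
    | loop_step hn _ _ => exact absurd hn hb
  | loop_step hb _ _ ih ih' =>
    cases h₂ with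
    | loop_done hn => exact absurd hb hn
    | loop_step _ a b =>
      obtain ⟨rfl, rfl⟩ := ih a
      obtain ⟨rfl, rfl⟩ := ih' b
      exact ⟨rfl, rfl⟩

/-- The arrays of natural numbers that a program may write. -/
def Prog.natWrites : Prog → List ℕ
  | skip => []
  | setNat A _ _ _ _ => [A]
  | setReal _ _ _ _ _ => []
  | seq P Q => P.natWrites ++ Q.natWrites
  | ite _ P Q => P.natWrites ++ Q.natWrites
  | loop _ P => P.natWrites

/-- The arrays of real numbers that a program may write. -/
def Prog.realWrites : Prog → List ℕ
  | skip => []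
  | setNat _ _ _ _ _ => []
  | setReal A _ _ _ _ => [A]
  | seq P Q => P.realWrites ++ Q.realWrites
  | ite _ P Q => P.realWrites ++ Q.realWrites
  | loop _ P => P.realWrites

/-- The memories agree outside the listed arrays. -/
structure Frame (ns rs : List ℕ) (σ σ' : Memory) : Prop where
  nat : ∀ A, A ∉ ns → ∀ q, σ'.nat (A, q) = σ.nat (A, q)
  real : ∀ A, A ∉ rs → ∀ q, σ'.real (A, q) = σ.real (A, q)

theorem Frame.refl (ns rs : List ℕ) (σ : Memory) : Frame ns rs σ σ :=
  ⟨fun _ _ _ => rfl, fun _ _ _ => rfl⟩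

theorem Frame.setNat (σ : Memory) (A : ℕ) (q : ℕ × ℕ × ℕ) (c : ℕ) :
    Frame [A] [] σ (σ.setNat (A, q) c) := by
  refine ⟨fun B hB p => ?_, fun _ _ _ => rfl⟩
  simp only [List.mem_singleton] at hB
  simp [hB]

theorem Frame.trans {ns rs : List ℕ} {σ σ' σ'' : Memory} (h : Frame ns rs σ σ')
    (h' : Frame ns rs σ' σ'') : Frame ns rs σ σ'' :=
  ⟨fun A hA q => (h'.nat A hA q).trans (h.nat A hA q),
    fun A hA q => (h'.real A hA q).trans (h.real A hA q)⟩

theorem Frame.mono {ns rs ns' rs' : List ℕ} {σ σ' : Memory} (h : Frame ns rs σ σ')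
    (hn : ns ⊆ ns') (hr : rs ⊆ rs') : Frame ns' rs' σ σ' :=
  ⟨fun A hA q => h.nat A (fun h' => hA (hn h')) q,
    fun A hA q => h.real A (fun h' => hA (hr h')) q⟩

theorem Exec.frame {ω : Tape} {P : Prog} {σ σ' : Memory} {t : ℕ} (h : Exec ω P σ t σ') :
    Frame P.natWrites P.realWrites σ σ' := by
  induction h with
  | skip => exact Frame.refl _ _ _
  | setNat σ A i j k e =>
    refine ⟨fun B hB q => ?_, fun _ _ _ => rfl⟩
    simp only [Prog.natWrites, List.mem_singleton] at hB
    simp [hB]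
  | setReal σ A i j k e =>
    refine ⟨fun _ _ _ => rfl, fun B hB q => ?_⟩
    simp only [Prog.realWrites, List.mem_singleton] at hB
    simp [hB]
  | seq _ _ ih ih' =>
    exact (ih.mono (by simp [Prog.natWrites]) (by simp [Prog.realWrites])).trans
      (ih'.mono (by simp [Prog.natWrites]) (by simp [Prog.realWrites]))
  | ite_true _ _ ih => exact ih.mono (by simp [Prog.natWrites]) (by simp [Prog.realWrites])
  | ite_false _ _ ih => exact ih.mono (by simp [Prog.natWrites]) (by simp [Prog.realWrites])
  | loop_done => exact Frame.refl _ _ _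
  | loop_step _ _ _ ih ih' => exact ih.trans ih'

/-- `P`, started in `σ`, halts within `T` time units in a memory that satisfies `Q`. -/
def Ex (ω : Tape) (P : Prog) (σ : Memory) (T : ℕ) (Q : Memory → Prop) : Prop :=
  ∃ t σ', Exec ω P σ t σ' ∧ t ≤ T ∧ Q σ'

theorem Ex.mono {ω : Tape} {P : Prog} {σ : Memory} {T T' : ℕ} {Q Q' : Memory → Prop}
    (h : Ex ω P σ T Q) (hT : T ≤ T') (hQ : ∀ σ', Q σ' → Q' σ') : Ex ω P σ T' Q' := by
  obtain ⟨t, σ', h1, h2, h3⟩ := h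
  exact ⟨t, σ', h1, h2.trans hT, hQ _ h3⟩

/-- A postcondition may use the memory before the execution outside the arrays written. -/
theorem Ex.framed {ω : Tape} {P : Prog} {σ : Memory} {T T' : ℕ} {Q Q' : Memory → Prop}
    (h : Ex ω P σ T Q) (hT : T ≤ T')
    (hQ : ∀ σ', Frame P.natWrites P.realWrites σ σ' → Q σ' → Q' σ') : Ex ω P σ T' Q' := by
  obtain ⟨t, σ', h1, h2, h3⟩ := h
  exact ⟨t, σ', h1, h2.trans hT, hQ _ h1.frame h3⟩

theorem Ex.skip {ω : Tape} {σ : Memory} {Q : Memory → Prop} (h : Q σ) : Ex ω Prog.skip σ 1 Q :=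
  ⟨1, σ, Exec.skip σ, le_rfl, h⟩

theorem Ex.setNat {ω : Tape} {σ : Memory} {A : ℕ} {i j k e : NatExpr} {Q : Memory → Prop}
    (h : Q (σ.setNat (A, i.eval σ, j.eval σ, k.eval σ) (e.eval σ))) :
    Ex ω (Prog.setNat A i j k e) σ (1 + i.cost + j.cost + k.cost + e.cost) Q :=
  ⟨_, _, Exec.setNat σ A i j k e, le_rfl, h⟩

theorem Ex.setReal {ω : Tape} {σ : Memory} {A : ℕ} {i j k : NatExpr} {e : RealExpr}
    {Q : Memory → Prop}
    (h : Q (σ.setReal (A, i.eval σ, j.eval σ, k.eval σ) (e.eval ω σ))) :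
    Ex ω (Prog.setReal A i j k e) σ (1 + i.cost + j.cost + k.cost + e.cost) Q :=
  ⟨_, _, Exec.setReal σ A i j k e, le_rfl, h⟩

theorem Ex.seq {ω : Tape} {σ : Memory} {P P' : Prog} {T T' : ℕ} {Q : Memory → Prop}
    (h : Ex ω P σ T fun σ' => Ex ω P' σ' T' Q) : Ex ω (Prog.seq P P') σ (T + T') Q := by
  obtain ⟨t, σ', h1, h2, t', σ'', h3, h4, h5⟩ := h
  exact ⟨_, _, Exec.seq h1 h3, by omega, h5⟩

theorem Ex.setNat_seq {ω : Tape} {σ : Memory} {A : ℕ} {i j k e : NatExpr} {P : Prog} {T : ℕ}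
    {Q : Memory → Prop}
    (h : Ex ω P (σ.setNat (A, i.eval σ, j.eval σ, k.eval σ) (e.eval σ)) T Q) :
    Ex ω (Prog.seq (Prog.setNat A i j k e) P) σ
      (1 + i.cost + j.cost + k.cost + e.cost + T) Q :=
  Ex.seq (Ex.setNat h)

theorem Ex.setReal_seq {ω : Tape} {σ : Memory} {A : ℕ} {i j k : NatExpr} {e : RealExpr}
    {P : Prog} {T : ℕ} {Q : Memory → Prop}
    (h : Ex ω P (σ.setReal (A, i.eval σ, j.eval σ, k.eval σ) (e.eval ω σ)) T Q) :
    Ex ω (Prog.seq (Prog.setReal A i j k e) P) σ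
      (1 + i.cost + j.cost + k.cost + e.cost + T) Q :=
  Ex.seq (Ex.setReal h)

theorem Ex.ite {ω : Tape} {σ : Memory} {b : Test} {P P' : Prog} {T : ℕ} {Q : Memory → Prop}
    (h : b.holds ω σ → Ex ω P σ T Q) (h' : ¬ b.holds ω σ → Ex ω P' σ T Q) :
    Ex ω (Prog.ite b P P') σ (b.cost + T) Q := by
  by_cases hb : b.holds ω σ
  · obtain ⟨t, σ', h1, h2, h3⟩ := h hb
    exact ⟨_, _, Exec.ite_true hb h1, by omega, h3⟩
  · obtain ⟨t, σ', h1, h2, h3⟩ := h' hb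
    exact ⟨_, _, Exec.ite_false hb h1, by omega, h3⟩

/-- A loop whose test fails after exactly `n` rounds. -/
theorem Ex.loop {ω : Tape} {σ : Memory} {b : Test} {P : Prog} (n T : ℕ) (I : ℕ → Memory → Prop)
    (h0 : I 0 σ)
    (step : ∀ k < n, ∀ σ', Frame P.natWrites P.realWrites σ σ' → I k σ' →
      b.holds ω σ' ∧ Ex ω P σ' T (I (k + 1)))
    (exit : ∀ σ', Frame P.natWrites P.realWrites σ σ' → I n σ' → ¬ b.holds ω σ') :
    Ex ω (Prog.loop b P) σ (n * (b.cost + T) + b.cost) (I n) := by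
  -- Induction on the number `r` of rounds still to come, for all starting points of the loop at
  -- once.
  have key : ∀ r k, k + r = n → ∀ σ', Frame P.natWrites P.realWrites σ σ' → I k σ' →
      Ex ω (Prog.loop b P) σ' (r * (b.cost + T) + b.cost) (I n) := by
    intro r
    induction r with
    | zero =>
      rintro k rfl σ' hF hI
      exact ⟨_, _, Exec.loop_done (exit σ' hF hI), by simp, hI⟩
    | succ r ih =>
      intro k hk σ' hF hI
      obtain ⟨hb, t, σ'', h1, h2, h3⟩ := step k (by omega) σ' hF hI
      obtain ⟨t', σ₃, h4, h5, h6⟩ := ih (k + 1) (by omega) σ'' (hF.trans h1.frame) h3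
      exact ⟨_, _, Exec.loop_step hb h1 h4, by rw [Nat.succ_mul]; omega, h6⟩
  exact key n 0 (by omega) σ (Frame.refl _ _ _) h0

/-- The scalar kept in the entry `0, 0, 0` of the array `v`. -/
abbrev sv (v : ℕ) : NatExpr := NatExpr.read v (NatExpr.const 0) (NatExpr.const 0) (NatExpr.const 0)

/-- Assignment to a scalar. -/
abbrev letNat (v : ℕ) (e : NatExpr) : Prog :=
  Prog.setNat v (NatExpr.const 0) (NatExpr.const 0) (NatExpr.const 0) e

/-- `for v = 0, …, N - 1 do P`. -/
def forTo (v : ℕ) (N : NatExpr) (P : Prog) : Prog :=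
  Prog.seq (letNat v (NatExpr.const 0))
    (Prog.loop (Test.natLe ((sv v).add (NatExpr.const 1)) N)
      (Prog.seq P (letNat v ((sv v).add (NatExpr.const 1)))))

@[simp] theorem forTo_natWrites (v : ℕ) (N : NatExpr) (P : Prog) :
    (forTo v N P).natWrites = v :: (P.natWrites ++ [v]) := by
  simp [forTo, Prog.natWrites]

@[simp] theorem forTo_realWrites (v : ℕ) (N : NatExpr) (P : Prog) :
    (forTo v N P).realWrites = P.realWrites := by
  simp [forTo, Prog.realWrites]

/-- The increment of the counter comes after the body has established the invariant, so the
invariant must be insensitive to writes to `v`. The bound `N` is evaluated again before every round,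
hence the demand that its value survives the body. -/
theorem Ex.forTo {ω : Tape} {σ : Memory} {v : ℕ} {N : NatExpr} {P : Prog} (n T : ℕ)
    (I : ℕ → Memory → Prop)
    (hI : ∀ k σ' c, I k σ' → I k (σ'.setNat (v, 0, 0, 0) c))
    (hv : v ∉ P.natWrites)
    (hN : ∀ σ', Frame (v :: P.natWrites) P.realWrites σ σ' → N.eval σ' = n)
    (h0 : I 0 σ)
    (step : ∀ k < n, ∀ σ', Frame (v :: P.natWrites) P.realWrites σ σ' →
      σ'.nat (v, 0, 0, 0) = k → I k σ' → Ex ω P σ' T (I (k + 1))) :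
    Ex ω (forTo v N P) σ (n * (T + N.cost + 17) + N.cost + 12) (I n) := by
  have hset : ∀ σ' c, Frame (v :: P.natWrites) P.realWrites σ' (σ'.setNat (v, 0, 0, 0) c) := by
    intro σ' c
    refine ⟨fun A hA q => ?_, fun _ _ _ => rfl⟩
    simp only [List.mem_cons, not_or] at hA
    simp [hA.1]
  have hloop := Ex.loop (ω := ω) (σ := σ.setNat (v, 0, 0, 0) 0)
    (b := Test.natLe ((sv v).add (NatExpr.const 1)) N)
    (P := Prog.seq P (letNat v ((sv v).add (NatExpr.const 1)))) n (T + 10)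
    (fun k σ' => (I k σ' ∧ σ'.nat (v, 0, 0, 0) = k) ∧ Frame (v :: P.natWrites) P.realWrites σ σ')
    ⟨⟨hI _ _ _ h0, by simp⟩, hset _ _⟩ ?_ ?_
  · refine (Ex.setNat_seq (hloop.mono le_rfl fun _ h => h.1.1)).mono ?_ fun _ h => h
    · simp only [NatExpr.cost, Test.cost]
      have : n * (1 + (1 + (1 + 1 + 1 + 1) + 1) + N.cost + (T + 10)) = n * (T + N.cost + 17) := by
        congr 1; omega
      omega
  · rintro k hk σ' - ⟨⟨h1, h2⟩, h3⟩
    refine ⟨?_, ?_⟩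
    · simp only [Test.holds, NatExpr.eval, h2, hN σ' h3]; omega
    · refine (Ex.seq ((step k hk σ' h3 h2 h1).framed le_rfl fun σ'' hF hI' => ?_) :
        Ex ω (Prog.seq P (letNat v ((sv v).add (NatExpr.const 1)))) σ' (T + 10) _)
      refine (Ex.setNat ?_ : Ex ω (letNat v ((sv v).add (NatExpr.const 1))) σ'' 10 _)
      have hv' : σ''.nat (v, 0, 0, 0) = k := by rw [hF.nat v hv, h2]
      simp only [NatExpr.eval, hv']
      refine ⟨⟨hI _ _ _ hI', by simp⟩, h3.trans (Frame.trans ?_ (hset _ _))⟩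
      exact hF.mono (List.subset_cons_self _ _) (List.Subset.refl _)
  · rintro σ' - ⟨⟨h1, h2⟩, h3⟩
    simp only [Test.holds, NatExpr.eval, h2, hN σ' h3]; omega

/-! ### Numbers of nodes -/

/-- Append a bit to the ternary word of a node. -/
def encBit (c : ℕ) (b : Bool) : ℕ := c + c + c + 1 + b.toNat

/-- Append a label to the ternary word of a node; the digit `0` marks its end. -/
def encLabel (c : ℕ) (l : List Bool) : ℕ :=
  l.foldl encBit c + l.foldl encBit c + l.foldl encBit c

/-- The number of a node. -/
def enc (v : Node) : ℕ := v.foldl encLabel 1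

theorem foldl_encBit_pos {c : ℕ} (hc : 0 < c) (l : List Bool) : 0 < l.foldl encBit c := by
  induction l generalizing c with
  | nil => exact hc
  | cons b l ih => exact ih (by simp [encBit])

theorem enc_append (v : Node) (l : List Bool) : enc (v ++ [l]) = encLabel (enc v) l := by
  simp [enc]

theorem enc_pos (v : Node) : 0 < enc v := by
  induction v using List.reverseRecOn with
  | nil => simp [enc]
  | append_singleton v l ih =>
    have := foldl_encBit_pos ih l
    rw [enc_append, encLabel]; omega

theorem enc_mod (v : Node) : enc v = 1 ∨ enc v % 3 = 0 := by
  induction v using List.reverseRecOn with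
  | nil => simp [enc]
  | append_singleton v l _ => right; rw [enc_append, encLabel]; omega

/-- A bit appends a ternary digit `1` or `2`. Reading from the end, these digits are stripped until
a number is reached that is `1` or a multiple of `3`; a positive number with a nonzero digit
appended is neither, so the place where the label starts is determined. -/
theorem foldl_encBit_inj {c c' : ℕ} (hc : 0 < c) (hc' : 0 < c') (h : c = 1 ∨ c % 3 = 0)
    (h' : c' = 1 ∨ c' % 3 = 0) {l l' : List Bool}
    (hl : l.foldl encBit c = l'.foldl encBit c') : c = c' ∧ l = l' := by
  induction l using List.reverseRecOn generalizing l' with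
  | nil =>
    induction l' using List.reverseRecOn with
    | nil => exact ⟨hl, rfl⟩
    | append_singleton m b _ =>
      have := foldl_encBit_pos hc' m
      simp only [List.foldl_nil, List.foldl_append, List.foldl_cons, encBit] at hl
      cases b <;> simp at hl <;> omega
  | append_singleton m b ih =>
    have := foldl_encBit_pos hc m
    induction l' using List.reverseRecOn with
    | nil =>
      simp only [List.foldl_nil, List.foldl_append, List.foldl_cons, encBit] at hl
      cases b <;> simp at hl <;> omega
    | append_singleton m' b' _ =>
      simp only [List.foldl_nil, List.foldl_append, List.foldl_cons, encBit] at hl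
      have hb : b = b' := by cases b <;> cases b' <;> simp at hl ⊢ <;> omega
      subst hb
      obtain ⟨h1, h2⟩ := ih (l' := m') (by omega)
      exact ⟨h1, by rw [h2]⟩

/-- The digit `0` closes each label and the leading `1` marks the root, so the ternary word can be
parsed from its end, one label at a time. -/
theorem enc_injective : Function.Injective enc := by
  intro v
  induction v using List.reverseRecOn with
  | nil =>
    intro v' h
    induction v' using List.reverseRecOn with
    | nil => rfl
    | append_singleton w l _ =>
      rw [enc_append, encLabel] at h
      simp only [enc, List.foldl_nil] at h
      omega
  | append_singleton v l ih =>
    intro v' h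
    induction v' using List.reverseRecOn with
    | nil =>
      rw [enc_append, encLabel] at h
      simp only [enc, List.foldl_nil] at h
      omega
    | append_singleton w l' _ =>
      rw [enc_append, enc_append, encLabel, encLabel] at h
      obtain ⟨h1, h2⟩ := foldl_encBit_inj (enc_pos v) (enc_pos w) (enc_mod v) (enc_mod w)
        (l := l) (l' := l') (by omega)
      rw [ih h1, h2]

theorem nodeAt_succ {L d : ℕ} (j : Coords L d) (a : Cube d) (ℓ : ℕ) :
    nodeAt j a (ℓ + 1) = nodeAt j a ℓ ++ [label j a ℓ] := by
  simp [nodeAt, List.range_succ]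

theorem nodeAt_length {L d : ℕ} (j : Coords L d) (a : Cube d) (ℓ : ℕ) :
    (nodeAt j a ℓ).length = ℓ := by
  simp [nodeAt]

/-! ### Computing the numbers of the nodes on a path -/

/-- The bit `q` of `a`, as a number. -/
def bitAt {d : ℕ} (a : Cube d) (q : ℕ) : Bool := if h : q < d then a ⟨q, h⟩ else false

/-- The projections `φ_0, …, φ_L` are stored: the lengths of the labels, at most `B`, in the
array `15`, the coordinates that are read in the array `16`, and `L + 1` in the scalar `12`. -/
structure CoordsStored {L d : ℕ} (j : Coords L d) (B : ℕ) (σ : Memory) : Prop where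
  depth : σ.nat (12, 0, 0, 0) = L + 1
  len_le : ∀ ℓ ≤ L, σ.nat (15, ℓ, 0, 0) ≤ B
  coord_lt : ∀ ℓ ≤ L, ∀ k < σ.nat (15, ℓ, 0, 0), σ.nat (16, ℓ, k, 0) < d
  label_eq : ∀ ℓ ≤ L, ∀ a, label j a ℓ =
    (List.range (σ.nat (15, ℓ, 0, 0))).map fun k => bitAt a (σ.nat (16, ℓ, k, 0))

theorem CoordsStored.frame {L d : ℕ} {j : Coords L d} {B : ℕ} {σ σ' : Memory} {ns rs : List ℕ}
    (h : CoordsStored j B σ) (hF : Frame ns rs σ σ') (h12 : 12 ∉ ns) (h15 : 15 ∉ ns)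
    (h16 : 16 ∉ ns) : CoordsStored j B σ' := by
  constructor
  · rw [hF.nat _ h12]; exact h.depth
  · intro ℓ hℓ; rw [hF.nat _ h15]; exact h.len_le ℓ hℓ
  · intro ℓ hℓ k; rw [hF.nat _ h15, hF.nat _ h16]; exact h.coord_lt ℓ hℓ k
  · intro ℓ hℓ a; simp only [hF.nat _ h15, hF.nat _ h16]; exact h.label_eq ℓ hℓ a

/-- The constant `0`. -/
abbrev c0 : NatExpr := NatExpr.const 0

/-- The constant `1`. -/
abbrev c1 : NatExpr := NatExpr.const 1

/-- `a + a + a`. -/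
abbrev thrice (e : NatExpr) : NatExpr := (e.add e).add e

/-- With the bits of `a` in the row `r` of the array `A`, the numbers of the nodes on the path
of `a` are written into the row `r` of the array `O`. -/
def codeProg (A r O : ℕ) : Prog :=
  Prog.seq (Prog.setNat O (sv r) c0 c0 c1)
    (forTo 30 (sv 12)
      (Prog.seq (letNat 32 (NatExpr.read O (sv r) (sv 30) c0))
        (Prog.seq
          (forTo 31 (NatExpr.read 15 (sv 30) c0 c0)
            (letNat 32 (((thrice (sv 32)).add c1).add
              (NatExpr.read A (sv r) (NatExpr.read 16 (sv 30) (sv 31) c0) c0))))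
          (Prog.setNat O (sv r) ((sv 30).add c1) c0 (thrice (sv 32))))))

@[simp] theorem codeProg_natWrites (A r O : ℕ) :
    (codeProg A r O).natWrites = [O, 30, 32, 31, 32, 31, O, 30] := by
  simp [codeProg, Prog.natWrites]

@[simp] theorem codeProg_realWrites (A r O : ℕ) : (codeProg A r O).realWrites = [] := by
  simp [codeProg, Prog.realWrites]

/-- A bound for the running time of `codeProg`. -/
def codeTime (L B : ℕ) : ℕ := (L + 1) * (B * 200 + 200) + 200

/-- The conditions on the array numbers exclude aliasing between the bits, the row index, the output
and the working scalars. Other rows of the output are untouched, which lets callers process one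
element after the other. -/
theorem codeProg_spec {ω : Tape} {σ : Memory} {L d B : ℕ} {j : Coords L d} {A r O row : ℕ}
    (hA : A ∉ [O, 30, 31, 32]) (hO : O ∉ [12, 15, 16, 30, 31, 32]) (hr : r ∉ [O, 30, 31, 32])
    (hc : CoordsStored j B σ) (hrow : σ.nat (r, 0, 0, 0) = row) (a : Cube d)
    (ha : ∀ q < d, σ.nat (A, row, q, 0) = (bitAt a q).toNat) :
    Ex ω (codeProg A r O) σ (codeTime L B) fun σ' =>
      (∀ ℓ ≤ L + 1, σ'.nat (O, row, ℓ, 0) = enc (nodeAt j a ℓ)) ∧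
      ∀ i ≠ row, ∀ p, σ'.nat (O, i, p) = σ.nat (O, i, p) := by
  simp only [List.mem_cons, List.not_mem_nil, or_false, not_or] at hA hO hr
  obtain ⟨hA1, hA2, hA3, hA4⟩ := hA
  obtain ⟨hO1, hO2, hO3, hO4, hO5, hO6⟩ := hO
  obtain ⟨hr1, hr2, hr3, hr4⟩ := hr
  refine Ex.mono (Ex.setNat_seq (Ex.forTo (L + 1) (B * 180 + 120)
      (fun n σ' => (∀ ℓ ≤ n, σ'.nat (O, row, ℓ, 0) = enc (nodeAt j a ℓ)) ∧
        ∀ i ≠ row, ∀ p, σ'.nat (O, i, p) = σ.nat (O, i, p)) ?_ ?_ ?_ ?_ ?_)) ?_ fun _ h => h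
  · intro k σ' c h
    simpa [hO4] using h
  · simp [Prog.natWrites, Ne.symm hO4]
  · intro σ' hF
    have := hF.nat 12 (by simp [Prog.natWrites, Ne.symm hO1]) (0, 0, 0)
    simp only [NatExpr.eval, this]
    simp [Ne.symm hO1, hc.depth]
  · simp only [NatExpr.eval]
    constructor
    · intro ℓ hℓ
      obtain rfl : ℓ = 0 := by omega
      simp [hrow, enc, nodeAt]
    · intro i hi p
      simp [hrow, hi]
  · intro n hn σ₁ hF h30 ⟨hI1, hI2⟩
    have hF' : Frame [O, 30, 31, 32] [] σ σ₁ := by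
      have h1 : Frame [O, 30, 31, 32] [] σ (σ.setNat (O, σ.nat (r, 0, 0, 0), 0, 0) 1) := by
        refine ⟨fun A hA q => ?_, fun _ _ _ => rfl⟩
        simp only [List.mem_cons, not_or] at hA
        simp [hA.1]
      refine h1.trans (hF.mono ?_ ?_)
      · simp [Prog.natWrites]
      · simp [Prog.realWrites]
    have hc' := hc.frame hF' (by simp [Ne.symm hO1]) (by simp [Ne.symm hO2])
      (by simp [Ne.symm hO3])
    have hr' : σ₁.nat (r, 0, 0, 0) = row := by
      rw [hF'.nat _ (by simp [hr1, hr2, hr3, hr4]), hrow]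
    have ha' : ∀ q < d, σ₁.nat (A, row, q, 0) = (bitAt a q).toNat := by
      intro q hq
      rw [hF'.nat _ (by simp [hA1, hA2, hA3, hA4]), ha q hq]
    refine Ex.mono (Ex.setNat_seq (Ex.seq (Ex.framed (T' := B * 170 + 19) (Ex.forTo (σ₁.nat (15, n, 0, 0)) 53
      (fun k σ' => σ'.nat (32, 0, 0, 0) =
        ((List.range k).map fun i => bitAt a (σ₁.nat (16, n, i, 0))).foldl encBit
          (enc (nodeAt j a n))) ?_ ?_ ?_ ?_ ?_) ?_ fun σ₂ hF₂ hI₂ =>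
            Ex.setNat ?_))) ?_ fun _ h => h
    · intro k σ' c h; simpa using h
    · simp [Prog.natWrites]
    · intro σ' hF₂
      simp only [Prog.natWrites, Prog.realWrites] at hF₂
      simp only [NatExpr.eval]
      rw [hF₂.nat 30 (by simp), hF₂.nat 15 (by simp)]
      simp [h30]
    · simp [NatExpr.eval, hr', h30, hI1 n le_rfl]
    · intro k hk σ₂ hF₂ h31 hI₂
      simp only [Prog.natWrites, Prog.realWrites] at hF₂
      refine Ex.mono (Ex.setNat ?_) (by simp [NatExpr.cost]) fun _ h => h
      simp only [NatExpr.eval, Memory.setNat_nat, if_true]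
      rw [hF₂.nat r (by simp [hr3, hr4]), hF₂.nat 30 (by simp), hF₂.nat 16 (by simp),
        hF₂.nat A (by simp [hA3, hA4]), h31, hI₂]
      simp only [Memory.setNat_nat, Prod.mk.injEq, hr4, hA4, false_and, if_false, h30, hr']
      norm_num
      rw [ha' _ (hc'.coord_lt n (by omega) k hk), List.range_succ]
      simp [encBit]
    · simp only [NatExpr.cost]
      have := hc'.len_le n (by omega)
      have : σ₁.nat (15, n, 0, 0) * 80 ≤ B * 80 := Nat.mul_le_mul_right _ this
      omega
    · rw [forTo_natWrites, forTo_realWrites] at hF₂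
      simp only [Prog.natWrites, Prog.realWrites] at hF₂
      have e1 : ∀ i p, σ₂.nat (O, i, p) = σ₁.nat (O, i, p) := by
        intro i p
        rw [hF₂.nat O (by simp [hO5, hO6])]
        simp [hO6]
      have e2 : σ₂.nat (r, 0, 0, 0) = row := by
        rw [hF₂.nat r (by simp [hr3, hr4])]
        simp [hr4, hr']
      have e3 : σ₂.nat (30, 0, 0, 0) = n := by
        rw [hF₂.nat 30 (by simp)]
        simp [h30]
      constructor
      · intro ℓ hℓ
        simp only [NatExpr.eval, Memory.setNat_nat, e2, e3, e1, hI₂]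
        by_cases h : ℓ = n + 1
        · subst h
          rw [nodeAt_succ, enc_append, encLabel, hc'.label_eq n (by omega)]
          simp
        · simp [h, hI1 ℓ (by omega)]
      · intro i hi p
        simp only [NatExpr.eval, Memory.setNat_nat, e2, e3, e1]
        simp [hi, hI2 i hi]
    · simp only [NatExpr.cost]; omega
  · have := Nat.mul_le_mul_left (L + 1)
      (show B * 180 + 120 + (1 + 1 + 1 + 1) + 17 ≤ B * 200 + 200 by omega)
    simp only [codeTime, NatExpr.cost]
    omega

/-! ### The memory after the initialization -/

/-- The number of elements of `x` below `v`. -/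
def below {L s d : ℕ} (j : Coords L d) (x : Point s d) (v : Node) : ℕ :=
  (Finset.univ.filter fun p : Fin s => x p ∈ elms j v).card

/-- What the queries use: the sizes, the projections, the scale `ξ`, the grid size `γ`, and for
each edge, in the arrays `21` and `22`, the sum and the number of the distances that define its
weight. -/
structure Ready (s : ℕ) {L d : ℕ} (j : Coords L d) (W : Finset (Cube d)) (ξ γ : ℝ) (B : ℕ)
    (σ : Memory) : Prop where
  size : σ.nat (0, 0, 0, 0) = s
  dim : σ.nat (0, 1, 0, 0) = d
  coords : CoordsStored j B σ
  pow : ∀ ℓ ≤ L, σ.nat (17, ℓ, 0, 0) = 2 ^ ℓ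
  scale : σ.real (2, 0, 0, 0) = ξ
  grid : σ.real (0, 2, 0, 0) = γ
  sum : ∀ ℓ ≤ L, ∀ a, σ.nat (21, enc (nodeAt j a (ℓ + 1)), 0, 0) =
    ∑ c ∈ elms j (nodeAt j a ℓ) ∩ W, ∑ c' ∈ elms j (nodeAt j a (ℓ + 1)) ∩ W, hammingDist c c'
  num : ∀ ℓ ≤ L, ∀ a, σ.nat (22, enc (nodeAt j a (ℓ + 1)), 0, 0) =
    (elms j (nodeAt j a ℓ) ∩ W).card * (elms j (nodeAt j a (ℓ + 1)) ∩ W).card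

theorem Ready.frame {s L d : ℕ} {j : Coords L d} {W : Finset (Cube d)} {ξ γ : ℝ} {B : ℕ}
    {σ σ' : Memory} {ns rs : List ℕ} (h : Ready s j W ξ γ B σ) (hF : Frame ns rs σ σ')
    (hn : ∀ A ∈ [0, 12, 15, 16, 17, 21, 22], A ∉ ns) (hr : ∀ A ∈ [0, 2], A ∉ rs) :
    Ready s j W ξ γ B σ' := by
  constructor
  · rw [hF.nat _ (hn 0 (by simp))]; exact h.size
  · rw [hF.nat _ (hn 0 (by simp))]; exact h.dim
  · exact h.coords.frame hF (hn 12 (by simp)) (hn 15 (by simp)) (hn 16 (by simp))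
  · intro ℓ hℓ; rw [hF.nat _ (hn 17 (by simp))]; exact h.pow ℓ hℓ
  · rw [hF.real _ (hr 2 (by simp))]; exact h.scale
  · rw [hF.real _ (hr 0 (by simp))]; exact h.grid
  · intro ℓ hℓ a; rw [hF.nat _ (hn 21 (by simp))]; exact h.sum ℓ hℓ a
  · intro ℓ hℓ a; rw [hF.nat _ (hn 22 (by simp))]; exact h.num ℓ hℓ a

theorem mem_elms {L d : ℕ} (j : Coords L d) (v : Node) (b : Cube d) :
    b ∈ elms j v ↔ nodeAt j b v.length = v := by
  simp [elms]

theorem mem_elms_nodeAt {L d : ℕ} (j : Coords L d) (a b : Cube d) (ℓ : ℕ) :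
    b ∈ elms j (nodeAt j a ℓ) ↔ nodeAt j b ℓ = nodeAt j a ℓ := by
  rw [mem_elms, nodeAt_length]

theorem nodeAt_dropLast {L d : ℕ} (j : Coords L d) (a : Cube d) (ℓ : ℕ) :
    (nodeAt j a (ℓ + 1)).dropLast = nodeAt j a ℓ := by
  rw [nodeAt_succ, List.dropLast_concat]

theorem nodeAt_eq_of_succ {L d : ℕ} {j : Coords L d} {a b : Cube d} {ℓ : ℕ}
    (h : nodeAt j a (ℓ + 1) = nodeAt j b (ℓ + 1)) : nodeAt j a ℓ = nodeAt j b ℓ := by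
  rw [← nodeAt_dropLast j a, h, nodeAt_dropLast]

theorem Ready.weight {s L d : ℕ} {j : Coords L d} {W : Finset (Cube d)} {ξ γ : ℝ} {B : ℕ}
    {σ : Memory} (h : Ready s j W ξ γ B σ) {ℓ : ℕ} (hℓ : ℓ ≤ L) (a : Cube d) :
    edgeWeight j W ξ (nodeAt j a (ℓ + 1)) =
      if σ.nat (22, enc (nodeAt j a (ℓ + 1)), 0, 0) = 0 then
        (σ.nat (0, 1, 0, 0) : ℝ) / (σ.nat (17, ℓ, 0, 0) : ℝ) * σ.real (2, 0, 0, 0)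
      else (σ.nat (21, enc (nodeAt j a (ℓ + 1)), 0, 0) : ℝ) /
        (σ.nat (22, enc (nodeAt j a (ℓ + 1)), 0, 0) : ℝ) := by
  have key : (elms j (nodeAt j a (ℓ + 1)) ∩ W).Nonempty ↔
      ¬ σ.nat (22, enc (nodeAt j a (ℓ + 1)), 0, 0) = 0 := by
    rw [h.num ℓ hℓ a, mul_eq_zero, not_or, Finset.card_eq_zero, Finset.card_eq_zero]
    simp only [← ne_eq, ← Finset.nonempty_iff_ne_empty]
    -- The stored count is a product of two cell sizes. The lower cell is contained in the upper
    -- one, so the product vanishes exactly when the lower cell has no element of `W`; this is the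
    -- case distinction in the weight.
    refine ⟨fun h' => ⟨h'.mono ?_, h'⟩, And.right⟩
    refine Finset.inter_subset_inter_right fun b hb => ?_
    rw [mem_elms_nodeAt] at hb ⊢
    exact nodeAt_eq_of_succ hb
  rw [edgeWeight, nodeAt_length, nodeAt_dropLast]
  by_cases hc : (elms j (nodeAt j a (ℓ + 1)) ∩ W).Nonempty
  · rw [if_pos hc, if_neg (key.1 hc), avgDist, h.num ℓ hℓ a, h.sum ℓ hℓ a]
    push_cast
    rfl
  · rw [if_neg hc, if_pos (not_not.1 fun h' => hc (key.2 h')), h.dim, h.pow ℓ hℓ, h.scale]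
    simp

/-! ### The numbers of the nodes of the query -/

/-- The nodes of all elements of the query. -/
def pathsProg : Prog := forTo 33 (NatExpr.read 0 c0 c0 c0) (codeProg 2 33 40)

theorem pathsProg_spec {ω : Tape} {σ : Memory} {s L d B : ℕ} {j : Coords L d}
    (hs : σ.nat (0, 0, 0, 0) = s) (hc : CoordsStored j B σ) (x : Point s d)
    (hx : ∀ i : Fin s, ∀ q < d, σ.nat (2, i, q, 0) = (bitAt (x i) q).toNat) :
    Ex ω pathsProg σ (s * (codeTime L B + 21) + 16) fun σ' =>
      ∀ i : Fin s, ∀ ℓ ≤ L + 1, σ'.nat (40, i, ℓ, 0) = enc (nodeAt j (x i) ℓ) := by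
  refine Ex.mono (Ex.forTo s (codeTime L B) (fun n σ' => ∀ i : Fin s, (i : ℕ) < n → ∀ ℓ ≤ L + 1,
    σ'.nat (40, i, ℓ, 0) = enc (nodeAt j (x i) ℓ)) ?_ ?_ ?_ ?_ ?_) ?_ fun _ h i => h i i.2
  · intro k σ' c h; simpa using h
  · simp
  · intro σ' hF
    simp only [NatExpr.eval]
    rw [hF.nat 0 (by simp), hs]
  · intro i hi; omega
  · intro n hn σ' hF h33 hI
    refine Ex.mono (codeProg_spec (row := n) (by simp) (by simp) (by simp)
      (hc.frame hF (by simp) (by simp) (by simp)) h33 (x ⟨n, hn⟩) ?_) le_rfl ?_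
    · intro q hq
      rw [hF.nat 2 (by simp)]
      exact hx ⟨n, hn⟩ q hq
    · rintro σ'' ⟨h1, h2⟩ i hi ℓ hℓ
      by_cases h : (i : ℕ) = n
      · subst h; exact h1 ℓ hℓ
      · rw [h2 _ h]; exact hI i (by omega) ℓ hℓ
  · simp [NatExpr.cost]

/-! ### The entries of the hash value -/

/-- The number of integers in `[1, n]` that are at most `z`. -/
def shrink (z : ℝ) (n : ℕ) : ℕ := ((Finset.range n).filter fun k : ℕ => ((k + 1 : ℕ) : ℝ) ≤ z).card

/-- The number that stands for the value `κ` at the node with the number `c`. -/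
def mark (c κ : ℕ) : ℕ := if κ = 0 then 0 else (c + c + 1) * 2 ^ κ

/-- The count of the elements in the node with the number in the scalar `35`. -/
def countProg : Prog :=
  Prog.seq (letNat 36 c0) (forTo 37 (NatExpr.read 0 c0 c0 c0)
    (Prog.ite (Test.natLe (NatExpr.read 40 (sv 37) ((sv 34).add c1) c0) (sv 35))
      (Prog.ite (Test.natLe (sv 35) (NatExpr.read 40 (sv 37) ((sv 34).add c1) c0))
        (letNat 36 ((sv 36).add c1)) Prog.skip) Prog.skip))

theorem countProg_spec {ω : Tape} {σ : Memory} {s L d ℓ : ℕ} {j : Coords L d}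
    (hs : σ.nat (0, 0, 0, 0) = s) (x : Point s d) (a : Cube d)
    (hq : ∀ i : Fin s, ∀ ℓ ≤ L + 1, σ.nat (40, i, ℓ, 0) = enc (nodeAt j (x i) ℓ))
    (hℓ : ℓ ≤ L) (h34 : σ.nat (34, 0, 0, 0) = ℓ)
    (h35 : σ.nat (35, 0, 0, 0) = enc (nodeAt j a (ℓ + 1))) :
    Ex ω countProg σ (s * 100 + 30) fun σ' =>
      σ'.nat (36, 0, 0, 0) = below j x (nodeAt j a (ℓ + 1)) := by
  refine Ex.mono (Ex.setNat_seq (Ex.forTo s 60 (fun n σ' => σ'.nat (36, 0, 0, 0) =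
    (Finset.univ.filter fun p : Fin s => (p : ℕ) < n ∧
      nodeAt j (x p) (ℓ + 1) = nodeAt j a (ℓ + 1)).card) ?_ ?_ ?_ ?_ ?_)) ?_ ?_
  · intro k σ' c h; simpa using h
  · simp [Prog.natWrites]
  · intro σ' hF
    simp only [Prog.natWrites, Prog.realWrites] at hF
    simp only [NatExpr.eval]
    rw [hF.nat 0 (by simp)]
    simp [hs]
  · simp [NatExpr.eval]
  · intro n hn σ' hF h37 hI
    simp only [Prog.natWrites, Prog.realWrites] at hF
    have e40 : σ'.nat (40, n, ℓ + 1, 0) = enc (nodeAt j (x ⟨n, hn⟩) (ℓ + 1)) := by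
      rw [hF.nat 40 (by simp)]
      simpa using hq ⟨n, hn⟩ (ℓ + 1) (by omega)
    have e34 : σ'.nat (34, 0, 0, 0) = ℓ := by
      rw [hF.nat 34 (by simp)]; simpa using h34
    have e35 : σ'.nat (35, 0, 0, 0) = enc (nodeAt j a (ℓ + 1)) := by
      rw [hF.nat 35 (by simp)]; simpa using h35
    have split : (Finset.univ.filter fun p : Fin s => (p : ℕ) < n + 1 ∧
        nodeAt j (x p) (ℓ + 1) = nodeAt j a (ℓ + 1)).card =
        (Finset.univ.filter fun p : Fin s => (p : ℕ) < n ∧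
          nodeAt j (x p) (ℓ + 1) = nodeAt j a (ℓ + 1)).card +
        if nodeAt j (x ⟨n, hn⟩) (ℓ + 1) = nodeAt j a (ℓ + 1) then 1 else 0 := by
      split_ifs with h
      · rw [show (Finset.univ.filter fun p : Fin s => (p : ℕ) < n + 1 ∧
          nodeAt j (x p) (ℓ + 1) = nodeAt j a (ℓ + 1)) = insert ⟨n, hn⟩
          (Finset.univ.filter fun p : Fin s => (p : ℕ) < n ∧
          nodeAt j (x p) (ℓ + 1) = nodeAt j a (ℓ + 1)) from ?_, Finset.card_insert_of_notMem]
        · simp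
        · ext p
          simp only [Finset.mem_filter, Finset.mem_univ, true_and, Finset.mem_insert, Fin.ext_iff]
          constructor
          · rintro ⟨h1, h2⟩
            by_cases hp : (p : ℕ) = n
            · exact Or.inl hp
            · exact Or.inr ⟨by omega, h2⟩
          · rintro (h1 | ⟨h1, h2⟩)
            · obtain rfl : p = ⟨n, hn⟩ := Fin.ext h1
              exact ⟨by simp, h⟩
            · exact ⟨by omega, h2⟩
      · rw [add_zero]
        congr 1
        ext p
        simp only [Finset.mem_filter, Finset.mem_univ, true_and]
        constructor
        · rintro ⟨h1, h2⟩
          refine ⟨?_, h2⟩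
          by_contra h3
          obtain rfl : p = ⟨n, hn⟩ := Fin.ext (by simp; omega)
          exact h h2
        · rintro ⟨h1, h2⟩
          exact ⟨by omega, h2⟩
    -- Nodes are compared through their numbers; equality is tested by two inequalities, the only
    -- comparison of the machine.
    have hiff : nodeAt j (x ⟨n, hn⟩) (ℓ + 1) = nodeAt j a (ℓ + 1) ↔
        σ'.nat (40, n, ℓ + 1, 0) = σ'.nat (35, 0, 0, 0) := by
      rw [e40, e35, enc_injective.eq_iff]
    rw [split]
    refine Ex.mono (Ex.ite (T := 30) (fun h1 => Ex.mono (Ex.ite (T := 10) (fun h2 =>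
      Ex.mono (Ex.setNat ?_) (by simp [NatExpr.cost]) fun _ h => h) (fun h2 => Ex.mono (Ex.skip ?_) (by simp) fun _ h => h))
      (by simp [Test.cost, NatExpr.cost]) fun _ h => h)
      fun h1 => Ex.mono (Ex.skip ?_) (by simp) fun _ h => h) (by simp [Test.cost, NatExpr.cost]) fun _ h => h
    · simp only [Test.holds, NatExpr.eval, h37, e34] at h1 h2
      rw [if_pos (hiff.2 (le_antisymm h1 h2))]
      simp [NatExpr.eval, hI]
    · simp only [Test.holds, NatExpr.eval, h37, e34] at h1 h2
      rw [if_neg (fun h => h2 (hiff.1 h).ge), hI, add_zero]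
    · simp only [Test.holds, NatExpr.eval, h37, e34] at h1
      rw [if_neg (fun h => h1 (hiff.1 h).le), hI, add_zero]
  · simp only [NatExpr.cost]; omega
  · intro σ' h
    rw [h, below]
    congr 1
    ext p
    simp [mem_elms_nodeAt]

theorem shrink_succ (z : ℝ) (n : ℕ) :
    shrink z (n + 1) = shrink z n + if ((n + 1 : ℕ) : ℝ) ≤ z then 1 else 0 := by
  rw [shrink, Finset.range_add_one, Finset.filter_insert]
  split_ifs with h
  · rw [Finset.card_insert_of_notMem (by simp), shrink]
  · rfl

theorem mark_zero (c : ℕ) : mark c 0 = 0 := rfl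

/-- The value of the grid hash at the node with the number in the scalar `35`, of which the scalar
`36` counts the elements, as an entry of the array `41`. -/
def entryProg : Prog :=
  Prog.seq (Prog.ite (Test.natLe (NatExpr.read 22 (sv 35) c0 c0) c0)
    (Prog.setReal 4 c0 c0 c0
      (((RealExpr.cast (NatExpr.read 0 c1 c0 c0)).div
        (RealExpr.cast (NatExpr.read 17 (sv 34) c0 c0))).mul (RealExpr.read 2 c0 c0 c0)))
    (Prog.setReal 4 c0 c0 c0 ((RealExpr.cast (NatExpr.read 21 (sv 35) c0 c0)).div
      (RealExpr.cast (NatExpr.read 22 (sv 35) c0 c0)))))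
  (Prog.seq (Prog.setReal 4 c0 c0 c0 ((((RealExpr.read 4 c0 c0 c0).mul
    (RealExpr.cast (sv 36))).div (RealExpr.read 0 (NatExpr.const 2) c0 c0)).add
      (RealExpr.rand (NatExpr.const 2) (sv 35) c0)))
  (Prog.seq (Prog.setNat 41 (sv 33) (sv 34) c0 c0)
  (Prog.seq (letNat 38 (((sv 35).add (sv 35)).add c1))
  (forTo 39 (sv 36)
    (Prog.ite (Test.realLe (RealExpr.cast ((sv 39).add c1)) (RealExpr.read 4 c0 c0 c0))
      (Prog.seq (letNat 38 ((sv 38).add (sv 38)))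
        (Prog.setNat 41 (sv 33) (sv 34) c0 (sv 38))) Prog.skip)))))

/-- Integers `1, …, n` are compared with the real value one by one, since the machine cannot round.
The mark is built by doubling an odd number at each success, since natural numbers cannot be
multiplied. Truncation at `n` keeps the time bounded whatever the size of weight and grid. -/
theorem entryProg_spec {ω : Tape} {σ : Memory} {s L d : ℕ} {j : Coords L d}
    {W : Finset (Cube d)} {ξ γ : ℝ} {B : ℕ} (h : Ready s j W ξ γ B σ) {i ℓ n : ℕ} (hℓ : ℓ ≤ L)
    (a : Cube d) (h33 : σ.nat (33, 0, 0, 0) = i) (h34 : σ.nat (34, 0, 0, 0) = ℓ)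
    (h35 : σ.nat (35, 0, 0, 0) = enc (nodeAt j a (ℓ + 1))) (h36 : σ.nat (36, 0, 0, 0) = n) :
    Ex ω entryProg σ (n * 100 + 200) fun σ' =>
      σ'.nat (41, i, ℓ, 0) = mark (enc (nodeAt j a (ℓ + 1)))
        (shrink (edgeWeight j W ξ (nodeAt j a (ℓ + 1)) * n / γ +
          ω (2, enc (nodeAt j a (ℓ + 1)), 0)) n) ∧
      ∀ p q, (p, q) ≠ (i, (ℓ, 0)) → σ'.nat (41, p, q) = σ.nat (41, p, q) := by
  set v := nodeAt j a (ℓ + 1) with hv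
  set z := edgeWeight j W ξ v * n / γ + ω (2, enc v, 0) with hz
  refine Ex.mono (Ex.seq (T := 60) (Ex.framed (Q := fun σ' => σ'.real (4, 0, 0, 0) =
    edgeWeight j W ξ v) (Ex.ite (T := 40) (fun hb => ?_) fun hb => ?_)
    (by simp [Test.cost, NatExpr.cost]) fun σ₁ hF h4 => Ex.setReal_seq (Ex.setNat_seq
      (Ex.setNat_seq ((Ex.forTo n 50
        -- The scalar `38` already holds the odd number when no integer has been counted, whereas
        -- the array entry is still `0`; after the first success the two agree.
        (fun k σ' => (σ'.nat (38, 0, 0, 0) = (enc v + enc v + 1) * 2 ^ shrink z k ∧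
          σ'.nat (41, i, ℓ, 0) = mark (enc v) (shrink z k)) ∧
          ∀ p q, (p, q) ≠ (i, (ℓ, 0)) → σ'.nat (41, p, q) = σ.nat (41, p, q))
        ?_ ?_ ?_ ?_ ?_).mono le_rfl fun _ h => ⟨h.1.2, h.2⟩))))) ?_ fun _ h => h
  · refine Ex.mono (Ex.setReal ?_) (by simp [RealExpr.cost, NatExpr.cost]) fun _ h => h
    simp only [Test.holds, NatExpr.eval, h35, Nat.le_zero] at hb
    have hw := h.weight hℓ a
    rw [if_pos hb] at hw
    simp [RealExpr.eval, NatExpr.eval, h34, hv, hw]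
  · refine Ex.mono (Ex.setReal ?_) (by simp [RealExpr.cost, NatExpr.cost]) fun _ h => h
    simp only [Test.holds, NatExpr.eval, h35, Nat.le_zero] at hb
    have hw := h.weight hℓ a
    rw [if_neg hb] at hw
    simp [RealExpr.eval, NatExpr.eval, h35, hv, hw]
  · intro k σ' c h'; simpa using h'
  · simp [Prog.natWrites]
  · intro σ' hF'
    simp only [Prog.natWrites, Prog.realWrites] at hF'
    simp only [NatExpr.eval]
    rw [hF'.nat 36 (by simp)]
    simp only [Prog.natWrites, Prog.realWrites] at hF
    have := hF.nat 36 (by simp) (0, 0, 0)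
    simp [this, h36]
  · simp only [Prog.natWrites, Prog.realWrites] at hF
    have e33 := hF.nat 33 (by simp) (0, 0, 0)
    have e34 := hF.nat 34 (by simp) (0, 0, 0)
    have e35 := hF.nat 35 (by simp) (0, 0, 0)
    rw [h33] at e33
    rw [h34] at e34
    rw [h35] at e35
    refine ⟨⟨?_, ?_⟩, ?_⟩
    · simp [NatExpr.eval, shrink, e35]
    · simp [NatExpr.eval, shrink, e33, e34, mark]
    · intro p q hpq
      simp only [NatExpr.eval, Memory.setNat_nat, Memory.setReal_nat]
      have e41 := hF.nat 41 (by simp) (p, q)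
      rw [if_neg, if_neg, e41]
      · simpa [e33, e34] using hpq
      · simp
  · intro k hk σ₂ hF₂ h39 hI
    simp only [Prog.natWrites, Prog.realWrites] at hF hF₂
    have e33 : σ₂.nat (33, 0, 0, 0) = i := by
      rw [hF₂.nat 33 (by simp)]
      have := hF.nat 33 (by simp) (0, 0, 0)
      simp [this, h33]
    have e34 : σ₂.nat (34, 0, 0, 0) = ℓ := by
      rw [hF₂.nat 34 (by simp)]
      have := hF.nat 34 (by simp) (0, 0, 0)
      simp [this, h34]
    have e4 : σ₂.real (4, 0, 0, 0) = z := by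
      rw [hF₂.real 4 (by simp)]
      have e1 := hF.nat 36 (by simp) (0, 0, 0)
      have e2 := hF.nat 35 (by simp) (0, 0, 0)
      have e3 := hF.real 0 (by simp) (2, 0, 0)
      simp [RealExpr.eval, NatExpr.eval, e1, e2, e3, h4, h36, h35, h.grid, hz]
    refine Ex.mono (Ex.ite (T := 30) (fun hb => Ex.mono (Ex.setNat_seq (Ex.setNat ?_))
      (by simp [NatExpr.cost]) fun _ h => h) fun hb => Ex.mono (Ex.skip ?_) (by simp)
      fun _ h => h) (by simp [Test.cost, RealExpr.cost, NatExpr.cost]) fun _ h => h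
    · simp only [Test.holds, RealExpr.eval, NatExpr.eval, h39, e4] at hb
      rw [shrink_succ, if_pos hb]
      refine ⟨⟨?_, ?_⟩, ?_⟩
      · simp [NatExpr.eval, hI.1.1, pow_succ]; ring
      · simp [NatExpr.eval, hI.1.1, pow_succ, e33, e34, mark]; ring
      · intro p q hpq
        simp only [NatExpr.eval, Memory.setNat_nat]
        rw [if_neg, if_neg, hI.2 p q hpq]
        · simp
        · simpa [e33, e34] using hpq
    · simp only [Test.holds, RealExpr.eval, NatExpr.eval, h39, e4] at hb
      rw [shrink_succ, if_neg hb]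
      exact hI
  · simp only [RealExpr.cost, NatExpr.cost]; omega

/-- All entries of the hash value. -/
def entriesProg : Prog :=
  forTo 33 (NatExpr.read 0 c0 c0 c0) (forTo 34 (sv 12)
    (Prog.seq (letNat 35 (NatExpr.read 40 (sv 33) ((sv 34).add c1) c0))
      (Prog.seq countProg entryProg)))

/-- The entry of the hash value of `x` at the node `v`, as a number. -/
def entry {s L d : ℕ} (j : Coords L d) (W : Finset (Cube d)) (ξ γ : ℝ) (u : Node → unitInterval)
    (x : Point s d) (v : Node) : ℕ :=
  mark (enc v) (shrink (edgeWeight j W ξ v * below j x v / γ + u v) (below j x v))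

theorem below_le {s L d : ℕ} (j : Coords L d) (x : Point s d) (v : Node) : below j x v ≤ s :=
  (Finset.card_le_univ _).trans (by simp)

theorem entriesProg_spec {ω : Tape} {σ : Memory} {s L d : ℕ} {j : Coords L d}
    {W : Finset (Cube d)} {ξ γ : ℝ} {B : ℕ} (h : Ready s j W ξ γ B σ) (x : Point s d)
    (hq : ∀ i : Fin s, ∀ ℓ ≤ L + 1, σ.nat (40, i, ℓ, 0) = enc (nodeAt j (x i) ℓ)) :
    Ex ω entriesProg σ (s * ((L + 1) * (s * 200 + 300) + 50) + 50) fun σ' =>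
      ∀ i : Fin s, ∀ ℓ ≤ L, σ'.nat (41, i, ℓ, 0) =
        entry j W ξ γ (fun v => ω (2, enc v, 0)) x (nodeAt j (x i) (ℓ + 1)) := by
  refine Ex.mono (Ex.forTo s ((L + 1) * (s * 200 + 300) + 20) (fun n σ' => ∀ i : Fin s, (i : ℕ) < n →
    ∀ ℓ ≤ L, σ'.nat (41, i, ℓ, 0) = entry j W ξ γ (fun v => ω (2, enc v, 0)) x
      (nodeAt j (x i) (ℓ + 1))) ?_ ?_ ?_ ?_ ?_) ?_ fun _ h i => h i i.2
  · intro k σ' c h; simpa using h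
  · simp [Prog.natWrites, countProg, entryProg]
  · intro σ' hF
    simp only [NatExpr.eval]
    rw [hF.nat 0 (by simp [Prog.natWrites, countProg, entryProg]), h.size]
  · intro i hi; omega
  · intro n hn σ₁ hF₁ h33 hI₁
    simp only [forTo_natWrites, forTo_realWrites, Prog.natWrites, Prog.realWrites, countProg,
      entryProg] at hF₁
    have hR₁ := h.frame hF₁ (by simp) (by simp)
    refine Ex.mono (Ex.forTo (L + 1) (s * 200 + 270) (fun m σ' => ∀ i : Fin s, ∀ ℓ ≤ L,
      ((i : ℕ) < n ∨ (i : ℕ) = n ∧ ℓ < m) → σ'.nat (41, i, ℓ, 0) =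
      entry j W ξ γ (fun v => ω (2, enc v, 0)) x
      (nodeAt j (x i) (ℓ + 1))) ?_ ?_ ?_ ?_ ?_) ?_ ?_
    · intro k σ' c h; simpa using h
    · simp [Prog.natWrites, countProg, entryProg]
    · intro σ' hF
      simp only [NatExpr.eval]
      rw [hF.nat 12 (by simp [Prog.natWrites, countProg, entryProg]), hR₁.coords.depth]
    · intro i ℓ hℓ hi
      exact hI₁ i (by omega) ℓ hℓ
    · intro ℓ hℓ σ₂ hF₂ h34 hI₂
      simp only [forTo_natWrites, forTo_realWrites, Prog.natWrites, Prog.realWrites, countProg,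
        entryProg] at hF₂
      have hR₂ := hR₁.frame hF₂ (by simp) (by simp)
      have hq₂ : ∀ i : Fin s, ∀ ℓ ≤ L + 1, σ₂.nat (40, i, ℓ, 0) = enc (nodeAt j (x i) ℓ) := by
        intro i ℓ hℓ
        rw [hF₂.nat 40 (by simp), hF₁.nat 40 (by simp)]
        exact hq i ℓ hℓ
      have h33' : σ₂.nat (33, 0, 0, 0) = n := by
        rw [hF₂.nat 33 (by simp)]
        exact h33
      have h35 := hq₂ ⟨n, hn⟩ (ℓ + 1) (by omega)
      simp only at h35
      refine Ex.mono (Ex.setNat_seq (Ex.seq (Ex.framed (T' := s * 100 + 30)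
        (countProg_spec (s := s) (ℓ := ℓ) (j := j) ?_ x (x ⟨n, hn⟩) ?_ (by omega) ?_ ?_) le_rfl
        fun σ₃ hF₃ h36 => Ex.mono (entryProg_spec (n := below j x (nodeAt j (x ⟨n, hn⟩) (ℓ + 1)))
          ((hR₂.frame (Frame.setNat _ _ _ _) (by simp) (by simp)).frame hF₃ ?_ ?_) (ℓ := ℓ) (by omega)
          (x ⟨n, hn⟩) (i := n) ?_ ?_ ?_ ?_) (T' := s * 100 + 200) ?_ ?_))) ?_ fun _ h => h
      · simp [hR₂.size]
      · intro i ℓ hℓ; simpa using hq₂ i ℓ hℓ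
      · simpa using h34
      · simp [NatExpr.eval, h33', h34, h35]
      · simp [Prog.natWrites, countProg]
      · simp [Prog.realWrites, countProg]
      · simp only [Prog.natWrites, Prog.realWrites, countProg, forTo_natWrites] at hF₃
        rw [hF₃.nat 33 (by simp)]
        simpa using h33'
      · simp only [Prog.natWrites, Prog.realWrites, countProg, forTo_natWrites] at hF₃
        rw [hF₃.nat 34 (by simp)]
        simpa using h34
      · simp only [Prog.natWrites, Prog.realWrites, countProg, forTo_natWrites] at hF₃
        rw [hF₃.nat 35 (by simp)]
        simp [NatExpr.eval, h33', h34, h35]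
      · exact h36
      · have := below_le j x (nodeAt j (x ⟨n, hn⟩) (ℓ + 1))
        omega
      · rintro σ₄ ⟨h1, h2⟩ i ℓ' hℓ' hi
        simp only [Prog.natWrites, Prog.realWrites, countProg, forTo_natWrites] at hF₃
        by_cases hc : (i : ℕ) = n ∧ ℓ' = ℓ
        · obtain ⟨rfl, rfl⟩ := hc
          exact h1
        · rw [h2 _ _ (by simpa using hc), hF₃.nat 41 (by simp)]
          simp only [Memory.setNat_nat]
          rw [if_neg (by simp)]
          exact hI₂ i ℓ' hℓ' (by omega)
      · simp only [NatExpr.cost]; omega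
    · have := Nat.mul_le_mul_left (L + 1)
        (show s * 200 + 270 + (1 + 1 + 1 + 1) + 17 ≤ s * 200 + 300 by omega)
      simp only [NatExpr.cost]
      linarith
    · intro σ' h i hi ℓ hℓ
      exact h i ℓ hℓ (by omega)
  · have := Nat.mul_le_mul_left s (show (L + 1) * (s * 200 + 300) + 20 + (1 + 1 + 1 + 1) + 17 ≤
      (L + 1) * (s * 200 + 300) + 50 by omega)
    simp only [NatExpr.cost]
    linarith

/-! ### Listing a finite set of numbers in increasing order, again and again -/

/-- The least element of `S` that is larger than `a`; `0` if there is none. -/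
def nxt (S : Finset ℕ) (a : ℕ) : ℕ :=
  if h : (S.filter (a < ·)).Nonempty then (S.filter (a < ·)).min' h else 0

theorem nxt_eq_zero {S : Finset ℕ} {a : ℕ} (h : ∀ e ∈ S, e ≤ a) : nxt S a = 0 := by
  rw [nxt, dif_neg]
  rintro ⟨e, he⟩
  rw [Finset.mem_filter] at he
  exact absurd (h e he.1) (by omega)

theorem nxt_spec {S : Finset ℕ} {a e : ℕ} (he : e ∈ S) (hae : a < e) :
    nxt S a ∈ S ∧ a < nxt S a ∧ nxt S a ≤ e := by
  have hm : e ∈ S.filter (a < ·) := Finset.mem_filter.2 ⟨he, hae⟩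
  rw [nxt, dif_pos ⟨e, hm⟩]
  have := Finset.mem_filter.1 (Finset.min'_mem (S.filter (a < ·)) ⟨e, hm⟩)
  exact ⟨this.1, this.2, Finset.min'_le _ _ hm⟩

theorem nxt_mem_or (S : Finset ℕ) (a : ℕ) : nxt S a ∈ S ∨ nxt S a = 0 := by
  by_cases h : ∀ e ∈ S, e ≤ a
  · exact Or.inr (nxt_eq_zero h)
  · push Not at h
    obtain ⟨e, he, hae⟩ := h
    exact Or.inl (nxt_spec he hae).1

theorem nxt_eq {S : Finset ℕ} {a b : ℕ} (hb : b ∈ S) (hab : a < b)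
    (hmin : ∀ e ∈ S, a < e → b ≤ e) : nxt S a = b := by
  obtain ⟨h1, h2, h3⟩ := nxt_spec hb hab
  exact le_antisymm h3 (hmin _ h1 h2)

theorem nxt_empty (a : ℕ) : nxt ∅ a = 0 := nxt_eq_zero (by simp)

/-- The right-hand side has the branches of the inner body of `nextProg`, with the value `0` meaning
that no candidate has been found yet. -/
theorem nxt_insert (S : Finset ℕ) (t a : ℕ) : nxt (insert t S) a =
    if a + 1 ≤ t then (if nxt S a ≤ 0 then t else if t ≤ nxt S a then t else nxt S a)
    else nxt S a := by
  by_cases h : ∃ e ∈ S, a < e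
  · obtain ⟨e, he, hae⟩ := h
    obtain ⟨h1, h2, -⟩ := nxt_spec he hae
    have hmin : ∀ e ∈ S, a < e → nxt S a ≤ e := fun e he hae => (nxt_spec he hae).2.2
    by_cases ht : a + 1 ≤ t
    · rw [if_pos ht, if_neg (by omega)]
      split_ifs with h3
      · refine nxt_eq (Finset.mem_insert_self _ _) ht fun e he hae => ?_
        rcases Finset.mem_insert.1 he with rfl | he
        · exact le_rfl
        · exact h3.trans (hmin e he hae)
      · refine nxt_eq (Finset.mem_insert_of_mem h1) h2 fun e he hae => ?_
        rcases Finset.mem_insert.1 he with rfl | he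
        · omega
        · exact hmin e he hae
    · rw [if_neg ht]
      refine nxt_eq (Finset.mem_insert_of_mem h1) h2 fun e he hae => ?_
      rcases Finset.mem_insert.1 he with rfl | he
      · omega
      · exact hmin e he hae
  · push Not at h
    rw [nxt_eq_zero h]
    by_cases ht : a + 1 ≤ t
    · rw [if_pos ht, if_pos le_rfl]
      refine nxt_eq (Finset.mem_insert_self _ _) ht fun e he hae => ?_
      rcases Finset.mem_insert.1 he with rfl | he
      · exact le_rfl
      · exact absurd (h e he) (by omega)
    · rw [if_neg ht]
      refine nxt_eq_zero fun e he => ?_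
      rcases Finset.mem_insert.1 he with rfl | he
      · omega
      · exact h e he

/-- The first `N` elements of the list. -/
def outList (N : ℕ) (S : Finset ℕ) : List ℕ := (List.range N).map fun k => (nxt S)^[k + 1] 0

theorem nxt_congr {S S' : Finset ℕ} (h : S.erase 0 = S'.erase 0) : nxt S = nxt S' := by
  have key : ∀ a, S.filter (a < ·) = S'.filter (a < ·) := by
    intro a
    ext e
    have := congrArg (e ∈ ·) h
    simp only [Finset.mem_erase, eq_iff_iff] at this
    simp only [Finset.mem_filter]
    constructor
    · rintro ⟨h1, h2⟩; exact ⟨(this.1 ⟨by omega, h1⟩).2, h2⟩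
    · rintro ⟨h1, h2⟩; exact ⟨(this.2 ⟨by omega, h1⟩).2, h2⟩
  funext a
  simp only [nxt, key]

/-- If `e` were missed in `N` steps, every step would have produced a larger element of `S` still
below `e`: these are `N` distinct elements of `S.erase e`, one too many. Once the elements are
exhausted the listing passes through `0` and may start again, which adds no new nonzero element. -/
theorem mem_outList {N : ℕ} {S : Finset ℕ} (hN : S.card ≤ N) {e : ℕ} (he : e ≠ 0) :
    e ∈ outList N S ↔ e ∈ S := by
  constructor
  · intro h
    obtain ⟨k, -, rfl⟩ := List.mem_map.1 h
    rw [Function.iterate_succ_apply'] at he ⊢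
    exact (nxt_mem_or S _).resolve_right he
  · intro hS
    by_contra hcon
    have hne : ∀ k < N, (nxt S)^[k + 1] 0 ≠ e := by
      intro k hk h
      exact hcon (List.mem_map.2 ⟨k, List.mem_range.2 hk, h⟩)
    have hlt : ∀ k ≤ N, (nxt S)^[k] 0 < e := by
      intro k
      induction k with
      | zero => intro _; simp; omega
      | succ k ih =>
        intro hk
        have h1 := (nxt_spec hS (ih (by omega))).2.2
        rw [← Function.iterate_succ_apply' (nxt S)] at h1
        exact lt_of_le_of_ne h1 (hne k (by omega))
    have hmono : ∀ k < N, (nxt S)^[k] 0 < (nxt S)^[k + 1] 0 := by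
      intro k hk
      rw [Function.iterate_succ_apply']
      exact (nxt_spec hS (hlt k (by omega))).2.1
    have hmem : ∀ k < N, (nxt S)^[k + 1] 0 ∈ S := by
      intro k hk
      rw [Function.iterate_succ_apply']
      exact (nxt_spec hS (hlt k (by omega))).1
    have hmono' : ∀ i k, i < k → k ≤ N → (nxt S)^[i] 0 < (nxt S)^[k] 0 := by
      intro i k hik
      induction k, hik using Nat.le_induction with
      | base => intro h; exact hmono i (by omega)
      | succ k hk ih => intro h; exact (ih (by omega)).trans (hmono k (by omega))
    have hinj : Set.InjOn (fun k => (nxt S)^[k + 1] 0) (Finset.range N : Set ℕ) := by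
      intro i hi k hk h
      simp only [Finset.coe_range, Set.mem_Iio] at hi hk
      rcases lt_trichotomy i k with h1 | h1 | h1
      · exact absurd h (hmono' (i + 1) (k + 1) (by omega) (by omega)).ne
      · exact h1
      · exact absurd h (hmono' (k + 1) (i + 1) (by omega) (by omega)).ne'
    have hsub : (Finset.range N).image (fun k => (nxt S)^[k + 1] 0) ⊆ S.erase e := by
      intro b hb
      obtain ⟨k, hk, rfl⟩ := Finset.mem_image.1 hb
      rw [Finset.mem_range] at hk
      exact Finset.mem_erase.2 ⟨hne k hk, hmem k hk⟩
    have := Finset.card_le_card hsub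
    rw [Finset.card_image_of_injOn hinj, Finset.card_range, Finset.card_erase_of_mem hS] at this
    have := Finset.card_pos.2 ⟨e, hS⟩
    omega

/-! ### The output of a query -/

/-- The least entry of the array `41` that is larger than the scalar `42`. -/
def nextProg : Prog :=
  Prog.seq (letNat 44 c0) (forTo 37 (NatExpr.read 0 c0 c0 c0) (forTo 39 (sv 12)
    (Prog.seq (letNat 45 (NatExpr.read 41 (sv 37) (sv 39) c0))
      (Prog.ite (Test.natLe ((sv 42).add c1) (sv 45))
        (Prog.ite (Test.natLe (sv 44) c0) (letNat 44 (sv 45))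
          (Prog.ite (Test.natLe (sv 45) (sv 44)) (letNat 44 (sv 45)) Prog.skip)) Prog.skip))))

/-- The entries `E i ℓ` with `i < n`, `ℓ < M`. -/
def entrySet (E : ℕ → ℕ → ℕ) (n M : ℕ) : Finset ℕ :=
  (Finset.range n ×ˢ Finset.range M).image fun p => E p.1 p.2

theorem nextProg_spec {ω : Tape} {σ : Memory} {s M a : ℕ} {E : ℕ → ℕ → ℕ}
    (hs : σ.nat (0, 0, 0, 0) = s) (hM : σ.nat (12, 0, 0, 0) = M)
    (hE : ∀ i < s, ∀ ℓ < M, σ.nat (41, i, ℓ, 0) = E i ℓ) (ha : σ.nat (42, 0, 0, 0) = a) :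
    Ex ω nextProg σ (s * (M * 100 + 40) + 40) fun σ' =>
      σ'.nat (44, 0, 0, 0) = nxt (entrySet E s M) a := by
  refine Ex.mono (Ex.setNat_seq (Ex.forTo s (M * 100 + 16) (fun n σ' => σ'.nat (44, 0, 0, 0) =
    nxt (entrySet E n M) a) ?_ ?_ ?_ ?_ ?_)) ?_ fun _ h => h
  · intro k σ' c h; simpa using h
  · simp [Prog.natWrites]
  · intro σ' hF
    simp only [NatExpr.eval]
    rw [hF.nat 0 (by simp [Prog.natWrites])]
    simp [hs]
  · simp [NatExpr.eval, entrySet, nxt_empty]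
  · intro n hn σ₁ hF₁ h37 hI₁
    simp only [forTo_natWrites, forTo_realWrites, Prog.natWrites, Prog.realWrites] at hF₁
    refine Ex.mono (Ex.forTo M 79 (fun m σ' => σ'.nat (44, 0, 0, 0) =
      nxt (entrySet E n M ∪ (Finset.range m).image (E n)) a) ?_ ?_ ?_ ?_ ?_) ?_ ?_
    · intro k σ' c h; simpa using h
    · simp [Prog.natWrites]
    · intro σ' hF
      simp only [NatExpr.eval]
      rw [hF.nat 12 (by simp [Prog.natWrites]), hF₁.nat 12 (by simp)]
      simpa using hM
    · simpa using hI₁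
    · intro ℓ hℓ σ₂ hF₂ h39 hI₂
      simp only [Prog.natWrites, Prog.realWrites] at hF₂
      have e37 : σ₂.nat (37, 0, 0, 0) = n := by rw [hF₂.nat 37 (by simp), h37]
      have e41 : σ₂.nat (41, n, ℓ, 0) = E n ℓ := by
        rw [hF₂.nat 41 (by simp), hF₁.nat 41 (by simp)]
        simpa using hE n hn ℓ hℓ
      have e42 : σ₂.nat (42, 0, 0, 0) = a := by
        rw [hF₂.nat 42 (by simp), hF₁.nat 42 (by simp)]
        simpa using ha
      have hset : entrySet E n M ∪ (Finset.range (ℓ + 1)).image (E n) =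
          insert (E n ℓ) (entrySet E n M ∪ (Finset.range ℓ).image (E n)) := by
        rw [Finset.range_add_one, Finset.image_insert, Finset.union_insert]
      rw [hset, nxt_insert]
      refine Ex.mono (Ex.setNat_seq (Ex.ite (T := 40) (fun h1 => Ex.mono (Ex.ite (T := 20)
        (fun h2 => Ex.mono (Ex.setNat ?_) (by simp [NatExpr.cost]) fun _ h => h)
        fun h2 => Ex.mono (Ex.ite (T := 8)
        (fun h3 => Ex.mono (Ex.setNat ?_) (by simp [NatExpr.cost]) fun _ h => h)
        fun h3 => Ex.mono (Ex.skip ?_) (by simp) fun _ h => h)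
        (by simp [Test.cost, NatExpr.cost]) fun _ h => h)
        (by simp [Test.cost, NatExpr.cost]) fun _ h => h)
        fun h1 => Ex.mono (Ex.skip ?_) (by simp) fun _ h => h))
        (by simp [Test.cost, NatExpr.cost]) fun _ h => h
      · simp [Test.holds, NatExpr.eval, e42, h39, e37, e41, hI₂] at h1 h2 ⊢
        grind
      · simp [Test.holds, NatExpr.eval, e42, h39, e37, e41, hI₂] at h1 h2 h3 ⊢
        grind
      · simp [Test.holds, NatExpr.eval, e42, h39, e37, e41, hI₂] at h1 h2 h3 ⊢
        grind
      · simp [Test.holds, NatExpr.eval, e42, h39, e37, e41, hI₂] at h1 ⊢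
        grind
    · simp only [NatExpr.cost]; omega
    · intro σ' h
      rw [h]
      congr 1
      ext b
      simp only [entrySet, Finset.mem_union, Finset.mem_image, Finset.mem_product,
        Finset.mem_range, Prod.exists]
      constructor
      · rintro (⟨i, k, ⟨h1, h2⟩, rfl⟩ | ⟨k, h1, rfl⟩)
        · exact ⟨i, k, ⟨by omega, h2⟩, rfl⟩
        · exact ⟨n, k, ⟨by omega, h1⟩, rfl⟩
      · rintro ⟨i, k, ⟨h1, h2⟩, rfl⟩
        by_cases hi : i = n
        · subst hi; exact Or.inr ⟨k, h2, rfl⟩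
        · exact Or.inl ⟨i, k, ⟨by omega, h2⟩, rfl⟩
  · have := Nat.mul_le_mul_left s (show M * 100 + 16 + 4 + 17 ≤ M * 100 + 40 by omega)
    simp only [NatExpr.cost]
    linarith

/-- The output. -/
def outProg : Prog :=
  Prog.seq (letNat 42 c0) (Prog.seq (letNat 43 c0)
    (Prog.seq (forTo 33 (NatExpr.read 0 c0 c0 c0) (forTo 34 (sv 12)
      (Prog.seq nextProg (Prog.seq (letNat 43 ((sv 43).add c1))
        (Prog.seq (Prog.setNat 3 (sv 43) c0 c0 (sv 44)) (letNat 42 (sv 44)))))))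
      (Prog.setNat 3 c0 c0 c0 (sv 43))))

theorem outProg_spec {ω : Tape} {σ : Memory} {s M : ℕ} {E : ℕ → ℕ → ℕ}
    (hs : σ.nat (0, 0, 0, 0) = s) (hM : σ.nat (12, 0, 0, 0) = M)
    (hE : ∀ i < s, ∀ ℓ < M, σ.nat (41, i, ℓ, 0) = E i ℓ) :
    Ex ω outProg σ (s * (M * (s * (M * 100 + 40) + 120) + 40) + 60) fun σ' =>
      σ'.output = outList (s * M) (entrySet E s M) := by
  set S := entrySet E s M with hS
  let I : ℕ → Memory → Prop := fun o σ' => σ'.nat (43, 0, 0, 0) = o ∧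
    σ'.nat (42, 0, 0, 0) = (nxt S)^[o] 0 ∧ ∀ k < o, σ'.nat (3, k + 1, 0, 0) = (nxt S)^[k + 1] 0
  refine Ex.mono (Ex.setNat_seq (Ex.setNat_seq (Ex.seq (Ex.mono (Q := I (s * M)) (Ex.forTo s
    (M * (s * (M * 100 + 40) + 120) + 16) (fun n σ' => I (n * M) σ') ?_ ?_ ?_ ?_ ?_) le_rfl
      fun σ₁ hI => Ex.setNat ?_)))) ?_ fun _ h => h
  · intro k σ' c h; simpa [I] using h
  · simp [Prog.natWrites, nextProg]
  · intro σ' hF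
    simp only [NatExpr.eval]
    rw [hF.nat 0 (by simp [Prog.natWrites, nextProg])]
    simp [hs]
  · simp [NatExpr.eval, I]
  · intro n hn σ₁ hF₁ h33 hI₁
    simp only [forTo_natWrites, forTo_realWrites, Prog.natWrites, Prog.realWrites, nextProg] at hF₁
    refine Ex.mono (Ex.forTo M ((s * (M * 100 + 40) + 40) + 50) (fun m σ' => I (n * M + m) σ')
      ?_ ?_ ?_ ?_ ?_) ?_ ?_
    · intro k σ' c h; simpa [I] using h
    · simp [Prog.natWrites, nextProg]
    · intro σ' hF
      simp only [NatExpr.eval]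
      rw [hF.nat 12 (by simp [Prog.natWrites, nextProg]), hF₁.nat 12 (by simp)]
      simpa using hM
    · simpa using hI₁
    · intro m hm σ₂ hF₂ h34 hI₂
      simp only [forTo_natWrites, forTo_realWrites, Prog.natWrites, Prog.realWrites,
        nextProg] at hF₂
      refine Ex.mono (Ex.seq (Ex.framed (T' := s * (M * 100 + 40) + 40)
        (nextProg_spec (s := s) (M := M) (E := E) ?_ ?_ ?_ hI₂.2.1)
        le_rfl fun σ₃ hF₃ h44 => Ex.setNat_seq (Ex.setNat_seq (Ex.setNat ?_)))) ?_ fun _ h => h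
      · rw [hF₂.nat 0 (by simp), hF₁.nat 0 (by simp)]; simpa using hs
      · rw [hF₂.nat 12 (by simp), hF₁.nat 12 (by simp)]; simpa using hM
      · intro i hi ℓ hℓ
        rw [hF₂.nat 41 (by simp), hF₁.nat 41 (by simp)]
        simpa using hE i hi ℓ hℓ
      · simp only [forTo_natWrites, Prog.natWrites, nextProg] at hF₃
        have h43 : σ₃.nat (43, 0, 0, 0) = n * M + m := by rw [hF₃.nat 43 (by simp), hI₂.1]
        have h44' : σ₃.nat (44, 0, 0, 0) = (nxt S)^[n * M + m + 1] 0 := by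
          rw [h44, Function.iterate_succ_apply']
        refine ⟨?_, ?_, ?_⟩
        · simp [NatExpr.eval, h43]; ring
        · simp [NatExpr.eval, h44']; rfl
        · intro k hk
          by_cases hk' : k = n * M + m
          · subst hk'
            simp [NatExpr.eval, h43, h44']
          · have := hI₂.2.2 k (by omega)
            simp [NatExpr.eval, h43, hk']
            rw [hF₃.nat 3 (by simp), this]; rfl
      · simp only [NatExpr.cost]; omega
    · have := Nat.mul_le_mul_left M (show (s * (M * 100 + 40) + 40) + 50 + 4 + 17 ≤
        s * (M * 100 + 40) + 120 by omega)
      simp only [NatExpr.cost]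
      linarith
    · intro σ' h
      have e : n * M + M = (n + 1) * M := by ring
      rwa [e] at h
  · simp only [NatExpr.eval, Memory.output, outList]
    simp only [Memory.setNat_nat, hI.1, if_true]
    refine List.map_congr_left fun k hk => ?_
    rw [if_neg (by simp)]
    exact hI.2.2 k (List.mem_range.1 hk)
  · have := Nat.mul_le_mul_left s (show M * (s * (M * 100 + 40) + 120) + 16 + 4 + 17 ≤
      M * (s * (M * 100 + 40) + 120) + 40 by omega)
    simp only [NatExpr.cost]
    linarith

/-! ### Names of the hash values -/

theorem shrink_eq_min {z : ℝ} (hz : 0 ≤ z) (n : ℕ) : shrink z n = min n ⌊z⌋₊ := by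
  have : (Finset.range n).filter (fun k : ℕ => ((k + 1 : ℕ) : ℝ) ≤ z) =
      Finset.range (min n ⌊z⌋₊) := by
    ext k
    rw [Finset.mem_filter, Finset.mem_range, Finset.mem_range, ← Nat.le_floor_iff hz]
    omega
  rw [shrink, this, Finset.card_range]

/-- On the values that occur, `shrink` is as fine as the floor function. -/
theorem shrink_eq_iff {c u : ℝ} (hc : 0 ≤ c) (hu : 0 ≤ u) (hu1 : u < 1) (n n' : ℕ) :
    shrink (c * n + u) n = shrink (c * n' + u) n' ↔ ⌊c * n + u⌋ = ⌊c * n' + u⌋ := by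
  have hz : ∀ n : ℕ, 0 ≤ c * n + u := fun n => by positivity
  rw [shrink_eq_min (hz n), shrink_eq_min (hz n')]
  -- For `c ≥ 1` the floor is strictly increasing in `n` and at least `n`, so the truncation returns
  -- `n` itself. For `c < 1` and `u < 1` the floor never exceeds `n`, so nothing is cut off.
  rcases le_or_gt 1 c with h1 | h1
  · have hge : ∀ n : ℕ, n ≤ ⌊c * n + u⌋₊ := by
      intro n
      rw [Nat.le_floor_iff (hz n)]
      nlinarith [(Nat.cast_nonneg n : (0 : ℝ) ≤ n)]
    rw [min_eq_left (hge n), min_eq_left (hge n')]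
    constructor
    · rintro rfl; rfl
    · intro h
      have key : ∀ n n' : ℕ, n < n' → ⌊c * n + u⌋ < ⌊c * n' + u⌋ := by
        intro n n' hn
        rw [Int.lt_iff_add_one_le, Int.le_floor]
        have h2 : (n : ℝ) + 1 ≤ n' := by exact_mod_cast hn
        have h3 := Int.floor_le (c * n + u)
        push_cast
        nlinarith
      rcases lt_trichotomy n n' with h2 | h2 | h2
      · exact absurd h (key _ _ h2).ne
      · exact h2
      · exact absurd h (key _ _ h2).ne'
  · have hle : ∀ n : ℕ, ⌊c * n + u⌋₊ ≤ n := by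
      intro n
      rw [← Nat.lt_succ_iff, Nat.floor_lt (hz n)]
      push_cast
      nlinarith [(Nat.cast_nonneg n : (0 : ℝ) ≤ n)]
    rw [min_eq_right (hle n), min_eq_right (hle n'), ← Int.natCast_floor_eq_floor (hz n),
      ← Int.natCast_floor_eq_floor (hz n')]
    exact Nat.cast_inj.symm

theorem mark_eq_zero {c κ : ℕ} : mark c κ = 0 ↔ κ = 0 := by
  rw [mark]
  split_ifs with h
  · simp [h]
  · simp [h]

/-- A nonzero mark is an odd number times a power of two; the exponent gives `κ` and the odd part
gives `c`. -/
theorem mark_inj {c c' κ κ' : ℕ} (h : mark c κ = mark c' κ') (hκ : κ ≠ 0) : c = c' ∧ κ = κ' := by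
  have hκ' : κ' ≠ 0 := by
    rw [ne_eq, ← mark_eq_zero (c := c'), ← h, mark_eq_zero]; exact hκ
  rw [mark, mark, if_neg hκ, if_neg hκ'] at h
  have key : ∀ a b k k' : ℕ, (a + a + 1) * 2 ^ k = (b + b + 1) * 2 ^ k' → k ≤ k' := by
    intro a b k k' h
    by_contra hk
    obtain ⟨r, rfl⟩ : ∃ r, k = k' + (r + 1) := ⟨k - k' - 1, by omega⟩
    have h2 : (a + a + 1) * 2 ^ (r + 1) = b + b + 1 := by
      have hp : 0 < 2 ^ k' := by positivity
      apply Nat.eq_of_mul_eq_mul_right hp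
      rw [← h, pow_add]; ring
    rw [pow_succ, ← mul_assoc] at h2
    omega
  obtain rfl : κ = κ' := le_antisymm (key _ _ _ _ h) (key _ _ _ _ h.symm)
  have := Nat.eq_of_mul_eq_mul_right (by positivity) h
  omega

theorem avgDist_nonneg {d : ℕ} (A B : Finset (Cube d)) : 0 ≤ avgDist A B := by
  unfold avgDist; positivity

theorem edgeWeight_nonneg {L d : ℕ} (j : Coords L d) (W : Finset (Cube d)) {ξ : ℝ} (hξ : 0 ≤ ξ)
    (v : Node) : 0 ≤ edgeWeight j W ξ v := by
  rw [edgeWeight]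
  split_ifs
  · exact avgDist_nonneg _ _
  · positivity

/-- The entries of the hash value of `x` at the nodes of its elements. -/
def entries {s L d : ℕ} (j : Coords L d) (W : Finset (Cube d)) (ξ γ : ℝ) (u : Node → unitInterval)
    (x : Point s d) : Finset ℕ :=
  (Finset.univ ×ˢ Finset.range (L + 1)).image fun p : Fin s × ℕ =>
    entry j W ξ γ u x (nodeAt j (x p.1) (p.2 + 1))

/-- The output for the query `x`. -/
def hashOut {s L d : ℕ} (j : Coords L d) (W : Finset (Cube d)) (ξ γ : ℝ) (u : Node → unitInterval)
    (x : Point s d) : List ℕ :=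
  outList (s * (L + 1)) (entries j W ξ γ u x)

theorem treeEmbed_eq {s L d : ℕ} (j : Coords L d) (W : Finset (Cube d)) (ξ : ℝ) (x : Point s d)
    (v : Node) : treeEmbed j W ξ x v =
      if 1 ≤ v.length ∧ v.length ≤ L + 1 then edgeWeight j W ξ v * below j x v else 0 := rfl

section

variable {s L d : ℕ} {j : Coords L d} {W : Finset (Cube d)} {ξ γ : ℝ} {u : Node → unitInterval}

theorem entry_eq_zero_iff (x : Point s d) (v : Node) : entry j W ξ γ u x v = 0 ↔
    shrink (edgeWeight j W ξ v * below j x v / γ + u v) (below j x v) = 0 := mark_eq_zero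

/-- A node without elements of `x` has entry `0`, because there is no integer in `[1, 0]` to count.
So nonzero entries occur only on the paths that the query visits. -/
theorem mem_entries {x : Point s d} {e : ℕ} (he : e ≠ 0) : e ∈ entries j W ξ γ u x ↔
    ∃ v : Node, 1 ≤ v.length ∧ v.length ≤ L + 1 ∧ entry j W ξ γ u x v = e := by
  rw [entries, Finset.mem_image]
  constructor
  · rintro ⟨⟨i, ℓ⟩, hp, rfl⟩
    simp only [Finset.mem_product, Finset.mem_univ, Finset.mem_range, true_and] at hp
    exact ⟨_, by rw [nodeAt_length]; omega, by rw [nodeAt_length]; omega, rfl⟩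
  · rintro ⟨v, h1, h2, rfl⟩
    rw [ne_eq, entry_eq_zero_iff] at he
    have hb : below j x v ≠ 0 := by
      intro hb
      rw [hb] at he
      exact he (by simp [shrink])
    rw [below, Finset.card_ne_zero] at hb
    obtain ⟨p, hp⟩ := hb
    rw [Finset.mem_filter, mem_elms] at hp
    refine ⟨(p, v.length - 1), ?_, ?_⟩
    · simp only [Finset.mem_product, Finset.mem_univ, Finset.mem_range, true_and]; omega
    · rw [show v.length - 1 + 1 = v.length by omega, hp.2]

/-- A nonzero entry carries the number of its node, so the unordered set of nonzero entries
determines the entry at every node. -/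
theorem entries_erase_iff (x x' : Point s d) :
    (entries j W ξ γ u x).erase 0 = (entries j W ξ γ u x').erase 0 ↔
      ∀ v : Node, 1 ≤ v.length → v.length ≤ L + 1 →
        entry j W ξ γ u x v = entry j W ξ γ u x' v := by
  constructor
  · intro h v h1 h2
    have key : ∀ x x' : Point s d, (entries j W ξ γ u x).erase 0 = (entries j W ξ γ u x').erase 0 →
        entry j W ξ γ u x v ≠ 0 → entry j W ξ γ u x v = entry j W ξ γ u x' v := by
      intro x x' h hne
      have hm : entry j W ξ γ u x v ∈ (entries j W ξ γ u x).erase 0 :=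
        Finset.mem_erase.2 ⟨hne, (mem_entries hne).2 ⟨v, h1, h2, rfl⟩⟩
      rw [h, Finset.mem_erase, mem_entries hne] at hm
      obtain ⟨-, w, -, -, hw⟩ := hm
      have hw' := mark_inj hw.symm ((entry_eq_zero_iff x v).not.1 hne)
      obtain rfl := enc_injective hw'.1
      exact hw.symm
    by_cases hne : entry j W ξ γ u x v = 0
    · by_cases hne' : entry j W ξ γ u x' v = 0
      · rw [hne, hne']
      · exact (key x' x h.symm hne').symm
    · exact key x x' h hne
  · intro h
    ext e
    simp only [Finset.mem_erase]
    refine and_congr_right fun he => ?_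
    rw [mem_entries he, mem_entries he]
    refine exists_congr fun v => ?_
    constructor
    · rintro ⟨h1, h2, h3⟩; exact ⟨h1, h2, (h v h1 h2).symm.trans h3⟩
    · rintro ⟨h1, h2, h3⟩; exact ⟨h1, h2, (h v h1 h2).trans h3⟩

/-- At a fixed node both coordinates are multiples, by numbers of elements, of one weight, so
`shrink_eq_iff` applies. The strict bound on the shifts is needed there; it holds almost surely. -/
theorem entry_eq_iff (hξ : 0 ≤ ξ) (hγ : 0 < γ) (hu : ∀ v, (u v : ℝ) < 1) (x x' : Point s d)
    {v : Node} (h1 : 1 ≤ v.length) (h2 : v.length ≤ L + 1) :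
    entry j W ξ γ u x v = entry j W ξ γ u x' v ↔
      gridHash γ u (treeEmbed j W ξ x) v = gridHash γ u (treeEmbed j W ξ x') v := by
  have e : ∀ x : Point s d, edgeWeight j W ξ v * below j x v / γ =
      edgeWeight j W ξ v / γ * below j x v := fun x => by ring
  rw [gridHash, gridHash, treeEmbed_eq, treeEmbed_eq, if_pos ⟨h1, h2⟩, if_pos ⟨h1, h2⟩, e, e,
    ← shrink_eq_iff (div_nonneg (edgeWeight_nonneg j W hξ v) hγ.le) (u v).2.1 (hu v), entry, entry,
    e, e]
  constructor
  · intro h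
    by_cases h0 : shrink (edgeWeight j W ξ v / γ * below j x v + u v) (below j x v) = 0
    · rw [h0, mark_zero] at h
      rw [h0, mark_eq_zero.1 h.symm]
    · exact (mark_inj h h0).2
  · intro h; rw [h]

theorem entries_card (x : Point s d) : (entries j W ξ γ u x).card ≤ s * (L + 1) := by
  refine Finset.card_image_le.trans ?_
  simp

/-- Equal outputs mean equal hash values. -/
theorem hashOut_eq_iff (hξ : 0 ≤ ξ) (hγ : 0 < γ) (hu : ∀ v, (u v : ℝ) < 1) (x x' : Point s d) :
    hashOut j W ξ γ u x = hashOut j W ξ γ u x' ↔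
      gridHash γ u (treeEmbed j W ξ x) = gridHash γ u (treeEmbed j W ξ x') := by
  have h1 : hashOut j W ξ γ u x = hashOut j W ξ γ u x' ↔
      (entries j W ξ γ u x).erase 0 = (entries j W ξ γ u x').erase 0 := by
    constructor
    · intro h
      ext e
      simp only [Finset.mem_erase]
      refine and_congr_right fun he => ?_
      rw [← mem_outList (entries_card x) he, ← mem_outList (entries_card x') he]
      exact iff_of_eq (congrArg (e ∈ ·) h)
    · intro h
      simp only [hashOut, outList, nxt_congr h]
  rw [h1, entries_erase_iff]
  constructor
  · intro h
    funext v
    by_cases hv : 1 ≤ v.length ∧ v.length ≤ L + 1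
    · exact (entry_eq_iff hξ hγ hu x x' hv.1 hv.2).1 (h v hv.1 hv.2)
    · simp only [gridHash, treeEmbed_eq, if_neg hv]
  · intro h v hv1 hv2
    exact (entry_eq_iff hξ hγ hu x x' hv1 hv2).2 (congrFun h v)

end

/-! ### The query program -/

/-- The program that answers a query. -/
def queryProg : Prog := Prog.seq pathsProg (Prog.seq entriesProg outProg)

theorem queryProg_natWrites : ∀ A ∈ [0, 12, 15, 16, 17, 21, 22], A ∉ queryProg.natWrites := by
  simp [queryProg, pathsProg, entriesProg, countProg, entryProg, outProg, nextProg, Prog.natWrites]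

theorem queryProg_realWrites : ∀ A ∈ [0, 2], A ∉ queryProg.realWrites := by
  simp [queryProg, pathsProg, entriesProg, countProg, entryProg, outProg, nextProg,
    Prog.realWrites]

/-- A bound for the time of a query. -/
def queryTime (s L B : ℕ) : ℕ :=
  s * (codeTime L B + 21) + 16 + ((s * ((L + 1) * (s * 200 + 300) + 50) + 50) +
    (s * ((L + 1) * (s * ((L + 1) * 100 + 40) + 120) + 40) + 60))

theorem loadQuery_frame {s d : ℕ} (x : Point s d) (σ : Memory) :
    Frame [2] [] σ (loadQuery x σ) := by
  refine ⟨fun A hA q => ?_, fun _ _ _ => rfl⟩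
  simp only [List.mem_singleton] at hA
  simp [loadQuery, hA]

theorem queryProg_spec {ω : Tape} {σ : Memory} {s L d : ℕ} {j : Coords L d}
    {W : Finset (Cube d)} {ξ γ : ℝ} {B : ℕ} (h : Ready s j W ξ γ B σ) (x : Point s d) :
    Ex ω queryProg (loadQuery x σ) (queryTime s L B) fun σ' =>
      Ready s j W ξ γ B σ' ∧
        σ'.output = hashOut j W ξ γ (fun v => ω (2, enc v, 0)) x := by
  have hR := h.frame (loadQuery_frame x σ) (by simp) (by simp)
  refine Ex.framed (Ex.seq (Ex.framed (pathsProg_spec hR.size hR.coords x ?_) le_rfl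
    fun σ₁ hF₁ h₁ => Ex.seq (Ex.framed (entriesProg_spec (hR.frame hF₁ ?_ ?_) x h₁) le_rfl
      fun σ₂ hF₂ h₂ => outProg_spec (s := s) (M := L + 1)
        (E := fun i ℓ => if hi : i < s then entry j W ξ γ (fun v => ω (2, enc v, 0)) x
          (nodeAt j (x ⟨i, hi⟩) (ℓ + 1)) else 0) ?_ ?_ ?_))) ?_ fun σ' hF' h' => ⟨?_, ?_⟩
  · intro i q hq
    simp [loadQuery, bitAt, hq, i.2]
  · simp [pathsProg]
  · simp [pathsProg]
  · rw [hF₂.nat 0 (by simp [entriesProg, countProg, entryProg, Prog.natWrites]),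
      hF₁.nat 0 (by simp [pathsProg]), hR.size]
  · rw [hF₂.nat 12 (by simp [entriesProg, countProg, entryProg, Prog.natWrites]),
      hF₁.nat 12 (by simp [pathsProg]), hR.coords.depth]
  · intro i hi ℓ hℓ
    rw [dif_pos hi]
    exact h₂ ⟨i, hi⟩ ℓ (by omega)
  · rfl
  · exact hR.frame hF' queryProg_natWrites queryProg_realWrites
  · rw [h', hashOut]
    congr 1
    ext e
    simp only [entrySet, entries, Finset.mem_image, Finset.mem_product, Finset.mem_range,
      Finset.mem_univ, true_and, Prod.exists]
    constructor
    · rintro ⟨i, ℓ, ⟨hi, hℓ⟩, rfl⟩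
      exact ⟨⟨i, hi⟩, ℓ, hℓ, by rw [dif_pos hi]⟩
    · rintro ⟨i, ℓ, hℓ, rfl⟩
      exact ⟨i, ℓ, ⟨i.2, hℓ⟩, by rw [dif_pos i.2]⟩

/-- The history of queries is given by executions that exist by assumption; determinism identifies
them with those constructed in `queryProg_spec`, which preserve the invariant. -/
theorem Served.ready {ω : Tape} {σ σ' : Memory} {s L d : ℕ} {j : Coords L d}
    {W : Finset (Cube d)} {ξ γ : ℝ} {B : ℕ} (h : Ready s j W ξ γ B σ)
    (hS : Served (s := s) (d := d) ω queryProg σ σ') : Ready s j W ξ γ B σ' := by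
  induction hS with
  | none => exact h
  | next x _ hE ih =>
    obtain ⟨t, σ₁, h1, -, h2, -⟩ := queryProg_spec (ω := ω) ih x
    rw [(hE.det h1).2]
    exact h2

/-! ### Initialization: the depth of the tree and the projections -/

/-- The dimension. -/
abbrev dimE : NatExpr := NatExpr.read 0 c1 c0 c0

/-- `L = κ ⌈log₂ d⌉`. -/
def depthProg (κ : ℕ) : Prog :=
  Prog.seq (letNat 10 c1) (Prog.seq (letNat 11 c0)
    (Prog.seq (Prog.loop (Test.natLe ((sv 10).add c1) dimE)
      (Prog.seq (letNat 10 ((sv 10).add (sv 10))) (letNat 11 ((sv 11).add (NatExpr.const κ)))))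
    (letNat 12 ((sv 11).add c1))))

theorem clog_le_self (d : ℕ) : Nat.clog 2 d ≤ d :=
  Nat.clog_le_of_le_pow Nat.lt_two_pow_self.le

theorem depthProg_spec {ω : Tape} {σ : Memory} {d : ℕ} (κ : ℕ) (hd : σ.nat (0, 1, 0, 0) = d) :
    Ex ω (depthProg κ) σ (d * 100 + 100) fun σ' =>
      σ'.nat (11, 0, 0, 0) = κ * Nat.clog 2 d ∧ σ'.nat (12, 0, 0, 0) = κ * Nat.clog 2 d + 1 := by
  refine Ex.mono (Ex.setNat_seq (Ex.setNat_seq (Ex.seq (Ex.mono (Ex.loop (Nat.clog 2 d) 40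
    (fun k σ' => σ'.nat (10, 0, 0, 0) = 2 ^ k ∧ σ'.nat (11, 0, 0, 0) = κ * k) ?_ ?_ ?_) le_rfl
      fun σ' h => Ex.setNat ?_)))) ?_ fun _ h => h
  · simp [NatExpr.eval]
  · intro k hk σ' hF ⟨h1, h2⟩
    refine ⟨?_, Ex.mono (Ex.setNat_seq (Ex.setNat ?_)) (by simp [NatExpr.cost]) fun _ h => h⟩
    · have := (Nat.lt_clog_iff_pow_lt one_lt_two).1 hk
      have e := hF.nat 0 (by simp [Prog.natWrites]) (1, 0, 0)
      simp [NatExpr.eval] at e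
      simp [Test.holds, NatExpr.eval, h1, e, hd]
      omega
    · simp [NatExpr.eval, h1, h2, pow_succ, mul_add]
      ring
  · intro σ' hF ⟨h1, h2⟩ h
    have := (Nat.clog_le_iff_le_pow one_lt_two).1 (le_refl (Nat.clog 2 d))
    have e := hF.nat 0 (by simp [Prog.natWrites]) (1, 0, 0)
    simp [NatExpr.eval] at e
    simp [Test.holds, NatExpr.eval, h1, e, hd] at h
    omega
  · simp [NatExpr.eval, h.2]
  · have := clog_le_self d
    simp only [Test.cost, NatExpr.cost]
    omega

/-- The lengths of the labels and the powers of two. -/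
def lengthsProg : Prog :=
  Prog.seq (letNat 10 c1) (Prog.seq
    (forTo 30 (sv 11) (Prog.seq (Prog.setNat 15 (sv 30) c0 c0 (sv 10))
      (Prog.seq (Prog.setNat 17 (sv 30) c0 c0 (sv 10)) (letNat 10 ((sv 10).add (sv 10))))))
    (Prog.seq (Prog.setNat 15 (sv 11) c0 c0 dimE) (Prog.setNat 17 (sv 11) c0 c0 (sv 10))))

theorem lengthsProg_spec {ω : Tape} {σ : Memory} {L d : ℕ} (hd : σ.nat (0, 1, 0, 0) = d)
    (hL : σ.nat (11, 0, 0, 0) = L) :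
    Ex ω lengthsProg σ (L * 100 + 100) fun σ' =>
      (∀ ℓ < L, σ'.nat (15, ℓ, 0, 0) = 2 ^ ℓ) ∧ σ'.nat (15, L, 0, 0) = d ∧
        ∀ ℓ ≤ L, σ'.nat (17, ℓ, 0, 0) = 2 ^ ℓ := by
  refine Ex.mono (Ex.setNat_seq (Ex.seq (Ex.framed (Ex.forTo L 60
    (fun k σ' => σ'.nat (10, 0, 0, 0) = 2 ^ k ∧ (∀ ℓ < k, σ'.nat (15, ℓ, 0, 0) = 2 ^ ℓ) ∧
      ∀ ℓ < k, σ'.nat (17, ℓ, 0, 0) = 2 ^ ℓ) ?_ ?_ ?_ ?_ ?_) le_rfl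
      fun σ' hF h => Ex.setNat_seq (Ex.setNat ?_)))) ?_ fun _ h => h
  · intro k σ' c h; simpa using h
  · simp [Prog.natWrites]
  · intro σ' hF
    simp only [NatExpr.eval]
    rw [hF.nat 11 (by simp [Prog.natWrites])]
    simp [hL]
  · simp [NatExpr.eval]
  · intro k hk σ' hF h30 ⟨h1, h2, h3⟩
    refine Ex.mono (Ex.setNat_seq (Ex.setNat_seq (Ex.setNat ?_))) (by simp [NatExpr.cost])
      fun _ h => h
    refine ⟨?_, ?_, ?_⟩
    · simp [NatExpr.eval, h1, pow_succ]; ring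
    · intro ℓ hℓ
      by_cases h : ℓ = k
      · subst h; simp [NatExpr.eval, h1, h30]
      · simp [NatExpr.eval, h30, h, h2 ℓ (by omega)]
    · intro ℓ hℓ
      by_cases h : ℓ = k
      · subst h; simp [NatExpr.eval, h1, h30]
      · simp [NatExpr.eval, h30, h, h3 ℓ (by omega)]
  · have e11 := hF.nat 11 (by simp [Prog.natWrites]) (0, 0, 0)
    have e0 := hF.nat 0 (by simp [Prog.natWrites]) (1, 0, 0)
    simp [NatExpr.eval, hL, hd] at e11 e0
    obtain ⟨h1, h2, h3⟩ := h
    refine ⟨fun ℓ hℓ => ?_, ?_, fun ℓ hℓ => ?_⟩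
    · simp [NatExpr.eval, e11, hℓ.ne, h2 ℓ hℓ]
    · simp [NatExpr.eval, e11, e0]
    · by_cases h : ℓ = L
      · subst h; simp [NatExpr.eval, e11, h1]
      · simp [NatExpr.eval, e11, h, h3 ℓ (by omega)]
  · simp only [NatExpr.cost]
    omega

/-- The random coordinates. -/
def coordsProg : Prog :=
  Prog.seq (forTo 30 (sv 11) (forTo 31 (NatExpr.read 15 (sv 30) c0 c0)
    (Prog.seq (letNat 32 c0) (Prog.seq
      (Prog.loop (Test.realLe (RealExpr.cast ((sv 32).add c1))
        ((RealExpr.cast dimE).mul (RealExpr.rand c1 (sv 30) (sv 31))))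
        (letNat 32 ((sv 32).add c1)))
      (Prog.setNat 16 (sv 30) (sv 31) c0 (sv 32))))))
  (forTo 31 dimE (Prog.setNat 16 (sv 11) (sv 31) c0 (sv 31)))

/-- The floor of `d` times a uniform number is found by counting up. Level `L` stores the identity
list of coordinates, so that all levels can be treated alike afterwards. -/
theorem coordsProg_spec {ω : Tape} {σ : Memory} {L d : ℕ} (j : Coords L d)
    (hj : ∀ (ℓ : Fin L) (k : Fin (2 ^ (ℓ : ℕ))),
      (j ℓ k : ℕ) = ⌊(d : ℝ) * (ω (1, (ℓ : ℕ), (k : ℕ)) : ℝ)⌋₊)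
    (hd : σ.nat (0, 1, 0, 0) = d) (hL : σ.nat (11, 0, 0, 0) = L)
    (hL1 : σ.nat (12, 0, 0, 0) = L + 1)
    (hlen : ∀ ℓ < L, σ.nat (15, ℓ, 0, 0) = 2 ^ ℓ) (hlenL : σ.nat (15, L, 0, 0) = d) :
    Ex ω coordsProg σ (L * (2 ^ L * (d * 100 + 100) + 100) + d * 100 + 100) fun σ' =>
      CoordsStored j (2 ^ L + d) σ' := by
  refine Ex.framed (Ex.seq (Ex.framed (Ex.forTo L (2 ^ L * (d * 100 + 100) + 30)
    (fun n σ' => ∀ (ℓ : Fin L) (k : Fin (2 ^ (ℓ : ℕ))), (ℓ : ℕ) < n →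
      σ'.nat (16, ℓ, k, 0) = j ℓ k) ?_ ?_ ?_ ?_ ?_) le_rfl
      fun σ₁ hF₁ h₁ => Ex.forTo d 30 (fun n σ' => (∀ k < n, σ'.nat (16, L, k, 0) = k) ∧
        ∀ (ℓ : Fin L) (k : Fin (2 ^ (ℓ : ℕ))), σ'.nat (16, ℓ, k, 0) = j ℓ k)
        ?_ ?_ ?_ ?_ ?_)) ?_ fun σ₂ hF₂ h₂ => ?_
  · intro k σ' c h; simpa using h
  · simp [Prog.natWrites]
  · intro σ' hF
    simp only [NatExpr.eval]
    rw [hF.nat 11 (by simp [Prog.natWrites]), hL]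
  · intro ℓ k h; omega
  · intro n hn σ₁ hF₁ h30 hI₁
    simp only [forTo_natWrites, forTo_realWrites, Prog.natWrites, Prog.realWrites] at hF₁
    refine Ex.mono (Ex.forTo (2 ^ n) (d * 50 + 50) (fun m σ' =>
      ∀ (ℓ : Fin L) (k : Fin (2 ^ (ℓ : ℕ))), ((ℓ : ℕ) < n ∨ (ℓ : ℕ) = n ∧ (k : ℕ) < m) →
      σ'.nat (16, ℓ, k, 0) = j ℓ k) ?_ ?_ ?_ ?_ ?_) ?_ ?_
    · intro k σ' c h; simpa using h
    · simp [Prog.natWrites]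
    · intro σ' hF
      simp only [NatExpr.eval]
      rw [hF.nat 15 (by simp [Prog.natWrites]), hF₁.nat 15 (by simp),
        hF.nat 30 (by simp [Prog.natWrites]), h30]
      exact hlen n hn
    · intro ℓ k h
      exact hI₁ ℓ k (by omega)
    · intro m hm σ₂ hF₂ h31 hI₂
      simp only [Prog.natWrites, Prog.realWrites] at hF₂
      set z : ℝ := (d : ℝ) * (ω (1, n, m) : ℝ) with hz
      have hz0 : 0 ≤ z := mul_nonneg (Nat.cast_nonneg _) (ω (1, n, m)).2.1
      -- This bounds the number of rounds, for the running time only.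
      have hzd : ⌊z⌋₊ ≤ d := by
        refine Nat.floor_le_of_le ?_
        exact mul_le_of_le_one_right (Nat.cast_nonneg _) (ω (1, n, m)).2.2
      have e30 : σ₂.nat (30, 0, 0, 0) = n := by rw [hF₂.nat 30 (by simp), h30]
      have e0 : σ₂.nat (0, 1, 0, 0) = d := by
        rw [hF₂.nat 0 (by simp), hF₁.nat 0 (by simp), hd]
      have ev : ∀ σ' : Memory, σ'.nat (30, 0, 0, 0) = n → σ'.nat (31, 0, 0, 0) = m →
          σ'.nat (0, 1, 0, 0) = d → (((RealExpr.cast dimE).mul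
          (RealExpr.rand c1 (sv 30) (sv 31))).eval ω σ') = z := by
        intro σ' a b c
        simp [RealExpr.eval, NatExpr.eval, a, b, c, hz]
      refine Ex.mono (Ex.setNat_seq (Ex.seq (Ex.framed (Ex.loop ⌊z⌋₊ 10
        (fun k σ' => σ'.nat (32, 0, 0, 0) = k) ?_ ?_ ?_) le_rfl
        fun σ₃ hF₃ h₃ => Ex.setNat ?_))) ?_ fun _ h => h
      · simp [NatExpr.eval]
      · intro k hk σ₃ hF₃ hI₃
        simp only [Prog.natWrites, Prog.realWrites] at hF₃
        refine ⟨?_, Ex.mono (Ex.setNat ?_) (by simp [NatExpr.cost]) fun _ h => h⟩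
        · rw [Test.holds, ev]
          · simp only [RealExpr.eval, NatExpr.eval, hI₃]
            rw [← Nat.le_floor_iff hz0]
            exact hk
          · rw [hF₃.nat 30 (by simp)]; simpa using e30
          · rw [hF₃.nat 31 (by simp)]; simpa using h31
          · rw [hF₃.nat 0 (by simp)]; simpa using e0
        · simp [NatExpr.eval, hI₃]
      · intro σ₃ hF₃ hI₃
        simp only [Prog.natWrites, Prog.realWrites] at hF₃
        rw [Test.holds, ev]
        · simp only [RealExpr.eval, NatExpr.eval, hI₃]
          rw [← Nat.le_floor_iff hz0]
          omega
        · rw [hF₃.nat 30 (by simp)]; simpa using e30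
        · rw [hF₃.nat 31 (by simp)]; simpa using h31
        · rw [hF₃.nat 0 (by simp)]; simpa using e0
      · simp only [Prog.natWrites, Prog.realWrites] at hF₃
        have e30' : σ₃.nat (30, 0, 0, 0) = n := by
          rw [hF₃.nat 30 (by simp)]; simpa using e30
        have e31' : σ₃.nat (31, 0, 0, 0) = m := by
          rw [hF₃.nat 31 (by simp)]; simpa using h31
        intro ℓ k hk
        have e16 : σ₃.nat (16, ℓ, k, 0) = σ₂.nat (16, ℓ, k, 0) := by
          rw [hF₃.nat 16 (by simp)]; simp
        simp only [NatExpr.eval, Memory.setNat_nat, e30', e31', h₃]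
        by_cases hc : (ℓ : ℕ) = n ∧ (k : ℕ) = m
        · have e : ((1, (ℓ : ℕ), (k : ℕ)) : ℕ × ℕ × ℕ) = (1, n, m) := by simp [hc.1, hc.2]
          rw [if_pos (by simp [hc.1, hc.2]), hj ℓ k, e]
        · rw [if_neg (by simpa using hc), e16]
          exact hI₂ ℓ k (by omega)
      · simp only [Test.cost, RealExpr.cost, NatExpr.cost]
        omega
    · have h1 : 2 ^ n * (d * 50 + 50 + 7 + 17) ≤ 2 ^ L * (d * 100 + 100) :=
        Nat.mul_le_mul (Nat.pow_le_pow_right two_pos hn.le) (by omega)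
      simp only [NatExpr.cost]
      linarith
    · intro σ' h ℓ k hk
      refine h ℓ k ((Nat.lt_succ_iff_lt_or_eq.1 hk).imp_right fun h' => ⟨h', ?_⟩)
      rw [← h']
      exact k.2
  · intro k σ' c h; simpa using h
  · simp [Prog.natWrites]
  · intro σ' hF
    simp only [NatExpr.eval]
    rw [hF.nat 0 (by simp [Prog.natWrites]), hF₁.nat 0 (by simp [Prog.natWrites]), hd]
  · exact ⟨fun k hk => by omega, fun ℓ k => h₁ ℓ k ℓ.2⟩
  · intro n hn σ₂ hF₂ h31 ⟨hI₁, hI₂⟩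
    simp only [forTo_natWrites, forTo_realWrites, Prog.natWrites, Prog.realWrites] at hF₁ hF₂
    have e11 : σ₂.nat (11, 0, 0, 0) = L := by
      rw [hF₂.nat 11 (by simp), hF₁.nat 11 (by simp), hL]
    refine Ex.mono (Ex.setNat ?_) (by simp [NatExpr.cost]) fun _ h => h
    constructor
    · intro k hk
      simp only [NatExpr.eval, Memory.setNat_nat, e11, h31]
      by_cases hc : k = n
      · subst hc; simp
      · simp [hc, hI₁ k (by omega)]
    · intro ℓ k
      simp only [NatExpr.eval, Memory.setNat_nat, e11, h31]
      rw [if_neg (by simp [ℓ.2.ne]), hI₂]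
  · have := Nat.mul_le_mul_left L (show 2 ^ L * (d * 100 + 100) + 30 + 4 + 17 ≤
      2 ^ L * (d * 100 + 100) + 100 by omega)
    simp only [NatExpr.cost]
    linarith
  · simp only [coordsProg, forTo_natWrites, forTo_realWrites, Prog.natWrites, Prog.realWrites]
      at hF₂
    have e15 : ∀ ℓ, σ₂.nat (15, ℓ, 0, 0) = σ.nat (15, ℓ, 0, 0) := fun ℓ => hF₂.nat 15 (by simp) _
    have elen : ∀ ℓ < L, σ₂.nat (15, ℓ, 0, 0) = 2 ^ ℓ := fun ℓ hℓ => by rw [e15, hlen ℓ hℓ]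
    have elenL : σ₂.nat (15, L, 0, 0) = d := by rw [e15, hlenL]
    have cases : ∀ ℓ ≤ L, ℓ < L ∨ ℓ = L := fun ℓ hℓ => lt_or_eq_of_le hℓ
    constructor
    · rw [hF₂.nat 12 (by simp), hL1]
    · intro ℓ hℓ
      rcases cases ℓ hℓ with h | rfl
      · rw [elen ℓ h]
        exact (Nat.pow_le_pow_right two_pos hℓ).trans (Nat.le_add_right _ _)
      · rw [elenL]; exact Nat.le_add_left _ _
    · intro ℓ hℓ k hk
      rcases cases ℓ hℓ with h | rfl
      · rw [elen ℓ h] at hk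
        rw [h₂.2 ⟨ℓ, h⟩ ⟨k, hk⟩]
        exact (j _ _).2
      · rw [elenL] at hk
        rw [h₂.1 k hk]
        exact hk
    · intro ℓ hℓ a
      rcases cases ℓ hℓ with h | rfl
      · rw [elen ℓ h, label, dif_pos h]
        refine List.ext_getElem (by simp) fun k h1 h2 => ?_
        simp only [List.length_ofFn] at h1
        simp only [List.getElem_ofFn, List.getElem_map, List.getElem_range]
        rw [h₂.2 ⟨ℓ, h⟩ ⟨k, h1⟩]
        simp [bitAt]
      · rw [elenL, label, dif_neg (lt_irrefl _)]
        refine List.ext_getElem (by simp) fun k h1 h2 => ?_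
        simp only [List.length_ofFn] at h1
        simp only [List.getElem_ofFn, List.getElem_map, List.getElem_range]
        rw [h₂.1 k h1]
        simp [bitAt, h1]

/-! ### Initialization: the number of samples and the scale -/

/-- The number of samples. -/
def sampleSize (κ s d : ℕ) (α : ℝ) : ℕ := ⌊((8 * κ : ℕ) : ℝ) * s * d / α⌋₊ + 2

/-- The size `s`. -/
abbrev sizeE : NatExpr := NatExpr.read 0 c0 c0 c0

/-- The number of samples, and the scale `ξ = C log (m s d / δ)`. -/
def scaleProg (κ C : ℕ) : Prog :=
  Prog.seq (letNat 13 (NatExpr.const 2)) (Prog.seq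
    (Prog.loop (Test.realLe (((RealExpr.cast (sv 13)).sub (RealExpr.cast c1)).mul
        (RealExpr.read 0 c0 c0 c0))
      (((RealExpr.cast (NatExpr.const (8 * κ))).mul (RealExpr.cast sizeE)).mul
        (RealExpr.cast dimE)))
      (letNat 13 ((sv 13).add c1)))
    (Prog.setReal 2 c0 c0 c0 ((RealExpr.cast (NatExpr.const C)).mul
      (RealExpr.log ((((RealExpr.cast (sv 13)).mul (RealExpr.cast sizeE)).mul
        (RealExpr.cast dimE)).div (RealExpr.read 0 (NatExpr.const 3) c0 c0))))))

/-- The scalar `13` starts at `2`, so after `k` rounds the test reads `(k + 1) α ≤ 8 κ s d`. It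
succeeds exactly `⌊8 κ s d / α⌋` times, which avoids both rounding and a division. -/
theorem scaleProg_spec {ω : Tape} {σ : Memory} {s d : ℕ} {α δ : ℝ} (κ C : ℕ)
    (hs : σ.nat (0, 0, 0, 0) = s) (hd : σ.nat (0, 1, 0, 0) = d)
    (hα : σ.real (0, 0, 0, 0) = α) (hα0 : 0 < α) (hδ : σ.real (0, 3, 0, 0) = δ) :
    Ex ω (scaleProg κ C) σ (sampleSize κ s d α * 100 + 100) fun σ' =>
      σ'.nat (13, 0, 0, 0) = sampleSize κ s d α ∧
      σ'.real (2, 0, 0, 0) = C * Real.log ((sampleSize κ s d α : ℝ) * s * d / δ) := by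
  set K : ℝ := ((8 * κ : ℕ) : ℝ) * s * d with hK
  have hK0 : 0 ≤ K / α := by positivity
  have htest : ∀ (k : ℕ) (σ' : Memory), Frame [13] [] σ σ' → σ'.nat (13, 0, 0, 0) = k + 2 →
      ((Test.realLe (((RealExpr.cast (sv 13)).sub (RealExpr.cast c1)).mul
        (RealExpr.read 0 c0 c0 c0))
      (((RealExpr.cast (NatExpr.const (8 * κ))).mul (RealExpr.cast sizeE)).mul
        (RealExpr.cast dimE))).holds ω σ' ↔ k + 1 ≤ ⌊K / α⌋₊) := by
    intro k σ' hF h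
    have e1 := hF.nat 0 (by simp) (0, 0, 0)
    have e2 := hF.nat 0 (by simp) (1, 0, 0)
    have e3 := hF.real 0 (by simp) (0, 0, 0)
    rw [Nat.le_floor_iff hK0, le_div_iff₀ hα0]
    simp only [Test.holds, RealExpr.eval, NatExpr.eval, e1, e2, e3, hs, hd, hα, h, hK]
    push_cast
    rw [show (k : ℝ) + 2 - 1 = k + 1 by ring]
  have hF0 : ∀ σ', Frame [13] [] (σ.setNat (13, 0, 0, 0) 2) σ' → Frame [13] [] σ σ' :=
    fun σ' h => (Frame.setNat σ 13 (0, 0, 0) 2).trans h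
  refine Ex.mono (Ex.setNat_seq (Ex.seq (Ex.framed (Ex.loop ⌊K / α⌋₊ 10
    (fun k σ' => σ'.nat (13, 0, 0, 0) = k + 2) ?_ ?_ ?_) le_rfl
      fun σ' hF h => Ex.setReal ?_))) ?_ fun _ h => h
  · simp [NatExpr.eval]
  · intro k hk σ' hF h
    refine ⟨(htest k σ' (hF0 σ' hF) h).2 hk, Ex.mono (Ex.setNat ?_) (by simp [NatExpr.cost])
      fun _ h => h⟩
    simp [NatExpr.eval, h]
  · intro σ' hF h
    rw [htest _ σ' (hF0 σ' hF) h]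
    omega
  · have e1 := hF.nat 0 (by simp [Prog.natWrites]) (0, 0, 0)
    have e2 := hF.nat 0 (by simp [Prog.natWrites]) (1, 0, 0)
    have e3 := hF.real 0 (by simp [Prog.realWrites]) (3, 0, 0)
    simp [NatExpr.eval] at e1 e2 e3
    constructor
    · simp [h, sampleSize, hK]
    · simp [RealExpr.eval, NatExpr.eval, h, e1, e2, e3, hs, hd, hδ, sampleSize, hK]
  · simp only [Test.cost, RealExpr.cost, NatExpr.cost, sampleSize, ← hK]
    omega

/-! ### Initialization: the samples -/

/-- The index of a sample. -/
def indexProg : Prog :=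
  Prog.seq (letNat 51 c0) (Prog.seq (Prog.setReal 3 c0 c0 c0 (RealExpr.read 1 c0 c0 c0))
    (Prog.loop (Test.realLe (RealExpr.read 3 c0 c0 c0) (RealExpr.rand c0 (sv 50) c0))
      (Prog.seq (letNat 51 ((sv 51).add c1))
        (Prog.setReal 3 c0 c0 c0 ((RealExpr.read 3 c0 c0 c0).add
          (RealExpr.read 1 (sv 51) c0 c0))))))

/-- Partial sums of the probabilities are accumulated until they exceed the random number.
Monotonicity of the partial sums makes all earlier tests succeed. -/
theorem indexProg_spec {ω : Tape} {σ : Memory} {w : ℕ → ℝ} {t i n : ℕ}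
    (hw : ∀ k, σ.real (1, k, 0, 0) = w k) (hw0 : ∀ k, 0 ≤ w k) (ht : σ.nat (50, 0, 0, 0) = t)
    (hi : ∑ k ∈ Finset.range i, w k ≤ ω (0, t, 0))
    (hi' : (ω (0, t, 0) : ℝ) < ∑ k ∈ Finset.range (i + 1), w k) (hn : i < n) :
    Ex ω indexProg σ (n * 50 + 50) fun σ' => σ'.nat (51, 0, 0, 0) = i := by
  refine Ex.mono (Ex.setNat_seq (Ex.setReal_seq (Ex.mono (Ex.loop i 30
    (fun k σ' => σ'.nat (51, 0, 0, 0) = k ∧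
      σ'.real (3, 0, 0, 0) = ∑ k ∈ Finset.range (k + 1), w k) ?_ ?_ ?_) le_rfl
      fun σ' h => h.1))) ?_ fun _ h => h
  · simp [NatExpr.eval, RealExpr.eval, hw]
  · intro k hk σ' hF ⟨h1, h2⟩
    simp only [Prog.natWrites, Prog.realWrites] at hF
    have e50 : σ'.nat (50, 0, 0, 0) = t := by
      rw [hF.nat 50 (by simp)]; simpa using ht
    have e1 : ∀ k, σ'.real (1, k, 0, 0) = w k := by
      intro k; rw [hF.real 1 (by simp)]; simpa using hw k
    refine ⟨?_, Ex.mono (Ex.setNat_seq (Ex.setReal ?_))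
      (by simp [RealExpr.cost, NatExpr.cost]) fun _ h => h⟩
    · simp only [Test.holds, RealExpr.eval, NatExpr.eval, h2, e50]
      refine le_trans (Finset.sum_le_sum_of_subset_of_nonneg ?_ fun _ _ _ => hw0 _) hi
      intro a ha
      simp only [Finset.mem_range] at ha ⊢
      omega
    · constructor
      · simp [NatExpr.eval, h1]
      · rw [Finset.sum_range_succ]
        simp [NatExpr.eval, RealExpr.eval, h1, h2, e1]
  · intro σ' hF ⟨h1, h2⟩
    simp only [Prog.natWrites, Prog.realWrites] at hF
    have e50 : σ'.nat (50, 0, 0, 0) = t := by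
      rw [hF.nat 50 (by simp)]; simpa using ht
    simp only [Test.holds, RealExpr.eval, NatExpr.eval, h2, e50, not_le]
    exact hi'
  · simp only [Test.cost, RealExpr.cost, NatExpr.cost]
    omega

/-! ### Initialization: the elements near the samples -/

/-- Flip the bit `f`, if there is one. -/
def flipAt {d : ℕ} (c : Cube d) (f : ℕ) : Cube d :=
  if h : f < d then Function.update c ⟨f, h⟩ (!c ⟨f, h⟩) else c

theorem bitAt_flipAt {d : ℕ} (c : Cube d) (f : ℕ) {q : ℕ} (hq : q < d) :
    bitAt (flipAt c f) q = if q = f then !bitAt c q else bitAt c q := by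
  unfold flipAt bitAt
  by_cases hf : f < d
  · simp only [hf, hq, dif_pos, Function.update_apply, Fin.mk.injEq]
    split_ifs with h
    · subst h; rfl
    · rfl
  · rw [if_neg (by omega)]
    simp [hf, hq]

theorem hammingDist_le_one_iff {d : ℕ} (c b : Cube d) :
    hammingDist c b ≤ 1 ↔ ∃ f ≤ d, flipAt c f = b := by
  constructor
  · intro h
    rcases Nat.le_one_iff_eq_zero_or_eq_one.1 h with h | h
    -- The index `d` is out of range and flips nothing; it stands for the element itself.
    · exact ⟨d, le_rfl, by simp [flipAt, hammingDist_eq_zero.1 h]⟩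
    · rw [hammingDist, Finset.card_eq_one] at h
      obtain ⟨q, hq⟩ := h
      refine ⟨q, q.2.le, ?_⟩
      funext p
      have hp := congrArg (p ∈ ·) hq
      simp only [Finset.mem_filter, Finset.mem_univ, true_and, Finset.mem_singleton,
        eq_iff_iff] at hp
      simp only [flipAt, q.2, dif_pos, Fin.eta, Function.update_apply]
      split_ifs with h
      · subst h
        have := hp.2 rfl
        revert this
        cases c p <;> cases b p <;> simp
      · by_contra h'
        exact h (hp.1 h')
  · rintro ⟨f, -, rfl⟩
    rw [flipAt]
    split_ifs with hf
    · rw [hammingDist]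
      refine (Finset.card_le_card (t := {⟨f, hf⟩}) fun p hp => ?_).trans (by simp)
      simp only [Finset.mem_filter, Finset.mem_univ, true_and, Function.update_apply] at hp
      by_contra hne
      rw [Finset.mem_singleton] at hne
      simp [hne] at hp
    · simp

theorem nodeAt_leaf_injective {L d : ℕ} (j : Coords L d) :
    Function.Injective fun b : Cube d => nodeAt j b (L + 1) := by
  intro a b h
  simp only [nodeAt_succ] at h
  have := (List.append_inj' h rfl).2
  simp only [List.cons.injEq, and_true, label, lt_irrefl, dite_false] at this
  exact List.ofFn_injective this

/-- The set `S` is listed: the array `18` has the bits and the array `19` the nodes of its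
elements, the scalar `14` has their number, and the array `20` marks the leaves. -/
def Listed {L d : ℕ} (j : Coords L d) (S : Finset (Cube d)) (σ : Memory) : Prop :=
  ∃ f : ℕ → Cube d, Set.InjOn f (Finset.range (σ.nat (14, 0, 0, 0))) ∧
    (Finset.range (σ.nat (14, 0, 0, 0))).image f = S ∧
    (∀ e < σ.nat (14, 0, 0, 0), (∀ q < d, σ.nat (18, e, q, 0) = (bitAt (f e) q).toNat) ∧
      ∀ ℓ ≤ L + 1, σ.nat (19, e, ℓ, 0) = enc (nodeAt j (f e) ℓ)) ∧
    ∀ b, σ.nat (20, enc (nodeAt j b (L + 1)), 0, 0) = if b ∈ S then 1 else 0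

theorem Listed.congr {L d : ℕ} {j : Coords L d} {S : Finset (Cube d)} {σ σ' : Memory}
    (h : Listed j S σ) (h' : ∀ A ∈ [14, 18, 19, 20], ∀ q, σ'.nat (A, q) = σ.nat (A, q)) :
    Listed j S σ' := by
  simpa only [Listed, h' 14 (by simp), h' 18 (by simp), h' 19 (by simp), h' 20 (by simp)] using h

/-- The candidate is always written into row `E`, the first free row. For a repeated element the
counter does not advance, and the row remains scratch space outside the list. -/
theorem Listed.insert {L d E : ℕ} {j : Coords L d} {S : Finset (Cube d)} {σ σ' : Memory}
    {a : Cube d} (h : Listed j S σ) (hE : σ.nat (14, 0, 0, 0) = E)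
    (h18 : ∀ q < d, σ'.nat (18, E, q, 0) = (bitAt a q).toNat)
    (h18' : ∀ e ≠ E, ∀ p, σ'.nat (18, e, p) = σ.nat (18, e, p))
    (h19 : ∀ ℓ ≤ L + 1, σ'.nat (19, E, ℓ, 0) = enc (nodeAt j a ℓ))
    (h19' : ∀ e ≠ E, ∀ p, σ'.nat (19, e, p) = σ.nat (19, e, p))
    (hnew : a ∉ S → σ'.nat (14, 0, 0, 0) = E + 1 ∧ ∀ q, σ'.nat (20, q) =
      if q = (enc (nodeAt j a (L + 1)), 0, 0) then 1 else σ.nat (20, q))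
    (hold : a ∈ S → σ'.nat (14, 0, 0, 0) = E ∧ ∀ q, σ'.nat (20, q) = σ.nat (20, q)) :
    Listed j (Insert.insert a S) σ' := by
  obtain ⟨g, hg1, hg2, hg3, hg4⟩ := h
  rw [hE] at hg1 hg2 hg3
  by_cases ha : a ∈ S
  · obtain ⟨h14, h20⟩ := hold ha
    rw [Finset.insert_eq_of_mem ha]
    refine ⟨g, by rwa [h14], by rwa [h14], fun e he => ?_, fun b => by rw [h20, hg4]⟩
    rw [h14] at he
    obtain ⟨h1, h2⟩ := hg3 e he
    exact ⟨fun q hq => by rw [h18' e he.ne, h1 q hq], fun ℓ hℓ => by rw [h19' e he.ne, h2 ℓ hℓ]⟩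
  · obtain ⟨h14, h20⟩ := hnew ha
    have hgu : ∀ e < E, Function.update g E a e = g e := fun e he => by
      rw [Function.update_of_ne he.ne]
    have himg : (Finset.range E).image (Function.update g E a) = S := by
      rw [← hg2]
      refine Finset.image_congr fun e he => ?_
      simp only [Finset.coe_range, Set.mem_Iio] at he
      exact hgu e he
    refine ⟨Function.update g E a, ?_, ?_, ?_, ?_⟩
    · rw [h14, Finset.range_add_one, Finset.coe_insert, Set.injOn_insert (by simp)]
      refine ⟨hg1.congr fun e he => (hgu e (by simpa using he)).symm, ?_⟩
      rw [Function.update_self, ← Finset.coe_image, himg]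
      exact_mod_cast ha
    · rw [h14, Finset.range_add_one, Finset.image_insert, himg, Function.update_self]
    · intro e he
      rw [h14] at he
      by_cases hc : e = E
      · subst hc
        rw [Function.update_self]
        exact ⟨h18, h19⟩
      · rw [hgu e (by omega)]
        obtain ⟨h1, h2⟩ := hg3 e (by omega)
        exact ⟨fun q hq => by rw [h18' e hc, h1 q hq], fun ℓ hℓ => by rw [h19' e hc, h2 ℓ hℓ]⟩
    · intro b
      rw [h20]
      by_cases hb : b = a
      · subst hb; simp
      · rw [if_neg, hg4]
        · simp [hb]
        · intro he
          simp only [Prod.mk.injEq, and_true] at he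
          exact hb (nodeAt_leaf_injective j (enc_injective he))

/-- Insert the element with the bits of the element `52` of the point `51`, with the bit `53`
flipped. -/
def insertProg : Prog :=
  Prog.seq (forTo 54 dimE (Prog.setNat 18 (sv 14) (sv 54) c0 (NatExpr.read 1 (sv 51) (sv 52) (sv 54))))
  (Prog.seq (Prog.ite (Test.natLe ((sv 53).add c1) dimE)
    (Prog.setNat 18 (sv 14) (sv 53) c0 (c1.sub (NatExpr.read 18 (sv 14) (sv 53) c0))) Prog.skip)
  (Prog.seq (codeProg 18 14 19)
    (Prog.ite (Test.natLe (NatExpr.read 20 (NatExpr.read 19 (sv 14) (sv 12) c0) c0 c0) c0)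
      (Prog.seq (Prog.setNat 20 (NatExpr.read 19 (sv 14) (sv 12) c0) c0 c0 c1)
        (letNat 14 ((sv 14).add c1))) Prog.skip)))

/-- Membership is looked up in constant time at the number of the leaf: the last projection is the
identity, so the leaf determines the element. -/
theorem insertProg_spec {ω : Tape} {σ : Memory} {L d B : ℕ} {j : Coords L d}
    {S : Finset (Cube d)} (hd : σ.nat (0, 1, 0, 0) = d) (hc : CoordsStored j B σ)
    (hS : Listed j S σ) (c : Cube d) {i k f : ℕ} (h51 : σ.nat (51, 0, 0, 0) = i)
    (h52 : σ.nat (52, 0, 0, 0) = k) (h53 : σ.nat (53, 0, 0, 0) = f)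
    (hbits : ∀ q < d, σ.nat (1, i, k, q) = (bitAt c q).toNat) :
    Ex ω insertProg σ (d * 50 + codeTime L B + 150) fun σ' =>
      Listed j (insert (flipAt c f) S) σ' := by
  have hS' := hS
  obtain ⟨g, hg1, hg2, hg3, hg4⟩ := hS
  set E := σ.nat (14, 0, 0, 0) with hE
  have e14 : ∀ {σ' : Memory} {ns rs : List ℕ}, Frame ns rs σ σ' → 14 ∉ ns →
      σ'.nat (14, 0, 0, 0) = E := fun hF h => hF.nat 14 h _
  refine Ex.mono (Ex.seq (Ex.framed (Ex.forTo d 23 (fun n σ' =>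
      (∀ q < n, σ'.nat (18, E, q, 0) = (bitAt c q).toNat) ∧
      ∀ e ≠ E, ∀ p, σ'.nat (18, e, p) = σ.nat (18, e, p)) ?_ ?_ ?_ ?_ ?_) le_rfl
    fun σ₁ hF₁ h₁ => Ex.seq (Ex.framed (Q := fun σ' =>
      (∀ q < d, σ'.nat (18, E, q, 0) = (bitAt (flipAt c f) q).toNat) ∧
      ∀ e ≠ E, ∀ p, σ'.nat (18, e, p) = σ.nat (18, e, p))
      (Ex.ite (T := 30) (fun hb => Ex.mono (Ex.setNat ?_)
      (by simp [NatExpr.cost]) fun _ h => h) fun hb => Ex.mono (Ex.skip ?_) (by simp)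
      fun _ h => h) (T' := 42) (by simp [Test.cost, NatExpr.cost]) fun σ₂ hF₂ h₂ =>
    Ex.seq (Ex.framed (codeProg_spec (row := E) (by simp) (by simp) (by simp)
      ((hc.frame hF₁ ?_ ?_ ?_).frame hF₂ ?_ ?_ ?_) ?_ (flipAt c f) h₂.1) le_rfl
      fun σ₃ hF₃ h₃ => Ex.ite (T := 30) (fun hb => Ex.mono (Ex.setNat_seq (Ex.setNat ?_))
      (by simp [NatExpr.cost]) fun _ h => h) fun hb => Ex.mono (Ex.skip ?_) (by simp)
      fun _ h => h)))) ?_ fun _ h => h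
  any_goals simp only [forTo_natWrites, forTo_realWrites, Prog.natWrites, Prog.realWrites] at hF₁
  any_goals simp only [Prog.natWrites, Prog.realWrites] at hF₂
  any_goals simp only [codeProg_natWrites, codeProg_realWrites] at hF₃
  · intro k σ' c h; simpa using h
  · simp [Prog.natWrites]
  · intro σ' hF
    simp only [NatExpr.eval]
    rw [hF.nat 0 (by simp [Prog.natWrites]), hd]
  · exact ⟨fun q hq => by omega, fun _ _ _ => rfl⟩
  · intro n hn σ₁ hF₁ h54 ⟨h1, h2⟩
    simp only [Prog.natWrites, Prog.realWrites] at hF₁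
    refine Ex.mono (Ex.setNat ?_) (by simp [NatExpr.cost]) fun _ h => h
    simp only [NatExpr.eval, e14 hF₁ (by simp), h54, hF₁.nat 51 (by simp), hF₁.nat 52 (by simp),
      hF₁.nat 1 (by simp), h51, h52, hbits n hn]
    constructor
    · intro q hq
      by_cases h : q = n
      · subst h; simp
      · simp [h, h1 q (by omega)]
    · intro e he p
      simp [he, h2 e he]
  · have e53 : σ₁.nat (53, 0, 0, 0) = f := by rw [hF₁.nat 53 (by simp), h53]
    have e0 : σ₁.nat (0, 1, 0, 0) = d := by rw [hF₁.nat 0 (by simp), hd]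
    simp only [Test.holds, NatExpr.eval, e53, e0] at hb
    simp only [NatExpr.eval, e53, e14 hF₁ (by simp)]
    constructor
    · intro q hq
      rw [bitAt_flipAt c f hq]
      by_cases h : q = f
      · subst h
        simp only [Memory.setNat_nat, if_true, h₁.1 q hq]
        cases bitAt c q <;> rfl
      · simp [h, h₁.1 q hq]
    · intro e he p
      simp [he, h₁.2 e he]
  · have e53 : σ₁.nat (53, 0, 0, 0) = f := by rw [hF₁.nat 53 (by simp), h53]
    have e0 : σ₁.nat (0, 1, 0, 0) = d := by rw [hF₁.nat 0 (by simp), hd]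
    simp only [Test.holds, NatExpr.eval, e53, e0] at hb
    refine ⟨fun q hq => ?_, h₁.2⟩
    rw [bitAt_flipAt c f hq, if_neg (by omega), h₁.1 q hq]
  any_goals solve | simp [Prog.natWrites]
  · rw [hF₂.nat 14 (by simp), hF₁.nat 14 (by simp)]
  · have e20 : ∀ q, σ₃.nat (20, q) = σ.nat (20, q) := fun q => by
      rw [hF₃.nat 20 (by simp), hF₂.nat 20 (by simp), hF₁.nat 20 (by simp)]
    have e14' : σ₃.nat (14, 0, 0, 0) = E := by
      rw [hF₃.nat 14 (by simp), hF₂.nat 14 (by simp), hF₁.nat 14 (by simp)]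
    have e12 : σ₃.nat (12, 0, 0, 0) = L + 1 := by
      rw [hF₃.nat 12 (by simp), hF₂.nat 12 (by simp), hF₁.nat 12 (by simp), hc.depth]
    have e18 : ∀ q, σ₃.nat (18, q) = σ₂.nat (18, q) := fun q => by rw [hF₃.nat 18 (by simp)]
    simp only [Test.holds, NatExpr.eval, e14', e12, h₃.1 (L + 1) le_rfl, e20, hg4] at hb
    refine hS'.insert rfl (a := flipAt c f) ?_ ?_ ?_ ?_ (fun ha => ⟨?_, ?_⟩) fun ha => ?_
    · intro q hq; simpa [NatExpr.eval, e18] using h₂.1 q hq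
    · intro e he p; simpa [NatExpr.eval, e18] using h₂.2 e he p
    · intro ℓ hℓ; simpa [NatExpr.eval] using h₃.1 ℓ hℓ
    · intro e he p
      have := h₃.2 e he p
      rw [hF₂.nat 19 (by simp), hF₁.nat 19 (by simp)] at this
      simpa [NatExpr.eval] using this
    · simp [NatExpr.eval, e14']
      exact hE
    · intro q
      simp [NatExpr.eval, e14', e12, h₃.1 (L + 1) le_rfl, e20]
    · rw [if_pos ha] at hb; omega
  · have e20 : ∀ q, σ₃.nat (20, q) = σ.nat (20, q) := fun q => by
      rw [hF₃.nat 20 (by simp), hF₂.nat 20 (by simp), hF₁.nat 20 (by simp)]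
    have e14' : σ₃.nat (14, 0, 0, 0) = E := by
      rw [hF₃.nat 14 (by simp), hF₂.nat 14 (by simp), hF₁.nat 14 (by simp)]
    have e12 : σ₃.nat (12, 0, 0, 0) = L + 1 := by
      rw [hF₃.nat 12 (by simp), hF₂.nat 12 (by simp), hF₁.nat 12 (by simp), hc.depth]
    have e18 : ∀ q, σ₃.nat (18, q) = σ₂.nat (18, q) := fun q => by rw [hF₃.nat 18 (by simp)]
    simp only [Test.holds, NatExpr.eval, e14', e12, h₃.1 (L + 1) le_rfl, e20, hg4] at hb
    refine hS'.insert rfl (a := flipAt c f) ?_ ?_ h₃.1 ?_ (fun ha => ?_) fun ha => ⟨e14', e20⟩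
    · intro q hq; rw [e18]; exact h₂.1 q hq
    · intro e he p; rw [e18]; exact h₂.2 e he p
    · intro e he p
      rw [h₃.2 e he p, hF₂.nat 19 (by simp), hF₁.nat 19 (by simp)]
    · rw [if_neg ha] at hb; omega
  · simp only [Test.cost, NatExpr.cost]
    omega

/-- The elements at distance at most `1` from the first `k` elements of a point. -/
theorem listed_step {d : ℕ} (S : Finset (Cube d)) (c : Cube d) (f : ℕ) :
    S ∪ (Finset.range (f + 1)).image (flipAt c) =
      insert (flipAt c f) (S ∪ (Finset.range f).image (flipAt c)) := by
  rw [Finset.range_add_one, Finset.image_insert, Finset.union_insert]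

/-- All elements near the elements of the point `51`. -/
def nearProg : Prog :=
  forTo 52 sizeE (forTo 53 (dimE.add c1) insertProg)

/-- The elements at distance at most `1` from the first `k` elements of `y`. -/
def nearUpTo {s d : ℕ} (y : Point s d) (k : ℕ) : Finset (Cube d) :=
  Finset.univ.filter fun b => ∃ i : Fin s, (i : ℕ) < k ∧ hammingDist (y i) b ≤ 1

theorem nearUpTo_succ {s d : ℕ} (y : Point s d) {k : ℕ} (hk : k < s) :
    nearUpTo y (k + 1) = nearUpTo y k ∪ (Finset.range (d + 1)).image (flipAt (y ⟨k, hk⟩)) := by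
  ext b
  simp only [nearUpTo, Finset.mem_filter, Finset.mem_univ, true_and, Finset.mem_union,
    Finset.mem_image, Finset.mem_range, Nat.lt_succ_iff, ← hammingDist_le_one_iff]
  constructor
  · rintro ⟨i, h1, h2⟩
    by_cases hi : (i : ℕ) = k
    · obtain rfl : i = ⟨k, hk⟩ := Fin.ext hi
      exact Or.inr h2
    · exact Or.inl ⟨i, by omega, h2⟩
  · rintro (⟨i, h1, h2⟩ | h)
    · exact ⟨i, by omega, h2⟩
    · exact ⟨⟨k, hk⟩, le_rfl, h⟩

theorem insertProg_natWrites :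
    insertProg.natWrites = [54, 18, 54, 18, 19, 30, 32, 31, 32, 31, 19, 30, 20, 14] := by
  simp [insertProg, Prog.natWrites]

theorem insertProg_realWrites : insertProg.realWrites = [] := by
  simp [insertProg, Prog.realWrites]

theorem nearProg_spec {ω : Tape} {σ : Memory} {s L d B i : ℕ} {j : Coords L d}
    {S : Finset (Cube d)} (hs : σ.nat (0, 0, 0, 0) = s) (hd : σ.nat (0, 1, 0, 0) = d)
    (hc : CoordsStored j B σ) (hS : Listed j S σ) (y : Point s d)
    (h51 : σ.nat (51, 0, 0, 0) = i)
    (hbits : ∀ k : Fin s, ∀ q < d, σ.nat (1, i, k, q) = (bitAt (y k) q).toNat) :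
    Ex ω nearProg σ (s * ((d + 1) * (d * 50 + codeTime L B + 180) + 60) + 20) fun σ' =>
      Listed j (S ∪ nearUpTo y s) σ' := by
  refine Ex.mono (Ex.forTo s ((d + 1) * (d * 50 + codeTime L B + 180) + 20)
    (fun k σ' => Listed j (S ∪ nearUpTo y k) σ') ?_ ?_ ?_ ?_ ?_) ?_ fun _ h => h
  · intro k σ' c h
    exact h.congr fun A hA q => by
      rw [Memory.setNat_nat, if_neg]; rintro ⟨⟩; simp at hA
  · simp [insertProg_natWrites]
  · intro σ' hF
    simp only [NatExpr.eval]
    rw [hF.nat 0 (by simp [insertProg_natWrites]), hs]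
  · simpa [nearUpTo] using hS
  · intro k hk σ₁ hF₁ h52 hI₁
    simp only [forTo_natWrites, forTo_realWrites, insertProg_natWrites,
      insertProg_realWrites] at hF₁
    refine Ex.mono (Ex.forTo (d + 1) (d * 50 + codeTime L B + 150)
      (fun f σ' => Listed j (S ∪ nearUpTo y k ∪ (Finset.range f).image (flipAt (y ⟨k, hk⟩))) σ')
      ?_ ?_ ?_ ?_ ?_) ?_ ?_
    · intro k σ' c h
      exact h.congr fun A hA q => by
        rw [Memory.setNat_nat, if_neg]; rintro ⟨⟩; simp at hA
    · simp [insertProg_natWrites]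
    · intro σ' hF
      simp only [NatExpr.eval]
      rw [hF.nat 0 (by simp [insertProg_natWrites]), hF₁.nat 0 (by simp), hd]
    · simpa using hI₁
    · intro f hf σ₂ hF₂ h53 hI₂
      simp only [insertProg_natWrites, insertProg_realWrites] at hF₂
      rw [listed_step]
      refine insertProg_spec (i := i) (k := k) ?_ ((hc.frame hF₁ ?_ ?_ ?_).frame hF₂ ?_ ?_ ?_)
        hI₂ (y ⟨k, hk⟩) ?_ ?_ h53 ?_
      any_goals solve | simp
      · rw [hF₂.nat 0 (by simp), hF₁.nat 0 (by simp), hd]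
      · rw [hF₂.nat 51 (by simp), hF₁.nat 51 (by simp), h51]
      · rw [hF₂.nat 52 (by simp), h52]
      · intro q hq
        rw [hF₂.nat 1 (by simp), hF₁.nat 1 (by simp)]
        exact hbits ⟨k, hk⟩ q hq
    · have := Nat.mul_le_mul_left (d + 1) (show d * 50 + codeTime L B + 150 + 6 + 17 ≤
        d * 50 + codeTime L B + 180 by omega)
      simp only [NatExpr.cost]
      linarith
    · intro σ' h
      rwa [Finset.union_assoc, ← nearUpTo_succ] at h
  · have := Nat.mul_le_mul_left s (show (d + 1) * (d * 50 + codeTime L B + 180) + 20 + 4 + 17 ≤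
      (d + 1) * (d * 50 + codeTime L B + 180) + 60 by omega)
    simp only [NatExpr.cost]
    linarith

/-! ### Initialization: the weights -/

/-- With truncated subtraction the absolute difference of two bits is the sum of the two
differences. -/
theorem hammingDist_eq_sum {d : ℕ} (a b : Cube d) : hammingDist a b = ∑ q ∈ Finset.range d,
    (((bitAt a q).toNat - (bitAt b q).toNat) + ((bitAt b q).toNat - (bitAt a q).toNat)) := by
  rw [hammingDist, Finset.card_filter, Finset.sum_range]
  refine Finset.sum_congr rfl fun q _ => ?_
  simp only [bitAt, q.2, dif_pos, Fin.eta]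
  cases a q <;> cases b q <;> simp

/-- How often the pair `a, b` counts for the edge with the number `c`. -/
def pairCount {L d : ℕ} (j : Coords L d) (a b : Cube d) (c n : ℕ) : ℕ :=
  ∑ ℓ ∈ Finset.range n,
    if nodeAt j a ℓ = nodeAt j b ℓ ∧ enc (nodeAt j b (ℓ + 1)) = c then 1 else 0

/-- The node at depth `58 + 1` on the path of the element `56`. -/
abbrev lowerE : NatExpr := NatExpr.read 19 (sv 56) ((sv 58).add c1) c0

/-- The contribution of the elements `55` and `56` to the weights. -/
def pairProg : Prog :=
  Prog.seq (letNat 57 c0) (Prog.seq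
    (forTo 54 dimE (letNat 57 ((sv 57).add
      (((NatExpr.read 18 (sv 55) (sv 54) c0).sub (NatExpr.read 18 (sv 56) (sv 54) c0)).add
      ((NatExpr.read 18 (sv 56) (sv 54) c0).sub (NatExpr.read 18 (sv 55) (sv 54) c0))))))
    (forTo 58 (sv 12) (Prog.ite (Test.natLe (NatExpr.read 19 (sv 55) (sv 58) c0)
        (NatExpr.read 19 (sv 56) (sv 58) c0))
      (Prog.ite (Test.natLe (NatExpr.read 19 (sv 56) (sv 58) c0)
          (NatExpr.read 19 (sv 55) (sv 58) c0))
        (Prog.seq (Prog.setNat 21 lowerE c0 c0 ((NatExpr.read 21 lowerE c0 c0).add (sv 57)))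
          (Prog.setNat 22 lowerE c0 c0 ((NatExpr.read 22 lowerE c0 c0).add c1)))
        Prog.skip) Prog.skip)))

theorem pairProg_natWrites : pairProg.natWrites = [57, 54, 57, 54, 58, 21, 22, 58] := by
  simp [pairProg, Prog.natWrites]

theorem pairProg_realWrites : pairProg.realWrites = [] := by
  simp [pairProg, Prog.realWrites]

theorem pairProg_spec {ω : Tape} {σ : Memory} {L d : ℕ} {j : Coords L d} {e e' : ℕ}
    {a b : Cube d} (hd : σ.nat (0, 1, 0, 0) = d) (hL : σ.nat (12, 0, 0, 0) = L + 1)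
    (h55 : σ.nat (55, 0, 0, 0) = e) (h56 : σ.nat (56, 0, 0, 0) = e')
    (ha : ∀ q < d, σ.nat (18, e, q, 0) = (bitAt a q).toNat)
    (hb : ∀ q < d, σ.nat (18, e', q, 0) = (bitAt b q).toNat)
    (ha' : ∀ ℓ ≤ L + 1, σ.nat (19, e, ℓ, 0) = enc (nodeAt j a ℓ))
    (hb' : ∀ ℓ ≤ L + 1, σ.nat (19, e', ℓ, 0) = enc (nodeAt j b ℓ)) :
    Ex ω pairProg σ (d * 100 + (L + 1) * 200 + 100) fun σ' => ∀ c,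
      σ'.nat (21, c, 0, 0) = σ.nat (21, c, 0, 0) + pairCount j a b c (L + 1) * hammingDist a b ∧
      σ'.nat (22, c, 0, 0) = σ.nat (22, c, 0, 0) + pairCount j a b c (L + 1) := by
  refine Ex.mono (Ex.setNat_seq (Ex.seq (Ex.framed (Ex.forTo d 60 (fun n σ' =>
      σ'.nat (57, 0, 0, 0) = ∑ q ∈ Finset.range n,
      (((bitAt a q).toNat - (bitAt b q).toNat) + ((bitAt b q).toNat - (bitAt a q).toNat)))
      ?_ ?_ ?_ ?_ ?_) le_rfl fun σ₁ hF₁ h₁ => Ex.forTo (L + 1) 160 (fun n σ' => ∀ c,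
      σ'.nat (21, c, 0, 0) = σ.nat (21, c, 0, 0) + pairCount j a b c n * hammingDist a b ∧
      σ'.nat (22, c, 0, 0) = σ.nat (22, c, 0, 0) + pairCount j a b c n) ?_ ?_ ?_ ?_ ?_)))
      ?_ fun _ h => h
  · intro k σ' c h; simpa using h
  · simp [Prog.natWrites]
  · intro σ' hF
    simp only [NatExpr.eval]
    rw [hF.nat 0 (by simp [Prog.natWrites])]
    simpa using hd
  · simp [NatExpr.eval]
  · intro n hn σ₁ hF₁ h54 hI₁
    simp only [Prog.natWrites, Prog.realWrites] at hF₁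
    refine Ex.mono (Ex.setNat ?_) (by simp [NatExpr.cost]) fun _ h => h
    rw [Finset.sum_range_succ, ← hI₁, ← ha n hn, ← hb n hn]
    simp [NatExpr.eval, h54, hF₁.nat 55, hF₁.nat 56, hF₁.nat 18, h55, h56]
  · intro k σ' c h; simpa using h
  · simp [Prog.natWrites]
  · intro σ' hF
    simp only [NatExpr.eval]
    rw [hF.nat 12 (by simp [Prog.natWrites]), hF₁.nat 12 (by simp [Prog.natWrites])]
    simpa using hL
  · intro c
    simp only [forTo_natWrites, Prog.natWrites] at hF₁
    simp [pairCount, hF₁.nat 21, hF₁.nat 22]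
  · intro n hn σ₂ hF₂ h58 hI₂
    rw [← hammingDist_eq_sum] at h₁
    simp only [forTo_natWrites, forTo_realWrites, Prog.natWrites, Prog.realWrites] at hF₁ hF₂
    have e55 : σ₂.nat (55, 0, 0, 0) = e := by
      rw [hF₂.nat 55 (by simp), hF₁.nat 55 (by simp)]; simpa using h55
    have e56 : σ₂.nat (56, 0, 0, 0) = e' := by
      rw [hF₂.nat 56 (by simp), hF₁.nat 56 (by simp)]; simpa using h56
    have e57 : σ₂.nat (57, 0, 0, 0) = hammingDist a b := by rw [hF₂.nat 57 (by simp), h₁]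
    have e19 : ∀ q, σ₂.nat (19, q) = σ.nat (19, q) := by
      intro q; rw [hF₂.nat 19 (by simp), hF₁.nat 19 (by simp)]; simp
    have ea := ha' n (by omega)
    have eb := hb' n (by omega)
    have eb1 := hb' (n + 1) (by omega)
    have hiff : nodeAt j a n = nodeAt j b n ↔ enc (nodeAt j a n) = enc (nodeAt j b n) :=
      enc_injective.eq_iff.symm
    have hsucc : ∀ c, pairCount j a b c (n + 1) = pairCount j a b c n +
        if nodeAt j a n = nodeAt j b n ∧ enc (nodeAt j b (n + 1)) = c then 1 else 0 :=
      fun c => Finset.sum_range_succ _ _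
    refine Ex.mono (Ex.ite (T := 120) (fun h1 => Ex.mono (Ex.ite (T := 80) (fun h2 =>
      Ex.mono (Ex.setNat_seq (Ex.setNat fun c => ?_)) (by simp [NatExpr.cost]) fun _ h => h)
      fun h2 => Ex.mono (Ex.skip fun c => ?_) (by simp) fun _ h => h)
      (by simp [Test.cost, NatExpr.cost]) fun _ h => h)
      fun h1 => Ex.mono (Ex.skip fun c => ?_) (by simp) fun _ h => h)
      (by simp [Test.cost, NatExpr.cost]) fun _ h => h
    · simp only [Test.holds, NatExpr.eval, e55, e56, e19, h58, ea, eb] at h1 h2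
      rw [hsucc]
      simp only [hiff, le_antisymm h1 h2, true_and]
      obtain ⟨i1, i2⟩ := hI₂ c
      simp only [NatExpr.eval, Memory.setNat_nat, e56, e57, e19, h58, eb1]
      by_cases hc : enc (nodeAt j b (n + 1)) = c
      · subst hc
        simp [i1, i2, eb1]
        ring_nf
        simp
      · simp [hc, Ne.symm hc, i1, i2, eb1]
    · simp only [Test.holds, NatExpr.eval, e55, e56, e19, h58, ea, eb] at h1 h2
      rw [hsucc, if_neg (fun h => h2 (hiff.1 h.1).ge)]
      exact hI₂ c
    · simp only [Test.holds, NatExpr.eval, e55, e56, e19, h58, ea, eb] at h1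
      rw [hsucc, if_neg (fun h => h1 (hiff.1 h.1).le)]
      exact hI₂ c
  · simp only [NatExpr.cost]
    omega

/-- The sums and the numbers of distances, for all edges. -/
def weightsProg : Prog := forTo 55 (sv 14) (forTo 56 (sv 14) pairProg)

theorem weightsProg_spec {ω : Tape} {σ : Memory} {L d : ℕ} {j : Coords L d}
    {S : Finset (Cube d)} {N : ℕ} (hd : σ.nat (0, 1, 0, 0) = d)
    (hL : σ.nat (12, 0, 0, 0) = L + 1) (hS : Listed j S σ) (hN : S.card ≤ N)
    (h21 : ∀ c, σ.nat (21, c, 0, 0) = 0) (h22 : ∀ c, σ.nat (22, c, 0, 0) = 0) :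
    Ex ω weightsProg σ (N * (N * (d * 100 + (L + 1) * 200 + 130) + 60) + 60) fun σ' => ∀ c,
      σ'.nat (21, c, 0, 0) = ∑ a ∈ S, ∑ b ∈ S, pairCount j a b c (L + 1) * hammingDist a b ∧
      σ'.nat (22, c, 0, 0) = ∑ a ∈ S, ∑ b ∈ S, pairCount j a b c (L + 1) := by
  obtain ⟨f, hf1, hf2, hf3, -⟩ := hS
  set E := σ.nat (14, 0, 0, 0) with hE
  have hEN : E ≤ N := by
    rw [← hf2, Finset.card_image_of_injOn hf1, Finset.card_range] at hN
    exact hN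
  have hsum : ∀ g : Cube d → ℕ, ∑ a ∈ S, g a = ∑ e ∈ Finset.range E, g (f e) := by
    intro g
    rw [← hf2, Finset.sum_image hf1]
  simp only [hsum]
  refine Ex.mono (Ex.forTo E (E * (d * 100 + (L + 1) * 200 + 130) + 20) (fun n σ' => ∀ c,
      σ'.nat (21, c, 0, 0) = ∑ e ∈ Finset.range n, ∑ e' ∈ Finset.range E,
        pairCount j (f e) (f e') c (L + 1) * hammingDist (f e) (f e') ∧
      σ'.nat (22, c, 0, 0) = ∑ e ∈ Finset.range n, ∑ e' ∈ Finset.range E,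
        pairCount j (f e) (f e') c (L + 1)) ?_ ?_ ?_ ?_ ?_) ?_ fun _ h => h
  · intro k σ' c h; simpa using h
  · simp [pairProg_natWrites]
  · intro σ' hF
    simp only [NatExpr.eval]
    rw [hF.nat 14 (by simp [pairProg_natWrites])]
  · intro c; simp [h21, h22]
  · intro n hn σ₁ hF₁ h55 hI₁
    simp only [forTo_natWrites, forTo_realWrites, pairProg_natWrites, pairProg_realWrites] at hF₁
    refine Ex.mono (Ex.forTo E (d * 100 + (L + 1) * 200 + 100) (fun k σ' => ∀ c,
      σ'.nat (21, c, 0, 0) = σ₁.nat (21, c, 0, 0) + ∑ e' ∈ Finset.range k,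
        pairCount j (f n) (f e') c (L + 1) * hammingDist (f n) (f e') ∧
      σ'.nat (22, c, 0, 0) = σ₁.nat (22, c, 0, 0) + ∑ e' ∈ Finset.range k,
        pairCount j (f n) (f e') c (L + 1)) ?_ ?_ ?_ ?_ ?_) ?_ ?_
    · intro k σ' c h; simpa using h
    · simp [pairProg_natWrites]
    · intro σ' hF
      simp only [NatExpr.eval]
      rw [hF.nat 14 (by simp [pairProg_natWrites]), hF₁.nat 14 (by simp)]
    · intro c; simp
    · intro k hk σ₂ hF₂ h56 hI₂
      simp only [pairProg_natWrites, pairProg_realWrites] at hF₂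
      refine Ex.mono (pairProg_spec (L := L) (j := j) (e := n) (e' := k) (a := f n) (b := f k)
        ?_ ?_ ?_ h56 ?_ ?_ ?_ ?_) le_rfl ?_
      · rw [hF₂.nat 0 (by simp), hF₁.nat 0 (by simp), hd]
      · rw [hF₂.nat 12 (by simp), hF₁.nat 12 (by simp), hL]
      · rw [hF₂.nat 55 (by simp), h55]
      · intro q hq; rw [hF₂.nat 18 (by simp), hF₁.nat 18 (by simp)]; exact (hf3 n hn).1 q hq
      · intro q hq; rw [hF₂.nat 18 (by simp), hF₁.nat 18 (by simp)]; exact (hf3 k hk).1 q hq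
      · intro q hq; rw [hF₂.nat 19 (by simp), hF₁.nat 19 (by simp)]; exact (hf3 n hn).2 q hq
      · intro q hq; rw [hF₂.nat 19 (by simp), hF₁.nat 19 (by simp)]; exact (hf3 k hk).2 q hq
      · intro σ' h c
        rw [(h c).1, (h c).2, (hI₂ c).1, (hI₂ c).2, Finset.sum_range_succ, Finset.sum_range_succ]
        constructor <;> ring
    · have := Nat.mul_le_mul_left E (show d * 100 + (L + 1) * 200 + 100 + 4 + 17 ≤
        d * 100 + (L + 1) * 200 + 130 by omega)
      simp only [NatExpr.cost]
      linarith
    · intro σ' h c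
      rw [(h c).1, (h c).2, (hI₁ c).1, (hI₁ c).2, Finset.sum_range_succ, Finset.sum_range_succ]
      exact ⟨rfl, rfl⟩
  · have h1 : E * (d * 100 + (L + 1) * 200 + 130) ≤ N * (d * 100 + (L + 1) * 200 + 130) :=
      Nat.mul_le_mul_right _ hEN
    have := Nat.mul_le_mul hEN (show E * (d * 100 + (L + 1) * 200 + 130) + 20 + 4 + 17 ≤
      N * (d * 100 + (L + 1) * 200 + 130) + 60 by omega)
    simp only [NatExpr.cost]
    linarith

/-- The number of a node determines its depth, so only one term of the sum over the levels can
survive. Agreement of `b` with `x` at depth `ℓ + 1` then turns the condition that `a` and `b` share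
their node into membership of `a` in the cell of `x`. -/
theorem pairCount_nodeAt {L d : ℕ} (j : Coords L d) (a b x : Cube d) {ℓ : ℕ} (hℓ : ℓ ≤ L) :
    pairCount j a b (enc (nodeAt j x (ℓ + 1))) (L + 1) =
      if a ∈ elms j (nodeAt j x ℓ) ∧ b ∈ elms j (nodeAt j x (ℓ + 1)) then 1 else 0 := by
  rw [pairCount, Finset.sum_eq_single ℓ]
  · simp only [mem_elms_nodeAt, enc_injective.eq_iff]
    by_cases hb : nodeAt j b (ℓ + 1) = nodeAt j x (ℓ + 1)
    · simp only [hb, and_true, nodeAt_eq_of_succ hb]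
    · simp [hb]
  · intro k _ hk
    rw [if_neg]
    rintro ⟨-, h⟩
    have := congrArg List.length (enc_injective h)
    rw [nodeAt_length, nodeAt_length] at this
    omega
  · intro h
    exact absurd (Finset.mem_range.2 (by omega)) h

/-- Used twice: with `g` the distance for the numerators of the weights, and with `g = 1` for the
denominators. -/
theorem sum_pairCount {L d : ℕ} (j : Coords L d) (W : Finset (Cube d)) (x : Cube d) {ℓ : ℕ}
    (hℓ : ℓ ≤ L) (g : Cube d → Cube d → ℕ) :
    ∑ a ∈ W, ∑ b ∈ W, pairCount j a b (enc (nodeAt j x (ℓ + 1))) (L + 1) * g a b =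
      ∑ a ∈ elms j (nodeAt j x ℓ) ∩ W, ∑ b ∈ elms j (nodeAt j x (ℓ + 1)) ∩ W, g a b := by
  have e : ∀ v, elms j v ∩ W = W.filter (· ∈ elms j v) := by
    intro v; ext b; simp [and_comm]
  simp only [e, Finset.sum_filter, pairCount_nodeAt j _ _ x hℓ]
  refine Finset.sum_congr rfl fun a _ => ?_
  split_ifs with h
  · exact Finset.sum_congr rfl fun b _ => by simp [h]
  · exact Finset.sum_eq_zero fun b _ => by simp [h]

theorem sampleNbr_card_le {m s d : ℕ} (y : Fin m → Point s d) :
    (sampleNbr y).card ≤ m * s * (d + 1) := by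
  have hsub : sampleNbr y ⊆ (Finset.univ : Finset (Fin m × Fin s)).biUnion fun p =>
      (Finset.range (d + 1)).image (flipAt (y p.1 p.2)) := by
    intro b hb
    simp only [sampleNbr, Finset.mem_filter, Finset.mem_univ, true_and] at hb
    obtain ⟨i, k, h⟩ := hb
    obtain ⟨f, hf, rfl⟩ := (hammingDist_le_one_iff _ _).1 h
    exact Finset.mem_biUnion.2 ⟨(i, k), Finset.mem_univ _,
      Finset.mem_image.2 ⟨f, Finset.mem_range.2 (by omega), rfl⟩⟩
  refine (Finset.card_le_card hsub).trans (Finset.card_biUnion_le.trans ?_)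
  refine (Finset.sum_le_sum fun p _ => Finset.card_image_le).trans ?_
  simp

/-! ### The initialization program -/

/-- All elements near the samples. -/
def samplesProg : Prog := forTo 50 (sv 13) (Prog.seq indexProg nearProg)

/-- The program that initializes the data structure. -/
def initProg (κ C : ℕ) : Prog :=
  Prog.seq (depthProg κ) (Prog.seq lengthsProg (Prog.seq coordsProg (Prog.seq (scaleProg κ C)
    (Prog.seq (letNat 14 c0) (Prog.seq samplesProg weightsProg)))))

/-- The time to list the elements near one sample. -/
def nearTime (s d L B : ℕ) : ℕ :=
  s * ((d + 1) * (d * 50 + codeTime L B + 180) + 60) + 20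

theorem nearProg_natWrites : nearProg.natWrites =
    [52, 53, 54, 18, 54, 18, 19, 30, 32, 31, 32, 31, 19, 30, 20, 14, 53, 52] := by
  simp [nearProg, insertProg_natWrites]

theorem nearProg_realWrites : nearProg.realWrites = [] := by
  simp [nearProg, insertProg_realWrites]

theorem indexProg_natWrites : indexProg.natWrites = [51, 51] := by
  simp [indexProg, Prog.natWrites]

theorem indexProg_realWrites : indexProg.realWrites = [3, 3] := by
  simp [indexProg, Prog.realWrites]

theorem samplesProg_natWrites : samplesProg.natWrites =
    [50, 51, 51, 52, 53, 54, 18, 54, 18, 19, 30, 32, 31, 32, 31, 19, 30, 20, 14, 53, 52, 50] := by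
  simp [samplesProg, Prog.natWrites, nearProg_natWrites, indexProg_natWrites]

theorem samplesProg_realWrites : samplesProg.realWrites = [3, 3] := by
  simp [samplesProg, Prog.realWrites, nearProg_realWrites, indexProg_realWrites]

theorem samplesProg_spec {ω : Tape} {σ : Memory} {s L d B m n : ℕ} {j : Coords L d}
    {w : ℕ → ℝ} (hs : σ.nat (0, 0, 0, 0) = s) (hd : σ.nat (0, 1, 0, 0) = d)
    (hm : σ.nat (13, 0, 0, 0) = m) (hc : CoordsStored j B σ) (hS : Listed j ∅ σ)
    (hw : ∀ k, σ.real (1, k, 0, 0) = w k) (hw0 : ∀ k, 0 ≤ w k) (pts : Fin n → Point s d)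
    (hbits : ∀ (i : Fin n) (k : Fin s), ∀ q < d, σ.nat (1, i, k, q) = (bitAt (pts i k) q).toNat)
    (idx : Fin m → Fin n)
    (hidx : ∀ t : Fin m, ∑ k ∈ Finset.range (idx t), w k ≤ ω (0, (t : ℕ), 0) ∧
      (ω (0, (t : ℕ), 0) : ℝ) < ∑ k ∈ Finset.range (idx t + 1), w k) :
    Ex ω samplesProg σ (m * (n * 50 + 50 + nearTime s d L B + 40) + 20) fun σ' =>
      Listed j (sampleNbr fun t => pts (idx t)) σ' := by
  refine Ex.mono (Ex.forTo m (n * 50 + 50 + nearTime s d L B) (fun t σ' =>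
    Listed j (Finset.univ.filter fun b => ∃ i : Fin m, (i : ℕ) < t ∧ ∃ k,
      hammingDist (pts (idx i) k) b ≤ 1) σ') ?_ ?_ ?_ ?_ ?_) ?_ ?_
  · intro k σ' c h
    exact h.congr fun A hA q => by
      rw [Memory.setNat_nat, if_neg]; rintro ⟨⟩; simp at hA
  · simp [Prog.natWrites, nearProg_natWrites, indexProg_natWrites]
  · intro σ' hF
    simp only [NatExpr.eval]
    rw [hF.nat 13 (by simp [Prog.natWrites, nearProg_natWrites, indexProg_natWrites]), hm]
  · simpa using hS
  · intro t ht σ₁ hF₁ h50 hI₁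
    simp only [Prog.natWrites, Prog.realWrites, nearProg_natWrites, indexProg_natWrites,
      nearProg_realWrites, indexProg_realWrites] at hF₁
    refine Ex.mono (Ex.seq (Ex.framed (indexProg_spec (w := w) (n := n) ?_ hw0 h50
      (hidx ⟨t, ht⟩).1 (hidx ⟨t, ht⟩).2 (idx ⟨t, ht⟩).2) le_rfl fun σ₂ hF₂ h51 =>
      nearProg_spec (s := s) (j := j) (B := B) ?_ ?_ ((hc.frame hF₁ ?_ ?_ ?_).frame hF₂ ?_ ?_ ?_) (hI₁.congr ?_)
        (pts (idx ⟨t, ht⟩)) h51 ?_)) ?_ ?_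
    any_goals simp only [indexProg_natWrites, indexProg_realWrites] at hF₂
    any_goals solve | simp [indexProg_natWrites]
    · intro k; rw [hF₁.real 1 (by simp)]; exact hw k
    · rw [hF₂.nat 0 (by simp), hF₁.nat 0 (by simp), hs]
    · rw [hF₂.nat 0 (by simp), hF₁.nat 0 (by simp), hd]
    · intro A hA q
      refine hF₂.nat A ?_ q
      intro h
      simp at h hA
      omega
    · intro k q hq
      rw [hF₂.nat 1 (by simp), hF₁.nat 1 (by simp)]
      exact hbits _ k q hq
    · exact le_rfl
    · intro σ' h
      convert h using 1
      ext b
      simp only [nearUpTo, Finset.mem_filter, Finset.mem_univ, true_and, Finset.mem_union]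
      constructor
      · rintro ⟨i, h1, h2⟩
        by_cases hi : (i : ℕ) = t
        · obtain rfl : i = ⟨t, ht⟩ := Fin.ext hi
          obtain ⟨k, hk⟩ := h2
          exact Or.inr ⟨k, k.2, hk⟩
        · exact Or.inl ⟨i, by omega, h2⟩
      · rintro (⟨i, h1, h2⟩ | ⟨k, -, h⟩)
        · exact ⟨i, by omega, h2⟩
        · exact ⟨⟨t, ht⟩, by simp, k, h⟩
  · have := Nat.mul_le_mul_left m (show n * 50 + 50 + nearTime s d L B + 4 + 17 ≤
      n * 50 + 50 + nearTime s d L B + 40 by omega)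
    simp only [NatExpr.cost]
    linarith
  · intro σ' h
    convert h using 1
    ext b
    simp [sampleNbr]

/-- A bound for the time of the initialization. -/
def initTime (s d L m n : ℕ) : ℕ :=
  (d * 100 + 100) + ((L * 100 + 100) + ((L * (2 ^ L * (d * 100 + 100) + 100) + d * 100 + 100) +
    ((m * 100 + 100) + (10 + ((m * (n * 50 + 50 + nearTime s d L (2 ^ L + d) + 40) + 20) +
      (m * s * (d + 1) * (m * s * (d + 1) * (d * 100 + (L + 1) * 200 + 130) + 60) + 60))))))

/-- The probabilities of the listed points. -/
def listedWeight {n : ℕ} (wt : Fin n → ℝ) (k : ℕ) : ℝ := if h : k < n then wt ⟨k, h⟩ else 0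

theorem Frame.append {ns rs ns' rs' : List ℕ} {σ σ' σ'' : Memory} (h : Frame ns rs σ σ')
    (h' : Frame ns' rs' σ' σ'') : Frame (ns ++ ns') (rs ++ rs') σ σ'' :=
  ⟨fun A hA q => (h'.nat A (fun h => hA (by simp [h])) q).trans
      (h.nat A (fun h => hA (by simp [h])) q),
    fun A hA q => (h'.real A (fun h => hA (by simp [h])) q).trans
      (h.real A (fun h => hA (by simp [h])) q)⟩

theorem inputMemory_nat {s d n : ℕ} (pts : Fin n → Point s d) (wt : Fin n → ℝ) (α τ γ δ : ℝ)
    {A : ℕ} (hA : 2 ≤ A) (q : ℕ × ℕ × ℕ) : (inputMemory pts wt α τ γ δ).nat (A, q) = 0 := by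
  have h0 : A ≠ 0 := by omega
  have h1 : A ≠ 1 := by omega
  simp [inputMemory, h0, h1]

theorem initProg_spec {ω : Tape} {s d n L : ℕ} (κ C : ℕ) (pts : Fin n → Point s d)
    (wt : Fin n → ℝ) (hwt : ∀ i, 0 ≤ wt i) {α τ γ δ : ℝ} (hα : 0 < α)
    (hL : κ * Nat.clog 2 d = L) (j : Coords L d)
    (hj : ∀ ℓ k, (j ℓ k : ℕ) = ⌊(d : ℝ) * (ω (1, (ℓ : ℕ), (k : ℕ)) : ℝ)⌋₊)
    (idx : Fin (sampleSize κ s d α) → Fin n)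
    (hidx : ∀ t, ∑ k ∈ Finset.range (idx t), listedWeight wt k ≤ ω (0, (t : ℕ), 0) ∧
      (ω (0, (t : ℕ), 0) : ℝ) < ∑ k ∈ Finset.range (idx t + 1), listedWeight wt k) :
    Ex ω (initProg κ C) (inputMemory pts wt α τ γ δ)
      (initTime s d L (sampleSize κ s d α) n) fun σ' =>
      Ready s j (sampleNbr fun t => pts (idx t))
        (C * Real.log ((sampleSize κ s d α : ℝ) * s * d / δ)) γ (2 ^ L + d) σ' := by
  have iz : ∀ A, 2 ≤ A → ∀ q, (inputMemory pts wt α τ γ δ).nat (A, q) = 0 :=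
    fun A hA q => inputMemory_nat pts wt α τ γ δ hA q
  have i0 : (inputMemory pts wt α τ γ δ).nat (0, 0, 0, 0) = s := by simp [inputMemory]
  have i1 : (inputMemory pts wt α τ γ δ).nat (0, 1, 0, 0) = d := by simp [inputMemory]
  have ib : ∀ (i : Fin n) (k : Fin s), ∀ q < d,
      (inputMemory pts wt α τ γ δ).nat (1, i, k, q) = (bitAt (pts i k) q).toNat := by
    intro i k q hq
    simp [inputMemory, bitAt, hq, i.2, k.2]
  have r0 : (inputMemory pts wt α τ γ δ).real (0, 0, 0, 0) = α := by simp [inputMemory]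
  have r2 : (inputMemory pts wt α τ γ δ).real (0, 2, 0, 0) = γ := by simp [inputMemory]
  have r3 : (inputMemory pts wt α τ γ δ).real (0, 3, 0, 0) = δ := by simp [inputMemory]
  have rw1 : ∀ k, (inputMemory pts wt α τ γ δ).real (1, k, 0, 0) = listedWeight wt k := by
    intro k
    by_cases hk : k < n <;> simp [inputMemory, listedWeight, hk]
  have hw0 : ∀ k, 0 ≤ listedWeight wt k := by
    intro k
    unfold listedWeight
    split_ifs
    exacts [hwt _, le_rfl]
  -- Only the entries recorded above matter. From here each phase is run in turn, and the frames say
  -- which arrays it leaves alone.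
  generalize inputMemory pts wt α τ γ δ = σ₀ at *
  obtain ⟨t₁, σ₁, e₁, b₁, h₁, h₁'⟩ := depthProg_spec (ω := ω) κ i1
  have F₁ := e₁.frame
  rw [hL] at h₁ h₁'
  obtain ⟨t₂, σ₂, e₂, b₂, h₂, h₂', h₂''⟩ := lengthsProg_spec (ω := ω) (σ := σ₁) (d := d)
    (by rw [F₁.nat 0 (by simp [depthProg, Prog.natWrites]), i1]) h₁
  have F₂ := F₁.append e₂.frame
  have G₂ := e₂.frame
  obtain ⟨t₃, σ₃, e₃, b₃, h₃⟩ := coordsProg_spec (ω := ω) (σ := σ₂) j hj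
    (by rw [F₂.nat 0 (by simp [depthProg, lengthsProg, Prog.natWrites]), i1])
    (by rw [G₂.nat 11 (by simp [lengthsProg, Prog.natWrites]), h₁])
    (by rw [G₂.nat 12 (by simp [lengthsProg, Prog.natWrites]), h₁']) h₂ h₂'
  have F₃ := F₂.append e₃.frame
  have G₃ := e₃.frame
  obtain ⟨t₄, σ₄, e₄, b₄, h₄, h₄'⟩ := scaleProg_spec (ω := ω) (σ := σ₃) (s := s) (d := d) (α := α)
    (δ := δ) κ C
    (by rw [F₃.nat 0 (by simp [depthProg, lengthsProg, coordsProg, Prog.natWrites]), i0])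
    (by rw [F₃.nat 0 (by simp [depthProg, lengthsProg, coordsProg, Prog.natWrites]), i1])
    (by rw [F₃.real 0 (by simp [depthProg, lengthsProg, coordsProg, Prog.realWrites]), r0]) hα
    (by rw [F₃.real 0 (by simp [depthProg, lengthsProg, coordsProg, Prog.realWrites]), r3])
  have F₄ := F₃.append e₄.frame
  have G₄ := e₄.frame
  obtain ⟨t₅, σ₅, e₅, b₅, h₅⟩ : Ex ω (letNat 14 c0) σ₄ 10 fun σ' => σ'.nat (14, 0, 0, 0) = 0 :=
    Ex.mono (Ex.setNat (by simp [NatExpr.eval])) (by simp [NatExpr.cost]) fun _ h => h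
  have F₅ := F₄.append e₅.frame
  have G₅ := e₅.frame
  simp only [Prog.natWrites, Prog.realWrites, depthProg, lengthsProg, coordsProg, scaleProg,
    forTo_natWrites, forTo_realWrites] at F₅ G₂ G₃ G₄ G₅
  have hc₅ : CoordsStored j (2 ^ L + d) σ₅ :=
    (h₃.frame G₄ (by simp) (by simp) (by simp)).frame G₅ (by simp) (by simp) (by simp)
  have hl₅ : Listed j ∅ σ₅ := by
    refine ⟨fun _ => fun _ => false, ?_, ?_, ?_, ?_⟩
    · simp [h₅]
    · simp [h₅]
    · simp [h₅]
    · intro b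
      rw [F₅.nat 20 (by simp), iz 20 (by norm_num)]
      simp
  obtain ⟨t₆, σ₆, e₆, b₆, h₆⟩ := samplesProg_spec (ω := ω) (σ := σ₅) (s := s) (d := d)
    (w := listedWeight wt)
    (by rw [F₅.nat 0 (by simp), i0]) (by rw [F₅.nat 0 (by simp), i1])
    (by rw [G₅.nat 13 (by simp), h₄]) hc₅ hl₅
    (fun k => by rw [F₅.real 1 (by simp), rw1]) hw0 pts
    (fun i k q hq => by rw [F₅.nat 1 (by simp), ib i k q hq]) idx hidx
  have F₆ := F₅.append e₆.frame
  have G₆ := e₆.frame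
  simp only [samplesProg_natWrites, samplesProg_realWrites] at F₆ G₆
  obtain ⟨t₇, σ₇, e₇, b₇, h₇⟩ := weightsProg_spec (ω := ω) (σ := σ₆) (L := L) (d := d)
    (by rw [F₆.nat 0 (by simp), i1]) (by rw [G₆.nat 12 (by simp), hc₅.depth]) h₆
    (sampleNbr_card_le _)
    (fun c => by rw [F₆.nat 21 (by simp), iz 21 (by norm_num)])
    (fun c => by rw [F₆.nat 22 (by simp), iz 22 (by norm_num)])
  have F₇ := F₆.append e₇.frame
  have G₇ := e₇.frame
  simp only [weightsProg, forTo_natWrites, forTo_realWrites, pairProg_natWrites,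
    pairProg_realWrites] at F₇ G₇
  refine ⟨_, σ₇, e₁.seq (e₂.seq (e₃.seq (e₄.seq (e₅.seq (e₆.seq e₇))))), ?_, ?_⟩
  · unfold initTime
    omega
  · have G₆₇ := G₆.append G₇
    constructor
    · rw [F₇.nat 0 (by simp), i0]
    · rw [F₇.nat 0 (by simp), i1]
    · exact hc₅.frame G₆₇ (by simp) (by simp) (by simp)
    · intro ℓ hℓ
      rw [(G₃.append (G₄.append (G₅.append G₆₇))).nat 17 (by simp), h₂'' ℓ hℓ]
    · rw [(G₅.append G₆₇).real 2 (by simp), h₄']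
    · rw [F₇.real 0 (by simp), r2]
    · intro ℓ hℓ a
      rw [(h₇ _).1, sum_pairCount j _ a hℓ]
    · intro ℓ hℓ a
      rw [(h₇ _).2]
      have := sum_pairCount j (sampleNbr fun t => pts (idx t)) a hℓ fun _ _ => 1
      simpa using this

/-! ### Uniform random numbers -/

theorem unitInterval_volume_real (S : Set ℝ) (hS : MeasurableSet S) :
    (volume : Measure unitInterval) {u | (u : ℝ) ∈ S} = volume (S ∩ Set.Icc 0 1) := by
  have h : {u : unitInterval | (u : ℝ) ∈ S} = Subtype.val ⁻¹' S := rfl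
  rw [h, Measure.Subtype.volume_def, ← Measure.map_apply measurable_subtype_coe hS,
    map_comap_subtype_coe measurableSet_Icc, Measure.restrict_apply hS]

theorem unitInterval_volume_Ico {a b : ℝ} (ha : 0 ≤ a) (hb : b ≤ 1) :
    (volume : Measure unitInterval) {u | a ≤ (u : ℝ) ∧ (u : ℝ) < b} = ENNReal.ofReal (b - a) := by
  have := unitInterval_volume_real (Set.Ico a b) measurableSet_Ico
  have hsub : Set.Ico a b ⊆ Set.Icc 0 1 := fun x hx => ⟨ha.trans hx.1, hx.2.le.trans hb⟩
  rw [Set.inter_eq_left.2 hsub, Real.volume_Ico] at this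
  exact this

theorem unitInterval_ae_lt_one : ∀ᵐ u : unitInterval, (u : ℝ) < 1 := by
  rw [ae_iff]
  have := unitInterval_volume_real (Set.Ici 1) measurableSet_Ici
  simp only [not_lt]
  refine this.trans ?_
  rw [show Set.Ici (1 : ℝ) ∩ Set.Icc 0 1 = {1} by
    ext x
    simp only [Set.mem_inter_iff, Set.mem_Ici, Set.mem_Icc, Set.mem_singleton_iff]
    constructor
    · rintro ⟨h, -, h'⟩; exact le_antisymm h' h
    · rintro rfl; norm_num]
  simp

instance : IsProbabilityMeasure tapeLaw := by unfold tapeLaw; infer_instance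

theorem tapeLaw_ae_lt_one : ∀ᵐ ω ∂tapeLaw, ∀ q, (ω q : ℝ) < 1 := by
  rw [ae_all_iff]
  intro q
  exact (measurePreserving_eval_infinitePi
    (fun _ : ℕ × ℕ × ℕ => (volume : Measure unitInterval)) q).quasiMeasurePreserving.ae
    unitInterval_ae_lt_one

/-! ### Inversion of a distribution function -/

/-- The least `k` with `u < c (k + 1)`. -/
def cdfIndex {n : ℕ} [NeZero n] (c : ℕ → ℝ) (u : unitInterval) : Fin n :=
  Fin.ofNat n (sInf {k | (u : ℝ) < c (k + 1)})

/-- For `u < 1 = c n` some index qualifies and the least one is below `n`, so the reduction modulo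
`n` hidden in `Fin.ofNat` is harmless. For `u = 1` it would not be, which is a null event. -/
theorem cdfIndex_spec {n : ℕ} [NeZero n] {c : ℕ → ℝ} (hc : Monotone c) (h0 : c 0 = 0)
    (h1 : c n = 1) {u : unitInterval} (hu : (u : ℝ) < 1) (k : Fin n) :
    cdfIndex c u = k ↔ c k ≤ u ∧ (u : ℝ) < c (k + 1) := by
  have hn : 0 < n := Nat.pos_of_ne_zero (NeZero.ne n)
  have hne : {k | (u : ℝ) < c (k + 1)}.Nonempty :=
    ⟨n - 1, by rw [Set.mem_ofPred_eq, Nat.sub_add_cancel hn, h1]; exact hu⟩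
  set K := sInf {k | (u : ℝ) < c (k + 1)} with hK
  have hK1 : (u : ℝ) < c (K + 1) := Nat.sInf_mem hne
  have hK2 : c K ≤ u := by
    rcases Nat.eq_zero_or_pos K with h | h
    · rw [h, h0]; exact u.2.1
    · by_contra! hlt
      have := Nat.sInf_le (s := {k | (u : ℝ) < c (k + 1)}) (m := K - 1)
        (by rw [Set.mem_ofPred_eq, Nat.sub_add_cancel h]; exact hlt)
      omega
  have hKn : K < n := by
    by_contra! h
    exact absurd (hu.trans_le (h1.symm.le.trans (hc h))) (not_lt.2 hK2)
  have hval : ((cdfIndex c u : Fin n) : ℕ) = K := by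
    simp only [cdfIndex, ← hK, Fin.val_ofNat]
    exact Nat.mod_eq_of_lt hKn
  constructor
  · rintro rfl
    rw [hval]
    exact ⟨hK2, hK1⟩
  · rintro ⟨h2, h3⟩
    apply Fin.ext
    rw [hval]
    have a1 : ¬ K + 1 ≤ k := fun h => absurd (hK1.trans_le (hc h)) (not_lt.2 h2)
    have a2 : ¬ (k : ℕ) + 1 ≤ K := fun h => absurd (h3.trans_le (hc h)) (not_lt.2 hK2)
    omega

theorem cdfIndex_measurable {n : ℕ} [NeZero n] (c : ℕ → ℝ) :
    Measurable (cdfIndex c : unitInterval → Fin n) := by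
  have : Measurable fun u : unitInterval => sInf {k | (u : ℝ) < c (k + 1)} := by
    refine measurable_to_countable' fun K => ?_
    have hm : ∀ k, MeasurableSet {u : unitInterval | (u : ℝ) < c k} := fun k =>
      measurableSet_lt measurable_subtype_coe measurable_const
    rcases Nat.eq_zero_or_pos K with rfl | hK
    · have e : (fun u : unitInterval => sInf {k | (u : ℝ) < c (k + 1)}) ⁻¹' {0} =
          {u : unitInterval | (u : ℝ) < c 1} ∪ ⋂ k, {u : unitInterval | (u : ℝ) < c (k + 1)}ᶜ := by
        ext u
        simp [Nat.sInf_eq_zero, Set.eq_empty_iff_forall_notMem]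
      rw [e]
      exact (hm 1).union (MeasurableSet.iInter fun k => (hm _).compl)
    · have e : (fun u : unitInterval => sInf {k | (u : ℝ) < c (k + 1)}) ⁻¹' {K} =
          {u : unitInterval | (u : ℝ) < c (K + 1)} ∩
            ⋂ k, ⋂ (_ : k < K), {u : unitInterval | (u : ℝ) < c (k + 1)}ᶜ := by
        ext u
        simp only [Set.mem_preimage, Set.mem_singleton_iff, Set.mem_inter_iff, Set.mem_iInter,
          Set.mem_compl_iff]
        constructor
        · intro h
          have hne : {k | (u : ℝ) < c (k + 1)}.Nonempty := by
            by_contra! hne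
            rw [hne, Nat.sInf_empty] at h
            omega
          refine ⟨h ▸ Nat.sInf_mem hne, fun k hk => ?_⟩
          exact Nat.notMem_of_lt_sInf (h.symm ▸ hk)
        · rintro ⟨h1, h2⟩
          refine le_antisymm (Nat.sInf_le h1) ?_
          by_contra! h
          exact h2 _ h (Nat.sInf_mem (s := {k | (u : ℝ) < c (k + 1)}) ⟨K, h1⟩)
      rw [e]
      exact (hm _).inter (MeasurableSet.iInter fun k => MeasurableSet.iInter fun _ => (hm _).compl)
  exact (measurable_of_countable (Fin.ofNat n)).comp this

theorem cdfIndex_map {n : ℕ} [NeZero n] {c : ℕ → ℝ} (hc : Monotone c) (h0 : c 0 = 0)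
    (h1 : c n = 1) (k : Fin n) :
    (volume : Measure unitInterval).map (cdfIndex c : unitInterval → Fin n) {k} =
      ENNReal.ofReal (c (k + 1) - c k) := by
  rw [Measure.map_apply (cdfIndex_measurable c) (measurableSet_singleton k),
    ← unitInterval_volume_Ico (h0.symm.le.trans (hc (Nat.zero_le k)))
      ((hc (show (k : ℕ) + 1 ≤ n from k.2)).trans h1.le)]
  apply measure_congr
  filter_upwards [unitInterval_ae_lt_one] with u hu
  exact propext (cdfIndex_spec hc h0 h1 hu k)

theorem cdfIndex_map_unif (d : ℕ) [NeZero d] :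
    (volume : Measure unitInterval).map (cdfIndex (fun k => (k : ℝ) / d) : _ → Fin d) =
      unifCoord d := by
  have hd : (0 : ℝ) < d := by exact_mod_cast Nat.pos_of_ne_zero (NeZero.ne d)
  refine Measure.ext_of_singleton fun k => ?_
  rw [cdfIndex_map (fun a b h => by gcongr) (by simp) (div_self hd.ne')]
  rw [unifCoord, PMF.toMeasure_apply_singleton _ _ (measurableSet_singleton k),
    PMF.uniformOfFintype_apply, Fintype.card_fin]
  push_cast
  rw [show ((k : ℝ) + 1) / d - k / d = (d : ℝ)⁻¹ by field_simp; ring,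
    ENNReal.ofReal_inv_of_pos hd, ENNReal.ofReal_natCast]

theorem cdfIndex_unif_eq_floor (d : ℕ) [NeZero d] {u : unitInterval} (hu : (u : ℝ) < 1) :
    ((cdfIndex (fun k => (k : ℝ) / d) u : Fin d) : ℕ) = ⌊(d : ℝ) * u⌋₊ := by
  have hd : (0 : ℝ) < d := by exact_mod_cast Nat.pos_of_ne_zero (NeZero.ne d)
  have := (cdfIndex_spec (n := d) (c := fun k => (k : ℝ) / d) (fun a b h => by
    dsimp only; gcongr) (by simp) (div_self hd.ne') hu _).1 rfl
  rw [div_le_iff₀ hd, lt_div_iff₀ hd] at this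
  refine ((Nat.floor_eq_iff (mul_nonneg hd.le u.2.1)).2 ⟨?_, ?_⟩).symm
  · rw [mul_comm]; exact this.1
  · rw [mul_comm]; exact_mod_cast this.2

/-- The sums of the first `k` probabilities of the listed points. -/
def listedCdf {n : ℕ} (wt : Fin n → ℝ) (k : ℕ) : ℝ := ∑ i ∈ Finset.range k, listedWeight wt i

theorem listedCdf_monotone {n : ℕ} {wt : Fin n → ℝ} (h : ∀ i, 0 ≤ wt i) :
    Monotone (listedCdf wt) := by
  refine monotone_nat_of_le_succ fun k => ?_
  rw [listedCdf, listedCdf, Finset.sum_range_succ, listedWeight]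
  split_ifs
  · linarith [h ⟨k, ‹_›⟩]
  · simp

theorem listedCdf_last {n : ℕ} (wt : Fin n → ℝ) : listedCdf wt n = ∑ i, wt i := by
  rw [listedCdf, Finset.sum_range]
  exact Finset.sum_congr rfl fun i _ => by simp [listedWeight]

section

variable {s d n : ℕ} {μ : PMF (Point s d)} {pts : Fin n → Point s d} {wt : Fin n → ℝ}

theorem sum_listed_weights
    (hp : ∀ p : Point s d, (μ p).toReal = ∑ i, if pts i = p then wt i else 0) :
    ∑ i, wt i = 1 := by
  have h1 : ∑ p, (μ p).toReal = 1 := by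
    rw [← ENNReal.toReal_sum fun p _ => μ.apply_ne_top p]
    have := μ.tsum_coe
    rw [tsum_fintype] at this
    rw [this]; rfl
  simp only [hp] at h1
  rw [Finset.sum_comm] at h1
  simpa using h1

/-- The list may contain a point several times; its probability is then the sum of the lengths of
the intervals of all its indices. -/
theorem listed_map [NeZero n] (hw : ∀ i, 0 ≤ wt i)
    (hp : ∀ p : Point s d, (μ p).toReal = ∑ i, if pts i = p then wt i else 0) :
    (volume : Measure unitInterval).map
      (fun u => pts (cdfIndex (listedCdf wt) u)) = μ.toMeasure := by
  have h1 := sum_listed_weights hp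
  have hm : Measurable pts := measurable_of_countable _
  have e := Measure.map_map (μ := (volume : Measure unitInterval)) hm
    (cdfIndex_measurable (n := n) (listedCdf wt))
  refine e.symm.trans (Measure.ext_of_singleton fun p => ?_)
  rw [Measure.map_apply hm (measurableSet_singleton p),
    PMF.toMeasure_apply_singleton _ _ (measurableSet_singleton p)]
  have hs : pts ⁻¹' {p} = ((Finset.univ.filter fun i => pts i = p : Finset (Fin n)) : Set (Fin n)) := by
    ext i; simp
  rw [hs, ← sum_measure_singleton]
  have : ∀ i : Fin n, (volume : Measure unitInterval).map
      (cdfIndex (listedCdf wt) : unitInterval → Fin n) {i} = ENNReal.ofReal (wt i) := by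
    intro i
    rw [cdfIndex_map (listedCdf_monotone hw) (by simp [listedCdf]) ((listedCdf_last wt).trans h1)]
    congr 1
    rw [listedCdf, listedCdf, Finset.sum_range_succ]
    simp [listedWeight]
  simp only [this]
  rw [← ENNReal.ofReal_sum_of_nonneg fun i _ => hw i, Finset.sum_filter, ← hp p,
    ENNReal.ofReal_toReal (μ.apply_ne_top p)]

end

/-- The samples determined by the random arrays. -/
def tapeSamples {s d n : ℕ} [NeZero n] (m : ℕ) (pts : Fin n → Point s d) (wt : Fin n → ℝ)
    (ω : Tape) : Fin m → Point s d :=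
  fun t => pts (cdfIndex (listedCdf wt) (ω (0, (t : ℕ), 0)))

/-- The coordinates determined by the random arrays. -/
def tapeCoords (L d : ℕ) [NeZero d] (ω : Tape) : Coords L d :=
  fun ℓ k => cdfIndex (fun k => (k : ℝ) / d) (ω (1, (ℓ : ℕ), (k : ℕ)))

/-- The shifts of the grid determined by the random arrays. -/
def tapeShifts (ω : Tape) : Node → unitInterval := fun v => ω (2, enc v, 0)

/-- Distinct cells of an i.i.d. array, each passed through its own measurable map, are independent
with the pushed-forward laws. Samples, coordinates and shifts are instances. -/
theorem tapeLaw_map_reindex {ι : Type} {Y : ι → Type} [∀ i, MeasurableSpace (Y i)]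
    {q : ι → ℕ × ℕ × ℕ} (hq : Function.Injective q) {g : ∀ i, unitInterval → Y i}
    (hg : ∀ i, Measurable (g i)) :
    tapeLaw.map (fun ω i => g i (ω (q i))) =
      Measure.infinitePi fun i => (volume : Measure unitInterval).map (g i) := by
  have h1 := Measure.map_infinitePi_infinitePi_of_inj
    (P := fun _ : ℕ × ℕ × ℕ => (volume : Measure unitInterval)) hq
  have h2 := Measure.infinitePi_map_pi (fun _ : ι => (volume : Measure unitInterval)) hg
  rw [← h1, Measure.map_map (by fun_prop) (by fun_prop)] at h2
  exact h2

theorem tapeSamples_map {s d n : ℕ} [NeZero n] (m : ℕ) {μ : PMF (Point s d)}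
    {pts : Fin n → Point s d} {wt : Fin n → ℝ} (hw : ∀ i, 0 ≤ wt i)
    (hp : ∀ p : Point s d, (μ p).toReal = ∑ i, if pts i = p then wt i else 0) :
    tapeLaw.map (tapeSamples m pts wt) = Measure.pi fun _ => μ.toMeasure := by
  have := tapeLaw_map_reindex (q := fun t : Fin m => (0, (t : ℕ), 0))
    (g := fun _ u => pts (cdfIndex (listedCdf wt) u))
    (fun a b h => by simpa [Fin.ext_iff] using h)
    (fun _ => (measurable_of_countable pts).comp (cdfIndex_measurable _))
  rw [← Measure.infinitePi_eq_pi]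
  simp only [listed_map hw hp] at this
  exact this

theorem tapeCoords_map (L d : ℕ) [NeZero d] :
    tapeLaw.map (tapeCoords L d) = Measure.pi fun _ => Measure.pi fun _ => unifCoord d := by
  have := tapeLaw_map_reindex (ι := (ℓ : Fin L) × Fin (2 ^ (ℓ : ℕ)))
    (q := fun p => (1, (p.1 : ℕ), (p.2 : ℕ)))
    (g := fun _ => (cdfIndex (fun k => (k : ℝ) / d) : _ → Fin d))
    (by
      rintro ⟨a, b⟩ ⟨a', b'⟩ h
      simp only [Prod.mk.injEq, true_and] at h
      obtain ⟨h1, h2⟩ := h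
      obtain rfl := Fin.ext h1
      obtain rfl := Fin.ext h2
      rfl)
    (fun _ => cdfIndex_measurable _)
  simp only [cdfIndex_map_unif] at this
  have h2 := Measure.infinitePi_map_piCurry (ι := Fin L) (κ := fun ℓ => Fin (2 ^ (ℓ : ℕ)))
    (X := fun _ _ => Fin d) fun _ _ => unifCoord d
  have e := Measure.map_map (μ := tapeLaw)
    (MeasurableEquiv.piCurry (fun (ℓ : Fin L) (_ : Fin (2 ^ (ℓ : ℕ))) => Fin d)).measurable
    (f := fun ω (p : (ℓ : Fin L) × Fin (2 ^ (ℓ : ℕ))) =>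
      (cdfIndex (fun k => (k : ℝ) / d) (ω (1, (p.1 : ℕ), (p.2 : ℕ))) : Fin d))
    (measurable_pi_lambda _ fun p => (cdfIndex_measurable _).comp (measurable_pi_apply _))
  rw [this, h2] at e
  simp only [Measure.infinitePi_eq_pi] at e
  exact e.symm

theorem enc_reindex_injective : Function.Injective fun v : Node => (2, enc v, 0) := by
  intro a b h
  simp only [Prod.mk.injEq, true_and, and_true] at h
  exact enc_injective h

theorem tapeShifts_map :
    tapeLaw.map tapeShifts = Measure.infinitePi fun _ => (volume : Measure unitInterval) := by
  have := tapeLaw_map_reindex (g := fun _ u => u) enc_reindex_injective (fun _ => measurable_id)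
  simp only [Measure.map_id'] at this
  exact this

/-- The planes of the random array with different first index are independent; the planes `0`, `1`,
`2` serve the samples, the coordinates and the shifts. -/
theorem tape_iIndepFun :
    iIndepFun (fun (i : ℕ) (ω : Tape) (p : ℕ × ℕ) => ω (i, p)) tapeLaw := by
  rw [iIndepFun_iff_map_fun_eq_infinitePi_map (by fun_prop)]
  have h1 := Measure.infinitePi_map_curry
    (fun (_ : ℕ) (_ : ℕ × ℕ) => (volume : Measure unitInterval))
  refine Eq.trans ?_ (h1.trans ?_)
  · rfl
  · congr 1
    ext1 i
    have := tapeLaw_map_reindex (g := fun _ u => u) (q := fun p : ℕ × ℕ => (i, p))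
      (fun a b h => by simpa using h) (fun _ => measurable_id)
    rw [this]
    simp only [Measure.map_id']

/-- The three components of the seed are functions of three different planes. Independence gives the
product structure, and the marginals were computed separately. -/
theorem tape_measurePreserving {s d n : ℕ} [NeZero n] [NeZero d] (L m : ℕ) {μ : PMF (Point s d)}
    {pts : Fin n → Point s d} {wt : Fin n → ℝ} (hw : ∀ i, 0 ≤ wt i)
    (hp : ∀ p : Point s d, (μ p).toReal = ∑ i, if pts i = p then wt i else 0) (ξ γ : ℝ) :
    MeasurePreserving (fun ω => (tapeSamples m pts wt ω, tapeCoords L d ω, tapeShifts ω)) tapeLaw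
      (sampleTreeFamily L μ m ξ γ).law := by
  have m0 : Measurable (tapeSamples m pts wt) := measurable_pi_lambda _ fun t =>
    ((measurable_of_countable pts).comp (cdfIndex_measurable _)).comp (measurable_pi_apply _)
  have m1 : Measurable (tapeCoords L d) := measurable_pi_lambda _ fun ℓ =>
    measurable_pi_lambda _ fun k => (cdfIndex_measurable _).comp (measurable_pi_apply _)
  have m2 : Measurable tapeShifts := measurable_pi_lambda _ fun v => measurable_pi_apply _
  refine ⟨m0.prodMk (m1.prodMk m2), ?_⟩
  have g0 : Measurable fun (a : ℕ × ℕ → unitInterval) (t : Fin m) =>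
      pts (cdfIndex (listedCdf wt) (a ((t : ℕ), 0))) := measurable_pi_lambda _ fun t =>
    ((measurable_of_countable pts).comp (cdfIndex_measurable _)).comp (measurable_pi_apply _)
  have g1 : Measurable fun (a : ℕ × ℕ → unitInterval) =>
      ((fun ℓ k => cdfIndex (fun k => (k : ℝ) / d) (a ((ℓ : ℕ), (k : ℕ)))) : Coords L d) :=
    measurable_pi_lambda _ fun ℓ =>
      measurable_pi_lambda _ fun k => (cdfIndex_measurable _).comp (measurable_pi_apply _)
  have g2 : Measurable fun (a : ℕ × ℕ → unitInterval) (v : Node) => a (enc v, 0) :=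
    measurable_pi_lambda _ fun v => measurable_pi_apply _
  have i01 := (tape_iIndepFun.indepFun_prodMk (fun i => by fun_prop) 1 2 0 (by norm_num)
    (by norm_num)).symm.comp g0 (g1.prodMap g2)
  have i12 := (tape_iIndepFun.indepFun (i := 1) (j := 2) (by norm_num)).comp g1 g2
  have e01 := i01.map_prod_eq_prod_map_map m0.aemeasurable (m1.prodMk m2).aemeasurable
  have e12 := i12.map_prod_eq_prod_map_map m1.aemeasurable m2.aemeasurable
  refine e01.trans ?_
  have e12' : tapeLaw.map (fun ω => (tapeCoords L d ω, tapeShifts ω)) =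
      (tapeLaw.map (tapeCoords L d)).prod (tapeLaw.map tapeShifts) := e12
  have s0 : tapeLaw.map (tapeSamples m pts wt) = _ := tapeSamples_map m hw hp
  change (tapeLaw.map (tapeSamples m pts wt)).prod
    (tapeLaw.map (fun ω => (tapeCoords L d ω, tapeShifts ω))) = _
  rw [e12', s0, tapeCoords_map, tapeShifts_map]
  rfl

/-! ### Polynomial time bounds -/

/-- `f ≤ C X^C` for a constant `C`. -/
def PolyBounded {ι : Type} (X : ι → ℝ) (f : ι → ℕ) : Prop := ∃ C : ℕ, ∀ i, (f i : ℝ) ≤ C * X i ^ C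

section

variable {ι : Type} {X : ι → ℝ} {f g : ι → ℕ}

theorem PolyBounded.of_le (hX : ∀ i, 1 ≤ X i) (a k : ℕ) (h : ∀ i, (f i : ℝ) ≤ a * X i ^ k) :
    PolyBounded X f := by
  refine ⟨a + k, fun i => (h i).trans ?_⟩
  have := hX i
  have h2 : X i ^ k ≤ X i ^ (a + k) := pow_le_pow_right₀ this (by omega)
  have h3 : (0 : ℝ) ≤ X i ^ (a + k) := by positivity
  push_cast
  have := mul_le_mul_of_nonneg_left h2 (Nat.cast_nonneg (α := ℝ) a)
  nlinarith [mul_nonneg (Nat.cast_nonneg (α := ℝ) k) h3]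

theorem PolyBounded.const (hX : ∀ i, 1 ≤ X i) (c : ℕ) : PolyBounded X fun _ => c :=
  .of_le hX c 0 fun i => by simp

theorem PolyBounded.add (hX : ∀ i, 1 ≤ X i) (hf : PolyBounded X f) (hg : PolyBounded X g) :
    PolyBounded X fun i => f i + g i := by
  obtain ⟨a, ha⟩ := hf
  obtain ⟨b, hb⟩ := hg
  refine ⟨a + b, fun i => ?_⟩
  have h1 : X i ^ a ≤ X i ^ (a + b) := pow_le_pow_right₀ (hX i) (by omega)
  have h2 : X i ^ b ≤ X i ^ (a + b) := pow_le_pow_right₀ (hX i) (by omega)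
  push_cast
  rw [add_mul]
  exact add_le_add ((ha i).trans (mul_le_mul_of_nonneg_left h1 (by positivity)))
    ((hb i).trans (mul_le_mul_of_nonneg_left h2 (by positivity)))

theorem PolyBounded.mul (hX : ∀ i, 1 ≤ X i) (hf : PolyBounded X f) (hg : PolyBounded X g) :
    PolyBounded X fun i => f i * g i := by
  obtain ⟨a, ha⟩ := hf
  obtain ⟨b, hb⟩ := hg
  refine .of_le hX (a * b) (a + b) fun i => ?_
  have := hX i
  push_cast
  calc (f i : ℝ) * g i ≤ (a * X i ^ a) * (b * X i ^ b) :=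
        mul_le_mul (ha i) (hb i) (by positivity) (by positivity)
    _ = _ := by ring

theorem PolyBounded.pow (hX : ∀ i, 1 ≤ X i) (hf : PolyBounded X f) (k : ℕ) :
    PolyBounded X fun i => f i ^ k := by
  induction k with
  | zero => simpa using PolyBounded.const hX 1
  | succ k ih => simpa only [pow_succ] using ih.mul hX hf

theorem PolyBounded.mono (hf : PolyBounded X f) (h : ∀ i, g i ≤ f i) : PolyBounded X g := by
  obtain ⟨a, ha⟩ := hf
  exact ⟨a, fun i => le_trans (by exact_mod_cast h i) (ha i)⟩

end

/-- The parameters `s, d, α` on which the time bounds depend. -/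
abbrev TimeParams : Type := {p : ℕ × ℕ × ℝ // 1 ≤ p.1 ∧ 1 ≤ p.2.1 ∧ 0 < p.2.2}

/-- The quantity `s d / min(α, 1)`. -/
def TimeParams.scale (p : TimeParams) : ℝ := (p.1.1 : ℝ) * p.1.2.1 / min p.1.2.2 1

theorem TimeParams.one_le_mul (p : TimeParams) : (1 : ℝ) ≤ (p.1.1 : ℝ) * p.1.2.1 := by
  have h1 : (1 : ℝ) ≤ p.1.1 := by exact_mod_cast p.2.1
  have h2 : (1 : ℝ) ≤ p.1.2.1 := by exact_mod_cast p.2.2.1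
  nlinarith

theorem TimeParams.mul_le_scale (p : TimeParams) : (p.1.1 : ℝ) * p.1.2.1 ≤ p.scale := by
  have h := p.one_le_mul
  have h3 : 0 < min p.1.2.2 1 := lt_min p.2.2.2 one_pos
  rw [scale, le_div_iff₀ h3]
  nlinarith [min_le_right p.1.2.2 1]

theorem TimeParams.one_le_scale (p : TimeParams) : 1 ≤ p.scale := p.one_le_mul.trans p.mul_le_scale

/-- The longest labels have length exponential in the depth, but the depth is logarithmic in `d`:
rounding the logarithm up loses a factor of at most `2` in its exponential. -/
theorem two_pow_clog_le {d : ℕ} (hd : 1 ≤ d) (κ : ℕ) : 2 ^ (κ * Nat.clog 2 d) ≤ (2 * d) ^ κ := by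
  rw [mul_comm, pow_mul]
  refine Nat.pow_le_pow_left ?_ κ
  rcases Nat.eq_zero_or_pos (Nat.clog 2 d) with h | h
  · rw [h]; omega
  · have := (Nat.lt_clog_iff_pow_lt one_lt_two).1 (Nat.sub_lt h one_pos)
    calc 2 ^ Nat.clog 2 d = 2 * 2 ^ (Nat.clog 2 d - 1) := by
          rw [← pow_succ']; congr 1; omega
      _ ≤ 2 * d := by omega

theorem polyBounded_size : PolyBounded TimeParams.scale fun p => p.1.1 :=
  .of_le (fun p => p.one_le_scale) 1 1 fun p => by
    have h := p.mul_le_scale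
    have h1 : (1 : ℝ) ≤ p.1.1 := by exact_mod_cast p.2.1
    have h2 : (1 : ℝ) ≤ p.1.2.1 := by exact_mod_cast p.2.2.1
    simp only [Nat.cast_one, one_mul, pow_one]
    nlinarith

theorem polyBounded_dim : PolyBounded TimeParams.scale fun p => p.1.2.1 :=
  .of_le (fun p => p.one_le_scale) 1 1 fun p => by
    have h := p.mul_le_scale
    have h1 : (1 : ℝ) ≤ p.1.1 := by exact_mod_cast p.2.1
    have h2 : (1 : ℝ) ≤ p.1.2.1 := by exact_mod_cast p.2.2.1
    simp only [Nat.cast_one, one_mul, pow_one]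
    nlinarith

theorem polyBounded_depth (κ : ℕ) :
    PolyBounded TimeParams.scale fun p => κ * Nat.clog 2 p.1.2.1 := by
  have hX := fun p : TimeParams => p.one_le_scale
  exact ((PolyBounded.const hX κ).mul hX polyBounded_dim).mono fun p =>
    Nat.mul_le_mul_left _ (clog_le_self _)

theorem polyBounded_two_pow_depth (κ : ℕ) :
    PolyBounded TimeParams.scale fun p => 2 ^ (κ * Nat.clog 2 p.1.2.1) := by
  have hX := fun p : TimeParams => p.one_le_scale
  exact (((PolyBounded.const hX 2).mul hX polyBounded_dim).pow hX κ).mono fun p =>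
    two_pow_clog_le p.2.2.1 κ

theorem polyBounded_sampleSize (κ : ℕ) :
    PolyBounded TimeParams.scale fun p => sampleSize κ p.1.1 p.1.2.1 p.1.2.2 := by
  refine .of_le (fun p => p.one_le_scale) (8 * κ + 2) 1 fun p => ?_
  have h0 := p.one_le_scale
  have h1 : (p.1.1 : ℝ) * p.1.2.1 / p.1.2.2 ≤ p.scale := by
    have := p.2.2.2
    rw [TimeParams.scale]
    have := p.one_le_mul
    have h3 : 0 < min p.1.2.2 1 := lt_min p.2.2.2 one_pos
    gcongr
    exact min_le_left _ _
  have h2 : 0 ≤ ((8 * κ : ℕ) : ℝ) * p.1.1 * p.1.2.1 / p.1.2.2 := by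
    have := p.2.2.2; positivity
  rw [sampleSize]
  push_cast
  have h3 := Nat.floor_le h2
  have h4 : ((8 * κ : ℕ) : ℝ) * p.1.1 * p.1.2.1 / p.1.2.2 =
    (8 * κ) * (p.1.1 * p.1.2.1 / p.1.2.2) := by push_cast; ring
  have h5 : (8 * κ : ℝ) * (p.1.1 * p.1.2.1 / p.1.2.2) ≤ 8 * κ * p.scale := by gcongr
  push_cast at h3 h4
  rw [pow_one]
  linarith

theorem polyBounded_codeTime (κ : ℕ) : PolyBounded TimeParams.scale fun p =>
    codeTime (κ * Nat.clog 2 p.1.2.1) (2 ^ (κ * Nat.clog 2 p.1.2.1) + p.1.2.1) := by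
  have hX := fun p : TimeParams => p.one_le_scale
  have c := PolyBounded.const hX
  exact (((polyBounded_depth κ).add hX (c 1)).mul hX ((((polyBounded_two_pow_depth κ).add hX
    polyBounded_dim).mul hX (c 200)).add hX (c 200))).add hX (c 200)

theorem polyBounded_queryTime (κ : ℕ) : PolyBounded TimeParams.scale fun p =>
    queryTime p.1.1 (κ * Nat.clog 2 p.1.2.1) (2 ^ (κ * Nat.clog 2 p.1.2.1) + p.1.2.1) := by
  have hX := fun p : TimeParams => p.one_le_scale
  have c := PolyBounded.const hX
  have s := polyBounded_size
  have L := (polyBounded_depth κ).add hX (c 1)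
  refine PolyBounded.add hX (PolyBounded.add hX (s.mul hX (.add hX (polyBounded_codeTime κ) (c _)))
    (c _)) (.add hX (.add hX (s.mul hX (.add hX (L.mul hX (.add hX (s.mul hX (c _)) (c _))) (c _)))
    (c _)) (.add hX (s.mul hX (.add hX (L.mul hX (.add hX (s.mul hX (.add hX (L.mul hX (c _)) (c _)))
      (c _))) (c _))) (c _)))

theorem polyBounded_initTime (κ : ℕ) : PolyBounded TimeParams.scale fun p =>
    initTime p.1.1 p.1.2.1 (κ * Nat.clog 2 p.1.2.1) (sampleSize κ p.1.1 p.1.2.1 p.1.2.2) 1 := by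
  have hX := fun p : TimeParams => p.one_le_scale
  have c := PolyBounded.const hX
  have s := polyBounded_size
  have d := polyBounded_dim
  have m := polyBounded_sampleSize κ
  have L := polyBounded_depth κ
  have d1 := (d.mul hX (c 100)).add hX (c 100)
  have L1 := L.add hX (c 1)
  have near := (s.mul hX (.add hX ((d.add hX (c 1)).mul hX
    (.add hX (.add hX (d.mul hX (c 50)) (polyBounded_codeTime κ)) (c 180))) (c 60))).add hX (c 20)
  have N := (m.mul hX s).mul hX (d.add hX (c 1))
  exact d1.add hX (((L.mul hX (c 100)).add hX (c 100)).add hX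
    (((((L.mul hX (((polyBounded_two_pow_depth κ).mul hX d1).add hX (c 100))).add hX
      (d.mul hX (c 100))).add hX (c 100))).add hX
    (((m.mul hX (c 100)).add hX (c 100)).add hX ((c 10).add hX
      (((m.mul hX (.add hX (.add hX (c (1 * 50 + 50)) near) (c 40))).add hX (c 20)).add hX
      ((N.mul hX (.add hX (N.mul hX (.add hX (.add hX (d.mul hX (c 100)) (L1.mul hX (c 200)))
        (c 130))) (c 60))).add hX (c 60)))))))

/-- The number `n` of listed points enters only in the search for the index of a sample, and there
linearly. -/
theorem initTime_le_mul (s d L m : ℕ) {n : ℕ} (hn : 1 ≤ n) :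
    initTime s d L m n ≤ n * initTime s d L m 1 := by
  obtain ⟨k, rfl⟩ := Nat.exists_eq_add_of_le hn
  unfold initTime
  generalize nearTime s d L (2 ^ L + d) = N
  generalize L * (2 ^ L * (d * 100 + 100) + 100) = A
  generalize m * s * (d + 1) * (m * s * (d + 1) * (d * 100 + (L + 1) * 200 + 130) + 60) = B
  have : ∀ x : ℕ, 0 ≤ k * x := fun x => Nat.zero_le _
  nlinarith [this (d * 100), this (L * 100), this A, this (m * 100), this B, this (m * N),
    Nat.zero_le (m * k)]

/-! ### The data structure -/

theorem maintains_sampleTreeFamily {κ C T T' : ℕ}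
    (hT : ∀ p : TimeParams, (initTime p.1.1 p.1.2.1 (κ * Nat.clog 2 p.1.2.1)
      (sampleSize κ p.1.1 p.1.2.1 p.1.2.2) 1 : ℝ) ≤ T * p.scale ^ T)
    (hT' : ∀ p : TimeParams, (queryTime p.1.1 (κ * Nat.clog 2 p.1.2.1)
      (2 ^ (κ * Nat.clog 2 p.1.2.1) + p.1.2.1) : ℝ) ≤ T' * p.scale ^ T')
    {s d : ℕ} [NeZero s] [NeZero d] {μ : PMF (Point s d)} {α τ γ δ : ℝ} (hα : 0 < α) (hγ : 0 < γ)
    (hδ : 0 < δ) (hδ1 : δ < 1) {n : ℕ} {pts : Fin n → Point s d} {wt : Fin n → ℝ}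
    (hw : ∀ i, 0 ≤ wt i)
    (hp : ∀ p : Point s d, (μ p).toReal = ∑ i, if pts i = p then wt i else 0) :
    Maintains (initProg κ C) queryProg (inputMemory pts wt α τ γ δ)
      (sampleTreeFamily (κ * Nat.clog 2 d) μ (sampleSize κ s d α)
        (C * Real.log ((sampleSize κ s d α : ℝ) * s * d / δ)) γ)
      (n * (T * ((s : ℝ) * d / min α 1) ^ T)) (T' * ((s : ℝ) * d) ^ T') := by
  classical
  have hs1 : 1 ≤ s := Nat.pos_of_ne_zero (NeZero.ne s)
  have hd1 : 1 ≤ d := Nat.pos_of_ne_zero (NeZero.ne d)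
  have hsum := sum_listed_weights hp
  have hn : NeZero n := ⟨by rintro rfl; simp at hsum⟩
  have hn1 : 1 ≤ n := Nat.pos_of_ne_zero hn.out
  set m := sampleSize κ s d α with hm
  set ξ : ℝ := C * Real.log ((m : ℝ) * s * d / δ) with hξ
  have hξ0 : 0 ≤ ξ := by
    refine mul_nonneg (by positivity) (Real.log_nonneg ?_)
    rw [le_div_iff₀ hδ]
    have h1 : (1 : ℝ) ≤ m := by
      have : 1 ≤ m := by rw [hm, sampleSize]; omega
      exact_mod_cast this
    have h2 : (1 : ℝ) ≤ s := by exact_mod_cast hs1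
    have h3 : (1 : ℝ) ≤ d := by exact_mod_cast hd1
    nlinarith [one_le_mul_of_one_le_of_one_le (one_le_mul_of_one_le_of_one_le h1 h2) h3]
  refine ⟨_, tape_measurePreserving (κ * Nat.clog 2 d) m hw hp ξ γ, ?_⟩
  filter_upwards [tapeLaw_ae_lt_one] with ω hω
  obtain ⟨t, σ, h1, h2, h3⟩ := initProg_spec (ω := ω) κ C pts wt hw (τ := τ) (γ := γ) (δ := δ) hα rfl
    (tapeCoords (κ * Nat.clog 2 d) d ω) (fun ℓ k => cdfIndex_unif_eq_floor d (hω _))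
    (fun t => cdfIndex (listedCdf wt) (ω (0, (t : ℕ), 0)))
    (fun t => (cdfIndex_spec (listedCdf_monotone hw) (by simp [listedCdf])
      ((listedCdf_last wt).trans hsum) (hω _) _).1 rfl)
  set H := sampleTreeFamily (κ * Nat.clog 2 d) μ m ξ γ with hH
  set θ : H.Seed := (tapeSamples m pts wt ω, tapeCoords (κ * Nat.clog 2 d) d ω, tapeShifts ω) with hθ
  have key : ∀ x x' : Point s d,
      hashOut (tapeCoords (κ * Nat.clog 2 d) d ω) (sampleNbr (tapeSamples m pts wt ω)) ξ γ
        (tapeShifts ω) x = hashOut (tapeCoords (κ * Nat.clog 2 d) d ω)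
          (sampleNbr (tapeSamples m pts wt ω)) ξ γ (tapeShifts ω) x' ↔ H.hash θ x = H.hash θ x' :=
    fun x x' => hashOut_eq_iff hξ0 hγ (fun v => hω _) x x'
  -- The name of a bucket is the output for an arbitrary point in it. By `key` the choice does not
  -- matter, and different buckets receive different outputs.
  let name : (Node → ℤ) → List ℕ := fun h => if hx : ∃ x, H.hash θ x = h then
    hashOut (tapeCoords (κ * Nat.clog 2 d) d ω) (sampleNbr (tapeSamples m pts wt ω)) ξ γ
      (tapeShifts ω) hx.choose else []
  have hname : ∀ x, name (H.hash θ x) = hashOut (tapeCoords (κ * Nat.clog 2 d) d ω)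
      (sampleNbr (tapeSamples m pts wt ω)) ξ γ (tapeShifts ω) x := by
    intro x
    have hx : ∃ x', H.hash θ x' = H.hash θ x := ⟨x, rfl⟩
    simp only [name, dif_pos hx]
    exact (key _ _).2 hx.choose_spec
  refine ⟨t, σ, name, h1, ?_, ?_, ?_⟩
  · have b1 := hT ⟨(s, d, α), hs1, hd1, hα⟩
    have b2 : (t : ℝ) ≤ n * initTime s d (κ * Nat.clog 2 d) m 1 := by
      exact_mod_cast h2.trans (initTime_le_mul _ _ _ _ hn1)
    exact b2.trans (mul_le_mul_of_nonneg_left b1 (by positivity))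
  · rintro _ ⟨x, rfl⟩ _ ⟨x', rfl⟩ h
    change name (H.hash θ x) = name (H.hash θ x') at h
    rw [hname, hname] at h
    exact (key x x').1 h
  · intro σ' hS x
    obtain ⟨t', σ'', e1, e2, -, e3⟩ := queryProg_spec (ω := ω) (Served.ready h3 hS) x
    refine ⟨t', σ'', e1, ?_, e3.trans (hname x).symm⟩
    -- The query time does not depend on `α`; the value `1` turns the scale into `s d`.
    have b1 := hT' ⟨(s, d, 1), hs1, hd1, one_pos⟩
    simp only [TimeParams.scale, min_self, div_one] at b1
    exact le_trans (by exact_mod_cast e2) b1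

/-! ### Union bounds over product measures -/

/-- The set is covered by the finitely many boxes `{a} × S_a`, so no measurability of `S` or of its
sections is required. -/
theorem prod_real_le_integral {A B : Type*} [Finite A] [MeasurableSpace A]
    [MeasurableSingletonClass A] [MeasurableSpace B] (P : Measure A) [IsProbabilityMeasure P]
    (Q : Measure B) [IsProbabilityMeasure Q] (S : Set (A × B)) :
    (P.prod Q).real S ≤ ∫ a, Q.real {b | (a, b) ∈ S} ∂P := by
  have := Fintype.ofFinite A
  rw [integral_fintype (Integrable.of_finite)]
  have hsub : S ⊆ ⋃ a ∈ (Finset.univ : Finset A), ({a} : Set A) ×ˢ {b | (a, b) ∈ S} := by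
    rintro ⟨a, b⟩ h
    simp only [Finset.mem_univ, Set.iUnion_true, Set.mem_iUnion]
    exact ⟨a, rfl, h⟩
  refine (measureReal_mono hsub (measure_ne_top _ _)).trans ((measureReal_biUnion_finset_le _ _).trans ?_)
  refine Finset.sum_le_sum fun a _ => ?_
  rw [measureReal_prod_prod, smul_eq_mul]

/-! ### The randomly shifted grid -/

theorem floor_add_eq (A : ℝ) {u : ℝ} (hu0 : 0 ≤ u) (hu1 : u < 1) :
    (⌊A + u⌋ : ℝ) = ⌊A⌋ + Set.indicator {u : ℝ | 1 - Int.fract A ≤ u} 1 u := by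
  have h1 := Int.floor_add_fract A
  have h2 := Int.fract_nonneg A
  have h3 := Int.fract_lt_one A
  by_cases h : 1 - Int.fract A ≤ u
  · rw [Set.indicator_of_mem (show u ∈ {u : ℝ | 1 - Int.fract A ≤ u} from h), Pi.one_apply]
    have : ⌊A + u⌋ = ⌊A⌋ + 1 := by
      rw [Int.floor_eq_iff]; push_cast; constructor <;> linarith
    rw [this]; push_cast; ring
  · rw [Set.indicator_of_notMem (show u ∉ {u : ℝ | 1 - Int.fract A ≤ u} from h), add_zero]
    push Not at h
    have : ⌊A + u⌋ = ⌊A⌋ := by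
      rw [Int.floor_eq_iff]; constructor <;> linarith
    rw [this]

theorem floor_shift_measurable (A : ℝ) :
    Measurable fun u : unitInterval => (⌊A + (u : ℝ)⌋ : ℝ) := by
  have : Measurable fun u : unitInterval => A + (u : ℝ) := measurable_subtype_coe.const_add A
  exact (measurable_from_top (f := fun z : ℤ => (z : ℝ))).comp this.floor

/-- The floor of `A + u` is `⌊A⌋`, increased by one with probability equal to the fractional part of
`A`. -/
theorem floor_shift_integral (A : ℝ) :
    Integrable (fun u : unitInterval => (⌊A + (u : ℝ)⌋ : ℝ)) ∧
      ∫ u : unitInterval, (⌊A + (u : ℝ)⌋ : ℝ) = A := by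
  set S : Set unitInterval := {u | 1 - Int.fract A ≤ (u : ℝ)} with hS
  have hSm : MeasurableSet S := measurableSet_le measurable_const measurable_subtype_coe
  have hae : (fun u : unitInterval => (⌊A + (u : ℝ)⌋ : ℝ)) =ᵐ[volume]
      fun u => (⌊A⌋ : ℝ) + S.indicator 1 u := by
    filter_upwards [unitInterval_ae_lt_one] with u hu
    exact floor_add_eq A u.2.1 hu
  have hSv : (volume : Measure unitInterval).real S = Int.fract A := by
    have e : S =ᵐ[volume] {u : unitInterval | 1 - Int.fract A ≤ (u : ℝ) ∧ (u : ℝ) < 1} := by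
      filter_upwards [unitInterval_ae_lt_one] with u hu
      exact propext ⟨fun h => ⟨h, hu⟩, fun h => h.1⟩
    rw [measureReal_congr e, measureReal_def,
      unitInterval_volume_Ico (by linarith [Int.fract_lt_one A]) le_rfl, ENNReal.toReal_ofReal]
    · ring
    · linarith [Int.fract_nonneg A]
  have hi : Integrable (S.indicator (1 : unitInterval → ℝ)) :=
    (integrable_const 1).indicator hSm
  refine ⟨((integrable_const _).add hi).congr hae.symm, ?_⟩
  rw [integral_congr_ae hae, integral_add (integrable_const _) hi, integral_indicator_one hSm, hSv]
  simp [Int.floor_add_fract]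

/-- The difference `X` of the two floors is a nonnegative integer of mean `B - A`. Markov's
inequality bounds the probability of `X ≠ 0`. If `B - A < 1`, then `X ≤ 1`, so `X = 0` has
probability at most `1 - (B - A)`; if `B - A ≥ 1`, then `X = 0` is impossible. -/
theorem grid_cell_bounds {A B : ℝ} (h : A ≤ B) :
    (volume : Measure unitInterval).real {u | ⌊A + (u : ℝ)⌋ ≠ ⌊B + (u : ℝ)⌋} ≤ B - A ∧
    (volume : Measure unitInterval).real {u | ⌊A + (u : ℝ)⌋ = ⌊B + (u : ℝ)⌋} ≤
      Real.exp (-(B - A)) := by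
  obtain ⟨iA, eA⟩ := floor_shift_integral A
  obtain ⟨iB, eB⟩ := floor_shift_integral B
  have hm : MeasurableSet {u : unitInterval | ⌊A + (u : ℝ)⌋ = ⌊B + (u : ℝ)⌋} := by
    have := measurableSet_eq_fun (floor_shift_measurable A) (floor_shift_measurable B)
    simpa using this
  have hle : ∀ u : unitInterval, ⌊A + (u : ℝ)⌋ ≤ ⌊B + (u : ℝ)⌋ := fun u =>
    Int.floor_le_floor (by linarith)
  have hint : ∫ u : unitInterval, ((⌊B + (u : ℝ)⌋ : ℝ) - ⌊A + (u : ℝ)⌋) = B - A := by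
    rw [integral_sub iB iA, eA, eB]
  have hne : {u : unitInterval | ⌊A + (u : ℝ)⌋ ≠ ⌊B + (u : ℝ)⌋} =
      {u : unitInterval | ⌊A + (u : ℝ)⌋ = ⌊B + (u : ℝ)⌋}ᶜ := rfl
  constructor
  · rw [← hint, ← integral_indicator_one (hne ▸ hm.compl)]
    refine integral_mono ((integrable_const 1).indicator (hne ▸ hm.compl)) (iB.sub iA) fun u => ?_
    by_cases hu : ⌊A + (u : ℝ)⌋ = ⌊B + (u : ℝ)⌋
    · rw [Set.indicator_of_notMem (by simpa using hu)]
      simp [hu]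
    · rw [Set.indicator_of_mem (by simpa using hu)]
      have := lt_of_le_of_ne (hle u) hu
      have : (⌊A + (u : ℝ)⌋ : ℝ) + 1 ≤ ⌊B + (u : ℝ)⌋ := by exact_mod_cast this
      simp only [Pi.one_apply]
      linarith
  · rcases lt_or_ge (B - A) 1 with h1 | h1
    · have : (volume : Measure unitInterval).real {u | ⌊A + (u : ℝ)⌋ = ⌊B + (u : ℝ)⌋} ≤
          1 - (B - A) := by
        have e : B - A ≤ (volume : Measure unitInterval).real
            {u | ⌊A + (u : ℝ)⌋ ≠ ⌊B + (u : ℝ)⌋} := by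
          rw [← hint, ← integral_indicator_one (hne ▸ hm.compl)]
          refine integral_mono (iB.sub iA)
            ((integrable_const 1).indicator (hne ▸ hm.compl)) fun u => ?_
          by_cases hu : ⌊A + (u : ℝ)⌋ = ⌊B + (u : ℝ)⌋
          · rw [Set.indicator_of_notMem (by simpa using hu)]
            simp [hu]
          · rw [Set.indicator_of_mem (by simpa using hu)]
            have h2 : ⌊B + (u : ℝ)⌋ ≤ ⌊A + (u : ℝ)⌋ + 1 := by
              rw [← Int.floor_add_one]
              exact Int.floor_le_floor (by linarith)
            have : (⌊B + (u : ℝ)⌋ : ℝ) ≤ ⌊A + (u : ℝ)⌋ + 1 := by exact_mod_cast h2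
            simp only [Pi.one_apply]
            linarith
        rw [hne, probReal_compl_eq_one_sub hm] at e
        linarith
      linarith [Real.add_one_le_exp (-(B - A))]
    · have : {u : unitInterval | ⌊A + (u : ℝ)⌋ = ⌊B + (u : ℝ)⌋} = ∅ := by
        ext u
        simp only [Set.mem_ofPred_eq, Set.mem_empty_iff_false, iff_false]
        have h2 : ⌊A + (u : ℝ)⌋ + 1 ≤ ⌊B + (u : ℝ)⌋ := by
          rw [← Int.floor_add_one]
          exact Int.floor_le_floor (by linarith)
        omega
      rw [this, measureReal_empty]
      positivity

theorem grid_cell_ne (A B : ℝ) :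
    (volume : Measure unitInterval).real {u | ⌊A + (u : ℝ)⌋ ≠ ⌊B + (u : ℝ)⌋} ≤ |A - B| := by
  rcases le_total A B with h | h
  · rw [abs_sub_comm, abs_of_nonneg (sub_nonneg.2 h)]
    exact (grid_cell_bounds h).1
  · rw [abs_of_nonneg (sub_nonneg.2 h)]
    simpa only [ne_comm] using (grid_cell_bounds h).1

theorem grid_cell_eq (A B : ℝ) :
    (volume : Measure unitInterval).real {u | ⌊A + (u : ℝ)⌋ = ⌊B + (u : ℝ)⌋} ≤
      Real.exp (-|A - B|) := by
  rcases le_total A B with h | h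
  · rw [abs_sub_comm, abs_of_nonneg (sub_nonneg.2 h)]
    exact (grid_cell_bounds h).2
  · rw [abs_of_nonneg (sub_nonneg.2 h)]
    simpa only [eq_comm] using (grid_cell_bounds h).2

/-- The distribution of the shifts of the grid. -/
abbrev shiftLaw : Measure (Node → unitInterval) :=
  Measure.infinitePi fun _ => (volume : Measure unitInterval)

/-- The shifts are independent, so the exponential bounds for single coordinates multiply. -/
theorem gridHash_eq_le {γ : ℝ} (hγ : 0 < γ) (z z' : Node → ℝ) (F : Finset Node) :
    shiftLaw.real {u | gridHash γ u z = gridHash γ u z'} ≤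
      Real.exp (-((∑ v ∈ F, |z v - z' v|) / γ)) := by
  have hm : ∀ v ∈ F, MeasurableSet
      {w : unitInterval | ⌊z v / γ + (w : ℝ)⌋ = ⌊z' v / γ + (w : ℝ)⌋} := fun v _ => by
    have := measurableSet_eq_fun (floor_shift_measurable (z v / γ))
      (floor_shift_measurable (z' v / γ))
    simpa using this
  have hsub : {u | gridHash γ u z = gridHash γ u z'} ⊆ Set.pi F fun v =>
      {w : unitInterval | ⌊z v / γ + (w : ℝ)⌋ = ⌊z' v / γ + (w : ℝ)⌋} :=
    fun u hu v _ => congrFun hu v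
  refine (measureReal_mono hsub).trans ?_
  rw [measureReal_def, Measure.infinitePi_pi _ hm, ENNReal.toReal_prod, Finset.sum_div,
    ← Finset.sum_neg_distrib, Real.exp_sum]
  refine Finset.prod_le_prod (fun _ _ => ENNReal.toReal_nonneg) fun v _ => ?_
  refine (grid_cell_eq _ _).trans (le_of_eq ?_)
  rw [← sub_div, abs_div, abs_of_pos hγ]

theorem gridHash_ne_le {γ : ℝ} (hγ : 0 < γ) (z z' : Node → ℝ) (F : Finset Node)
    (hF : ∀ v ∉ F, z v = z' v) :
    shiftLaw.real {u | gridHash γ u z ≠ gridHash γ u z'} ≤ (∑ v ∈ F, |z v - z' v|) / γ := by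
  have hsub : {u | gridHash γ u z ≠ gridHash γ u z'} ⊆ ⋃ v ∈ F, (fun u => u v) ⁻¹'
      {w : unitInterval | ⌊z v / γ + (w : ℝ)⌋ ≠ ⌊z' v / γ + (w : ℝ)⌋} := by
    intro u hu
    obtain ⟨v, hv⟩ := Function.ne_iff.1 hu
    have hvF : v ∈ F := by
      by_contra h
      exact hv (by simp only [gridHash, hF v h])
    simp only [Set.mem_iUnion]
    exact ⟨v, hvF, hv⟩
  refine (measureReal_mono hsub (measure_ne_top _ _)).trans ((measureReal_biUnion_finset_le _ _).trans ?_)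
  rw [Finset.sum_div]
  refine Finset.sum_le_sum fun v _ => ?_
  have hm : MeasurableSet
      {w : unitInterval | ⌊z v / γ + (w : ℝ)⌋ ≠ ⌊z' v / γ + (w : ℝ)⌋} := by
    have := (measurableSet_eq_fun (floor_shift_measurable (z v / γ))
      (floor_shift_measurable (z' v / γ))).compl
    simpa [Set.compl_def] using this
  rw [(measurePreserving_eval_infinitePi (fun _ : Node => (volume : Measure unitInterval))
    v).measureReal_preimage hm.nullMeasurableSet]
  refine (grid_cell_ne _ _).trans (le_of_eq ?_)
  rw [← sub_div, abs_div, abs_of_pos hγ]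

/-! ### The tree metric -/

section

variable {L d : ℕ} (j : Coords L d) (W : Finset (Cube d)) (ξ : ℝ)

/-- The elements of `W` below the depth-`ℓ` node on the path of `a`. -/
def cell (a : Cube d) (ℓ : ℕ) : Finset (Cube d) := W.filter fun c => nodeAt j c ℓ = nodeAt j a ℓ

/-- The weight of the edge from depth `ℓ` to depth `ℓ + 1` on the path of `a`. -/
def pathWeight (a : Cube d) (ℓ : ℕ) : ℝ :=
  if (cell j W a (ℓ + 1)).Nonempty then avgDist (cell j W a ℓ) (cell j W a (ℓ + 1))
  else (d : ℝ) / 2 ^ ℓ * ξ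

/-- The distance of two leaves in the tree. -/
def treeDist (a b : Cube d) : ℝ :=
  ∑ ℓ ∈ Finset.range (L + 1), if nodeAt j a (ℓ + 1) = nodeAt j b (ℓ + 1) then 0
    else pathWeight j W ξ a ℓ + pathWeight j W ξ b ℓ

/-- The lower ends of the edges. -/
def treeNodes : Finset Node :=
  (Finset.univ ×ˢ Finset.range (L + 1)).image fun p : Cube d × ℕ => nodeAt j p.1 (p.2 + 1)

variable {j W ξ}

theorem elms_nodeAt_inter (a : Cube d) (ℓ : ℕ) : elms j (nodeAt j a ℓ) ∩ W = cell j W a ℓ := by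
  ext c
  rw [Finset.mem_inter, mem_elms_nodeAt, cell, Finset.mem_filter]
  tauto

theorem edgeWeight_nodeAt (a : Cube d) (ℓ : ℕ) :
    edgeWeight j W ξ (nodeAt j a (ℓ + 1)) = pathWeight j W ξ a ℓ := by
  rw [edgeWeight, pathWeight, nodeAt_dropLast, elms_nodeAt_inter, elms_nodeAt_inter, nodeAt_length,
    Nat.add_sub_cancel]

theorem pathWeight_nonneg (hξ : 0 ≤ ξ) (a : Cube d) (ℓ : ℕ) : 0 ≤ pathWeight j W ξ a ℓ := by
  rw [← edgeWeight_nodeAt]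
  exact edgeWeight_nonneg j W hξ _

theorem treeDist_nonneg (hξ : 0 ≤ ξ) (a b : Cube d) : 0 ≤ treeDist j W ξ a b := by
  refine Finset.sum_nonneg fun ℓ _ => ?_
  split_ifs
  · exact le_rfl
  · exact add_nonneg (pathWeight_nonneg hξ _ _) (pathWeight_nonneg hξ _ _)

/-- On each level at most two nodes contribute, those of `a` and of `b`, and none if they coincide.
So the tree distance is the weighted `ℓ₁` distance between the path indicators. -/
theorem sum_treeNodes_indicator (a b : Cube d) :
    ∑ v ∈ treeNodes j, edgeWeight j W ξ v *
      |(if a ∈ elms j v then (1 : ℝ) else 0) - if b ∈ elms j v then 1 else 0| =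
      treeDist j W ξ a b := by
  have hsplit : treeNodes j = (Finset.range (L + 1)).biUnion fun ℓ =>
      (Finset.univ : Finset (Cube d)).image fun c => nodeAt j c (ℓ + 1) := by
    ext v
    simp only [treeNodes, Finset.mem_image, Finset.mem_product, Finset.mem_univ, true_and,
      Prod.exists, Finset.mem_biUnion]
    constructor
    · rintro ⟨c, ℓ, h1, h2⟩; exact ⟨ℓ, h1, c, h2⟩
    · rintro ⟨ℓ, h1, c, h2⟩; exact ⟨c, ℓ, h1, h2⟩
  rw [hsplit, Finset.sum_biUnion, treeDist]
  · refine Finset.sum_congr rfl fun ℓ _ => ?_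
    set F := (Finset.univ : Finset (Cube d)).image fun c => nodeAt j c (ℓ + 1) with hF
    have ha : nodeAt j a (ℓ + 1) ∈ F := Finset.mem_image_of_mem _ (Finset.mem_univ a)
    have hb : nodeAt j b (ℓ + 1) ∈ F := Finset.mem_image_of_mem _ (Finset.mem_univ b)
    have hmem : ∀ v ∈ F, ∀ c, c ∈ elms j v ↔ v = nodeAt j c (ℓ + 1) := by
      intro v hv c
      obtain ⟨e, -, rfl⟩ := Finset.mem_image.1 hv
      rw [mem_elms_nodeAt, eq_comm]
    by_cases h : nodeAt j a (ℓ + 1) = nodeAt j b (ℓ + 1)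
    · rw [if_pos h]
      refine Finset.sum_eq_zero fun v hv => ?_
      simp only [hmem v hv, h, sub_self, abs_zero, mul_zero]
    · rw [if_neg h, ← edgeWeight_nodeAt, ← edgeWeight_nodeAt]
      have hba := Ne.symm h
      rw [← Finset.sum_subset (s₁ := {nodeAt j a (ℓ + 1), nodeAt j b (ℓ + 1)})
        (by intro v hv; simp only [Finset.mem_insert, Finset.mem_singleton] at hv
            rcases hv with rfl | rfl <;> assumption)
        (by
          intro v hv hv'
          simp only [Finset.mem_insert, Finset.mem_singleton, not_or] at hv'
          simp [hmem v hv, hv'.1, hv'.2]), Finset.sum_pair h]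
      simp [hmem _ ha, hmem _ hb, h, hba]
  · intro ℓ _ ℓ' _ hne
    rw [Function.onFun, Finset.disjoint_left]
    rintro v h1 h2
    obtain ⟨c, -, rfl⟩ := Finset.mem_image.1 h1
    obtain ⟨c', -, h⟩ := Finset.mem_image.1 h2
    have := congrArg List.length h
    rw [nodeAt_length, nodeAt_length] at this
    omega

theorem treeEmbed_of_mem {s : ℕ} (x : Point s d) {v : Node} (hv : v ∈ treeNodes j) :
    treeEmbed j W ξ x v =
      edgeWeight j W ξ v * ∑ p, if x p ∈ elms j v then (1 : ℝ) else 0 := by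
  obtain ⟨⟨c, ℓ⟩, h, rfl⟩ := Finset.mem_image.1 hv
  simp only [Finset.mem_product, Finset.mem_univ, true_and, Finset.mem_range] at h
  rw [treeEmbed, if_pos, Finset.sum_boole]
  rw [nodeAt_length]
  omega

theorem treeEmbed_of_notMem {s : ℕ} (x : Point s d) {v : Node} (hv : v ∉ treeNodes j) :
    treeEmbed j W ξ x v = 0 := by
  rw [treeEmbed]
  split_ifs with h
  · have : (Finset.univ.filter fun p : Fin s => x p ∈ elms j v) = ∅ := by
      rw [Finset.filter_eq_empty_iff]
      intro p _ hp
      refine hv (Finset.mem_image.2 ⟨(x p, v.length - 1), ?_, ?_⟩)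
      · simp only [Finset.mem_product, Finset.mem_univ, true_and, Finset.mem_range]
        omega
      · dsimp only
        rw [Nat.sub_add_cancel h.1]
        exact (mem_elms j _ _).1 hp
    rw [this]
    simp
  · rfl

theorem sum_abs_treeEmbed_le {s : ℕ} (hξ : 0 ≤ ξ) (x y : Point s d) (π : Equiv.Perm (Fin s)) :
    ∑ v ∈ treeNodes j, |treeEmbed j W ξ x v - treeEmbed j W ξ y v| ≤
      ∑ i, treeDist j W ξ (x i) (y (π i)) := by
  simp only [← sum_treeNodes_indicator]
  rw [Finset.sum_comm]
  refine Finset.sum_le_sum fun v hv => ?_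
  rw [treeEmbed_of_mem x hv, treeEmbed_of_mem y hv, ← mul_sub, abs_mul,
    abs_of_nonneg (edgeWeight_nonneg j W hξ v), ← Finset.mul_sum]
  refine mul_le_mul_of_nonneg_left ?_ (edgeWeight_nonneg j W hξ v)
  rw [← Equiv.sum_comp π fun p => if y p ∈ elms j v then (1 : ℝ) else 0, ← Finset.sum_sub_distrib]
  exact Finset.abs_sum_le_sum_abs _ _

/-! ### An optimal matching of the leaves -/

/-- The number of common nodes of two paths. -/
def commonDepth (j : Coords L d) (a b : Cube d) : ℕ :=
  ((Finset.range (L + 2)).filter fun ℓ => nodeAt j a ℓ = nodeAt j b ℓ).card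

theorem nodeAt_eq_of_le {a b : Cube d} {ℓ k : ℕ} (hk : k ≤ ℓ)
    (h : nodeAt j a ℓ = nodeAt j b ℓ) : nodeAt j a k = nodeAt j b k := by
  induction hk with
  | refl => exact h
  | step _ ih => exact ih (nodeAt_eq_of_succ h)

theorem lt_commonDepth {a b : Cube d} {ℓ : ℕ} (hℓ : ℓ ≤ L + 1) :
    ℓ < commonDepth j a b ↔ nodeAt j a ℓ = nodeAt j b ℓ := by
  constructor
  · intro h
    by_contra hne
    have : (Finset.range (L + 2)).filter (fun ℓ => nodeAt j a ℓ = nodeAt j b ℓ) ⊆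
        Finset.range ℓ := by
      intro k hk
      rw [Finset.mem_filter] at hk
      rw [Finset.mem_range]
      by_contra! hlt
      exact hne (nodeAt_eq_of_le hlt hk.2)
    have := Finset.card_le_card this
    rw [Finset.card_range] at this
    unfold commonDepth at h
    omega
  · intro h
    have : Finset.range (ℓ + 1) ⊆
        (Finset.range (L + 2)).filter fun ℓ => nodeAt j a ℓ = nodeAt j b ℓ := by
      intro k hk
      rw [Finset.mem_range] at hk
      exact Finset.mem_filter.2 ⟨Finset.mem_range.2 (by omega), nodeAt_eq_of_le (by omega) h⟩
    have := Finset.card_le_card this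
    rw [Finset.card_range] at this
    exact this

theorem commonDepth_le (a b : Cube d) : commonDepth j a b ≤ L + 2 := by
  have := Finset.card_filter_le (Finset.range (L + 2)) fun ℓ => nodeAt j a ℓ = nodeAt j b ℓ
  rw [Finset.card_range] at this
  exact this

theorem commonDepth_comm (a b : Cube d) : commonDepth j a b = commonDepth j b a := by
  simp only [commonDepth, eq_comm]

/-- The ultrametric inequality: agreement with `b` up to some depth is transitive. -/
theorem min_commonDepth_le (a b c : Cube d) :
    min (commonDepth j a b) (commonDepth j b c) ≤ commonDepth j a c := by
  by_contra! h
  rw [lt_min_iff] at h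
  have hL : commonDepth j a c ≤ L + 1 := by
    have := commonDepth_le (j := j) a b
    omega
  have h1 := (lt_commonDepth hL).1 h.1
  have h2 := (lt_commonDepth hL).1 h.2
  exact absurd ((lt_commonDepth hL).2 (h1.trans h2)) (lt_irrefl _)

/-- The matching maximizes the total common depth. If some `x i` below `v` is matched out of `v`
while some `y (π k)` below `v` is matched from outside, exchanging the partners of `i` and `k` would
increase the total: the pair joined inside `v` beats both old pairs, and the ultrametric inequality
keeps the other pair at least as deep as the worse old one. -/
theorem exists_tree_matching {s : ℕ} (x y : Point s d) : ∃ π : Equiv.Perm (Fin s),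
    ∀ v ∈ treeNodes j, ∀ i k, x i ∈ elms j v → y (π i) ∉ elms j v → y (π k) ∈ elms j v →
      x k ∈ elms j v := by
  obtain ⟨π, -, hπ⟩ := Finset.exists_max_image (Finset.univ : Finset (Equiv.Perm (Fin s)))
    (fun π => ∑ i, commonDepth j (x i) (y (π i))) Finset.univ_nonempty
  refine ⟨π, fun v hv i k h1 h2 h3 => ?_⟩
  by_contra h4
  obtain ⟨⟨c, ℓ⟩, hℓ, rfl⟩ := Finset.mem_image.1 hv
  simp only [Finset.mem_product, Finset.mem_univ, true_and, Finset.mem_range] at hℓ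
  simp only [mem_elms_nodeAt] at h1 h2 h3 h4
  have hik : i ≠ k := by rintro rfl; exact h2 h3
  have hℓ' : ℓ + 1 ≤ L + 1 := by omega
  have f1 : ℓ + 1 < commonDepth j (x i) (y (π k)) := (lt_commonDepth hℓ').2 (h1.trans h3.symm)
  have f2 : ¬ ℓ + 1 < commonDepth j (x i) (y (π i)) := fun h =>
    h2 (((lt_commonDepth hℓ').1 h).symm.trans h1)
  have f3 : ¬ ℓ + 1 < commonDepth j (x k) (y (π k)) := fun h =>
    h4 (((lt_commonDepth hℓ').1 h).trans h3)
  -- Two ultrametric steps along `x k`, `y (π k)`, `x i`, `y (π i)`; the middle link is deeper than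
  -- both ends by `f1`, `f2`, `f3`, so it drops out of the minimum.
  have f4 : min (commonDepth j (x k) (y (π k))) (commonDepth j (x i) (y (π i))) ≤
      commonDepth j (x k) (y (π i)) := by
    have g1 := min_commonDepth_le (j := j) (x k) (y (π k)) (x i)
    have g2 := min_commonDepth_le (j := j) (x k) (x i) (y (π i))
    rw [commonDepth_comm (y (π k))] at g1
    omega
  have hsum := hπ (π * Equiv.swap i k) (Finset.mem_univ _)
  have hsplit : ∀ f : Fin s → ℕ, ∑ p, f p = f i + f k + ∑ p ∈ {i, k}ᶜ, f p := by
    intro f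
    rw [← Finset.sum_add_sum_compl {i, k} f, Finset.sum_pair hik]
  rw [hsplit, hsplit fun p => commonDepth j (x p) (y (π p))] at hsum
  have hrest : ∑ p ∈ {i, k}ᶜ, commonDepth j (x p) (y ((π * Equiv.swap i k) p)) =
      ∑ p ∈ {i, k}ᶜ, commonDepth j (x p) (y (π p)) := by
    refine Finset.sum_congr rfl fun p hp => ?_
    simp only [Finset.mem_compl, Finset.mem_insert, Finset.mem_singleton, not_or] at hp
    rw [Equiv.Perm.mul_apply, Equiv.swap_apply_of_ne_of_ne hp.1 hp.2]
  rw [hrest] at hsum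
  simp only [Equiv.Perm.mul_apply, Equiv.swap_apply_left, Equiv.swap_apply_right] at hsum
  omega

/-- Without crossings all terms of the sum have the same sign. -/
theorem abs_sum_sub_of_no_crossing {ι : Type*} (s : Finset ι) (p q : ι → Prop) [DecidablePred p]
    [DecidablePred q] (h : ∀ i ∈ s, ∀ k ∈ s, p i → ¬ q i → q k → p k) :
    |∑ i ∈ s, ((if p i then (1 : ℝ) else 0) - if q i then 1 else 0)| =
      ∑ i ∈ s, |(if p i then (1 : ℝ) else 0) - if q i then 1 else 0| := by
  by_cases h1 : ∃ i ∈ s, p i ∧ ¬ q i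
  · obtain ⟨i, hi, hp, hq⟩ := h1
    have : ∀ k ∈ s, 0 ≤ (if p k then (1 : ℝ) else 0) - if q k then 1 else 0 := by
      intro k hk
      have := h i hi k hk hp hq
      split_ifs <;> simp_all
    rw [abs_of_nonneg (Finset.sum_nonneg this)]
    exact Finset.sum_congr rfl fun k hk => (abs_of_nonneg (this k hk)).symm
  · push Not at h1
    have : ∀ k ∈ s, (if p k then (1 : ℝ) else 0) - (if q k then 1 else 0) ≤ 0 := by
      intro k hk
      have := h1 k hk
      split_ifs <;> simp_all
    rw [abs_of_nonpos (Finset.sum_nonpos this), ← Finset.sum_neg_distrib]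
    exact Finset.sum_congr rfl fun k hk => (abs_of_nonpos (this k hk)).symm

theorem exists_sum_treeDist_le {s : ℕ} (hξ : 0 ≤ ξ) (x y : Point s d) :
    ∃ π : Equiv.Perm (Fin s), ∑ i, treeDist j W ξ (x i) (y (π i)) ≤
      ∑ v ∈ treeNodes j, |treeEmbed j W ξ x v - treeEmbed j W ξ y v| := by
  obtain ⟨π, hπ⟩ := exists_tree_matching (j := j) x y
  refine ⟨π, le_of_eq ?_⟩
  simp only [← sum_treeNodes_indicator]
  rw [Finset.sum_comm]
  refine Finset.sum_congr rfl fun v hv => ?_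
  rw [treeEmbed_of_mem x hv, treeEmbed_of_mem y hv, ← mul_sub, abs_mul,
    abs_of_nonneg (edgeWeight_nonneg j W hξ v), ← Finset.mul_sum]
  congr 1
  rw [← Equiv.sum_comp π fun p => if y p ∈ elms j v then (1 : ℝ) else 0, ← Finset.sum_sub_distrib,
    abs_sum_sub_of_no_crossing]
  exact fun i _ k _ => hπ v hv i k

end

/-! ### Averages of distances -/

/-- The mean distance of the elements of `A` to `e`. -/
def avgTo {d : ℕ} (A : Finset (Cube d)) (e : Cube d) : ℝ :=
  (∑ c ∈ A, (hammingDist c e : ℝ)) / A.card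

theorem hammingDist_triangle_real {d : ℕ} (a b c : Cube d) :
    (hammingDist a c : ℝ) ≤ hammingDist a b + hammingDist b c := by
  exact_mod_cast hammingDist_triangle a b c

theorem hammingDist_le_dim {d : ℕ} (a b : Cube d) : (hammingDist a b : ℝ) ≤ d := by
  have := hammingDist_le_card_fintype (x := a) (y := b)
  rw [Fintype.card_fin] at this
  exact_mod_cast this

section

variable {d : ℕ} {A B : Finset (Cube d)}

theorem avgTo_nonneg (A : Finset (Cube d)) (e : Cube d) : 0 ≤ avgTo A e := by
  unfold avgTo; positivity

theorem avgTo_le_of_forall {e : Cube d} {M : ℝ} (hM : 0 ≤ M)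
    (h : ∀ c ∈ A, (hammingDist c e : ℝ) ≤ M) : avgTo A e ≤ M := by
  rw [avgTo]
  refine div_le_of_le_mul₀ (by positivity) hM ?_
  rw [mul_comm, ← nsmul_eq_mul]
  exact Finset.sum_le_card_nsmul _ _ _ h

theorem avgDist_le_of_forall {M : ℝ} (hM : 0 ≤ M)
    (h : ∀ c ∈ A, ∀ c' ∈ B, (hammingDist c c' : ℝ) ≤ M) : avgDist A B ≤ M := by
  rw [avgDist]
  refine div_le_of_le_mul₀ (by positivity) hM ?_
  calc ∑ c ∈ A, ∑ c' ∈ B, (hammingDist c c' : ℝ) ≤ ∑ c ∈ A, ∑ c' ∈ B, M :=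
        Finset.sum_le_sum fun c hc => Finset.sum_le_sum fun c' hc' => h c hc c' hc'
    _ = M * (A.card * B.card) := by simp; ring

theorem sum_sum_left (hB : B.Nonempty) (e : Cube d) :
    (∑ c ∈ A, ∑ _c' ∈ B, (hammingDist c e : ℝ)) / ((A.card : ℝ) * B.card) = avgTo A e := by
  have hB' : (B.card : ℝ) ≠ 0 := by exact_mod_cast hB.card_pos.ne'
  simp only [Finset.sum_const, nsmul_eq_mul, ← Finset.mul_sum, avgTo]
  rw [mul_comm (A.card : ℝ), mul_div_mul_left _ _ hB']

theorem sum_sum_right (hA : A.Nonempty) (e : Cube d) :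
    (∑ _c ∈ A, ∑ c' ∈ B, (hammingDist c' e : ℝ)) / ((A.card : ℝ) * B.card) = avgTo B e := by
  have hA' : (A.card : ℝ) ≠ 0 := by exact_mod_cast hA.card_pos.ne'
  simp only [Finset.sum_const, nsmul_eq_mul, avgTo]
  rw [mul_div_mul_left _ _ hA']

theorem avgTo_le_avgDist_add (hA : A.Nonempty) (hB : B.Nonempty) (e : Cube d) :
    avgTo A e ≤ avgDist A B + avgTo B e := by
  rw [← sum_sum_left hB, ← sum_sum_right hA, avgDist, ← add_div, ← Finset.sum_add_distrib]
  simp only [← Finset.sum_add_distrib]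
  gcongr
  exact hammingDist_triangle_real _ _ _

theorem avgDist_le_avgTo_add (hA : A.Nonempty) (hB : B.Nonempty) (e : Cube d) :
    avgDist A B ≤ avgTo A e + avgTo B e := by
  rw [← sum_sum_left hB, ← sum_sum_right hA, avgDist, ← add_div, ← Finset.sum_add_distrib]
  simp only [← Finset.sum_add_distrib]
  gcongr with c hc c' hc'
  rw [hammingDist_comm c' e]
  exact hammingDist_triangle_real _ _ _

theorem hammingDist_le_avgTo_add (hA : A.Nonempty) (a b : Cube d) :
    (hammingDist a b : ℝ) ≤ avgTo A a + avgTo A b := by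
  have hA' : (0 : ℝ) < A.card := by exact_mod_cast hA.card_pos
  rw [avgTo, avgTo, ← add_div, ← Finset.sum_add_distrib, le_div_iff₀ hA', mul_comm, ← nsmul_eq_mul]
  refine Finset.card_nsmul_le_sum _ _ _ fun c _ => ?_
  rw [hammingDist_comm c a]
  exact hammingDist_triangle_real _ _ _

end

/-! ### Trees whose cells are small -/

section

variable {L d : ℕ} {j : Coords L d} {W U : Finset (Cube d)} {ξ : ℝ}

/-- Elements of `U` with a common node at depth `p ≤ L` have distance at most `ξ d / 2^p`. -/
def Controlled (j : Coords L d) (U : Finset (Cube d)) (ξ : ℝ) : Prop :=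
  ∀ a ∈ U, ∀ b ∈ U, ∀ p ≤ L, nodeAt j a p = nodeAt j b p → (hammingDist a b : ℝ) ≤ d / 2 ^ p * ξ

theorem mem_cell {a c : Cube d} {ℓ : ℕ} :
    c ∈ cell j W a ℓ ↔ c ∈ W ∧ nodeAt j c ℓ = nodeAt j a ℓ := Finset.mem_filter

theorem cell_subset (a : Cube d) (ℓ : ℕ) : cell j W a (ℓ + 1) ⊆ cell j W a ℓ := fun _ hc =>
  mem_cell.2 ⟨(mem_cell.1 hc).1, nodeAt_eq_of_succ (mem_cell.1 hc).2⟩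

/-- Going up from the leaf, each edge weight pays for the passage from one cell to the next larger
one, by the triangle inequality for averages. At the first empty cell the default weight alone
exceeds every distance in the cell above it, since the tree is controlled. -/
theorem avgTo_cell_le_sum_pathWeight (hU : Controlled j U ξ) (hW : W ⊆ U) (hξ : 0 ≤ ξ)
    {a : Cube d} (ha : a ∈ U) {p : ℕ} (hp : p ≤ L + 1) (hne : (cell j W a p).Nonempty) :
    avgTo (cell j W a p) a ≤ ∑ ℓ ∈ Finset.Ico p (L + 1), pathWeight j W ξ a ℓ := by
  induction hp using Nat.decreasingInduction with
  | self =>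
    rw [Finset.Ico_self, Finset.sum_empty]
    refine avgTo_le_of_forall le_rfl fun c hc => ?_
    rw [nodeAt_leaf_injective j (mem_cell.1 hc).2, hammingDist_self, Nat.cast_zero]
  | of_succ p hp ih =>
    rw [Finset.sum_eq_sum_Ico_succ_bot hp]
    by_cases h : (cell j W a (p + 1)).Nonempty
    · refine (avgTo_le_avgDist_add hne h a).trans (add_le_add ?_ (ih h))
      rw [pathWeight, if_pos h]
    · have h1 : pathWeight j W ξ a p = d / 2 ^ p * ξ := by rw [pathWeight, if_neg h]
      have h2 : 0 ≤ ∑ ℓ ∈ Finset.Ico (p + 1) (L + 1), pathWeight j W ξ a ℓ :=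
        Finset.sum_nonneg fun _ _ => pathWeight_nonneg hξ _ _
      have h3 : avgTo (cell j W a p) a ≤ d / 2 ^ p * ξ :=
        avgTo_le_of_forall (by positivity) fun c hc =>
          hU c (hW (mem_cell.1 hc).1) a ha p (by omega) (mem_cell.1 hc).2
      linarith

theorem exists_branching_depth {a b : Cube d} (h : a ≠ b) :
    ∃ p ≤ L, nodeAt j a p = nodeAt j b p ∧ nodeAt j a (p + 1) ≠ nodeAt j b (p + 1) := by
  by_contra! hc
  have : ∀ p ≤ L + 1, nodeAt j a p = nodeAt j b p := by
    intro p
    induction p with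
    | zero => intro _; rfl
    | succ p ih => intro hp; exact hc p (by omega) (ih (by omega))
  exact h (nodeAt_leaf_injective j (this (L + 1) le_rfl))

/-- Below the node where the two paths separate, all their edges count. The mean distances of `a`
and of `b` to the common cell are each bounded by one of the two path sums, and together they bound
the distance of `a` and `b`. -/
theorem hammingDist_le_treeDist (hU : Controlled j U ξ) (hW : W ⊆ U) (hξ : 0 ≤ ξ)
    {a b : Cube d} (ha : a ∈ U) (hb : b ∈ U) : (hammingDist a b : ℝ) ≤ treeDist j W ξ a b := by
  by_cases hab : a = b
  · rw [hab, hammingDist_self, Nat.cast_zero]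
    exact treeDist_nonneg hξ _ _
  obtain ⟨p, hp, h1, h2⟩ := exists_branching_depth (j := j) hab
  have hlow : ∑ ℓ ∈ Finset.Ico p (L + 1), pathWeight j W ξ a ℓ +
      ∑ ℓ ∈ Finset.Ico p (L + 1), pathWeight j W ξ b ℓ ≤ treeDist j W ξ a b := by
    rw [← Finset.sum_add_distrib, treeDist]
    have : ∀ ℓ ∈ Finset.Ico p (L + 1), pathWeight j W ξ a ℓ + pathWeight j W ξ b ℓ =
        if nodeAt j a (ℓ + 1) = nodeAt j b (ℓ + 1) then 0
          else pathWeight j W ξ a ℓ + pathWeight j W ξ b ℓ := by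
      intro ℓ hℓ
      rw [if_neg fun h => h2 (nodeAt_eq_of_le (by have := (Finset.mem_Ico.1 hℓ).1; omega) h)]
    rw [Finset.sum_congr rfl this]
    refine Finset.sum_le_sum_of_subset_of_nonneg (fun ℓ hℓ => ?_) fun ℓ _ _ => ?_
    · exact Finset.mem_range.2 (Finset.mem_Ico.1 hℓ).2
    · split_ifs
      · exact le_rfl
      · exact add_nonneg (pathWeight_nonneg hξ _ _) (pathWeight_nonneg hξ _ _)
  refine le_trans ?_ hlow
  have hcell : cell j W a p = cell j W b p := by simp only [cell, h1]
  by_cases hne : (cell j W a p).Nonempty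
  · refine (hammingDist_le_avgTo_add hne a b).trans (add_le_add
      (avgTo_cell_le_sum_pathWeight hU hW hξ ha (by omega) hne) ?_)
    rw [hcell]
    exact avgTo_cell_le_sum_pathWeight hU hW hξ hb (by omega) (hcell ▸ hne)
  -- With no sampled neighbour in the common cell, the first edge below it has the default weight,
  -- which already dominates the distance.
  · have e : pathWeight j W ξ a p = d / 2 ^ p * ξ := by
      rw [pathWeight, if_neg fun h => hne (h.mono (cell_subset a p))]
    have h3 : pathWeight j W ξ a p ≤ ∑ ℓ ∈ Finset.Ico p (L + 1), pathWeight j W ξ a ℓ :=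
      Finset.single_le_sum (f := fun ℓ => pathWeight j W ξ a ℓ)
        (fun _ _ => pathWeight_nonneg hξ _ _) (Finset.mem_Ico.2 ⟨le_rfl, by omega⟩)
    have h4 : 0 ≤ ∑ ℓ ∈ Finset.Ico p (L + 1), pathWeight j W ξ b ℓ :=
      Finset.sum_nonneg fun _ _ => pathWeight_nonneg hξ _ _
    have h5 := hU a ha b hb p hp h1
    linarith

end

/-! ### Probabilities of events about the coordinates -/

/-- The places of the coordinates. -/
abbrev Slot (L : ℕ) : Type := (ℓ : Fin L) × Fin (2 ^ (ℓ : ℕ))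

section

variable {L d : ℕ}

/-- The coordinates in which `a` and `b` agree. -/
def agreeSet (a b : Cube d) : Finset (Fin d) := Finset.univ.filter fun q => a q = b q

/-- The coordinates in which `a` and `b` differ. -/
def diffSet (a b : Cube d) : Finset (Fin d) := Finset.univ.filter fun q => a q ≠ b q

theorem diffSet_card (a b : Cube d) : (diffSet a b).card = hammingDist a b := rfl

theorem agreeSet_card (a b : Cube d) : ((agreeSet a b).card : ℝ) = d - hammingDist a b := by
  have := Finset.card_filter_add_card_filter_not (s := (Finset.univ : Finset (Fin d)))
    fun q => a q = b q
  rw [Finset.card_univ, Fintype.card_fin] at this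
  have h2 : ((agreeSet a b).card : ℝ) + hammingDist a b = d := by exact_mod_cast this
  linarith

theorem nodeAt_eq_iff_forall_slot {j : Coords L d} {a b : Cube d} {p : ℕ} (hp : p ≤ L) :
    nodeAt j a p = nodeAt j b p ↔ ∀ t : Slot L, (t.1 : ℕ) < p → a (j t.1 t.2) = b (j t.1 t.2) := by
  rw [nodeAt, nodeAt, List.map_inj_left]
  simp only [List.mem_range]
  constructor
  · rintro h ⟨ℓ, k⟩ hℓ
    have := h ℓ hℓ
    simp only [label, ℓ.2, dite_true] at this
    exact congrFun (List.ofFn_injective this) k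
  · intro h ℓ hℓ
    have hL : ℓ < L := by omega
    simp only [label, hL, dite_true]
    congr 1
    funext k
    exact h ⟨⟨ℓ, hL⟩, k⟩ hℓ

/-- The slots of the levels below `p`. -/
def slotsBelow (L p : ℕ) : Finset (Slot L) := Finset.univ.filter fun t => (t.1 : ℕ) < p

theorem mem_slotsBelow {p : ℕ} {t : Slot L} : t ∈ slotsBelow L p ↔ (t.1 : ℕ) < p := by
  simp [slotsBelow]

/-- The levels below `p` read `1 + 2 + … + 2^(p-1) = 2^p - 1` coordinates. -/
theorem slotsBelow_card {p : ℕ} (hp : p ≤ L) : (slotsBelow L p).card + 1 = 2 ^ p := by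
  have h1 : slotsBelow L p = (Finset.univ.filter fun ℓ : Fin L => (ℓ : ℕ) < p).sigma
      fun _ => Finset.univ := by
    ext t; simp [slotsBelow]
  rw [h1, Finset.card_sigma]
  simp only [Finset.card_univ, Fintype.card_fin]
  rw [Finset.sum_filter, Fin.sum_univ_eq_sum_range (fun ℓ => if ℓ < p then 2 ^ ℓ else 0) L,
    ← Finset.sum_filter]
  have h2 : (Finset.range L).filter (· < p) = Finset.range p := by
    ext k; simp; omega
  rw [h2]
  clear h1 h2
  induction p with
  | zero => simp
  | succ p ih =>
    have := ih (by omega)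
    rw [Finset.sum_range_succ, pow_succ]
    omega

end

/-! ### The law of the coordinates and the probability that a tree is controlled. -/

section

/-- The distribution of the coordinates. -/
abbrev coordLaw (L d : ℕ) [NeZero d] : Measure (Coords L d) :=
  Measure.pi fun _ => Measure.pi fun _ => unifCoord d

variable {L d : ℕ} [NeZero d]

theorem unifCoord_real (A : Finset (Fin d)) : (unifCoord d).real (A : Set (Fin d)) = A.card / d := by
  rw [unifCoord, measureReal_def, PMF.toMeasure_uniformOfFintype_apply _ A.measurableSet]
  simp

theorem coordLaw_box (B : Slot L → Finset (Fin d)) :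
    (coordLaw L d).real {j | ∀ t : Slot L, j t.1 t.2 ∈ B t} = ∏ t, ((B t).card : ℝ) / d := by
  have hset : {j : Coords L d | ∀ t : Slot L, j t.1 t.2 ∈ B t} =
      Set.pi Set.univ fun ℓ => Set.pi Set.univ fun k => (B ⟨ℓ, k⟩ : Set (Fin d)) := by
    ext j
    simp only [Set.mem_ofPred_eq, Set.mem_pi, Set.mem_univ, true_imp_iff, Finset.mem_coe]
    exact ⟨fun h ℓ k => h ⟨ℓ, k⟩, fun h t => h t.1 t.2⟩
  rw [hset, measureReal_def, Measure.pi_pi, ENNReal.toReal_prod, Fintype.prod_sigma]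
  refine Finset.prod_congr rfl fun ℓ _ => ?_
  rw [Measure.pi_pi, ENNReal.toReal_prod]
  exact Finset.prod_congr rfl fun k _ => unifCoord_real _

theorem dim_pos (d : ℕ) [NeZero d] : (0 : ℝ) < d := by
  exact_mod_cast Nat.pos_of_ne_zero (NeZero.ne d)

theorem coordLaw_forall_mem (T : Finset (Slot L)) (A : Finset (Fin d)) :
    (coordLaw L d).real {j | ∀ t ∈ T, j t.1 t.2 ∈ A} = ((A.card : ℝ) / d) ^ T.card := by
  classical
  have := coordLaw_box (d := d) fun t : Slot L => if t ∈ T then A else Finset.univ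
  have hset : {j : Coords L d | ∀ t ∈ T, j t.1 t.2 ∈ A} =
      {j | ∀ t : Slot L, j t.1 t.2 ∈ if t ∈ T then A else Finset.univ} := by
    ext j
    refine forall_congr' fun t => ?_
    split_ifs with h <;> simp [h]
  have hd := (dim_pos d).ne'
  rw [hset, this]
  have e : ∀ t : Slot L, (((if t ∈ T then A else Finset.univ).card : ℕ) : ℝ) / d =
      if t ∈ T then (A.card : ℝ) / d else 1 := by
    intro t; split_ifs <;> simp [hd]
  simp only [e]
  rw [Finset.prod_ite_mem, Finset.univ_inter, Finset.prod_const]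

theorem coordLaw_slot_and_forall_mem (T : Finset (Slot L)) (A : Finset (Fin d)) {t : Slot L}
    (ht : t ∉ T) (q : Fin d) :
    (coordLaw L d).real {j | j t.1 t.2 = q ∧ ∀ t ∈ T, j t.1 t.2 ∈ A} =
      1 / d * ((A.card : ℝ) / d) ^ T.card := by
  classical
  have := coordLaw_box (d := d) fun t' : Slot L =>
    if t' = t then {q} else if t' ∈ T then A else Finset.univ
  have hset : {j : Coords L d | j t.1 t.2 = q ∧ ∀ t ∈ T, j t.1 t.2 ∈ A} =
      {j | ∀ t' : Slot L, j t'.1 t'.2 ∈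
        if t' = t then {q} else if t' ∈ T then A else Finset.univ} := by
    ext j
    simp only [Set.mem_ofPred_eq]
    constructor
    · rintro ⟨h1, h2⟩ t'
      split_ifs with h3 h4
      · subst h3; simpa using h1
      · exact h2 _ h4
      · simp
    · intro h
      refine ⟨by simpa using h t, fun t' ht' => ?_⟩
      have := h t'
      rwa [if_neg (by rintro rfl; exact ht ht'), if_pos ht'] at this
  have hd := (dim_pos d).ne'
  rw [hset, this]
  have e : ∀ t' : Slot L, (((if t' = t then {q} else if t' ∈ T then A else Finset.univ).card : ℕ) : ℝ)
      / d = (if t' = t then 1 / (d : ℝ) else 1) * if t' ∈ T then (A.card : ℝ) / d else 1 := by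
    intro t'
    by_cases h1 : t' = t
    · subst h1; simp [ht]
    · by_cases h2 : t' ∈ T <;> simp [h1, h2, hd]
  simp only [e]
  rw [Finset.prod_mul_distrib, Finset.prod_ite_mem, Finset.univ_inter, Finset.prod_const,
    Finset.prod_ite_eq' Finset.univ t, if_pos (Finset.mem_univ t)]

theorem agree_pow_le (a b : Cube d) (k : ℕ) :
    (((agreeSet a b).card : ℝ) / d) ^ k ≤ Real.exp (-(hammingDist a b * k / d)) := by
  have hd := dim_pos d
  rw [agreeSet_card, sub_div, div_self hd.ne']
  have h0 : 0 ≤ 1 - (hammingDist a b : ℝ) / d := by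
    rw [sub_nonneg, div_le_one hd]
    exact hammingDist_le_dim a b
  calc (1 - (hammingDist a b : ℝ) / d) ^ k ≤ Real.exp (-((hammingDist a b : ℝ) / d)) ^ k :=
        pow_le_pow_left₀ h0 (Real.one_sub_le_exp_neg _) k
    _ = _ := by rw [← Real.exp_nat_mul]; congr 1; ring

theorem coordLaw_nodeAt_eq_le (a b : Cube d) {p : ℕ} (hp : p ≤ L) :
    (coordLaw L d).real {j | nodeAt j a p = nodeAt j b p} ≤
      Real.exp (-(hammingDist a b * (slotsBelow L p).card / d)) := by
  refine le_trans (le_of_eq ?_) (agree_pow_le a b _)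
  rw [← coordLaw_forall_mem]
  congr 1
  ext j
  simp only [Set.mem_ofPred_eq, nodeAt_eq_iff_forall_slot hp, mem_slotsBelow, agreeSet,
    Finset.mem_filter, Finset.mem_univ, true_and]

/-- A union bound over pairs and depths `1, …, L`. Since `2^p - 1 ≥ 2^p / 2` for `p ≥ 1`, a pair at
distance more than `ξ d / 2^p` shares its node at depth `p` with probability at most `exp(-ξ/2)`. -/
theorem coordLaw_not_controlled_le (U : Finset (Cube d)) {ξ : ℝ} (hξ : 1 ≤ ξ) :
    (coordLaw L d).real {j | ¬ Controlled j U ξ} ≤ U.card ^ 2 * L * Real.exp (-(ξ / 2)) := by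
  have hd := dim_pos d
  have hsub : {j : Coords L d | ¬ Controlled j U ξ} ⊆
      ⋃ q ∈ (U ×ˢ U) ×ˢ Finset.range L, {j | nodeAt j q.1.1 (q.2 + 1) = nodeAt j q.1.2 (q.2 + 1) ∧
        (d : ℝ) / 2 ^ (q.2 + 1) * ξ < hammingDist q.1.1 q.1.2} := by
    intro j hj
    simp only [Controlled, Set.mem_ofPred_eq] at hj
    push Not at hj
    obtain ⟨a, ha, b, hb, p, hp, h1, h2⟩ := hj
    -- At the root nothing can go wrong, because distances are at most `d ≤ ξ d`.
    have hp0 : p ≠ 0 := by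
      rintro rfl
      rw [pow_zero, div_one] at h2
      nlinarith [hammingDist_le_dim a b]
    simp only [Set.mem_iUnion]
    refine ⟨((a, b), p - 1), ?_, ?_⟩
    · simp only [Finset.mem_product, Finset.mem_range]
      exact ⟨⟨ha, hb⟩, by omega⟩
    · rw [show p - 1 + 1 = p by omega]
      exact ⟨h1, h2⟩
  refine (measureReal_mono hsub (measure_ne_top _ _)).trans
    ((measureReal_biUnion_finset_le _ _).trans ?_)
  refine (Finset.sum_le_card_nsmul _ _ (Real.exp (-(ξ / 2))) ?_).trans (le_of_eq ?_)
  · rintro ⟨⟨a, b⟩, p⟩ hq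
    simp only [Finset.mem_product, Finset.mem_range] at hq
    by_cases h : (d : ℝ) / 2 ^ (p + 1) * ξ < hammingDist a b
    · simp only [h, and_true]
      refine (coordLaw_nodeAt_eq_le a b (by omega)).trans (Real.exp_le_exp.2 ?_)
      have hc : ((slotsBelow L (p + 1)).card : ℝ) + 1 = 2 ^ (p + 1) := by
        exact_mod_cast slotsBelow_card (L := L) (p := p + 1) (by omega)
      have h2p : (2 : ℝ) ≤ 2 ^ (p + 1) := by
        rw [pow_succ]
        have : (1 : ℝ) ≤ 2 ^ p := one_le_pow₀ (by norm_num)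
        linarith
      rw [div_mul_eq_mul_div, div_lt_iff₀ (by positivity)] at h
      rw [neg_le_neg_iff, le_div_iff₀ hd]
      have h3 : (0 : ℝ) ≤ hammingDist a b := by positivity
      nlinarith
    · simp only [h, and_false, Set.ofPred_false, measureReal_empty]
      positivity
  · simp only [Finset.card_product, Finset.card_range, nsmul_eq_mul]
    push_cast
    ring

end

/-! ### Far points separate -/

theorem emd_le_sum {s d : ℕ} (x y : Point s d) (π : Equiv.Perm (Fin s)) :
    emd x y ≤ ∑ i, (hammingDist (x i) (y (π i)) : ℝ) :=
  ciInf_le (Set.finite_range _).bddBelow π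

theorem emd_le_sum_abs_treeEmbed {L s d : ℕ} {j : Coords L d} {W U : Finset (Cube d)} {ξ : ℝ}
    (hU : Controlled j U ξ) (hW : W ⊆ U) (hξ : 0 ≤ ξ) (x y : Point s d) (hx : ∀ i, x i ∈ U)
    (hy : ∀ i, y i ∈ U) :
    emd x y ≤ ∑ v ∈ treeNodes j, |treeEmbed j W ξ x v - treeEmbed j W ξ y v| := by
  obtain ⟨π, hπ⟩ := exists_sum_treeDist_le (j := j) (W := W) hξ x y
  exact (emd_le_sum x y π).trans (le_trans (Finset.sum_le_sum fun i _ =>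
    hammingDist_le_treeDist hU hW hξ (hx i) (hy _)) hπ)

theorem integral_le_of_forall_le {A : Type*} [Finite A] [MeasurableSpace A]
    [MeasurableSingletonClass A] (P : Measure A) [IsProbabilityMeasure P] {f : A → ℝ} {c : ℝ}
    (h : ∀ a, f a ≤ c) : ∫ a, f a ∂P ≤ c := by
  have := integral_mono (μ := P) (Integrable.of_finite) (integrable_const c) h
  simpa using this

/-- The elements of the sample, their neighbours, and the elements of `x` and `y`. -/
def relevant {m s d : ℕ} (w : Fin m → Point s d) (x y : Point s d) : Finset (Cube d) :=
  sampleNbr w ∪ (Finset.univ.image x ∪ Finset.univ.image y)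

theorem relevant_card_le {m s d : ℕ} (hm : 2 ≤ m) (hd : 1 ≤ d) (w : Fin m → Point s d)
    (x y : Point s d) : (relevant w x y).card ≤ 3 * (m * s * d) := by
  have h1 := sampleNbr_card_le w
  have h2 : (Finset.univ.image x).card ≤ s := by
    simpa using Finset.card_image_le (s := (Finset.univ : Finset (Fin s))) (f := x)
  have h3 : (Finset.univ.image y).card ≤ s := by
    simpa using Finset.card_image_le (s := (Finset.univ : Finset (Fin s))) (f := y)
  have h4 := Finset.card_union_le (sampleNbr w) (Finset.univ.image x ∪ Finset.univ.image y)
  have h5 := Finset.card_union_le (Finset.univ.image x) (Finset.univ.image y)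
  have h6 : m * s ≤ m * s * d := Nat.le_mul_of_pos_right _ hd
  have h7 : 2 * s ≤ m * s := Nat.mul_le_mul_right _ hm
  unfold relevant
  nlinarith

/-- The constant `8 κ + 16` in the scale is chosen for this power: it must beat the polynomial
number of pairs and levels, with the factor `κ` as well. -/
theorem exp_neg_half_scale (κ : ℕ) {N δ : ℝ} (hN : 0 < N) (hδ : 0 < δ) :
    Real.exp (-(((8 * κ + 16 : ℕ) : ℝ) * Real.log (N / δ) / 2)) = (δ / N) ^ (4 * κ + 8) := by
  have h : 0 < N / δ := by positivity
  rw [show -(((8 * κ + 16 : ℕ) : ℝ) * Real.log (N / δ) / 2) =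
      ((4 * κ + 8 : ℕ) : ℝ) * Real.log (δ / N) by
    rw [← inv_div N δ, Real.log_inv]; push_cast; ring]
  rw [Real.exp_nat_mul, Real.exp_log (by positivity)]

theorem coordLaw_not_controlled_le_pow {κ m s d : ℕ} [NeZero d] {δ : ℝ} (hs : 1 ≤ s)
    (hm : 2 ≤ m) (hδ : 0 < δ) {U : Finset (Cube d)}
    (hU : U.card ≤ 3 * (m * s * d))
    (hξ : 1 ≤ ((8 * κ + 16 : ℕ) : ℝ) * Real.log ((m : ℝ) * s * d / δ)) :
    (coordLaw (κ * Nat.clog 2 d) d).real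
      {j | ¬ Controlled j U (((8 * κ + 16 : ℕ) : ℝ) * Real.log ((m : ℝ) * s * d / δ))} ≤
      9 * κ * ((m : ℝ) * s * d) ^ 3 * (δ / ((m : ℝ) * s * d)) ^ (4 * κ + 8) := by
  have hd : 1 ≤ d := Nat.pos_of_ne_zero (NeZero.ne d)
  have hN : (0 : ℝ) < (m : ℝ) * s * d := by positivity
  refine (coordLaw_not_controlled_le U hξ).trans ?_
  rw [exp_neg_half_scale κ hN hδ]
  refine mul_le_mul_of_nonneg_right ?_ (by positivity)
  have h1 : (U.card : ℝ) ≤ 3 * ((m : ℝ) * s * d) := by exact_mod_cast hU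
  have h2 : ((κ * Nat.clog 2 d : ℕ) : ℝ) ≤ κ * ((m : ℝ) * s * d) := by
    have : Nat.clog 2 d ≤ m * s * d :=
      (clog_le_self d).trans (Nat.le_mul_of_pos_left _ (Nat.mul_pos (by omega) hs))
    exact_mod_cast Nat.mul_le_mul_left κ this
  calc (U.card : ℝ) ^ 2 * ((κ * Nat.clog 2 d : ℕ) : ℝ)
      ≤ (3 * ((m : ℝ) * s * d)) ^ 2 * (κ * ((m : ℝ) * s * d)) := by gcongr
    _ = _ := by ring

theorem one_le_scale {κ m s d : ℕ} {δ : ℝ} (hs : 1 ≤ s) (hd : 1 ≤ d) (hm : 2 ≤ m) (hδ : 0 < δ)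
    (hδ1 : δ < 1) : 1 ≤ ((8 * κ + 16 : ℕ) : ℝ) * Real.log ((m : ℝ) * s * d / δ) := by
  have h1 : (2 : ℝ) ≤ m := by exact_mod_cast hm
  have h2 : (1 : ℝ) ≤ s := by exact_mod_cast hs
  have h3 : (1 : ℝ) ≤ d := by exact_mod_cast hd
  have h4 : (2 : ℝ) ≤ (m : ℝ) * s * d / δ := by
    rw [le_div_iff₀ hδ]
    have : (2 : ℝ) ≤ (m : ℝ) * s := by nlinarith
    nlinarith
  have h5 : Real.log 2 ≤ Real.log ((m : ℝ) * s * d / δ) := Real.log_le_log (by norm_num) h4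
  have h6 : (16 : ℝ) ≤ ((8 * κ + 16 : ℕ) : ℝ) := by push_cast; linarith [Nat.cast_nonneg (α := ℝ) κ]
  nlinarith [Real.log_two_gt_d9]

/-- For every sample the tree is controlled on all elements of `x`, of `y` and near the samples,
except with probability `δ`. On controlled trees the embedding does not contract the earth mover's
distance, and the grid hash collides with at most the exponential probability. -/
theorem collide_sampleTreeFamily_le {κ m s d : ℕ} [NeZero s] [NeZero d] (hm : 2 ≤ m)
    (μ : PMF (Point s d)) {γ δ : ℝ} (hγ : 0 < γ) (hδ : 0 < δ) (hδ1 : δ < 1) (x y : Point s d) :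
    (sampleTreeFamily (κ * Nat.clog 2 d) μ m
      (((8 * κ + 16 : ℕ) : ℝ) * Real.log ((m : ℝ) * s * d / δ)) γ).collide x y ≤
      Real.exp (-(emd x y / γ)) + δ := by
  have hs1 : 1 ≤ s := Nat.pos_of_ne_zero (NeZero.ne s)
  have hd1 : 1 ≤ d := Nat.pos_of_ne_zero (NeZero.ne d)
  have hξ1 := one_le_scale (κ := κ) hs1 hd1 hm hδ hδ1
  have hbad : ∀ w : Fin m → Point s d, (coordLaw (κ * Nat.clog 2 d) d).real
      {j | ¬ Controlled j (relevant w x y)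
        (((8 * κ + 16 : ℕ) : ℝ) * Real.log ((m : ℝ) * s * d / δ))} ≤ δ := by
    intro w
    refine (coordLaw_not_controlled_le_pow hs1 hm hδ (relevant_card_le hm hd1 w x y) hξ1).trans ?_
    have hN : (2 : ℝ) ≤ (m : ℝ) * s * d := by
      have : 2 ≤ m * s * d :=
        hm.trans ((Nat.le_mul_of_pos_right m hs1).trans (Nat.le_mul_of_pos_right _ hd1))
      exact_mod_cast this
    generalize (m : ℝ) * s * d = N at *
    have hN0 : 0 < N := by linarith
    have e : 9 * (κ : ℝ) * N ^ 3 * (δ / N) ^ (4 * κ + 8) =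
        δ ^ (4 * κ + 8) * (9 * κ / N ^ (4 * κ + 5)) := by
      rw [div_pow, show 4 * κ + 8 = (4 * κ + 5) + 3 by ring, pow_add N]
      field_simp
    rw [e]
    have h1 : δ ^ (4 * κ + 8) ≤ δ := by
      calc δ ^ (4 * κ + 8) ≤ δ ^ 1 := pow_le_pow_of_le_one hδ.le hδ1.le (by omega)
        _ = δ := pow_one δ
    have h2 : 9 * (κ : ℝ) / N ^ (4 * κ + 5) ≤ 1 := by
      rw [div_le_one (by positivity)]
      have h3 : (2 : ℝ) ^ (4 * κ + 5) ≤ N ^ (4 * κ + 5) := pow_le_pow_left₀ (by norm_num) hN _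
      have h4 : 9 * κ ≤ 2 ^ (4 * κ + 5) := by
        have h5 : κ < 2 ^ κ := Nat.lt_two_pow_self
        have h6 : 2 ^ κ ≤ 2 ^ (4 * κ) := Nat.pow_le_pow_right (by norm_num) (by omega)
        rw [pow_add]
        omega
      have h4' : (9 : ℝ) * κ ≤ 2 ^ (4 * κ + 5) := by exact_mod_cast h4
      linarith
    calc δ ^ (4 * κ + 8) * (9 * κ / N ^ (4 * κ + 5)) ≤ δ * 1 :=
          mul_le_mul h1 h2 (by positivity) hδ.le
      _ = δ := mul_one δ
  set ξ : ℝ := ((8 * κ + 16 : ℕ) : ℝ) * Real.log ((m : ℝ) * s * d / δ) with hξ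
  have hξ0 : 0 ≤ ξ := by linarith
  set L := κ * Nat.clog 2 d with hL
  have hrw : (sampleTreeFamily L μ m ξ γ).collide x y = ((Measure.pi fun _ : Fin m =>
      μ.toMeasure).prod ((coordLaw L d).prod shiftLaw)).real
      {ω | gridHash γ ω.2.2 (treeEmbed ω.2.1 (sampleNbr ω.1) ξ x) =
        gridHash γ ω.2.2 (treeEmbed ω.2.1 (sampleNbr ω.1) ξ y)} := rfl
  rw [hrw]
  refine (prod_real_le_integral _ _ _).trans (integral_le_of_forall_le _ fun w => ?_)
  refine (prod_real_le_integral _ _ _).trans ?_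
  have hpt : ∀ j : Coords L d, shiftLaw.real
      {u | gridHash γ u (treeEmbed j (sampleNbr w) ξ x) =
        gridHash γ u (treeEmbed j (sampleNbr w) ξ y)} ≤
      Real.exp (-(emd x y / γ)) + Set.indicator {j | ¬ Controlled j (relevant w x y) ξ} 1 j := by
    intro j
    by_cases hj : Controlled j (relevant w x y) ξ
    · rw [Set.indicator_of_notMem (by simpa using hj), add_zero]
      refine (gridHash_eq_le hγ _ _ (treeNodes j)).trans (Real.exp_le_exp.2 (neg_le_neg ?_))
      gcongr
      exact emd_le_sum_abs_treeEmbed hj Finset.subset_union_left hξ0 x y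
        (fun i => by simp [relevant]) (fun i => by simp [relevant])
    · rw [Set.indicator_of_mem (by simpa using hj), Pi.one_apply]
      have h1 : shiftLaw.real {u | gridHash γ u (treeEmbed j (sampleNbr w) ξ x) =
        gridHash γ u (treeEmbed j (sampleNbr w) ξ y)} ≤ 1 := measureReal_le_one
      linarith [Real.exp_pos (-(emd x y / γ))]
  refine (integral_mono (Integrable.of_finite) (Integrable.of_finite) hpt).trans ?_
  rw [integral_add (Integrable.of_finite) (Integrable.of_finite), integral_const,
    integral_indicator_one (Set.toFinite _).measurableSet]
  simp only [probReal_univ, smul_eq_mul, one_mul]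
  exact add_le_add le_rfl (hbad w)

/-! ### The mean distance to an element in a random cell -/

theorem integral_ite_eq_real {A : Type*} [Finite A] [MeasurableSpace A]
    [MeasurableSingletonClass A] (P : Measure A) [IsProbabilityMeasure P] (p : A → Prop)
    [DecidablePred p] : ∫ a, (if p a then (1 : ℝ) else 0) ∂P = P.real {a | p a} := by
  rw [← integral_indicator_one (Set.toFinite {a | p a}).measurableSet]
  congr 1
  ext a
  by_cases h : p a <;> simp [h]

section

variable {d : ℕ} {A U S : Finset (Cube d)} {e : Cube d}

theorem avgTo_le_add_far (hA : A.Nonempty) {θ : ℝ} (hθ : 0 ≤ θ) :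
    avgTo A e ≤ θ + (∑ c ∈ A with θ < hammingDist c e, (hammingDist c e : ℝ)) / A.card := by
  have hA' : (0 : ℝ) < A.card := by exact_mod_cast hA.card_pos
  rw [avgTo, div_le_iff₀ hA', add_mul, div_mul_cancel₀ _ hA'.ne',
    ← Finset.sum_filter_add_sum_filter_not A fun c => θ < (hammingDist c e : ℝ), add_comm]
  gcongr
  refine (Finset.sum_le_card_nsmul _ _ θ fun c hc => not_lt.1 (Finset.mem_filter.1 hc).2).trans ?_
  rw [nsmul_eq_mul, mul_comm]
  gcongr
  exact Finset.filter_subset _ _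

/-- `A` is going to be random and `S` a fixed ball around `e`; the point is a bound linear in the
indicators of membership in `A`, free of the random denominator. If `A` contains at least half of
`S`, its size is at least `|S| / 2`, and distances beyond `θ` are averaged accordingly. Otherwise
the count of missed elements of `S` pays for the cruder threshold `Θ`. -/
theorem avgTo_le_split (hAU : A ⊆ U) (hA : A.Nonempty) (hS : S.Nonempty) {θ Θ : ℝ} (hθ : 0 ≤ θ)
    (hΘ : 0 ≤ Θ) : avgTo A e ≤ θ +
      2 / S.card * (∑ c ∈ U with θ < hammingDist c e, if c ∈ A then (hammingDist c e : ℝ) else 0) +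
      2 * Θ / S.card * (∑ c ∈ S, if c ∈ A then 0 else 1) +
      ∑ c ∈ U with Θ < hammingDist c e, if c ∈ A then (hammingDist c e : ℝ) else 0 := by
  have hA' : (1 : ℝ) ≤ A.card := by exact_mod_cast hA.card_pos
  have hS' : (0 : ℝ) < S.card := by exact_mod_cast hS.card_pos
  have hsum : ∀ η : ℝ, ∑ c ∈ A with η < hammingDist c e, (hammingDist c e : ℝ) =
      ∑ c ∈ U with η < hammingDist c e, if c ∈ A then (hammingDist c e : ℝ) else 0 := by
    intro η
    rw [← Finset.sum_filter]
    refine Finset.sum_congr ?_ fun _ _ => rfl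
    ext c
    simp only [Finset.mem_filter]
    exact ⟨fun h => ⟨⟨hAU h.1, h.2⟩, h.1⟩, fun h => ⟨h.2, h.1.2⟩⟩
  rw [← hsum, ← hsum]
  have hmiss : (∑ c ∈ S, if c ∈ A then (0 : ℝ) else 1) = (S.filter fun c => c ∉ A).card := by
    rw [← Finset.sum_boole]
    exact Finset.sum_congr rfl fun c _ => by by_cases h : c ∈ A <;> simp [h]
  rw [hmiss]
  have p1 : 0 ≤ ∑ c ∈ A with θ < hammingDist c e, (hammingDist c e : ℝ) :=
    Finset.sum_nonneg fun _ _ => by positivity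
  have p2 : 0 ≤ ∑ c ∈ A with Θ < hammingDist c e, (hammingDist c e : ℝ) :=
    Finset.sum_nonneg fun _ _ => by positivity
  rcases le_or_gt (2 * (S.filter fun c => c ∉ A).card) S.card with h | h
  · have hcard : S.card ≤ 2 * A.card := by
      have h1 := Finset.card_filter_add_card_filter_not (s := S) fun c => c ∈ A
      have h2 : (S.filter fun c => c ∈ A).card ≤ A.card :=
        Finset.card_le_card fun c hc => (Finset.mem_filter.1 hc).2
      omega
    have hcard' : (S.card : ℝ) ≤ 2 * A.card := by exact_mod_cast hcard
    have h3 := avgTo_le_add_far (e := e) hA hθ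
    have h4 : (∑ c ∈ A with θ < hammingDist c e, (hammingDist c e : ℝ)) / A.card ≤
        2 / S.card * ∑ c ∈ A with θ < hammingDist c e, (hammingDist c e : ℝ) := by
      rw [div_eq_inv_mul]
      refine mul_le_mul_of_nonneg_right ?_ p1
      rw [inv_eq_one_div, div_le_div_iff₀ (by linarith) hS']
      linarith
    have h5 : 0 ≤ 2 * Θ / S.card * ((S.filter fun c => c ∉ A).card : ℝ) := by positivity
    linarith
  · have h3 := avgTo_le_add_far (e := e) hA hΘ
    have h4 : (∑ c ∈ A with Θ < hammingDist c e, (hammingDist c e : ℝ)) / A.card ≤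
        ∑ c ∈ A with Θ < hammingDist c e, (hammingDist c e : ℝ) := div_le_self p2 hA'
    have h5 : Θ ≤ 2 * Θ / S.card * ((S.filter fun c => c ∉ A).card : ℝ) := by
      have h6 : (S.card : ℝ) ≤ 2 * ((S.filter fun c => c ∉ A).card : ℝ) := by exact_mod_cast h.le
      rw [div_mul_eq_mul_div, le_div_iff₀ hS']
      nlinarith
    have h6 : 0 ≤ 2 / S.card * ∑ c ∈ A with θ < hammingDist c e, (hammingDist c e : ℝ) := by
      positivity
    linarith

/-- Half of the exponential decay absorbs the linear factor. -/
theorem mul_exp_neg_half_le {x r : ℝ} (hr : 0 < r) :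
    x * Real.exp (-(x / (2 * r))) ≤ 4 * r * Real.exp (-(x / (4 * r))) := by
  have h1 : x / (4 * r) ≤ Real.exp (x / (4 * r)) := by
    linarith [Real.add_one_le_exp (x / (4 * r))]
  have h2 : x ≤ 4 * r * Real.exp (x / (4 * r)) := by
    rw [div_le_iff₀ (by positivity)] at h1
    linarith
  calc x * Real.exp (-(x / (2 * r))) ≤
        4 * r * Real.exp (x / (4 * r)) * Real.exp (-(x / (2 * r))) := by gcongr
    _ = _ := by
      rw [mul_assoc, ← Real.exp_add]
      congr 2
      field_simp
      ring

/-- The elements of `U` at distance at most `θ` from `e`. -/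
def nearby (U : Finset (Cube d)) (e : Cube d) (θ : ℝ) : Finset (Cube d) :=
  U.filter fun c => (hammingDist c e : ℝ) ≤ θ

theorem far_sum_le {r θ : ℝ} (hr : 0 < r) {V : Finset (Cube d)}
    (hV : ∀ c ∈ V, θ * r ≤ hammingDist c e) :
    ∑ c ∈ V, (hammingDist c e : ℝ) * Real.exp (-(hammingDist c e / (2 * r))) ≤
      V.card * (4 * r * Real.exp (-(θ / 4))) := by
  rw [← nsmul_eq_mul]
  refine Finset.sum_le_card_nsmul _ _ _ fun c hc => (mul_exp_neg_half_le hr).trans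
    (mul_le_mul_of_nonneg_left (Real.exp_le_exp.2 (neg_le_neg ?_)) (by positivity))
  rw [div_le_div_iff₀ (by norm_num) (by positivity)]
  have := hV c hc
  nlinarith

/-- The expectation of the bound `avgTo_le_split` for `S` the ball of radius `r / Λ`. The threshold
is chosen so that `exp(-θ/4)` is the ratio of the sizes of the balls of radii `r / Λ` and `Λ r`,
which cancels the number of elements between `θ r` and `Λ r`. Beyond `Λ r` the factor `exp(-Λ/4) ≤ 1
/ |U|` cancels the number of all elements. The constant is `22 = 16 + 2 + 4`, from the three sums.
-/
theorem split_arith {r Λ : ℝ} (hr : 0 < r) (hΛ : 1 ≤ Λ) (he : e ∈ U)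
    (hlog : 4 * Real.log U.card ≤ Λ) :
    4 * (Real.log (nearby U e (Λ * r)).card - Real.log (nearby U e (r / Λ)).card) * r +
      2 / (nearby U e (r / Λ)).card * (∑ c ∈ U with
        4 * (Real.log (nearby U e (Λ * r)).card - Real.log (nearby U e (r / Λ)).card) * r <
          hammingDist c e, (hammingDist c e : ℝ) * Real.exp (-(hammingDist c e / (2 * r)))) +
      2 * (Λ * r) / (nearby U e (r / Λ)).card *
        (∑ c ∈ nearby U e (r / Λ), (hammingDist c e : ℝ) / r) +
      ∑ c ∈ U with Λ * r < hammingDist c e,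
        (hammingDist c e : ℝ) * Real.exp (-(hammingDist c e / (2 * r))) ≤
      r * (4 * (Real.log (nearby U e (Λ * r)).card - Real.log (nearby U e (r / Λ)).card) + 22) := by
  have hΛ0 : 0 < Λ := by linarith
  set S := nearby U e (r / Λ) with hS
  set S' := nearby U e (Λ * r) with hS'
  set θ := 4 * (Real.log S'.card - Real.log S.card) with hθ
  have heS : e ∈ S := Finset.mem_filter.2 ⟨he, by rw [hammingDist_self]; simp; positivity⟩
  have hS1 : (1 : ℝ) ≤ S.card := by exact_mod_cast Finset.card_pos.2 ⟨e, heS⟩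
  have hSS' : S ⊆ S' := by
    intro c hc
    rw [hS, nearby, Finset.mem_filter] at hc
    refine Finset.mem_filter.2 ⟨hc.1, hc.2.trans ?_⟩
    rw [div_le_iff₀ hΛ0]
    nlinarith [mul_le_mul hΛ hΛ zero_le_one hΛ0.le]
  have hS'1 : (0 : ℝ) < S'.card := by
    have : (S.card : ℝ) ≤ S'.card := by exact_mod_cast Finset.card_le_card hSS'
    linarith
  have hU1 : (0 : ℝ) < U.card := by exact_mod_cast Finset.card_pos.2 ⟨e, he⟩
  have f1 : ∑ c ∈ U with Λ * r < hammingDist c e,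
      (hammingDist c e : ℝ) * Real.exp (-(hammingDist c e / (2 * r))) ≤ 4 * r := by
    refine (far_sum_le (θ := Λ) hr fun c hc => (Finset.mem_filter.1 hc).2.le).trans ?_
    have h1 : Real.exp (-(Λ / 4)) ≤ (U.card : ℝ)⁻¹ := by
      rw [← Real.exp_log (inv_pos.2 hU1), Real.log_inv]
      exact Real.exp_le_exp.2 (by linarith)
    have h2 : ((U.filter fun c => Λ * r < hammingDist c e).card : ℝ) ≤ U.card := by
      exact_mod_cast Finset.card_filter_le _ _
    calc _ ≤ (U.card : ℝ) * (4 * r * (U.card : ℝ)⁻¹) := by gcongr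
      _ = 4 * r := by field_simp
  have f2 : ∑ c ∈ U with θ * r < hammingDist c e,
      (hammingDist c e : ℝ) * Real.exp (-(hammingDist c e / (2 * r))) ≤ 4 * r * S.card + 4 * r := by
    rw [← Finset.sum_filter_add_sum_filter_not (U.filter fun c => θ * r < hammingDist c e)
      fun c => (hammingDist c e : ℝ) ≤ Λ * r]
    refine add_le_add ?_ (le_trans (Finset.sum_le_sum_of_subset_of_nonneg ?_ fun _ _ _ => ?_) f1)
    · refine (far_sum_le (θ := θ) hr fun c hc =>
        (Finset.mem_filter.1 (Finset.mem_filter.1 hc).1).2.le).trans ?_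
      have h1 : Real.exp (-(θ / 4)) = S.card / S'.card := by
        rw [hθ, show -(4 * (Real.log S'.card - Real.log S.card) / 4) =
          Real.log S.card - Real.log S'.card by ring, Real.exp_sub, Real.exp_log hS'1,
          Real.exp_log (by linarith)]
      rw [h1]
      have h2 : (((U.filter fun c => θ * r < hammingDist c e).filter
          fun c => (hammingDist c e : ℝ) ≤ Λ * r).card : ℝ) ≤ S'.card := by
        exact_mod_cast Finset.card_le_card fun c hc => Finset.mem_filter.2
          ⟨(Finset.mem_filter.1 (Finset.mem_filter.1 hc).1).1, (Finset.mem_filter.1 hc).2⟩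
      calc _ ≤ (S'.card : ℝ) * (4 * r * (S.card / S'.card)) := by gcongr
        _ = 4 * r * S.card := by field_simp
    · intro c hc
      rw [Finset.mem_filter, Finset.mem_filter, not_le] at hc
      exact Finset.mem_filter.2 ⟨hc.1.1, hc.2⟩
    · positivity
  have f3 : ∑ c ∈ S, (hammingDist c e : ℝ) / r ≤ S.card * (1 / Λ) := by
    rw [← nsmul_eq_mul]
    refine Finset.sum_le_card_nsmul _ _ _ fun c hc => ?_
    rw [div_le_iff₀ hr, one_div_mul_eq_div]
    exact (Finset.mem_filter.1 hc).2
  have g2 : 2 / (S.card : ℝ) * (4 * r * S.card + 4 * r) ≤ 16 * r := by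
    rw [div_mul_eq_mul_div, div_le_iff₀ (by linarith)]
    nlinarith
  have g3 : 2 * (Λ * r) / S.card * (S.card * (1 / Λ)) = 2 * r := by field_simp
  have k2 := mul_le_mul_of_nonneg_left f2 (show 0 ≤ 2 / (S.card : ℝ) by positivity)
  have k3 := mul_le_mul_of_nonneg_left f3 (show 0 ≤ 2 * (Λ * r) / (S.card : ℝ) by positivity)
  nlinarith

end

/-! ### The expected mean distance from an element to its random cell. -/

section

variable {L d : ℕ} [NeZero d]

/-- The elements of `U` that agree with `e` on the slots `T`. -/
def agreeing (j : Coords L d) (T : Finset (Slot L)) (U : Finset (Cube d)) (e : Cube d) :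
    Finset (Cube d) := U.filter fun c => ∀ t ∈ T, c (j t.1 t.2) = e (j t.1 t.2)

theorem slot_and_agree_real (T : Finset (Slot L)) {t : Slot L} (ht : t ∉ T) (q : Fin d)
    (c e : Cube d) :
    (coordLaw L d).real {j | j t.1 t.2 = q ∧ ∀ t ∈ T, c (j t.1 t.2) = e (j t.1 t.2)} =
      1 / d * (((agreeSet c e).card : ℝ) / d) ^ T.card := by
  rw [← coordLaw_slot_and_forall_mem T _ ht q]
  simp [agreeSet]

theorem slot_real (t : Slot L) (q : Fin d) : (coordLaw L d).real {j | j t.1 t.2 = q} = 1 / d := by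
  have := coordLaw_slot_and_forall_mem (d := d) ∅ ∅ (Finset.notMem_empty t) q
  simpa using this

/-- The slot `t` is independent of the slots in `T`, so the event that it holds `q` only contributes
the factor `1 / d`. With about `d / r` slots in `T`, an element at distance `x` from `e` survives
with probability at most `exp(-x / (2r))` and is lost with probability at most `x / r`; these are
the inputs of `split_arith`. -/
theorem integral_slot_avgTo_le {T : Finset (Slot L)} {t : Slot L} (ht : t ∉ T) (q : Fin d)
    {U : Finset (Cube d)} {e : Cube d} (he : e ∈ U) {r Λ : ℝ} (hr : 0 < r) (hΛ : 1 ≤ Λ)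
    (hlog : 4 * Real.log U.card ≤ Λ) (h1 : T.card * r ≤ d) (h2 : (d : ℝ) ≤ 2 * r * T.card) :
    ∫ j, (if j t.1 t.2 = q then avgTo (agreeing j T U e) e else 0) ∂(coordLaw L d) ≤
      1 / d * (r * (4 * (Real.log (nearby U e (Λ * r)).card -
        Real.log (nearby U e (r / Λ)).card) + 22)) := by
  classical
  have hd := dim_pos d
  have hΛ0 : 0 < Λ := by linarith
  set S := nearby U e (r / Λ) with hS
  set θ := 4 * (Real.log (nearby U e (Λ * r)).card - Real.log S.card) with hθ
  have heS : e ∈ S := Finset.mem_filter.2 ⟨he, by rw [hammingDist_self]; simp; positivity⟩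
  have hθ0 : 0 ≤ θ := by
    have h3 : S ⊆ nearby U e (Λ * r) := by
      intro c hc
      rw [hS, nearby, Finset.mem_filter] at hc
      refine Finset.mem_filter.2 ⟨hc.1, hc.2.trans ?_⟩
      rw [div_le_iff₀ hΛ0]
      nlinarith [mul_le_mul hΛ hΛ zero_le_one hΛ0.le]
    have h4 : (0 : ℝ) < S.card := by exact_mod_cast Finset.card_pos.2 ⟨e, heS⟩
    have h5 : (S.card : ℝ) ≤ (nearby U e (Λ * r)).card := by exact_mod_cast Finset.card_le_card h3
    have := Real.log_le_log h4 h5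
    rw [hθ]
    linarith
  have eX : ∀ c, ∫ j, (if j t.1 t.2 = q ∧ ∀ t ∈ T, c (j t.1 t.2) = e (j t.1 t.2) then (1 : ℝ)
      else 0) ∂(coordLaw L d) ≤ 1 / d * Real.exp (-(hammingDist c e / (2 * r))) := by
    intro c
    rw [integral_ite_eq_real, slot_and_agree_real T ht]
    gcongr
    refine (agree_pow_le c e _).trans (Real.exp_le_exp.2 (neg_le_neg ?_))
    rw [div_le_div_iff₀ (by positivity) hd]
    have : (0 : ℝ) ≤ hammingDist c e := by positivity
    nlinarith
  have eQ : ∫ j, (if j t.1 t.2 = q then (1 : ℝ) else 0) ∂(coordLaw L d) = 1 / d := by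
    rw [integral_ite_eq_real, slot_real]
  have eY : ∀ c, ∫ j, ((if j t.1 t.2 = q then (1 : ℝ) else 0) -
      if j t.1 t.2 = q ∧ ∀ t ∈ T, c (j t.1 t.2) = e (j t.1 t.2) then (1 : ℝ) else 0)
      ∂(coordLaw L d) ≤ 1 / d * (hammingDist c e / r) := by
    intro c
    rw [integral_sub Integrable.of_finite Integrable.of_finite, eQ, integral_ite_eq_real,
      slot_and_agree_real T ht, agreeSet_card, sub_div, div_self hd.ne', ← mul_one_sub]
    gcongr
    have hle : (hammingDist c e : ℝ) / d ≤ 1 := (div_le_one hd).2 (hammingDist_le_dim c e)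
    -- Bernoulli's inequality for the probability that an element near `e` agrees with `e` on all
    -- slots.
    have hb := one_add_mul_le_pow (a := -((hammingDist c e : ℝ) / d)) (by linarith) T.card
    have hc : T.card * ((hammingDist c e : ℝ) / d) ≤ hammingDist c e / r := by
      rw [mul_div_assoc', div_le_div_iff₀ hd hr]
      have : (0 : ℝ) ≤ hammingDist c e := by positivity
      nlinarith
    rw [← sub_eq_add_neg] at hb
    linarith
  have hpt : ∀ j : Coords L d, (if j t.1 t.2 = q then avgTo (agreeing j T U e) e else 0) ≤
      θ * r * (if j t.1 t.2 = q then (1 : ℝ) else 0) +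
      2 / S.card * (∑ c ∈ U with θ * r < hammingDist c e, (hammingDist c e : ℝ) *
        if j t.1 t.2 = q ∧ ∀ t ∈ T, c (j t.1 t.2) = e (j t.1 t.2) then (1 : ℝ) else 0) +
      2 * (Λ * r) / S.card * (∑ c ∈ S, ((if j t.1 t.2 = q then (1 : ℝ) else 0) -
        if j t.1 t.2 = q ∧ ∀ t ∈ T, c (j t.1 t.2) = e (j t.1 t.2) then (1 : ℝ) else 0)) +
      ∑ c ∈ U with Λ * r < hammingDist c e, (hammingDist c e : ℝ) *
        if j t.1 t.2 = q ∧ ∀ t ∈ T, c (j t.1 t.2) = e (j t.1 t.2) then (1 : ℝ) else 0 := by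
    intro j
    by_cases hq : j t.1 t.2 = q
    · simp only [hq, if_true, true_and, mul_one]
      refine (avgTo_le_split (A := agreeing j T U e) (U := U) (S := S) (Finset.filter_subset _ _)
        ⟨e, Finset.mem_filter.2 ⟨he, fun _ _ => rfl⟩⟩ ⟨e, heS⟩ (θ := θ * r) (Θ := Λ * r)
        (by positivity) (by positivity)).trans (le_of_eq ?_)
      congr 1
      · congr 1
        · congr 2
          refine Finset.sum_congr rfl fun c hc => ?_
          have hcU := (Finset.mem_filter.1 hc).1
          simp only [agreeing, Finset.mem_filter, hcU, true_and, mul_ite, mul_one, mul_zero]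
        · congr 1
          refine Finset.sum_congr rfl fun c hc => ?_
          have hcU := (Finset.mem_filter.1 hc).1
          simp only [agreeing, Finset.mem_filter, hcU, true_and]
          split_ifs <;> simp
      · refine Finset.sum_congr rfl fun c hc => ?_
        have hcU := (Finset.mem_filter.1 hc).1
        simp only [agreeing, Finset.mem_filter, hcU, true_and, mul_ite, mul_one, mul_zero]
    · simp [hq]
  refine (integral_mono Integrable.of_finite Integrable.of_finite hpt).trans ?_
  rw [integral_add Integrable.of_finite Integrable.of_finite,
    integral_add Integrable.of_finite Integrable.of_finite,
    integral_add Integrable.of_finite Integrable.of_finite,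
    integral_const_mul, integral_const_mul, integral_const_mul,
    integral_finsetSum _ fun _ _ => Integrable.of_finite,
    integral_finsetSum _ fun _ _ => Integrable.of_finite,
    integral_finsetSum _ fun _ _ => Integrable.of_finite]
  simp only [integral_const_mul]
  rw [eQ]
  have key := split_arith (U := U) hr hΛ he hlog
  rw [← hS, ← hθ] at key
  refine le_trans ?_ (mul_le_mul_of_nonneg_left key (show 0 ≤ 1 / (d : ℝ) by positivity))
  rw [mul_add, mul_add, mul_add]
  have m1 : ∀ V : Finset (Cube d), ∑ c ∈ V, (hammingDist c e : ℝ) *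
      ∫ j, (if j t.1 t.2 = q ∧ ∀ t ∈ T, c (j t.1 t.2) = e (j t.1 t.2) then (1 : ℝ)
        else 0) ∂(coordLaw L d) ≤
      1 / d * ∑ c ∈ V, (hammingDist c e : ℝ) * Real.exp (-(hammingDist c e / (2 * r))) := by
    intro V
    rw [Finset.mul_sum]
    refine Finset.sum_le_sum fun c _ => ?_
    rw [mul_left_comm]
    exact mul_le_mul_of_nonneg_left (eX c) (by positivity)
  refine add_le_add (add_le_add (add_le_add ?_ ?_) ?_) (m1 _)
  · rw [mul_comm]
  · rw [mul_left_comm]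
    exact mul_le_mul_of_nonneg_left (m1 _) (by positivity)
  · rw [mul_left_comm (1 / (d : ℝ)), Finset.mul_sum S _ (1 / (d : ℝ))]
    exact mul_le_mul_of_nonneg_left (Finset.sum_le_sum fun c _ => eY c) (by positivity)

end

/-! ### Edge weights, cells, and telescoping logarithms of ball sizes. -/

section

variable {L d : ℕ} {j : Coords L d} {W : Finset (Cube d)} {ξ : ℝ}

theorem pathWeight_le_of_controlled (hC : Controlled j W ξ) (hξ : 0 ≤ ξ) (a : Cube d) {ℓ : ℕ}
    (hℓ : ℓ ≤ L) : pathWeight j W ξ a ℓ ≤ d / 2 ^ ℓ * ξ := by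
  rw [pathWeight]
  split_ifs with h
  · refine avgDist_le_of_forall (by positivity) fun c hc c' hc' => ?_
    have h1 := mem_cell.1 hc
    have h2 := mem_cell.1 (cell_subset a ℓ hc')
    exact hC c h1.1 c' h2.1 ℓ hℓ (h1.2.trans h2.2.symm)
  · exact le_rfl

theorem pathWeight_le (hξ : 1 ≤ ξ) (a : Cube d) (ℓ : ℕ) : pathWeight j W ξ a ℓ ≤ d * ξ := by
  have hd : (0 : ℝ) ≤ d := by positivity
  rw [pathWeight]
  split_ifs with h
  · exact avgDist_le_of_forall (by positivity) fun c _ c' _ =>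
      (hammingDist_le_dim c c').trans (by nlinarith)
  · gcongr
    exact div_le_self hd (one_le_pow₀ (by norm_num))

theorem treeDist_le (hξ : 1 ≤ ξ) (a b : Cube d) : treeDist j W ξ a b ≤ 2 * (L + 1) * (d * ξ) := by
  rw [treeDist]
  refine (Finset.sum_le_card_nsmul _ _ (2 * (d * ξ)) fun ℓ _ => ?_).trans (le_of_eq ?_)
  · split_ifs
    · positivity
    · linarith [pathWeight_le (j := j) (W := W) hξ a ℓ, pathWeight_le (j := j) (W := W) hξ b ℓ]
  · rw [Finset.card_range, nsmul_eq_mul]; push_cast; ring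

/-- Any element `e` of `W` in the lower cell can serve as the centre through which both averages are
taken. -/
theorem pathWeight_le_avgTo {a e : Cube d} (he : e ∈ W) {ℓ : ℕ}
    (h : nodeAt j e (ℓ + 1) = nodeAt j a (ℓ + 1)) :
    pathWeight j W ξ a ℓ ≤ avgTo (cell j W e ℓ) e + avgTo (cell j W e (ℓ + 1)) e := by
  have h1 : e ∈ cell j W e (ℓ + 1) := mem_cell.2 ⟨he, rfl⟩
  have h2 : ∀ k ≤ ℓ + 1, cell j W a k = cell j W e k := fun k hk => by
    simp only [cell, nodeAt_eq_of_le hk h]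
  rw [pathWeight, h2 _ le_rfl, h2 ℓ (by omega), if_pos ⟨e, h1⟩]
  exact avgDist_le_avgTo_add ⟨e, cell_subset _ _ h1⟩ ⟨e, h1⟩ e

theorem cell_eq_agreeing (j : Coords L d) (W : Finset (Cube d)) (e : Cube d) {p : ℕ} (hp : p ≤ L) :
    cell j W e p = agreeing j (slotsBelow L p) W e := by
  ext c
  simp only [cell, agreeing, Finset.mem_filter, nodeAt_eq_iff_forall_slot hp, mem_slotsBelow]

/-- `log #{c ∈ U : ‖c - e‖₁ ≤ d 2^λ / 2^p}`. -/
def logNear (U : Finset (Cube d)) (e : Cube d) (lam p : ℕ) : ℝ :=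
  Real.log (nearby U e ((d : ℝ) * 2 ^ lam / 2 ^ p)).card

theorem logNear_nonneg {U : Finset (Cube d)} {e : Cube d} (lam p : ℕ) :
    0 ≤ logNear U e lam p := Real.log_natCast_nonneg _

theorem logNear_le {U : Finset (Cube d)} {e : Cube d} (he : e ∈ U) (lam p : ℕ) :
    logNear U e lam p ≤ Real.log U.card := by
  have h1 : e ∈ nearby U e ((d : ℝ) * 2 ^ lam / 2 ^ p) :=
    Finset.mem_filter.2 ⟨he, by rw [hammingDist_self]; simp; positivity⟩
  have h2 : (nearby U e ((d : ℝ) * 2 ^ lam / 2 ^ p)).card ≤ U.card := Finset.card_filter_le _ _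
  refine Real.log_le_log ?_ (by exact_mod_cast h2)
  exact_mod_cast Finset.card_pos.2 ⟨e, h1⟩

theorem logNear_antitone {U : Finset (Cube d)} {e : Cube d} (he : e ∈ U) (lam : ℕ) {p p' : ℕ}
    (h : p ≤ p') : logNear U e lam p' ≤ logNear U e lam p := by
  have h1 : e ∈ nearby U e ((d : ℝ) * 2 ^ lam / 2 ^ p') :=
    Finset.mem_filter.2 ⟨he, by rw [hammingDist_self]; simp; positivity⟩
  have h0 : (d : ℝ) * 2 ^ lam / 2 ^ p' ≤ (d : ℝ) * 2 ^ lam / 2 ^ p := by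
    gcongr
    norm_num
  have h2 : nearby U e ((d : ℝ) * 2 ^ lam / 2 ^ p') ⊆ nearby U e ((d : ℝ) * 2 ^ lam / 2 ^ p) :=
    fun c hc => Finset.mem_filter.2 ⟨(Finset.mem_filter.1 hc).1,
      (Finset.mem_filter.1 hc).2.trans h0⟩
  refine Real.log_le_log ?_ (by exact_mod_cast Finset.card_le_card h2)
  exact_mod_cast Finset.card_pos.2 ⟨e, h1⟩

/-- Telescoping with a shift of `k`: only the first `k` values remain with a positive sign. -/
theorem sum_sub_shift_le {g : ℕ → ℝ} {M : ℝ} (h0 : ∀ i, 0 ≤ g i) (hM : ∀ i, g i ≤ M) (k n : ℕ) :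
    ∑ p ∈ Finset.range n, (g p - g (p + k)) ≤ k * M := by
  have h1 : ∑ p ∈ Finset.range n, g p + ∑ p ∈ Finset.range k, g (n + p) =
      ∑ p ∈ Finset.range k, g p + ∑ p ∈ Finset.range n, g (k + p) := by
    rw [← Finset.sum_range_add, ← Finset.sum_range_add, add_comm]
  have h2 : 0 ≤ ∑ p ∈ Finset.range k, g (n + p) := Finset.sum_nonneg fun _ _ => h0 _
  have h3 : ∑ p ∈ Finset.range k, g p ≤ k * M := by
    refine (Finset.sum_le_card_nsmul _ _ M fun p _ => hM p).trans (le_of_eq ?_)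
    rw [Finset.card_range, nsmul_eq_mul]
  rw [Finset.sum_sub_distrib]
  simp only [add_comm _ k]
  linarith

/-- The bound for the mean distance in the cell at depth `p`, in units of `d / 2^p`. -/
def cellBound (W : Finset (Cube d)) (e : Cube d) (q : Fin d) (lam p : ℕ) : ℝ :=
  4 * ((logNear W e lam p - logNear W e lam (p + 2 * lam)) +
    (logNear (W.filter fun c => c q = e q) e lam p -
      logNear (W.filter fun c => c q = e q) e lam (p + 2 * lam))) + 22

theorem cellBound_ge {e : Cube d} (he : e ∈ W) (q : Fin d) (lam p : ℕ) :
    22 ≤ cellBound W e q lam p := by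
  have h1 := logNear_antitone he lam (show p ≤ p + 2 * lam by omega)
  have h2 := logNear_antitone (U := W.filter fun c => c q = e q) (e := e)
    (Finset.mem_filter.2 ⟨he, rfl⟩) lam (show p ≤ p + 2 * lam by omega)
  unfold cellBound
  linarith

/-- With `Λ = 2^lam`, the ball of radius `r / Λ` at one level is the ball of radius `Λ r` taken `2
lam` levels deeper. So both differences of logarithms telescope, each with total at most `2 lam log
|W|`. -/
theorem sum_cellBound_le {e : Cube d} (he : e ∈ W) (q : Fin d) (lam n i : ℕ) :
    ∑ p ∈ Finset.range n, cellBound W e q lam (p + i) ≤ 16 * lam * Real.log W.card + 22 * n := by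
  have hWq : e ∈ W.filter fun c => c q = e q := Finset.mem_filter.2 ⟨he, rfl⟩
  have hlog : Real.log (W.filter fun c => c q = e q).card ≤ Real.log W.card := by
    refine Real.log_le_log (by exact_mod_cast Finset.card_pos.2 ⟨e, hWq⟩) ?_
    exact_mod_cast Finset.card_filter_le _ _
  have h1 := sum_sub_shift_le (g := fun p => logNear W e lam (p + i))
    (fun p => logNear_nonneg lam _) (fun p => logNear_le he lam _) (2 * lam) n
  have h2 := sum_sub_shift_le (g := fun p => logNear (W.filter fun c => c q = e q) e lam (p + i))
    (fun p => logNear_nonneg lam _) (fun p => (logNear_le hWq lam _).trans hlog) (2 * lam) n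
  simp only [cellBound, Finset.sum_add_distrib, ← Finset.mul_sum, Finset.sum_const,
    Finset.card_range, nsmul_eq_mul]
  simp only [add_right_comm _ (2 * lam) i] at h1 h2
  push_cast at h1 h2
  linarith

end

/-! ### Expected mean distances in the cells of the tree. -/

section

variable {L d : ℕ} [NeZero d] {W : Finset (Cube d)} {ξ : ℝ}

/-- If the slot `t` is not among those that define the cell, it is independent of the cell. If it
is, then on the event that it holds `q` the cell consists of the elements with the same bit `q` as
`e` that agree with `e` on the remaining slots. This accounts for the second pair of logarithms in
`cellBound`. -/
theorem integral_slot_cell_le (t : Slot L) (q : Fin d) {e : Cube d} (he : e ∈ W) {lam p : ℕ}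
    (hp : p ≤ L) (hlog : 4 * Real.log W.card ≤ 2 ^ lam) :
    ∫ j, (if j t.1 t.2 = q then avgTo (cell j W e p) e else 0) ∂(coordLaw L d) ≤
      1 / d * (d / 2 ^ p * cellBound W e q lam p) := by
  have hd := dim_pos d
  have hΛ : (1 : ℝ) ≤ 2 ^ lam := one_le_pow₀ (by norm_num)
  have hWq : e ∈ W.filter fun c => c q = e q := Finset.mem_filter.2 ⟨he, rfl⟩
  have hlogq : 4 * Real.log (W.filter fun c => c q = e q).card ≤ 2 ^ lam := by
    refine le_trans ?_ hlog
    gcongr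
    · exact_mod_cast Finset.card_pos.2 ⟨e, hWq⟩
    · exact Finset.filter_subset _ _
  have r1 : (2 : ℝ) ^ lam * (d / 2 ^ p) = d * 2 ^ lam / 2 ^ p := by ring
  have r2 : (d : ℝ) / 2 ^ p / 2 ^ lam = d * 2 ^ lam / 2 ^ (p + 2 * lam) := by
    rw [pow_add, two_mul, pow_add]
    field_simp
  have a1 := logNear_antitone he lam (show p ≤ p + 2 * lam by omega)
  have a2 := logNear_antitone hWq lam (show p ≤ p + 2 * lam by omega)
  -- For `p ≤ 1` the trivial bound `d` suffices, as `22 d / 2^p ≥ d`. For `p ≥ 2`, even after the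
  -- removal of one slot there remain `2^p - 2 ≥ 2^p / 2`, as `integral_slot_avgTo_le` requires.
  rcases le_or_gt p 1 with hp1 | hp1
  · have h1 : ∫ j, (if j t.1 t.2 = q then avgTo (cell j W e p) e else 0) ∂(coordLaw L d) ≤
        ∫ j, (d : ℝ) * (if j t.1 t.2 = q then 1 else 0) ∂(coordLaw L d) := by
      refine integral_mono Integrable.of_finite Integrable.of_finite fun j => ?_
      dsimp only
      split_ifs
      · rw [mul_one]
        exact avgTo_le_of_forall hd.le fun c _ => hammingDist_le_dim c e
      · simp
    rw [integral_const_mul, integral_ite_eq_real, slot_real] at h1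
    refine h1.trans ?_
    have h2 : (2 : ℝ) ^ p ≤ 2 := by
      calc (2 : ℝ) ^ p ≤ 2 ^ 1 := pow_le_pow_right₀ (by norm_num) hp1
        _ = 2 := pow_one 2
    have h3 := cellBound_ge (W := W) he q lam p
    have h4 : (d : ℝ) ≤ d / 2 ^ p * cellBound W e q lam p := by
      rw [div_mul_eq_mul_div, le_div_iff₀ (by positivity)]
      nlinarith
    rw [mul_comm]
    gcongr
  · have h4 : (4 : ℝ) ≤ 2 ^ p := by
      calc (4 : ℝ) = 2 ^ 2 := by norm_num
        _ ≤ 2 ^ p := pow_le_pow_right₀ (by norm_num) hp1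
    have hcard : ((slotsBelow L p).card : ℝ) + 1 = 2 ^ p := by exact_mod_cast slotsBelow_card hp
    by_cases ht : t ∈ slotsBelow L p
    · have hcard' : (((slotsBelow L p).erase t).card : ℝ) + 1 = (slotsBelow L p).card := by
        exact_mod_cast Finset.card_erase_add_one ht
      have key := integral_slot_avgTo_le (Finset.notMem_erase t (slotsBelow L p)) q hWq
        (r := (d : ℝ) / 2 ^ p) (by positivity) hΛ hlogq
        (by rw [mul_div_assoc', div_le_iff₀ (by positivity)]; nlinarith)
        (by rw [mul_div_assoc', div_mul_eq_mul_div, le_div_iff₀ (by positivity)]; nlinarith)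
      rw [r1, r2] at key
      have e1 : ∀ j : Coords L d, (if j t.1 t.2 = q then avgTo (cell j W e p) e else 0) =
          if j t.1 t.2 = q then avgTo (agreeing j ((slotsBelow L p).erase t)
            (W.filter fun c => c q = e q) e) e else 0 := by
        intro j
        split_ifs with hq
        · congr 1
          rw [cell_eq_agreeing j W e hp]
          ext c
          simp only [agreeing, Finset.mem_filter, Finset.mem_erase]
          constructor
          · rintro ⟨h1, h2⟩
            exact ⟨⟨h1, hq ▸ h2 t ht⟩, fun t' h' => h2 t' h'.2⟩
          · rintro ⟨⟨h1, h2⟩, h3⟩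
            refine ⟨h1, fun t' h' => ?_⟩
            by_cases htt : t' = t
            · subst htt; rw [hq]; exact h2
            · exact h3 t' ⟨htt, h'⟩
        · rfl
      simp only [e1]
      refine key.trans ?_
      unfold cellBound
      unfold logNear at *
      gcongr
      linarith
    · have key := integral_slot_avgTo_le ht q he (r := (d : ℝ) / 2 ^ p) (by positivity) hΛ hlog
        (by rw [mul_div_assoc', div_le_iff₀ (by positivity)]; nlinarith)
        (by rw [mul_div_assoc', div_mul_eq_mul_div, le_div_iff₀ (by positivity)]; nlinarith)
      rw [r1, r2] at key
      simp only [cell_eq_agreeing _ W e hp]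
      refine key.trans ?_
      unfold cellBound
      unfold logNear at *
      gcongr
      linarith

end

/-! ### One level of the tree distance, seen from a nearby sampled element. -/

section

variable {L d : ℕ} {W : Finset (Cube d)} {ξ : ℝ}

theorem mem_diffSet {a b : Cube d} {q : Fin d} : q ∈ diffSet a b ↔ a q ≠ b q := by
  simp [diffSet]

/-- Two of the slots below level `p` hold coordinates in `A` and in `B`. -/
def twoHits (L p : ℕ) (A B : Finset (Fin d)) : Set (Coords L d) :=
  {j | ∃ t ∈ slotsBelow L p, ∃ t' ∈ slotsBelow L p, t ≠ t' ∧ j t.1 t.2 ∈ A ∧ j t'.1 t'.2 ∈ B}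

/-- The contribution of level `ℓ` to the distance of `a` and `b` in the tree. -/
def levelDist (j : Coords L d) (W : Finset (Cube d)) (ξ : ℝ) (a b : Cube d) (ℓ : ℕ) : ℝ :=
  if nodeAt j a (ℓ + 1) = nodeAt j b (ℓ + 1) then 0 else pathWeight j W ξ a ℓ + pathWeight j W ξ b ℓ

/-- The mean distances that bound the weights of the edges above and below the depth-`ℓ` node on
the path of `e`. -/
def twoCells (j : Coords L d) (W : Finset (Cube d)) (e : Cube d) (ℓ : ℕ) : ℝ :=
  avgTo (cell j W e ℓ) e + avgTo (cell j W e (ℓ + 1)) e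

theorem twoCells_nonneg (j : Coords L d) (W : Finset (Cube d)) (e : Cube d) (ℓ : ℕ) :
    0 ≤ twoCells j W e ℓ := add_nonneg (avgTo_nonneg _ _) (avgTo_nonneg _ _)

/-- Suppose `a` and `b` are separated by depth `ℓ + 1`. Either two slots hit differences, one
between `a` and `b` and another between `a` and `b` or `a` and `c`, and the controlled weights are
paid. Or a single slot, holding `q`, separates them and all other slots see `a`, `b`, `c` agree.
Then `c` with bit `q` taken from `a` lies in the cell of `a`, likewise for `b`, and both elements
belong to `W`. -/
theorem levelDist_le_near {j : Coords L d} (hC : Controlled j W ξ) (hξ : 0 ≤ ξ) {a b c : Cube d}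
    (hc : ∀ q v, Function.update c q v ∈ W) {ℓ : ℕ} (hℓ : ℓ + 1 ≤ L) :
    levelDist j W ξ a b ℓ ≤ 2 * (d / 2 ^ ℓ * ξ) *
        (twoHits L (ℓ + 1) (diffSet a b) (diffSet a b ∪ diffSet a c)).indicator 1 j +
      ∑ t ∈ slotsBelow L (ℓ + 1), ∑ q ∈ diffSet a b, if j t.1 t.2 = q then
        twoCells j W (Function.update c q (a q)) ℓ + twoCells j W (Function.update c q (b q)) ℓ
        else 0 := by
  have hpos : ∀ t : Slot L, ∀ q, (0 : ℝ) ≤ if j t.1 t.2 = q then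
      twoCells j W (Function.update c q (a q)) ℓ + twoCells j W (Function.update c q (b q)) ℓ
      else 0 := fun t q => by
    split_ifs
    · exact add_nonneg (twoCells_nonneg _ _ _ _) (twoCells_nonneg _ _ _ _)
    · exact le_rfl
  have hsum : 0 ≤ ∑ t ∈ slotsBelow L (ℓ + 1), ∑ q ∈ diffSet a b, if j t.1 t.2 = q then
      twoCells j W (Function.update c q (a q)) ℓ + twoCells j W (Function.update c q (b q)) ℓ
      else 0 := Finset.sum_nonneg fun t _ => Finset.sum_nonneg fun q _ => hpos t q
  have hr : 0 ≤ (d : ℝ) / 2 ^ ℓ * ξ := by positivity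
  rw [levelDist]
  split_ifs with heq
  · refine add_nonneg (mul_nonneg (by positivity) ?_) hsum
    exact Set.indicator_nonneg (fun _ _ => zero_le_one) _
  by_cases h2 : j ∈ twoHits L (ℓ + 1) (diffSet a b) (diffSet a b ∪ diffSet a c)
  · rw [Set.indicator_of_mem h2, Pi.one_apply, mul_one]
    have h3 := pathWeight_le_of_controlled hC hξ a (show ℓ ≤ L by omega)
    have h4 := pathWeight_le_of_controlled hC hξ b (show ℓ ≤ L by omega)
    linarith
  · rw [Set.indicator_of_notMem h2, mul_zero, zero_add]
    rw [nodeAt_eq_iff_forall_slot hℓ] at heq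
    push Not at heq
    obtain ⟨t, ht, hab⟩ := heq
    have hother : ∀ t' : Slot L, (t'.1 : ℕ) < ℓ + 1 → t' ≠ t →
        a (j t'.1 t'.2) = b (j t'.1 t'.2) ∧ a (j t'.1 t'.2) = c (j t'.1 t'.2) := by
      intro t' ht' hne
      by_contra hcon
      refine h2 ⟨t, mem_slotsBelow.2 ht, t', mem_slotsBelow.2 ht', hne.symm,
        Finset.mem_filter.2 ⟨Finset.mem_univ _, hab⟩, ?_⟩
      rw [Finset.mem_union]
      by_cases h5 : a (j t'.1 t'.2) = b (j t'.1 t'.2)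
      · exact Or.inr (Finset.mem_filter.2 ⟨Finset.mem_univ _, fun h6 => hcon ⟨h5, h6⟩⟩)
      · exact Or.inl (Finset.mem_filter.2 ⟨Finset.mem_univ _, h5⟩)
    set q := j t.1 t.2 with hq
    -- Other slots may hold the same coordinate `q`; the changed bit is correct there too.
    have hA : nodeAt j (Function.update c q (a q)) (ℓ + 1) = nodeAt j a (ℓ + 1) := by
      rw [nodeAt_eq_iff_forall_slot hℓ]
      intro t' ht'
      by_cases hqq : j t'.1 t'.2 = q
      · rw [hqq, Function.update_self]
      · rw [Function.update_of_ne hqq]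
        exact ((hother t' ht' (by rintro rfl; exact hqq hq.symm)).2).symm
    have hB : nodeAt j (Function.update c q (b q)) (ℓ + 1) = nodeAt j b (ℓ + 1) := by
      rw [nodeAt_eq_iff_forall_slot hℓ]
      intro t' ht'
      by_cases hqq : j t'.1 t'.2 = q
      · rw [hqq, Function.update_self]
      · rw [Function.update_of_ne hqq]
        have := hother t' ht' (by rintro rfl; exact hqq hq.symm)
        exact this.2.symm.trans this.1
    have h3 := pathWeight_le_avgTo (ξ := ξ) (hc q (a q)) hA
    have h4 := pathWeight_le_avgTo (ξ := ξ) (hc q (b q)) hB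
    refine (add_le_add h3 h4).trans ?_
    have h5 := Finset.single_le_sum (f := fun t : Slot L => ∑ q ∈ diffSet a b,
      if j t.1 t.2 = q then twoCells j W (Function.update c q (a q)) ℓ +
        twoCells j W (Function.update c q (b q)) ℓ else 0)
      (fun t _ => Finset.sum_nonneg fun q _ => hpos t q) (mem_slotsBelow.2 ht)
    refine le_trans ?_ h5
    have h6 := Finset.single_le_sum (f := fun q' => if j t.1 t.2 = q' then
      twoCells j W (Function.update c q' (a q')) ℓ +
        twoCells j W (Function.update c q' (b q')) ℓ else 0)
      (fun q' _ => hpos t q') (show q ∈ diffSet a b from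
        Finset.mem_filter.2 ⟨Finset.mem_univ _, hab⟩)
    refine le_trans (le_of_eq ?_) h6
    rw [if_pos hq.symm]
    rfl

end

/-! ### Expected contributions of the levels. -/

section

variable {L d : ℕ} [NeZero d] {W : Finset (Cube d)} {ξ : ℝ}

theorem slot_mem_real (t : Slot L) (A : Finset (Fin d)) :
    (coordLaw L d).real {j | j t.1 t.2 ∈ A} = A.card / d := by
  have := coordLaw_forall_mem (d := d) {t} A
  simpa using this

theorem slot_pair_real_le {t t' : Slot L} (h : t ≠ t') (A B : Finset (Fin d)) :
    (coordLaw L d).real {j | j t.1 t.2 ∈ A ∧ j t'.1 t'.2 ∈ B} ≤ A.card / d * (B.card / d) := by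
  have hsub : {j : Coords L d | j t.1 t.2 ∈ A ∧ j t'.1 t'.2 ∈ B} ⊆
      ⋃ q ∈ A, {j | j t.1 t.2 = q ∧ ∀ t'' ∈ ({t'} : Finset (Slot L)), j t''.1 t''.2 ∈ B} := by
    rintro j ⟨h1, h2⟩
    simp only [Set.mem_iUnion]
    exact ⟨_, h1, rfl, by simpa using h2⟩
  refine (measureReal_mono hsub (measure_ne_top _ _)).trans
    ((measureReal_biUnion_finset_le _ _).trans (le_of_eq ?_))
  simp only [coordLaw_slot_and_forall_mem {t'} B (t := t) (by simpa using h), Finset.sum_const,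
    Finset.card_singleton, pow_one, nsmul_eq_mul]
  ring

theorem slotsBelow_card_le {p : ℕ} (hp : p ≤ L) : ((slotsBelow L p).card : ℝ) ≤ 2 ^ p := by
  have : ((slotsBelow L p).card : ℝ) + 1 = 2 ^ p := by exact_mod_cast slotsBelow_card hp
  linarith

theorem nodeAt_ne_real_le (a b : Cube d) {p : ℕ} (hp : p ≤ L) :
    (coordLaw L d).real {j | nodeAt j a p ≠ nodeAt j b p} ≤ 2 ^ p * (hammingDist a b / d) := by
  have hsub : {j : Coords L d | nodeAt j a p ≠ nodeAt j b p} ⊆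
      ⋃ t ∈ slotsBelow L p, {j | j t.1 t.2 ∈ diffSet a b} := by
    intro j hj
    simp only [Set.mem_ofPred_eq, ne_eq, nodeAt_eq_iff_forall_slot hp] at hj
    push Not at hj
    obtain ⟨t, h1, h2⟩ := hj
    simp only [Set.mem_iUnion]
    exact ⟨t, mem_slotsBelow.2 h1, mem_diffSet.2 h2⟩
  refine (measureReal_mono hsub (measure_ne_top _ _)).trans
    ((measureReal_biUnion_finset_le _ _).trans ?_)
  simp only [slot_mem_real, diffSet_card, Finset.sum_const, nsmul_eq_mul]
  gcongr
  exact slotsBelow_card_le hp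

/-- A union bound over the at most `4^p` ordered pairs of slots; different slots are independent. -/
theorem twoHits_real_le {p : ℕ} (hp : p ≤ L) (A B : Finset (Fin d)) :
    (coordLaw L d).real (twoHits L p A B) ≤ 4 ^ p * (A.card / d * (B.card / d)) := by
  have hsub : twoHits L p A B ⊆ ⋃ q ∈ (slotsBelow L p ×ˢ slotsBelow L p).filter fun q => q.1 ≠ q.2,
      {j | j q.1.1 q.1.2 ∈ A ∧ j q.2.1 q.2.2 ∈ B} := by
    rintro j ⟨t, h1, t', h2, h3, h4⟩
    simp only [Set.mem_iUnion]
    exact ⟨(t, t'), Finset.mem_filter.2 ⟨Finset.mem_product.2 ⟨h1, h2⟩, h3⟩, h4⟩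
  refine (measureReal_mono hsub (measure_ne_top _ _)).trans
    ((measureReal_biUnion_finset_le _ _).trans ?_)
  refine (Finset.sum_le_card_nsmul _ _ ((A.card : ℝ) / d * (B.card / d)) fun q hq =>
    slot_pair_real_le (Finset.mem_filter.1 hq).2 A B).trans ?_
  rw [nsmul_eq_mul]
  gcongr
  calc ((((slotsBelow L p ×ˢ slotsBelow L p).filter fun q => q.1 ≠ q.2).card : ℕ) : ℝ)
      ≤ ((slotsBelow L p ×ˢ slotsBelow L p).card : ℝ) := by
        exact_mod_cast Finset.card_filter_le _ _
    _ = ((slotsBelow L p).card : ℝ) * (slotsBelow L p).card := by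
        rw [Finset.card_product]; push_cast; ring
    _ ≤ 2 ^ p * 2 ^ p := by
        have := slotsBelow_card_le hp
        gcongr
    _ = 4 ^ p := by rw [← mul_pow]; norm_num

/-- The bound for the contribution of one coordinate `q` to the level `ℓ`. -/
def nearBound (W : Finset (Cube d)) (a b c : Cube d) (lam ℓ : ℕ) (q : Fin d) : ℝ :=
  2 * cellBound W (Function.update c q (a q)) q lam ℓ +
    cellBound W (Function.update c q (a q)) q lam (ℓ + 1) +
    (2 * cellBound W (Function.update c q (b q)) q lam ℓ +
      cellBound W (Function.update c q (b q)) q lam (ℓ + 1))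

theorem integral_slot_twoCells_le (t : Slot L) (q : Fin d) {e : Cube d} (he : e ∈ W) {lam ℓ : ℕ}
    (hℓ : ℓ + 1 ≤ L) (hlog : 4 * Real.log W.card ≤ 2 ^ lam) :
    2 ^ (ℓ + 1) * ∫ j, (if j t.1 t.2 = q then twoCells j W e ℓ else 0) ∂(coordLaw L d) ≤
      2 * cellBound W e q lam ℓ + cellBound W e q lam (ℓ + 1) := by
  have hd := dim_pos d
  have e1 : ∀ j : Coords L d, (if j t.1 t.2 = q then twoCells j W e ℓ else 0) =
      (if j t.1 t.2 = q then avgTo (cell j W e ℓ) e else 0) +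
        if j t.1 t.2 = q then avgTo (cell j W e (ℓ + 1)) e else 0 := by
    intro j
    split_ifs
    · rfl
    · simp
  simp only [e1]
  rw [integral_add Integrable.of_finite Integrable.of_finite]
  have h1 := integral_slot_cell_le (lam := lam) t q he (show ℓ ≤ L by omega) hlog
  have h2 := integral_slot_cell_le (lam := lam) t q he hℓ hlog
  refine (mul_le_mul_of_nonneg_left (add_le_add h1 h2) (by positivity)).trans (le_of_eq ?_)
  rw [pow_succ]
  field_simp

/-- Meant for the coarse levels. The first term is the weight `2 ξ d / 2^ℓ` times the probability of
two hits, which is quadratic in `2^ℓ / d`. The second sums over fewer than `2^(ℓ+1)` slots and over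
the coordinate held, each of probability `1 / d`, the expected mean distances in the cells. -/
theorem integral_levelDist_near_le (hξ : 0 ≤ ξ) {a b c : Cube d}
    (hc : ∀ q v, Function.update c q v ∈ W) {ℓ lam : ℕ} (hℓ : ℓ + 1 ≤ L)
    (hlog : 4 * Real.log W.card ≤ 2 ^ lam) :
    ∫ j, {j : Coords L d | Controlled j W ξ}.indicator (fun j => levelDist j W ξ a b ℓ) j
      ∂(coordLaw L d) ≤
      8 * ξ * hammingDist a b * (hammingDist a b + hammingDist a c) * (2 ^ ℓ / d) +
        ∑ q ∈ diffSet a b, nearBound W a b c lam ℓ q := by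
  have hd := dim_pos d
  have hpt : ∀ j : Coords L d,
      {j : Coords L d | Controlled j W ξ}.indicator (fun j => levelDist j W ξ a b ℓ) j ≤
      2 * (d / 2 ^ ℓ * ξ) *
        (twoHits L (ℓ + 1) (diffSet a b) (diffSet a b ∪ diffSet a c)).indicator 1 j +
      ∑ t ∈ slotsBelow L (ℓ + 1), ∑ q ∈ diffSet a b,
        ((if j t.1 t.2 = q then twoCells j W (Function.update c q (a q)) ℓ else 0) +
        if j t.1 t.2 = q then twoCells j W (Function.update c q (b q)) ℓ else 0) := by
    intro j
    have hs : ∀ t : Slot L, ∀ q,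
        ((if j t.1 t.2 = q then twoCells j W (Function.update c q (a q)) ℓ else 0) +
        if j t.1 t.2 = q then twoCells j W (Function.update c q (b q)) ℓ else 0) =
        if j t.1 t.2 = q then twoCells j W (Function.update c q (a q)) ℓ +
          twoCells j W (Function.update c q (b q)) ℓ else 0 := by
      intro t q
      split_ifs
      · rfl
      · simp
    simp only [hs]
    by_cases hC : Controlled j W ξ
    · rw [Set.indicator_of_mem (by simpa using hC)]
      exact levelDist_le_near hC hξ hc hℓ
    · rw [Set.indicator_of_notMem (by simpa using hC)]
      refine add_nonneg (mul_nonneg (by positivity) (Set.indicator_nonneg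
        (fun _ _ => zero_le_one) _)) (Finset.sum_nonneg fun t _ => Finset.sum_nonneg fun q _ => ?_)
      split_ifs
      · exact add_nonneg (twoCells_nonneg _ _ _ _) (twoCells_nonneg _ _ _ _)
      · exact le_rfl
  refine (integral_mono Integrable.of_finite Integrable.of_finite hpt).trans ?_
  rw [integral_add Integrable.of_finite Integrable.of_finite, integral_const_mul,
    integral_indicator_one (Set.toFinite _).measurableSet,
    integral_finsetSum _ fun _ _ => Integrable.of_finite]
  refine add_le_add ?_ ?_
  · refine (mul_le_mul_of_nonneg_left (twoHits_real_le hℓ _ _) (by positivity)).trans ?_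
    have h1 : ((diffSet a b ∪ diffSet a c).card : ℝ) ≤ hammingDist a b + hammingDist a c := by
      exact_mod_cast Finset.card_union_le (diffSet a b) (diffSet a c)
    rw [diffSet_card]
    calc 2 * (d / 2 ^ ℓ * ξ) * (4 ^ (ℓ + 1) * ((hammingDist a b : ℝ) / d *
          ((diffSet a b ∪ diffSet a c).card / d)))
        ≤ 2 * (d / 2 ^ ℓ * ξ) * (4 ^ (ℓ + 1) * ((hammingDist a b : ℝ) / d *
          ((hammingDist a b + hammingDist a c) / d))) := by gcongr
      _ = _ := by
        have : (4 : ℝ) ^ ℓ = 2 ^ ℓ * 2 ^ ℓ := by rw [← mul_pow]; norm_num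
        rw [pow_succ, this]
        field_simp
        ring
  · have hT : ∀ t ∈ slotsBelow L (ℓ + 1), 2 ^ (ℓ + 1) * ∫ j, (∑ q ∈ diffSet a b,
        ((if j t.1 t.2 = q then twoCells j W (Function.update c q (a q)) ℓ else 0) +
        if j t.1 t.2 = q then twoCells j W (Function.update c q (b q)) ℓ else 0)) ∂(coordLaw L d) ≤
        ∑ q ∈ diffSet a b, nearBound W a b c lam ℓ q := by
      intro t _
      rw [integral_finsetSum _ fun _ _ => Integrable.of_finite, Finset.mul_sum]
      refine Finset.sum_le_sum fun q _ => ?_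
      rw [integral_add Integrable.of_finite Integrable.of_finite, mul_add]
      exact add_le_add (integral_slot_twoCells_le t q (hc _ _) hℓ hlog)
        (integral_slot_twoCells_le t q (hc _ _) hℓ hlog)
    have hB : 0 ≤ ∑ q ∈ diffSet a b, nearBound W a b c lam ℓ q := by
      refine Finset.sum_nonneg fun q _ => ?_
      have h1 := cellBound_ge (hc q (a q)) q lam ℓ
      have h2 := cellBound_ge (hc q (a q)) q lam (ℓ + 1)
      have h3 := cellBound_ge (hc q (b q)) q lam ℓ
      have h4 := cellBound_ge (hc q (b q)) q lam (ℓ + 1)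
      unfold nearBound
      linarith
    have hp : (0 : ℝ) < 2 ^ (ℓ + 1) := by positivity
    refine (Finset.sum_le_card_nsmul _ _ ((∑ q ∈ diffSet a b, nearBound W a b c lam ℓ q) /
      2 ^ (ℓ + 1)) fun t ht => ?_).trans ?_
    · rw [le_div_iff₀ hp, mul_comm]
      exact hT t ht
    · rw [nsmul_eq_mul, mul_div_assoc', div_le_iff₀ hp, mul_comm]
      exact mul_le_mul_of_nonneg_left (slotsBelow_card_le hℓ) hB

theorem integral_levelDist_le (hξ : 0 ≤ ξ) (a b : Cube d) {ℓ : ℕ} (hℓ : ℓ ≤ L) :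
    ∫ j, {j : Coords L d | Controlled j W ξ}.indicator (fun j => levelDist j W ξ a b ℓ) j
      ∂(coordLaw L d) ≤ 2 * ξ * (d / 2 ^ ℓ) := by
  have hd := dim_pos d
  refine integral_le_of_forall_le _ fun j => ?_
  by_cases hC : Controlled j W ξ
  · rw [Set.indicator_of_mem (by simpa using hC), levelDist]
    split_ifs
    · positivity
    · linarith [pathWeight_le_of_controlled hC hξ a hℓ, pathWeight_le_of_controlled hC hξ b hℓ]
  · rw [Set.indicator_of_notMem (by simpa using hC)]
    positivity

/-- Meant for the middle levels: the separation probability, at most `2^(ℓ+1) D / d`, cancels the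
scale `d / 2^ℓ` of the weights. -/
theorem integral_levelDist_le_mul (hξ : 0 ≤ ξ) (a b : Cube d) {ℓ : ℕ} (hℓ : ℓ + 1 ≤ L) :
    ∫ j, {j : Coords L d | Controlled j W ξ}.indicator (fun j => levelDist j W ξ a b ℓ) j
      ∂(coordLaw L d) ≤ 4 * ξ * hammingDist a b := by
  have hd := dim_pos d
  have hpt : ∀ j : Coords L d,
      {j : Coords L d | Controlled j W ξ}.indicator (fun j => levelDist j W ξ a b ℓ) j ≤
      2 * ξ * (d / 2 ^ ℓ) *
        {j : Coords L d | nodeAt j a (ℓ + 1) ≠ nodeAt j b (ℓ + 1)}.indicator 1 j := by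
    intro j
    by_cases hC : Controlled j W ξ
    · rw [Set.indicator_of_mem (by simpa using hC), levelDist]
      split_ifs with h
      · rw [Set.indicator_of_notMem (by simpa using h)]
        simp
      · rw [Set.indicator_of_mem (by simpa using h)]
        simp only [Pi.one_apply, mul_one]
        linarith [pathWeight_le_of_controlled hC hξ a (show ℓ ≤ L by omega),
          pathWeight_le_of_controlled hC hξ b (show ℓ ≤ L by omega)]
    · rw [Set.indicator_of_notMem (by simpa using hC)]
      exact mul_nonneg (by positivity) (Set.indicator_nonneg (fun _ _ => zero_le_one) _)
  refine (integral_mono Integrable.of_finite Integrable.of_finite hpt).trans ?_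
  rw [integral_const_mul, integral_indicator_one (Set.toFinite _).measurableSet]
  refine (mul_le_mul_of_nonneg_left (nodeAt_ne_real_le a b hℓ) (by positivity)).trans (le_of_eq ?_)
  rw [pow_succ]
  field_simp
  ring

end

/-! ### Sums over the levels -/

theorem div_two_pow_succ (x : ℝ) (ℓ : ℕ) : x / 2 ^ (ℓ + 1) = x / 2 / 2 ^ ℓ := by
  rw [pow_succ', div_div]

theorem sum_fine_levels_le {D : ℝ} (hD : 0 ≤ D) (n : ℕ) {x : ℝ} (hx : 0 ≤ x) :
    ∑ ℓ ∈ Finset.range n, (if x / 2 ^ ℓ ≤ D then x / 2 ^ ℓ else 0) ≤ 2 * min x D := by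
  induction n generalizing x with
  | zero => simp [hx, hD]
  | succ n ih =>
    rw [Finset.sum_range_succ']
    simp only [div_two_pow_succ, pow_zero, div_one]
    have := ih (x := x / 2) (by linarith)
    split_ifs with h
    · rw [min_eq_left h]
      linarith [min_le_left (x / 2) D]
    · rw [min_eq_right (not_le.1 h).le]
      linarith [min_le_right (x / 2) D]

/-- A geometric sum dominated by its last term. The correction `- 1 / x` strengthens the claim so
that the induction, which halves `x`, closes. -/
theorem sum_coarse_levels_le {E : ℝ} (hE : 0 < E) (n : ℕ) {x : ℝ} (hx : 0 < x) :
    ∑ ℓ ∈ Finset.range n, (if E < x / 2 ^ ℓ then 2 ^ ℓ / x else 0) ≤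
      if E < x then 2 / E - 1 / x else 0 := by
  induction n generalizing x with
  | zero =>
    rw [Finset.range_zero, Finset.sum_empty]
    split_ifs with h
    · have := one_div_le_one_div_of_le hE h.le
      have := one_div_pos.2 hE
      have e : 2 / E = 2 * (1 / E) := by ring
      linarith
    · exact le_rfl
  | succ n ih =>
    rw [Finset.sum_range_succ']
    have e : ∀ ℓ : ℕ, (2 : ℝ) ^ (ℓ + 1) / x = 2 ^ ℓ / (x / 2) := by
      intro ℓ; rw [pow_succ]; field_simp
    simp only [div_two_pow_succ, e, pow_zero, div_one]
    have := ih (x := x / 2) (by linarith)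
    have e2 : 1 / (x / 2) = 2 * (1 / x) := by field_simp
    by_cases h : E < x
    · rw [if_pos h, if_pos h]
      by_cases h2 : E < x / 2
      · rw [if_pos h2] at this
        linarith
      · rw [if_neg h2] at this
        have h3 := one_div_le_one_div_of_le hE h.le
        have e3 : 2 / E = 2 * (1 / E) := by ring
        linarith
    · rw [if_neg h, if_neg h]
      rw [if_neg (by linarith)] at this
      linarith

/-- Halving `x` lowers the bound by `2 log 2 ≥ 1`, which pays for one level. -/
theorem sum_middle_levels_le {D M : ℝ} (hD : 0 < D) (hDM : D ≤ M) (n : ℕ) {x : ℝ} (hx : 0 < x) :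
    ∑ ℓ ∈ Finset.range n, (if D < x / 2 ^ ℓ ∧ x / 2 ^ ℓ ≤ M then (1 : ℝ) else 0) ≤
      if D < x then 1 + 2 * Real.log (min x M / D) else 0 := by
  have hmono : ∀ {u v : ℝ}, 0 < u → u ≤ v → Real.log (u / D) ≤ Real.log (v / D) :=
    fun hu huv => Real.log_le_log (by positivity) (by gcongr)
  have hlog0 : ∀ {u : ℝ}, D ≤ u → 0 ≤ Real.log (u / D) := fun hu =>
    Real.log_nonneg ((one_le_div hD).2 hu)
  induction n generalizing x with
  | zero =>
    rw [Finset.range_zero, Finset.sum_empty]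
    split_ifs with h
    · linarith [hlog0 (le_min h.le hDM)]
    · exact le_rfl
  | succ n ih =>
    rw [Finset.sum_range_succ']
    simp only [div_two_pow_succ, pow_zero, div_one]
    have := ih (x := x / 2) (by linarith)
    by_cases h : D < x
    · rw [if_pos h]
      by_cases hM : x ≤ M
      · rw [if_pos ⟨h, hM⟩, min_eq_left hM]
        by_cases h2 : D < x / 2
        · rw [if_pos h2, min_eq_left (by linarith)] at this
          have e : Real.log (x / 2 / D) = Real.log (x / D) - Real.log 2 := by
            rw [div_right_comm, Real.log_div (by positivity) (by norm_num)]
          have := Real.log_two_gt_d9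
          linarith
        · rw [if_neg h2] at this
          linarith [hlog0 h.le]
      · rw [if_neg fun hc => hM hc.2, add_zero]
        by_cases h2 : D < x / 2
        · rw [if_pos h2] at this
          have h3 := hmono (show 0 < min (x / 2) M from lt_min (by linarith) (by linarith))
            (min_le_min_right M (show x / 2 ≤ x by linarith))
          linarith
        · rw [if_neg h2] at this
          linarith [hlog0 (le_min h.le hDM)]
    · rw [if_neg h, if_neg fun hc => h hc.1]
      rw [if_neg (by linarith)] at this
      linarith

/-! ### The expected distance in the tree -/

section

variable {d : ℕ} {W : Finset (Cube d)}

theorem sum_nearBound_le {c : Cube d} (hc : ∀ q v, Function.update c q v ∈ W) (a b : Cube d)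
    (lam n : ℕ) : ∑ ℓ ∈ Finset.range n, ∑ q ∈ diffSet a b, nearBound W a b c lam ℓ q ≤
      hammingDist a b * (96 * lam * Real.log W.card + 132 * n) := by
  rw [Finset.sum_comm]
  refine (Finset.sum_le_card_nsmul _ _ (96 * lam * Real.log W.card + 132 * n) fun q _ => ?_).trans
    (le_of_eq ?_)
  · simp only [nearBound, Finset.sum_add_distrib, ← Finset.mul_sum]
    have h1 := sum_cellBound_le (hc q (a q)) q lam n 0
    have h2 := sum_cellBound_le (hc q (a q)) q lam n 1
    have h3 := sum_cellBound_le (hc q (b q)) q lam n 0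
    have h4 := sum_cellBound_le (hc q (b q)) q lam n 1
    simp only [add_zero] at h1 h3
    linarith
  · rw [nsmul_eq_mul, diffSet_card]

theorem nearBound_sum_nonneg {c : Cube d} (hc : ∀ q v, Function.update c q v ∈ W) (a b : Cube d)
    (lam ℓ : ℕ) : 0 ≤ ∑ q ∈ diffSet a b, nearBound W a b c lam ℓ q := by
  refine Finset.sum_nonneg fun q _ => ?_
  have h1 := cellBound_ge (hc q (a q)) q lam ℓ
  have h2 := cellBound_ge (hc q (a q)) q lam (ℓ + 1)
  have h3 := cellBound_ge (hc q (b q)) q lam ℓ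
  have h4 := cellBound_ge (hc q (b q)) q lam (ℓ + 1)
  unfold nearBound
  linarith

end

/-! ### The expected tree distance of two elements. -/

section

variable {L d : ℕ} [NeZero d] {W : Finset (Cube d)} {ξ : ℝ}

/-- Each level takes the best of the three bounds. With `D` and `R` the distances of `a` to `b` and
to `c`, the fine levels cost `4 ξ D`, the middle ones `4 ξ D (1 + 2 log(1 + R/D))` and two hits on
the coarse ones `16 ξ D`. The remaining terms are the telescoped logarithms and the trivial bound on
uncontrolled trees. -/
theorem integral_treeDist_le (hξ : 1 ≤ ξ) {a b c : Cube d}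
    (hc : ∀ q v, Function.update c q v ∈ W) (hdL : d ≤ 2 ^ L) (hab : a ≠ b) {lam : ℕ}
    (hlog : 4 * Real.log W.card ≤ 2 ^ lam) :
    ∫ j, treeDist j W ξ a b ∂(coordLaw L d) ≤
      (hammingDist a b : ℝ) *
        (24 * ξ + 8 * ξ * Real.log (1 + (hammingDist a c : ℝ) / (hammingDist a b : ℝ)) +
        96 * lam * Real.log W.card + 132 * L) +
      2 * (L + 1) * (d * ξ) * (coordLaw L d).real {j | ¬ Controlled j W ξ} := by
  have hd := dim_pos d
  have hξ0 : 0 ≤ ξ := by linarith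
  have hD1 : (1 : ℝ) ≤ hammingDist a b := by
    exact_mod_cast Nat.one_le_iff_ne_zero.2 (hammingDist_ne_zero.2 hab)
  set D : ℝ := ((hammingDist a b : ℕ) : ℝ) with hD
  set R : ℝ := ((hammingDist a c : ℕ) : ℝ) with hR
  have hR0 : 0 ≤ R := by positivity
  have hpt : ∀ j : Coords L d, treeDist j W ξ a b ≤
      ∑ ℓ ∈ Finset.range (L + 1),
        {j : Coords L d | Controlled j W ξ}.indicator (fun j => levelDist j W ξ a b ℓ) j +
      2 * (L + 1) * (d * ξ) * {j : Coords L d | ¬ Controlled j W ξ}.indicator 1 j := by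
    intro j
    by_cases hC : Controlled j W ξ
    · have h1 : j ∈ {j : Coords L d | Controlled j W ξ} := hC
      simp only [Set.indicator_of_mem h1]
      rw [Set.indicator_of_notMem (by simpa using hC), mul_zero, add_zero]
      exact le_rfl
    · have h1 : j ∉ {j : Coords L d | Controlled j W ξ} := hC
      simp only [Set.indicator_of_notMem h1]
      rw [Set.indicator_of_mem (by simpa using hC), Pi.one_apply, mul_one, Finset.sum_const_zero,
        zero_add]
      exact treeDist_le hξ a b
  refine (integral_mono Integrable.of_finite Integrable.of_finite hpt).trans ?_
  rw [integral_add Integrable.of_finite Integrable.of_finite, integral_const_mul,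
    integral_indicator_one (Set.toFinite _).measurableSet,
    integral_finsetSum _ fun _ _ => Integrable.of_finite]
  refine add_le_add ?_ le_rfl
  have hlevel : ∀ ℓ ∈ Finset.range (L + 1), ∫ j, {j : Coords L d | Controlled j W ξ}.indicator
      (fun j => levelDist j W ξ a b ℓ) j ∂(coordLaw L d) ≤
      2 * ξ * (if (d : ℝ) / 2 ^ ℓ ≤ D then (d : ℝ) / 2 ^ ℓ else 0) +
      4 * ξ * D * (if D < (d : ℝ) / 2 ^ ℓ ∧ (d : ℝ) / 2 ^ ℓ ≤ D + R then (1 : ℝ) else 0) +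
      8 * ξ * D * (D + R) * (if D + R < (d : ℝ) / 2 ^ ℓ then 2 ^ ℓ / (d : ℝ) else 0) +
      if ℓ < L then ∑ q ∈ diffSet a b, nearBound W a b c lam ℓ q else 0 := by
    intro ℓ hℓ
    have hℓ' : ℓ ≤ L := by have := Finset.mem_range.1 hℓ; omega
    have hn : 0 ≤ if ℓ < L then ∑ q ∈ diffSet a b, nearBound W a b c lam ℓ q else 0 := by
      split_ifs
      · exact nearBound_sum_nonneg hc a b lam ℓ
      · exact le_rfl
    by_cases h1 : (d : ℝ) / 2 ^ ℓ ≤ D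
    · rw [if_pos h1, if_neg fun h => absurd h.1 (not_lt.2 h1),
        if_neg (show ¬ D + R < (d : ℝ) / 2 ^ ℓ by linarith)]
      have := integral_levelDist_le (L := L) (W := W) hξ0 a b hℓ'
      linarith
    -- The last level is always fine, because `d / 2^L ≤ 1 ≤ D`; so the other two bounds are needed
    -- only where the labels are random projections.
    · have hlt : ℓ < L := by
        rcases Nat.lt_or_ge ℓ L with h | h
        · exact h
        · exfalso
          refine h1 (le_trans ?_ hD1)
          rw [div_le_one (by positivity)]
          have : (d : ℝ) ≤ 2 ^ L := by exact_mod_cast hdL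
          exact this.trans (pow_le_pow_right₀ (by norm_num) h)
      by_cases h2 : (d : ℝ) / 2 ^ ℓ ≤ D + R
      · rw [if_neg h1, if_pos ⟨not_le.1 h1, h2⟩, if_neg (not_lt.2 h2)]
        have := integral_levelDist_le_mul (L := L) (W := W) hξ0 a b (show ℓ + 1 ≤ L from hlt)
        linarith
      · rw [if_neg h1, if_neg fun h => h2 h.2, if_pos (not_le.1 h2), if_pos hlt]
        have := integral_levelDist_near_le (L := L) hξ0 (a := a) (b := b) hc
          (show ℓ + 1 ≤ L from hlt) hlog
        linarith
  refine (Finset.sum_le_sum hlevel).trans ?_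
  rw [Finset.sum_add_distrib, Finset.sum_add_distrib, Finset.sum_add_distrib, ← Finset.mul_sum,
    ← Finset.mul_sum, ← Finset.mul_sum]
  have s1 := sum_fine_levels_le (show 0 ≤ D by linarith) (L + 1) hd.le
  have s2 := sum_middle_levels_le (show 0 < D by linarith) (show D ≤ D + R by linarith) (L + 1) hd
  have s3 := sum_coarse_levels_le (show 0 < D + R by linarith) (L + 1) hd
  have s4 := sum_nearBound_le hc a b lam L
  have e4 : ∑ ℓ ∈ Finset.range (L + 1),
      (if ℓ < L then ∑ q ∈ diffSet a b, nearBound W a b c lam ℓ q else 0) =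
      ∑ ℓ ∈ Finset.range L, ∑ q ∈ diffSet a b, nearBound W a b c lam ℓ q := by
    rw [Finset.sum_range_succ, if_neg (lt_irrefl L), add_zero]
    exact Finset.sum_congr rfl fun ℓ hℓ => if_pos (Finset.mem_range.1 hℓ)
  rw [e4]
  have t1 : ∑ ℓ ∈ Finset.range (L + 1), (if (d : ℝ) / 2 ^ ℓ ≤ D then (d : ℝ) / 2 ^ ℓ else 0) ≤
      2 * D := s1.trans (by linarith [min_le_right (d : ℝ) D])
  have hlogR : 0 ≤ Real.log (1 + R / D) := Real.log_nonneg (by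
    have : 0 ≤ R / D := by positivity
    linarith)
  have t2 : ∑ ℓ ∈ Finset.range (L + 1),
      (if D < (d : ℝ) / 2 ^ ℓ ∧ (d : ℝ) / 2 ^ ℓ ≤ D + R then (1 : ℝ) else 0) ≤
      1 + 2 * Real.log (1 + R / D) := by
    refine s2.trans ?_
    split_ifs with h
    · have e : (D + R) / D = 1 + R / D := by field_simp
      have : Real.log (min (d : ℝ) (D + R) / D) ≤ Real.log (1 + R / D) := by
        rw [← e]
        refine Real.log_le_log (div_pos (lt_min hd (by linarith)) (by linarith)) ?_
        gcongr
        exact min_le_right _ _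
      linarith
    · linarith
  have t3 : ∑ ℓ ∈ Finset.range (L + 1),
      (if D + R < (d : ℝ) / 2 ^ ℓ then 2 ^ ℓ / (d : ℝ) else 0) ≤ 2 / (D + R) := by
    refine s3.trans ?_
    have h1 : 0 ≤ 1 / (d : ℝ) := by positivity
    have h2 : 0 ≤ 2 / (D + R) := by positivity
    split_ifs <;> linarith
  have u1 := mul_le_mul_of_nonneg_left t1 (show 0 ≤ 2 * ξ by positivity)
  have u2 := mul_le_mul_of_nonneg_left t2 (show 0 ≤ 4 * ξ * D by positivity)
  have u3 := mul_le_mul_of_nonneg_left t3 (show 0 ≤ 8 * ξ * D * (D + R) by positivity)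
  have e3 : 8 * ξ * D * (D + R) * (2 / (D + R)) = 16 * ξ * D := by
    have : D + R ≠ 0 := by linarith
    field_simp
    norm_num
  rw [e3] at u3
  linarith

end

/-! ### Local density -/

section

variable {s d : ℕ}

/-- The elements of `x` at distance more than `θ` from all elements of `u`. -/
def farFrom (x u : Point s d) (θ : ℝ) : Finset (Fin s) :=
  Finset.univ.filter fun i => ∀ k, θ < hammingDist (x i) (u k)

/-- The projection of `a` to the coordinates `i`. -/
def project {t : ℕ} (i : Fin t → Fin d) (a : Cube d) : Fin t → Bool := fun q => a (i q)

theorem card_fin_succ_le {n : ℕ} (hn : n ≤ s) :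
    (Finset.univ.filter fun k : Fin s => (k : ℕ) + 1 ≤ n).card = n := by
  have : (Finset.univ.filter fun k : Fin s => (k : ℕ) + 1 ≤ n) =
      (Finset.univ : Finset (Fin n)).map (Fin.castLEEmb hn) := by
    ext k
    simp only [Finset.mem_filter, Finset.mem_univ, true_and, Finset.mem_map]
    constructor
    · intro h; exact ⟨⟨k, by omega⟩, Fin.ext rfl⟩
    · rintro ⟨k', rfl⟩; exact k'.2
  rw [this, Finset.card_map, Finset.card_univ, Fintype.card_fin]

/-- In a bucket `w` that contains elements of `F`, the point `u` has none, so all indices `(w, k)`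
with `k` up to the number of elements of `x` in it separate `x` from `u`. -/
theorem exists_separating_cells {t : ℕ} (i : Fin t → Fin d) (x u : Point s d) (F : Finset (Fin s))
    (hF : ∀ p ∈ F, ∀ k, project i (x p) ≠ project i (u k)) :
    ∃ Z : Finset ((Fin t → Bool) × Fin s), F.card ≤ Z.card ∧
      ∀ z ∈ Z, chi i x z.1 z.2 = true ∧ chi i u z.1 z.2 = false := by
  classical
  set n : (Fin t → Bool) → ℕ := fun w => (Finset.univ.filter fun p : Fin s =>
    (fun q => x p (i q)) = w).card with hn
  have hns : ∀ w, n w ≤ s := fun w => by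
    have := Finset.card_filter_le (Finset.univ : Finset (Fin s)) fun p => (fun q => x p (i q)) = w
    rwa [Finset.card_univ, Fintype.card_fin] at this
  set I := F.image fun p => project i (x p) with hI
  refine ⟨Finset.univ.filter fun z => z.1 ∈ I ∧ (z.2 : ℕ) + 1 ≤ n z.1, ?_, ?_⟩
  · rw [Finset.card_eq_sum_card_fiberwise (f := fun p => project i (x p)) (t := I)
      (fun p hp => Finset.mem_image_of_mem _ hp),
      Finset.card_eq_sum_card_fiberwise (f := Prod.fst) (t := I)
      (fun z hz => (Finset.mem_filter.1 hz).2.1)]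
    refine Finset.sum_le_sum fun w hw => ?_
    calc (F.filter fun p => project i (x p) = w).card ≤ n w :=
          Finset.card_le_card fun p hp => Finset.mem_filter.2
            ⟨Finset.mem_univ _, (Finset.mem_filter.1 hp).2⟩
      _ = (Finset.univ.filter fun k : Fin s => (k : ℕ) + 1 ≤ n w).card :=
          (card_fin_succ_le (hns w)).symm
      _ ≤ _ := by
          refine Finset.card_le_card_of_injOn (fun k => (w, k)) (fun k hk => ?_) ?_
          · have := (Finset.mem_filter.1 hk).2
            simp only [Finset.coe_filter, Finset.mem_filter, Finset.mem_univ, true_and,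
              Set.mem_ofPred_eq]
            exact ⟨⟨hw, this⟩, trivial⟩
          · intro k _ k' _ h
            exact (Prod.mk.inj h).2
  · intro z hz
    obtain ⟨-, h1, h2⟩ := Finset.mem_filter.1 hz
    refine ⟨decide_eq_true h2, decide_eq_false ?_⟩
    obtain ⟨p, hp, hpw⟩ := Finset.mem_image.1 h1
    have : (Finset.univ.filter fun k : Fin s => (fun q => u k (i q)) = z.1) = ∅ := by
      rw [Finset.filter_eq_empty_iff]
      intro k _ hk
      exact hF p hp k (hpw.trans hk.symm)
    rw [this, Finset.card_empty]
    omega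

variable [NeZero d]

theorem project_eq_real_le (ℓ : ℕ) (a b : Cube d) :
    (Measure.pi fun _ : Fin (2 ^ ℓ) => unifCoord d).real {i | project i a = project i b} ≤
      Real.exp (-(hammingDist a b * 2 ^ ℓ / d)) := by
  have hset : {i : Fin (2 ^ ℓ) → Fin d | project i a = project i b} =
      Set.pi Set.univ fun _ => (agreeSet a b : Set (Fin d)) := by
    ext i
    simp [project, funext_iff, agreeSet, Set.mem_pi]
  have h1 := agree_pow_le a b (2 ^ ℓ)
  push_cast at h1
  refine le_trans (le_of_eq ?_) h1
  rw [hset, measureReal_def, Measure.pi_pi, ENNReal.toReal_prod]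
  simp only [← measureReal_def, unifCoord_real]
  simp [div_pow]

theorem bernoulli_all_false_real {K : Type} [Fintype K] (p : unitInterval) (Z : Finset K) :
    (Measure.pi fun _ : K => bernoulliMeasure true false p).real {C | ∀ z ∈ Z, C z = false} =
      (1 - (p : ℝ)) ^ Z.card := by
  classical
  have hset : {C : K → Bool | ∀ z ∈ Z, C z = false} =
      Set.pi Set.univ fun z => if z ∈ Z then {false} else Set.univ := by
    ext C
    simp only [Set.mem_ofPred_eq, Set.mem_pi, Set.mem_univ, true_imp_iff]
    refine forall_congr' fun z => ?_
    split_ifs with h <;> simp [h]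
  rw [hset, measureReal_def, Measure.pi_pi, ENNReal.toReal_prod]
  have e : ∀ z, (bernoulliMeasure true false p (if z ∈ Z then {false} else Set.univ)).toReal =
      if z ∈ Z then 1 - (p : ℝ) else 1 := by
    intro z
    rw [← measureReal_def]
    split_ifs
    · rw [bernoulliMeasure_real_apply_of_notMem_of_mem] <;> simp
    · exact probReal_univ
  simp only [e]
  rw [Finset.prod_ite_mem, Finset.univ_inter, Finset.prod_const]

/-- Unless the success probability is cut off at `1`, where the power vanishes because `n ≠ 0`, `n`
times this probability exceeds `B`. -/
theorem one_sub_levelProb_pow_le {τ B : ℝ} (hτ : 0 < τ) (hB : 0 ≤ B) {ℓ n : ℕ}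
    (hn : 2 * τ * B / (d / 2 ^ ℓ) < n) :
    (1 - (levelProb d τ ℓ : ℝ)) ^ n ≤ Real.exp (-B) := by
  have hd := dim_pos d
  have hn0 : (0 : ℝ) < n := lt_of_le_of_lt (by positivity) hn
  have hn1 : n ≠ 0 := by rintro rfl; simp at hn0
  rw [levelProb, Set.coe_projIcc]
  rcases le_or_gt 1 ((d : ℝ) / (τ * 2 ^ (ℓ + 1))) with h | h
  · rw [min_eq_left h, max_eq_right zero_le_one, sub_self, zero_pow hn1]
    positivity
  · have hp : 0 ≤ (d : ℝ) / (τ * 2 ^ (ℓ + 1)) := by positivity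
    rw [min_eq_right h.le, max_eq_right hp]
    calc (1 - (d : ℝ) / (τ * 2 ^ (ℓ + 1))) ^ n
        ≤ Real.exp (-((d : ℝ) / (τ * 2 ^ (ℓ + 1)))) ^ n :=
          pow_le_pow_left₀ (by linarith) (Real.one_sub_le_exp_neg _) n
      _ = Real.exp (-(n * ((d : ℝ) / (τ * 2 ^ (ℓ + 1))))) := by
          rw [← Real.exp_nat_mul]; congr 1; ring
      _ ≤ Real.exp (-B) := by
          refine Real.exp_le_exp.2 (neg_le_neg ?_)
          rw [div_lt_iff₀ (by positivity)] at hn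
          rw [mul_div_assoc', le_div_iff₀ (by positivity), pow_succ]
          rw [mul_div_assoc', lt_div_iff₀ (by positivity)] at hn
          nlinarith

/-- Far elements of `x` share a projection with an element of `u` with probability at most `s²
exp(-B)` in total. Otherwise a collision requires that the Bernoulli variables vanish on at least as
many separating indices as there are far elements. -/
theorem levelFamily_collide_le {τ B : ℝ} (hτ : 0 < τ) (hB : 0 ≤ B) (ℓ : ℕ) (x u : Point s d)
    (hF : 2 * τ * B / (d / 2 ^ ℓ) < (farFrom x u (d / 2 ^ ℓ * B)).card) :
    (levelFamily s d τ ℓ).law.real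
      {ω | (levelFamily s d τ ℓ).hash ω x = (levelFamily s d τ ℓ).hash ω u} ≤
      (s ^ 2 + 1) * Real.exp (-B) := by
  have hd := dim_pos d
  set F := farFrom x u (d / 2 ^ ℓ * B) with hFdef
  have hrw : (levelFamily s d τ ℓ).law.real
      {ω | (levelFamily s d τ ℓ).hash ω x = (levelFamily s d τ ℓ).hash ω u} =
      ((Measure.pi fun _ : Fin (2 ^ ℓ) => unifCoord d).prod
        (Measure.pi fun _ : (Fin (2 ^ ℓ) → Bool) × Fin s =>
          bernoulliMeasure true false (levelProb d τ ℓ))).real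
      {ω | (fun p => ω.2 p && chi ω.1 x p.1 p.2) = fun p => ω.2 p && chi ω.1 u p.1 p.2} := rfl
  rw [hrw]
  refine (prod_real_le_integral _ _ _).trans ?_
  set bad : Set (Fin (2 ^ ℓ) → Fin d) :=
    ⋃ q ∈ F ×ˢ (Finset.univ : Finset (Fin s)), {i | project i (x q.1) = project i (u q.2)} with hbad
  have hpt : ∀ i : Fin (2 ^ ℓ) → Fin d, (Measure.pi fun _ : (Fin (2 ^ ℓ) → Bool) × Fin s =>
      bernoulliMeasure true false (levelProb d τ ℓ)).real
      {C | (fun p => C p && chi i x p.1 p.2) = fun p => C p && chi i u p.1 p.2} ≤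
      bad.indicator 1 i + Real.exp (-B) := by
    intro i
    by_cases hi : i ∈ bad
    · rw [Set.indicator_of_mem hi, Pi.one_apply]
      have h1 := measureReal_le_one (μ := Measure.pi fun _ : (Fin (2 ^ ℓ) → Bool) × Fin s =>
        bernoulliMeasure true false (levelProb d τ ℓ))
        (s := {C | (fun p => C p && chi i x p.1 p.2) = fun p => C p && chi i u p.1 p.2})
      linarith [Real.exp_pos (-B)]
    · rw [Set.indicator_of_notMem hi, zero_add]
      obtain ⟨Z, hZ1, hZ2⟩ := exists_separating_cells i x u F (by
        intro p hp k h
        refine hi ?_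
        simp only [hbad, Set.mem_iUnion]
        exact ⟨(p, k), Finset.mem_product.2 ⟨hp, Finset.mem_univ _⟩, h⟩)
      have hsub : {C : (Fin (2 ^ ℓ) → Bool) × Fin s → Bool |
          (fun p => C p && chi i x p.1 p.2) = fun p => C p && chi i u p.1 p.2} ⊆
          {C | ∀ z ∈ Z, C z = false} := by
        intro C hC z hz
        have := congrFun hC z
        simpa [(hZ2 z hz).1, (hZ2 z hz).2] using this
      refine (measureReal_mono hsub (measure_ne_top _ _)).trans ?_
      rw [bernoulli_all_false_real]
      exact one_sub_levelProb_pow_le hτ hB (hF.trans_le (by exact_mod_cast hZ1))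
  refine (integral_mono Integrable.of_finite Integrable.of_finite hpt).trans ?_
  rw [integral_add Integrable.of_finite Integrable.of_finite, integral_const,
    integral_indicator_one (Set.toFinite _).measurableSet]
  simp only [probReal_univ, smul_eq_mul, one_mul]
  have hbadle : (Measure.pi fun _ : Fin (2 ^ ℓ) => unifCoord d).real bad ≤
      s ^ 2 * Real.exp (-B) := by
    refine (measureReal_biUnion_finset_le _ _).trans ?_
    refine (Finset.sum_le_card_nsmul _ _ (Real.exp (-B)) fun q hq => ?_).trans ?_
    · refine (project_eq_real_le ℓ _ _).trans (Real.exp_le_exp.2 (neg_le_neg ?_))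
      have h1 := (Finset.mem_filter.1 (Finset.mem_product.1 hq).1).2 q.2
      rw [le_div_iff₀ hd]
      rw [div_mul_eq_mul_div, div_lt_iff₀ (by positivity)] at h1
      linarith
    · rw [nsmul_eq_mul]
      gcongr
      rw [Finset.card_product, Finset.card_univ, Fintype.card_fin]
      have : F.card ≤ s := by
        simpa using F.card_le_univ
      push_cast
      rw [sq]
      gcongr
  linarith

/-- With `B = log(4 s² / α)`, points `u` with too many far elements collide with probability at most
`(s² + 1) α / (4 s²) ≤ α / 2`, so the others must supply the remaining collision probability. -/
theorem LocallyDense.measure_near_ge {L : ℕ} {μ : PMF (Point s d)} {α τ : ℝ} {x : Point s d}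
    (h : LocallyDense L μ α τ x) (hs : 1 ≤ s) (hα : 0 < α) (hα1 : α ≤ 1) (hτ : 0 < τ) {ℓ : ℕ}
    (hℓ : ℓ ≤ L) :
    α / 2 ≤ μ.toMeasure.real {u | ((farFrom x u (d / 2 ^ ℓ * Real.log (4 * s ^ 2 / α))).card : ℝ) ≤
      2 * τ * Real.log (4 * s ^ 2 / α) / (d / 2 ^ ℓ)} := by
  have hs' : (1 : ℝ) ≤ s := by exact_mod_cast hs
  set B := Real.log (4 * s ^ 2 / α) with hBdef
  have hB : 0 ≤ B := by
    refine Real.log_nonneg ?_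
    rw [le_div_iff₀ hα]
    nlinarith
  have hexp : Real.exp (-B) = α / (4 * s ^ 2) := by
    rw [hBdef, ← Real.log_inv, Real.exp_log (by positivity), inv_div]
  set G : Set (Point s d) := {u | ((farFrom x u (d / 2 ^ ℓ * B)).card : ℝ) ≤
    2 * τ * B / (d / 2 ^ ℓ)} with hG
  have h1 := (h ℓ hℓ).trans (prod_real_le_integral _ _ _)
  have hpt : ∀ u : Point s d, (levelFamily s d τ ℓ).law.real
      {ω | (u, ω) ∈ {p : Point s d × _ | (levelFamily s d τ ℓ).hash p.2 x =
        (levelFamily s d τ ℓ).hash p.2 p.1}} ≤ G.indicator 1 u + α / 2 := by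
    intro u
    by_cases hu : u ∈ G
    · rw [Set.indicator_of_mem hu, Pi.one_apply]
      have := measureReal_le_one (μ := (levelFamily s d τ ℓ).law)
        (s := {ω | (u, ω) ∈ {p : Point s d × _ | (levelFamily s d τ ℓ).hash p.2 x =
        (levelFamily s d τ ℓ).hash p.2 p.1}})
      linarith
    · rw [Set.indicator_of_notMem hu, zero_add]
      refine (levelFamily_collide_le hτ hB ℓ x u (not_le.1 hu)).trans ?_
      rw [hexp, mul_div_assoc', div_le_div_iff₀ (by positivity) (by norm_num)]
      nlinarith [mul_pos hα (show (0 : ℝ) < s ^ 2 by positivity), one_le_pow₀ hs' (n := 2)]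
  have h2 := integral_mono (μ := μ.toMeasure) Integrable.of_finite Integrable.of_finite hpt
  rw [integral_add Integrable.of_finite Integrable.of_finite, integral_const,
    integral_indicator_one (Set.toFinite _).measurableSet] at h2
  simp only [probReal_univ, smul_eq_mul, one_mul] at h2
  linarith

end

/-! ### The distance to the sample -/

section

variable {m s d : ℕ}

/-- The distance of `a` to the elements of the sample. -/
def sampleDist (w : Fin m → Point s d) (a : Cube d) : ℕ :=
  sInf (Set.range fun p : Fin m × Fin s => hammingDist a (w p.1 p.2))

theorem sampleDist_le (w : Fin m → Point s d) (a : Cube d) (t : Fin m) (k : Fin s) :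
    sampleDist w a ≤ hammingDist a (w t k) :=
  Nat.sInf_le ⟨(t, k), rfl⟩

theorem exists_sampleDist_eq (hm : 0 < m) (hs : 0 < s) (w : Fin m → Point s d) (a : Cube d) :
    ∃ t k, hammingDist a (w t k) = sampleDist w a := by
  obtain ⟨p, hp⟩ := Nat.sInf_mem
    (⟨_, (⟨0, hm⟩, ⟨0, hs⟩), rfl⟩ :
      (Set.range fun p : Fin m × Fin s => hammingDist a (w p.1 p.2)).Nonempty)
  exact ⟨p.1, p.2, hp⟩

theorem hammingDist_update_le_one (c : Cube d) (q : Fin d) (v : Bool) :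
    hammingDist c (Function.update c q v) ≤ 1 := by
  have hsub : (Finset.univ.filter fun i => c i ≠ Function.update c q v i) ⊆ {q} := by
    intro i hi
    by_contra h
    exact (Finset.mem_filter.1 hi).2 (by
      rw [Function.update_of_ne (by simpa using h)])
  simpa [hammingDist] using Finset.card_le_card hsub

theorem update_mem_sampleNbr (w : Fin m → Point s d) (t : Fin m) (k : Fin s) (q : Fin d)
    (v : Bool) : Function.update (w t k) q v ∈ sampleNbr w :=
  Finset.mem_filter.2 ⟨Finset.mem_univ _, t, k, hammingDist_update_le_one _ _ _⟩

theorem sampleDist_le_dim (hm : 0 < m) (hs : 0 < s) (w : Fin m → Point s d) (a : Cube d) :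
    (sampleDist w a : ℝ) ≤ d := by
  obtain ⟨t, k, h⟩ := exists_sampleDist_eq hm hs w a
  rw [← h]
  exact hammingDist_le_dim _ _

/-- A dyadic layer decomposition. If the threshold at level `n` is at least `R`, the leading term at
`n + 1` covers `R` alone; otherwise the new term replaces the old leading term. -/
theorem le_add_sum_levels {R e B : ℝ} (hB : 1 / 2 ≤ B) (he : 0 ≤ e) (hR : R ≤ e) (n : ℕ) :
    R ≤ 2 * (e / 2 ^ n) * B + ∑ ℓ ∈ Finset.range n,
      if e / 2 ^ ℓ * B < R then 2 * (e / 2 ^ ℓ) * B else 0 := by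
  induction n with
  | zero => simp; nlinarith
  | succ n ih =>
    have hsum : 0 ≤ ∑ ℓ ∈ Finset.range n, if e / 2 ^ ℓ * B < R then 2 * (e / 2 ^ ℓ) * B else 0 :=
      Finset.sum_nonneg fun ℓ _ => by split_ifs <;> positivity
    have hpos : 0 ≤ e / 2 ^ (n + 1) * B := by positivity
    rw [Finset.sum_range_succ]
    split_ifs with h
    · linarith
    · have : 2 * (e / 2 ^ (n + 1)) = e / 2 ^ n := by rw [pow_succ]; field_simp
      rw [this]
      linarith [not_lt.1 h]

/-- At level `ℓ` some sample leaves at most `2 τ B 2^ℓ / d` elements of `x` beyond distance `d B /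
2^ℓ`, each charged `2 d B / 2^ℓ`. So every level costs at most `4 τ B²`, and the finest scale leaves
`B` per element. -/
theorem sum_sampleDist_le (hm : 0 < m) (hs : 0 < s) {L : ℕ} {τ B : ℝ}
    (hB : 1 / 2 ≤ B) (hd : 0 < d) (hdL : d ≤ 2 ^ L) (w : Fin m → Point s d) (x : Point s d)
    (hw : ∀ ℓ ≤ L, ∃ t, ((farFrom x (w t) (d / 2 ^ ℓ * B)).card : ℝ) ≤
      2 * τ * B / (d / 2 ^ ℓ)) :
    ∑ i, (sampleDist w (x i) : ℝ) ≤ s * B + 4 * (L + 1) * τ * B ^ 2 := by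
  have hd' : (0 : ℝ) < d := by exact_mod_cast hd
  have hdL' : (d : ℝ) / 2 ^ L ≤ 1 := by
    rw [div_le_one (by positivity)]; exact_mod_cast hdL
  have h1 : ∀ i, (sampleDist w (x i) : ℝ) ≤ B + ∑ ℓ ∈ Finset.range (L + 1),
      if (d : ℝ) / 2 ^ ℓ * B < sampleDist w (x i) then 2 * ((d : ℝ) / 2 ^ ℓ) * B else 0 := by
    intro i
    refine (le_add_sum_levels hB hd'.le (sampleDist_le_dim hm hs w (x i)) (L + 1)).trans ?_
    refine add_le_add ?_ le_rfl
    have : 2 * ((d : ℝ) / 2 ^ (L + 1)) = d / 2 ^ L := by rw [pow_succ]; field_simp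
    rw [this]
    nlinarith
  refine (Finset.sum_le_sum fun i _ => h1 i).trans ?_
  rw [Finset.sum_add_distrib, Finset.sum_const, Finset.card_univ, Fintype.card_fin, nsmul_eq_mul,
    Finset.sum_comm]
  refine add_le_add le_rfl ?_
  refine (Finset.sum_le_card_nsmul _ _ (4 * τ * B ^ 2) fun ℓ hℓ => ?_).trans (le_of_eq ?_)
  · obtain ⟨t, ht⟩ := hw ℓ (Nat.lt_succ_iff.1 (Finset.mem_range.1 hℓ))
    rw [← Finset.sum_filter, Finset.sum_const, nsmul_eq_mul]
    have hsub : (Finset.univ.filter fun i => (d : ℝ) / 2 ^ ℓ * B < sampleDist w (x i)) ⊆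
        farFrom x (w t) (d / 2 ^ ℓ * B) := fun i hi =>
      Finset.mem_filter.2 ⟨Finset.mem_univ _, fun k => (Finset.mem_filter.1 hi).2.trans_le
        (by exact_mod_cast sampleDist_le w (x i) t k)⟩
    have hcard : ((Finset.univ.filter fun i => (d : ℝ) / 2 ^ ℓ * B < sampleDist w (x i)).card : ℝ) ≤
        2 * τ * B / (d / 2 ^ ℓ) :=
      le_trans (by exact_mod_cast Finset.card_le_card hsub) ht
    refine (mul_le_mul_of_nonneg_right hcard (by positivity)).trans (le_of_eq ?_)
    field_simp
    ring
  · rw [Finset.card_range, nsmul_eq_mul]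
    push_cast
    ring

/-- Jensen's inequality with weights `D i`: the logarithm lies below its tangent at `1 + M / ∑ D i`.
Terms with `D i = 0` vanish under the convention for division by zero. -/
theorem sum_mul_log_le {ι : Type*} (S : Finset ι) (D R : ι → ℝ) (hD : ∀ i ∈ S, 0 ≤ D i)
    (hR : ∀ i ∈ S, 0 ≤ R i) {M : ℝ} (hM : ∑ i ∈ S, R i ≤ M) (hpos : 0 < ∑ i ∈ S, D i) :
    ∑ i ∈ S, D i * Real.log (1 + R i / D i) ≤
      (∑ i ∈ S, D i) * Real.log (1 + M / ∑ i ∈ S, D i) := by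
  set T := ∑ i ∈ S, D i with hT
  have hM0 : 0 ≤ M := (Finset.sum_nonneg hR).trans hM
  set v := M / T with hv
  have hv0 : 0 ≤ v := by positivity
  have h1 : ∀ i ∈ S, D i * Real.log (1 + R i / D i) ≤
      D i * Real.log (1 + v) + (R i - D i * v) / (1 + v) := by
    intro i hi
    rcases (hD i hi).eq_or_lt with h | h
    · rw [← h]
      simpa using div_nonneg (hR i hi) (by linarith)
    · have hx : 0 < (1 + R i / D i) / (1 + v) := by
        have := div_nonneg (hR i hi) h.le
        positivity
      have h2 := Real.log_le_sub_one_of_pos hx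
      rw [Real.log_div (by have := div_nonneg (hR i hi) h.le; positivity) (by positivity)] at h2
      have h3 : D i * Real.log (1 + R i / D i) ≤
          D i * (Real.log (1 + v) + ((1 + R i / D i) / (1 + v) - 1)) :=
        mul_le_mul_of_nonneg_left (by linarith) h.le
      refine h3.trans (le_of_eq ?_)
      field_simp
      ring
  refine (Finset.sum_le_sum h1).trans ?_
  rw [Finset.sum_add_distrib, ← Finset.sum_mul, ← Finset.sum_div, Finset.sum_sub_distrib,
    ← Finset.sum_mul, ← hT]
  have h4 : T * v = M := by rw [hv]; field_simp
  rw [h4]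
  have : (∑ i ∈ S, R i - M) / (1 + v) ≤ 0 := div_nonpos_of_nonpos_of_nonneg (by linarith) (by linarith)
  linarith

end

/-! ### Samples that meet all levels -/

section

theorem pi_forall_notMem_real_le {A : Type*} [Fintype A] [MeasurableSpace A]
    [MeasurableSingletonClass A] (P : Measure A) [IsProbabilityMeasure P] (m : ℕ) (G : Set A)
    {p : ℝ} (hG : p ≤ P.real G) :
    (Measure.pi fun _ : Fin m => P).real {w | ∀ t, w t ∉ G} ≤ Real.exp (-(p * m)) := by
  have hset : {w : Fin m → A | ∀ t, w t ∉ G} = Set.pi Set.univ fun _ => Gᶜ := by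
    ext w; simp
  rw [hset, measureReal_def, Measure.pi_pi, ENNReal.toReal_prod, Finset.prod_const,
    Finset.card_univ, Fintype.card_fin, ← measureReal_def,
    probReal_compl_eq_one_sub (Set.toFinite G).measurableSet]
  calc (1 - P.real G) ^ m ≤ Real.exp (-p) ^ m :=
        pow_le_pow_left₀ (by linarith [measureReal_le_one (μ := P) (s := G)])
          (by linarith [Real.one_sub_le_exp_neg p]) m
    _ = Real.exp (-(p * m)) := by rw [← Real.exp_nat_mul]; congr 1; ring

variable {s d : ℕ} [NeZero d]

theorem LocallyDense.le_one {L : ℕ} {μ : PMF (Point s d)} {α τ : ℝ} {x : Point s d}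
    (h : LocallyDense L μ α τ x) : α ≤ 1 :=
  (h 0 (Nat.zero_le _)).trans measureReal_le_one

/-- With `m ≥ 8 κ s d / α` samples one level is missed with probability at most `exp(-4 κ d)`; the
number of levels is at most `exp(κ d)`. The failure probability `1 / d` is what the trivial bound
`d` for the logarithm on failing samples calls for. -/
theorem LocallyDense.sample_real_le {κ : ℕ} (hκ : 1 ≤ κ) {μ : PMF (Point s d)} {α τ : ℝ}
    {x : Point s d} (h : LocallyDense (κ * Nat.clog 2 d) μ α τ x) (hs : 1 ≤ s) (hα : 0 < α)
    (hτ : 0 < τ) {m : ℕ} (hm : ((8 * κ : ℕ) : ℝ) * s * d / α ≤ m) :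
    (Measure.pi fun _ : Fin m => μ.toMeasure).real
      {w | ¬ ∀ ℓ ≤ κ * Nat.clog 2 d, ∃ t,
        ((farFrom x (w t) (d / 2 ^ ℓ * Real.log (4 * s ^ 2 / α))).card : ℝ) ≤
        2 * τ * Real.log (4 * s ^ 2 / α) / (d / 2 ^ ℓ)} ≤ 1 / d := by
  have hd := dim_pos d
  set L := κ * Nat.clog 2 d with hL
  set G : ℕ → Set (Point s d) := fun ℓ =>
    {u | ((farFrom x u (d / 2 ^ ℓ * Real.log (4 * s ^ 2 / α))).card : ℝ) ≤
      2 * τ * Real.log (4 * s ^ 2 / α) / (d / 2 ^ ℓ)} with hG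
  have hsub : {w : Fin m → Point s d | ¬ ∀ ℓ ≤ L, ∃ t,
        ((farFrom x (w t) (d / 2 ^ ℓ * Real.log (4 * s ^ 2 / α))).card : ℝ) ≤
        2 * τ * Real.log (4 * s ^ 2 / α) / (d / 2 ^ ℓ)} ⊆
      ⋃ ℓ ∈ Finset.range (L + 1), {w | ∀ t, w t ∉ G ℓ} := by
    intro w hw
    rw [Set.mem_ofPred_eq] at hw
    push Not at hw
    obtain ⟨ℓ, hℓ, hw⟩ := hw
    simp only [Set.mem_iUnion]
    exact ⟨ℓ, Finset.mem_range.2 (by omega), fun t ht => absurd ht (not_le.2 (hw t))⟩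
  refine (measureReal_mono hsub (measure_ne_top _ _)).trans
    ((measureReal_biUnion_finset_le _ _).trans ?_)
  refine (Finset.sum_le_card_nsmul _ _ (Real.exp (-(α / 2 * m))) fun ℓ hℓ =>
    pi_forall_notMem_real_le _ m (G ℓ) (h.measure_near_ge hs hα h.le_one hτ
      (Nat.lt_succ_iff.1 (Finset.mem_range.1 hℓ)))).trans ?_
  rw [Finset.card_range, nsmul_eq_mul]
  have hs' : (1 : ℝ) ≤ s := by exact_mod_cast hs
  have hκ' : (1 : ℝ) ≤ κ := by exact_mod_cast hκ
  have hLd : ((L + 1 : ℕ) : ℝ) ≤ Real.exp (κ * d) := by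
    have h1 : (L : ℝ) ≤ κ * d := by
      exact_mod_cast Nat.mul_le_mul_left κ (clog_le_self d)
    push_cast
    linarith [Real.add_one_le_exp ((κ : ℝ) * d)]
  have hmd : (4 : ℝ) * (κ * d) ≤ α / 2 * m := by
    rw [div_le_iff₀ hα] at hm
    push_cast at hm
    have : (κ : ℝ) * d ≤ κ * s * d := by
      have : 0 ≤ (κ : ℝ) * d := by positivity
      nlinarith
    nlinarith
  have hkd : (d : ℝ) ≤ κ * d := by nlinarith
  have hdexp : (d : ℝ) * Real.exp (-d) ≤ 1 := by
    rw [Real.exp_neg, mul_inv_le_iff₀ (Real.exp_pos _)]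
    linarith [Real.add_one_le_exp (d : ℝ)]
  rw [le_div_iff₀ hd]
  calc ((L + 1 : ℕ) : ℝ) * Real.exp (-(α / 2 * m)) * d
      ≤ Real.exp (κ * d) * Real.exp (-(4 * (κ * d))) * d := by gcongr
    _ = d * Real.exp (-(3 * (κ * d))) := by
        rw [← Real.exp_add, mul_comm]; congr 2; ring
    _ ≤ d * Real.exp (-d) := by
        gcongr
        nlinarith
    _ ≤ 1 := hdexp

end

/-! ### Close points collide -/

section

variable {s d : ℕ}

theorem prod_real_le_integral_of_le {A B : Type*} [Finite A] [MeasurableSpace A]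
    [MeasurableSingletonClass A] [MeasurableSpace B] (P : Measure A) [IsProbabilityMeasure P]
    (Q : Measure B) [IsProbabilityMeasure Q] (S : Set (A × B)) {f : A → ℝ}
    (h : ∀ a, Q.real {b | (a, b) ∈ S} ≤ f a) : (P.prod Q).real S ≤ ∫ a, f a ∂P :=
  (prod_real_le_integral P Q S).trans (integral_mono Integrable.of_finite Integrable.of_finite h)

theorem exists_sum_eq_emd (x y : Point s d) :
    ∃ π : Equiv.Perm (Fin s), ∑ i, (hammingDist (x i) (y (π i)) : ℝ) = emd x y :=
  exists_eq_ciInf_of_finite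

theorem emd_nonneg (x y : Point s d) : 0 ≤ emd x y :=
  Real.iInf_nonneg fun _ => Finset.sum_nonneg fun _ _ => Nat.cast_nonneg _

theorem treeDist_self {L : ℕ} (j : Coords L d) (W : Finset (Cube d)) (ξ : ℝ) (a : Cube d) :
    treeDist j W ξ a a = 0 := by simp [treeDist]

variable [NeZero d]

/-- The union bound over the edges, with the `ℓ₁` distance bounded through an arbitrary matching and
averaged over samples and coordinates. -/
theorem separate_sampleTreeFamily_le {L m : ℕ} (μ : PMF (Point s d)) {ξ γ : ℝ} (hξ : 0 ≤ ξ)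
    (hγ : 0 < γ) (x y : Point s d) (π : Equiv.Perm (Fin s)) :
    (sampleTreeFamily L μ m ξ γ).separate x y ≤
      (∫ w, ∑ i, ∫ j, treeDist j (sampleNbr w) ξ (x i) (y (π i)) ∂coordLaw L d
        ∂(Measure.pi fun _ : Fin m => μ.toMeasure)) / γ := by
  have hrw : (sampleTreeFamily L μ m ξ γ).separate x y = ((Measure.pi fun _ : Fin m =>
      μ.toMeasure).prod ((coordLaw L d).prod shiftLaw)).real
      {ω | gridHash γ ω.2.2 (treeEmbed ω.2.1 (sampleNbr ω.1) ξ x) ≠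
        gridHash γ ω.2.2 (treeEmbed ω.2.1 (sampleNbr ω.1) ξ y)} := rfl
  have h1 : ∀ w : Fin m → Point s d, ((coordLaw L d).prod shiftLaw).real
      {p | gridHash γ p.2 (treeEmbed p.1 (sampleNbr w) ξ x) ≠
        gridHash γ p.2 (treeEmbed p.1 (sampleNbr w) ξ y)} ≤
      (∑ i, ∫ j, treeDist j (sampleNbr w) ξ (x i) (y (π i)) ∂coordLaw L d) / γ := by
    intro w
    have h2 : ∀ j : Coords L d, shiftLaw.real
        {u | gridHash γ u (treeEmbed j (sampleNbr w) ξ x) ≠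
          gridHash γ u (treeEmbed j (sampleNbr w) ξ y)} ≤
        (∑ i, treeDist j (sampleNbr w) ξ (x i) (y (π i))) / γ := fun j =>
      (gridHash_ne_le hγ (treeEmbed j (sampleNbr w) ξ x) (treeEmbed j (sampleNbr w) ξ y)
        (treeNodes j) fun v hv => by
          rw [treeEmbed_of_notMem x hv, treeEmbed_of_notMem y hv]).trans
        (div_le_div_of_nonneg_right (sum_abs_treeEmbed_le hξ x y π) hγ.le)
    rw [← integral_finsetSum _ fun _ _ => Integrable.of_finite, ← integral_div]
    exact prod_real_le_integral_of_le _ _ _ h2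
  rw [hrw, ← integral_div]
  exact prod_real_le_integral_of_le _ _ _ h1

/-- The weights are polynomial in `N = m s d` apart from `ξ`, for which `log(N/δ) ≤ N/δ` suffices.
Six of the `4 κ + 8` factors `δ / N` cancel all powers of `N`, and `δ^5 ≤ 1` remains. -/
theorem not_controlled_term_le {κ m : ℕ} {δ : ℝ} (hκ : 1 ≤ κ) (hs : 1 ≤ s) (hm : 2 ≤ m)
    (hδ : 0 < δ) (hδ1 : δ < 1) (w : Fin m → Point s d) :
    2 * (((κ * Nat.clog 2 d : ℕ) : ℝ) + 1) *
      (d * (((8 * κ + 16 : ℕ) : ℝ) * Real.log ((m : ℝ) * s * d / δ))) *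
      (coordLaw (κ * Nat.clog 2 d) d).real {j | ¬ Controlled j (sampleNbr w)
        (((8 * κ + 16 : ℕ) : ℝ) * Real.log ((m : ℝ) * s * d / δ))} ≤
      36 * κ ^ 2 * ((8 * κ + 16 : ℕ) : ℝ) := by
  have hd1 : 1 ≤ d := Nat.pos_of_ne_zero (NeZero.ne d)
  have hms : 1 ≤ m * s := Nat.mul_pos (by omega) hs
  have hξ1 := one_le_scale (κ := κ) hs hd1 hm hδ hδ1
  have hcard : (sampleNbr w).card ≤ 3 * (m * s * d) := by
    refine (sampleNbr_card_le w).trans ?_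
    nlinarith
  have hP := coordLaw_not_controlled_le_pow (κ := κ) hs hm hδ hcard hξ1
  have hdN : (d : ℝ) ≤ (m : ℝ) * s * d := by
    exact_mod_cast Nat.le_mul_of_pos_left d hms
  have hLN : ((κ * Nat.clog 2 d : ℕ) : ℝ) + 1 ≤ 2 * κ * ((m : ℝ) * s * d) := by
    have h1 : κ * Nat.clog 2 d ≤ κ * (m * s * d) :=
      Nat.mul_le_mul_left κ ((clog_le_self d).trans (Nat.le_mul_of_pos_left d hms))
    have h2 : 1 ≤ κ * (m * s * d) := Nat.mul_pos hκ (Nat.mul_pos hms hd1)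
    have h3 : κ * Nat.clog 2 d + 1 ≤ 2 * κ * (m * s * d) := by linarith
    exact_mod_cast h3
  have hN1 : (1 : ℝ) ≤ (m : ℝ) * s * d := by
    exact_mod_cast Nat.mul_pos hms hd1
  set c : ℝ := ((8 * κ + 16 : ℕ) : ℝ) with hc
  have hc0 : 0 ≤ c := Nat.cast_nonneg _
  set P := (coordLaw (κ * Nat.clog 2 d) d).real {j | ¬ Controlled j (sampleNbr w)
        (c * Real.log ((m : ℝ) * s * d / δ))}
  have hP0 : 0 ≤ P := measureReal_nonneg
  generalize (m : ℝ) * s * d = N at *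
  have hN0 : 0 < N := by linarith
  have hlog : Real.log (N / δ) ≤ N / δ :=
    (Real.log_le_sub_one_of_pos (by positivity)).trans (by linarith)
  have hP' : P ≤ 9 * κ * N ^ 3 * (δ / N) ^ 6 := by
    refine hP.trans (mul_le_mul_of_nonneg_left ?_ (by positivity))
    exact pow_le_pow_of_le_one (by positivity) (by rw [div_le_one hN0]; linarith) (by omega)
  have hlog0 : 0 ≤ Real.log (N / δ) := by
    refine Real.log_nonneg ?_
    rw [le_div_iff₀ hδ]; linarith
  calc 2 * (((κ * Nat.clog 2 d : ℕ) : ℝ) + 1) * (d * (c * Real.log (N / δ))) * P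
      ≤ 2 * (2 * κ * N) * (N * (c * (N / δ))) * (9 * κ * N ^ 3 * (δ / N) ^ 6) := by
        refine mul_le_mul ?_ hP' hP0 (by positivity)
        refine mul_le_mul (by linarith) ?_ (by positivity) (by positivity)
        exact mul_le_mul hdN (mul_le_mul_of_nonneg_left hlog hc0) (by positivity) hN0.le
    _ = 36 * κ ^ 2 * c * δ ^ 5 := by field_simp; ring
    _ ≤ 36 * κ ^ 2 * c * 1 := by
        refine mul_le_mul_of_nonneg_left (pow_le_one₀ hδ.le hδ1.le) (by positivity)
    _ = 36 * κ ^ 2 * c := mul_one _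

/-- The centre is a sampled element nearest to `a`; all its one-bit changes lie in the neighbourhood
of the sample. For `a ≠ b` the distance is at least `1`, so the constant from uncontrolled trees can
be multiplied by it. -/
theorem integral_treeDist_sample_le {κ m lam : ℕ} {δ : ℝ} (hκ : 1 ≤ κ) (hs : 1 ≤ s) (hm : 2 ≤ m)
    (hδ : 0 < δ) (hδ1 : δ < 1) (w : Fin m → Point s d) (a b : Cube d)
    (hlog : 4 * Real.log ((m : ℝ) * s * (d + 1)) ≤ 2 ^ lam) {ξ : ℝ}
    (hξ : ξ = ((8 * κ + 16 : ℕ) : ℝ) * Real.log ((m : ℝ) * s * d / δ)) :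
    ∫ j, treeDist j (sampleNbr w) ξ a b ∂coordLaw (κ * Nat.clog 2 d) d ≤
      (hammingDist a b : ℝ) * (24 * ξ + 96 * lam * Real.log ((m : ℝ) * s * (d + 1)) +
        132 * ((κ * Nat.clog 2 d : ℕ) : ℝ) + 36 * κ ^ 2 * ((8 * κ + 16 : ℕ) : ℝ)) +
      8 * ξ * ((hammingDist a b : ℝ) *
        Real.log (1 + (sampleDist w a : ℝ) / (hammingDist a b : ℝ))) := by
  have hd1 : 1 ≤ d := Nat.pos_of_ne_zero (NeZero.ne d)
  have hξ1 : 1 ≤ ξ := hξ ▸ one_le_scale (κ := κ) hs hd1 hm hδ hδ1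
  by_cases hab : a = b
  · subst hab
    simp [treeDist_self]
  have hD1 : (1 : ℝ) ≤ hammingDist a b := by
    exact_mod_cast Nat.one_le_iff_ne_zero.2 (hammingDist_ne_zero.2 hab)
  obtain ⟨t, k, htk⟩ := exists_sampleDist_eq (by omega) hs w a
  have hdL : d ≤ 2 ^ (κ * Nat.clog 2 d) :=
    (Nat.le_pow_clog (by norm_num) d).trans
      (Nat.pow_le_pow_right (by norm_num) (Nat.le_mul_of_pos_left _ hκ))
  have hcardpos : 0 < (sampleNbr w).card := Finset.card_pos.2
    ⟨_, update_mem_sampleNbr w t k ⟨0, hd1⟩ true⟩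
  have hcard : Real.log (sampleNbr w).card ≤ Real.log ((m : ℝ) * s * (d + 1)) := by
    refine Real.log_le_log (by exact_mod_cast hcardpos) ?_
    exact_mod_cast sampleNbr_card_le w
  have h1 := integral_treeDist_le (L := κ * Nat.clog 2 d) hξ1
    (fun q v => update_mem_sampleNbr w t k q v) hdL hab (by linarith : 4 * Real.log _ ≤ 2 ^ lam)
  rw [htk] at h1
  have h2 := not_controlled_term_le hκ hs hm hδ hδ1 w
  rw [← hξ] at h2
  refine h1.trans ?_
  have h3 : 96 * (lam : ℝ) * Real.log (sampleNbr w).card ≤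
      96 * lam * Real.log ((m : ℝ) * s * (d + 1)) := mul_le_mul_of_nonneg_left hcard (by positivity)
  have hc0 : (0 : ℝ) ≤ 36 * κ ^ 2 * ((8 * κ + 16 : ℕ) : ℝ) := by positivity
  set D : ℝ := ((hammingDist a b : ℕ) : ℝ)
  have h4 := mul_le_mul_of_nonneg_left h3 (by linarith : 0 ≤ D)
  have h5 := mul_le_mul_of_nonneg_right hD1 hc0
  linarith

theorem separate_le_of_sample_real_le {κ m lam : ℕ} {δ γ τ B : ℝ} (hκ : 1 ≤ κ) (hs : 1 ≤ s)
    (hm : 2 ≤ m) (hδ : 0 < δ) (hδ1 : δ < 1) (hγ : 0 < γ) (hτ : 0 ≤ τ) (hB : 1 / 2 ≤ B)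
    (μ : PMF (Point s d)) (x y : Point s d)
    (hlog : 4 * Real.log ((m : ℝ) * s * (d + 1)) ≤ 2 ^ lam) {ξ : ℝ}
    (hξ : ξ = ((8 * κ + 16 : ℕ) : ℝ) * Real.log ((m : ℝ) * s * d / δ))
    (hx : (Measure.pi fun _ : Fin m => μ.toMeasure).real
      {w | ¬ ∀ ℓ ≤ κ * Nat.clog 2 d, ∃ t, ((farFrom x (w t) (d / 2 ^ ℓ * B)).card : ℝ) ≤
        2 * τ * B / (d / 2 ^ ℓ)} ≤ 1 / d) :
    (sampleTreeFamily (κ * Nat.clog 2 d) μ m ξ γ).separate x y ≤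
      emd x y * (32 * ξ + 96 * lam * Real.log ((m : ℝ) * s * (d + 1)) +
        132 * ((κ * Nat.clog 2 d : ℕ) : ℝ) + 36 * κ ^ 2 * ((8 * κ + 16 : ℕ) : ℝ) +
        8 * ξ * Real.log (1 + (s * B + 4 * (((κ * Nat.clog 2 d : ℕ) : ℝ) + 1) * τ * B ^ 2) /
          emd x y)) / γ := by
  have hd := dim_pos d
  have hd1 : 1 ≤ d := Nat.pos_of_ne_zero (NeZero.ne d)
  have hξ1 : 1 ≤ ξ := hξ ▸ one_le_scale (κ := κ) hs hd1 hm hδ hδ1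
  obtain ⟨π, hπ⟩ := exists_sum_eq_emd x y
  refine (separate_sampleTreeFamily_le μ (by linarith) hγ x y π).trans
    (div_le_div_of_nonneg_right ?_ hγ.le)
  set A : ℝ := 24 * ξ + 96 * lam * Real.log ((m : ℝ) * s * (d + 1)) +
        132 * ((κ * Nat.clog 2 d : ℕ) : ℝ) + 36 * κ ^ 2 * ((8 * κ + 16 : ℕ) : ℝ) with hA
  set M : ℝ := s * B + 4 * (((κ * Nat.clog 2 d : ℕ) : ℝ) + 1) * τ * B ^ 2 with hM
  have hM0 : 0 ≤ M := by positivity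
  set bad : Set (Fin m → Point s d) := {w | ¬ ∀ ℓ ≤ κ * Nat.clog 2 d, ∃ t,
    ((farFrom x (w t) (d / 2 ^ ℓ * B)).card : ℝ) ≤ 2 * τ * B / (d / 2 ^ ℓ)} with hbad
  have hE0 := emd_nonneg x y
  have hlogM : 0 ≤ Real.log (1 + M / emd x y) :=
    Real.log_nonneg (by have := div_nonneg hM0 hE0; linarith)
  have hpt : ∀ w : Fin m → Point s d,
      ∑ i, ∫ j, treeDist j (sampleNbr w) ξ (x i) (y (π i)) ∂coordLaw (κ * Nat.clog 2 d) d ≤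
      emd x y * A + 8 * ξ * (emd x y * Real.log (1 + M / emd x y)) +
        8 * ξ * emd x y * d * bad.indicator 1 w := by
    intro w
    refine (Finset.sum_le_sum fun i _ =>
      integral_treeDist_sample_le hκ hs hm hδ hδ1 w (x i) (y (π i)) hlog hξ).trans ?_
    rw [Finset.sum_add_distrib, ← Finset.sum_mul, hπ, ← Finset.mul_sum, add_assoc (emd x y * _)]
    refine add_le_add le_rfl ?_
    by_cases hw : w ∈ bad
    · rw [Set.indicator_of_mem hw, Pi.one_apply, mul_one]
      -- On samples that miss a level, `log(1 + R/D) ≤ R/D ≤ d`. Weighted with the probability `1 /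
      -- d` this adds `8 ξ` times the distance, whence `32 ξ` in place of `24 ξ`.
      have h1 : ∑ i, (hammingDist (x i) (y (π i)) : ℝ) * Real.log
          (1 + (sampleDist w (x i) : ℝ) / (hammingDist (x i) (y (π i)) : ℝ)) ≤ emd x y * d := by
        rw [← hπ, Finset.sum_mul]
        refine Finset.sum_le_sum fun i _ => mul_le_mul_of_nonneg_left ?_ (Nat.cast_nonneg _)
        set R : ℝ := ((sampleDist w (x i) : ℕ) : ℝ) with hR
        set D : ℝ := ((hammingDist (x i) (y (π i)) : ℕ) : ℝ) with hD
        have hR0 : 0 ≤ R := Nat.cast_nonneg _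
        have hD0 : 0 ≤ D := Nat.cast_nonneg _
        have h2 : R / D ≤ d := by
          refine le_trans ?_ (sampleDist_le_dim (by omega) hs w (x i))
          rcases Nat.eq_zero_or_pos (hammingDist (x i) (y (π i))) with h | h
          · rw [hD, h]; simp
          · exact div_le_self hR0 (by rw [hD]; exact_mod_cast h)
        have h3 := div_nonneg hR0 hD0
        exact (Real.log_le_sub_one_of_pos (by linarith)).trans (by linarith)
      have h4 := mul_le_mul_of_nonneg_left h1 (by linarith : 0 ≤ 8 * ξ)
      have h5 : 0 ≤ 8 * ξ * (emd x y * Real.log (1 + M / emd x y)) := by positivity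
      linarith
    · rw [Set.indicator_of_notMem hw, mul_zero, add_zero]
      refine mul_le_mul_of_nonneg_left ?_ (by linarith)
      have hgood : ∑ i, (sampleDist w (x i) : ℝ) ≤ M := by
        refine sum_sampleDist_le (by omega) hs hB hd1
          ((Nat.le_pow_clog (by norm_num) d).trans
            (Nat.pow_le_pow_right (by norm_num) (Nat.le_mul_of_pos_left _ hκ))) w x ?_
        simpa [hbad] using hw
      rcases hE0.eq_or_lt with h0 | h0
      · rw [← h0, zero_mul]
        refine le_of_eq (Finset.sum_eq_zero fun i _ => ?_)
        have : (hammingDist (x i) (y (π i)) : ℝ) = 0 :=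
          (Finset.sum_eq_zero_iff_of_nonneg fun i _ => Nat.cast_nonneg _).1 (hπ.trans h0.symm) i
            (Finset.mem_univ i)
        rw [this, zero_mul]
      · have := sum_mul_log_le Finset.univ (fun i => (hammingDist (x i) (y (π i)) : ℝ))
          (fun i => (sampleDist w (x i) : ℝ)) (fun i _ => Nat.cast_nonneg _)
          (fun i _ => Nat.cast_nonneg _) hgood (by rw [hπ]; exact h0)
        rwa [hπ] at this
  refine (integral_mono Integrable.of_finite Integrable.of_finite hpt).trans ?_
  rw [integral_add Integrable.of_finite Integrable.of_finite, integral_const, integral_const_mul,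
    integral_indicator_one (Set.toFinite _).measurableSet]
  simp only [probReal_univ, smul_eq_mul, one_mul]
  have h6 : 8 * ξ * emd x y * d *
      (Measure.pi fun _ : Fin m => μ.toMeasure).real bad ≤ 8 * ξ * emd x y * d * (1 / d) :=
    mul_le_mul_of_nonneg_left hx (by positivity)
  rw [mul_one_div, mul_div_assoc, div_self hd.ne', mul_one] at h6
  rw [hA]
  linarith

end

/-! ### Logarithmic bounds -/

section

theorem half_le_log_two : (1 / 2 : ℝ) ≤ Real.log 2 := by linarith [Real.log_two_gt_d9]

theorem one_le_log_log {z : ℝ} (hz : 16 ≤ z) : 1 ≤ Real.log (Real.log z) := by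
  have h1 : Real.exp 1 ≤ Real.log z := by
    have h2 : Real.log 16 = 4 * Real.log 2 := by
      rw [show (16 : ℝ) = 2 ^ 4 by norm_num, Real.log_pow]; norm_num
    have h3 := Real.log_le_log (by norm_num) hz
    linarith [Real.log_two_gt_d9, Real.exp_one_lt_d9]
  have := Real.log_le_log (Real.exp_pos 1) h1
  rwa [Real.log_exp] at this

theorem one_le_log {z : ℝ} (hz : 16 ≤ z) : 1 ≤ Real.log z := by
  have h := one_le_log_log hz
  by_contra hlt
  have h0 : 0 ≤ Real.log z := Real.log_nonneg (by linarith)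
  linarith [Real.log_nonpos h0 (not_le.1 hlt).le]

theorem log_le_self_mul {a t : ℝ} (ha : 0 < a) (ht : 1 ≤ t) : Real.log a ≤ a * t := by
  have := Real.log_le_sub_one_of_pos ha
  nlinarith

theorem clog_le_log {d : ℕ} (hd : 1 ≤ d) {t : ℝ} (ht : 1 ≤ t) (hdt : Real.log d ≤ t) :
    (Nat.clog 2 d : ℝ) ≤ 4 * t := by
  have h1 : (2 : ℝ) ^ Nat.clog 2 d ≤ 2 * d := by
    have := two_pow_clog_le hd 1
    rw [one_mul, pow_one] at this
    exact_mod_cast this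
  have h2 := Real.log_le_log (by positivity) h1
  have hd' : (0 : ℝ) < d := by exact_mod_cast hd
  rw [Real.log_pow, Real.log_mul (by norm_num) hd'.ne'] at h2
  have h3 : Real.log 2 ≤ 1 := by linarith [Real.log_two_lt_d9]
  have h4 := mul_le_mul_of_nonneg_left half_le_log_two (Nat.cast_nonneg (α := ℝ) (Nat.clog 2 d))
  linarith

/-- Supplies `lam` with `2^lam` above four times the logarithm of the number of elements near the
samples; `lam` is of order `log t = log log z`. -/
theorem exists_two_pow_ge {e t : ℝ} (he : 1 ≤ e) (ht : 1 ≤ t) (hlog : 1 ≤ Real.log t) :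
    ∃ lam : ℕ, 4 * (e * t) ≤ 2 ^ lam ∧ (lam : ℝ) ≤ (20 * e + 2) * Real.log t := by
  have het : 1 ≤ e * t := by nlinarith
  set k := ⌈4 * (e * t)⌉₊ with hk
  have hk1 : 1 ≤ k := Nat.one_le_ceil_iff.2 (by linarith)
  refine ⟨Nat.clog 2 k, (Nat.le_ceil _).trans ?_, ?_⟩
  · exact_mod_cast Nat.le_pow_clog (by norm_num) k
  · have h1 : (2 : ℝ) ^ Nat.clog 2 k ≤ 2 * k := by
      have := two_pow_clog_le hk1 1
      rw [one_mul, pow_one] at this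
      exact_mod_cast this
    have h2 : (k : ℝ) ≤ 4 * (e * t) + 1 := (Nat.ceil_lt_add_one (by linarith)).le
    have h3 := Real.log_le_log (by positivity) (h1.trans (by linarith : 2 * (k : ℝ) ≤ 10 * e * t))
    rw [Real.log_pow, Real.log_mul (by positivity) (by positivity)] at h3
    have h4 := log_le_self_mul (by linarith : 0 < 10 * e) hlog
    have h5 := mul_le_mul_of_nonneg_left half_le_log_two (Nat.cast_nonneg (α := ℝ) (Nat.clog 2 k))
    linarith

variable {κ s d : ℕ} {α δ : ℝ}

theorem log_sampleSize_le (hs : 1 ≤ s) (hd : 1 ≤ d) (hα : 0 < α) {z : ℝ} (hz : 16 ≤ z)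
    (h : (s : ℝ) * d / α ≤ z) : Real.log (sampleSize κ s d α) ≤ (8 * κ + 3) * Real.log z := by
  have h1 : (sampleSize κ s d α : ℝ) ≤ (8 * κ + 2) * z := by
    have h2 : (sampleSize κ s d α : ℝ) ≤ ((8 * κ : ℕ) : ℝ) * s * d / α + 2 := by
      rw [sampleSize]
      push_cast
      exact add_le_add (Nat.floor_le (by positivity)) le_rfl
    refine h2.trans ?_
    have h3 := mul_le_mul_of_nonneg_left h (Nat.cast_nonneg (α := ℝ) (8 * κ))
    have h4 : ((8 * κ : ℕ) : ℝ) * s * d / α = ((8 * κ : ℕ) : ℝ) * (s * d / α) := by ring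
    rw [h4]
    push_cast at h3 ⊢
    linarith
  have h0 : (0 : ℝ) < sampleSize κ s d α := by
    rw [sampleSize]; positivity
  have h5 := Real.log_le_log h0 h1
  rw [Real.log_mul (by positivity) (by positivity)] at h5
  have h6 := log_le_self_mul (by positivity : (0 : ℝ) < 8 * κ + 2) (one_le_log hz)
  linarith

end

/-! ### Collecting the logarithmic factors for close points. -/

section

/-- The constant factor in the bound for close points. -/
def closeFactor (κ : ℕ) : ℝ :=
  32 * (8 * κ + 16) * (8 * κ + 6) + 96 * (20 * (8 * κ + 6) + 2) * (8 * κ + 6) + 528 * κ +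
    36 * κ ^ 2 * (8 * κ + 16) + 8 * (8 * κ + 16) * (8 * κ + 6) * (256 * κ + 71)

/-- The total distance to the sample is at most `K (τ + s)` with `K` of order `t³`, so its logarithm
adds only `O(log t)` to that of `(τ + s) / E + 1`. -/
theorem log_one_add_sample_bound_le {k s τ L B E t : ℝ} (hk : 0 ≤ k) (hs : 0 ≤ s) (hτ : 0 ≤ τ)
    (hL0 : 0 ≤ L) (hL : L ≤ 4 * k * t) (hB0 : 0 ≤ B) (hB : B ≤ 4 * t) (hE : 0 ≤ E) (ht : 1 ≤ t)
    (hlog : 1 ≤ Real.log t) :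
    Real.log (1 + (s * B + 4 * (L + 1) * τ * B ^ 2) / E) ≤
      (256 * k + 71) * Real.log t + Real.log ((τ + s) / E + 1) := by
  set K : ℝ := (256 * k + 68) * t ^ 3 with hK
  have ht2 : t ≤ t ^ 3 := by nlinarith [sq_nonneg t, mul_nonneg (sub_nonneg.2 ht) (sub_nonneg.2 ht)]
  have hK1 : 1 ≤ K := by nlinarith
  have h1 : B ≤ K := by nlinarith [mul_nonneg hk (by linarith : 0 ≤ t ^ 3)]
  have h2 : 4 * (L + 1) * B ^ 2 ≤ K := by
    have h3 : B ^ 2 ≤ (4 * t) ^ 2 := pow_le_pow_left₀ hB0 hB 2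
    have h4 : L + 1 ≤ (4 * k + 1) * t := by linarith
    calc 4 * (L + 1) * B ^ 2 ≤ 4 * ((4 * k + 1) * t) * (4 * t) ^ 2 := by gcongr
      _ ≤ K := by rw [hK]; nlinarith [mul_nonneg hk (by linarith : 0 ≤ t ^ 3)]
  have h3 : s * B + 4 * (L + 1) * τ * B ^ 2 ≤ K * (τ + s) := by
    nlinarith [mul_le_mul_of_nonneg_left h1 hs, mul_le_mul_of_nonneg_left h2 hτ]
  have h4 : 0 ≤ s * B + 4 * (L + 1) * τ * B ^ 2 := by positivity
  have h5 : 0 ≤ (τ + s) / E := by positivity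
  have h6 : (s * B + 4 * (L + 1) * τ * B ^ 2) / E ≤ K * ((τ + s) / E) := by
    rw [mul_div_assoc']
    exact div_le_div_of_nonneg_right h3 hE
  have h7 : 0 ≤ (s * B + 4 * (L + 1) * τ * B ^ 2) / E := div_nonneg h4 hE
  have h8 := Real.log_le_log (by linarith)
    (by linarith : 1 + (s * B + 4 * (L + 1) * τ * B ^ 2) / E ≤ K * ((τ + s) / E + 1))
  rw [Real.log_mul (by positivity) (by positivity), hK, Real.log_mul (by positivity) (by positivity),
    Real.log_pow] at h8
  have h9 := log_le_self_mul (by positivity : (0 : ℝ) < 256 * k + 68) hlog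
  push_cast at h8
  linarith

theorem close_arith {k ξ t q lam W L u v : ℝ} (hk : 0 ≤ k) (hq : 1 ≤ q) (ht : 1 ≤ t) (hu : 0 ≤ u)
    (hξ0 : 0 ≤ ξ) (hξ : ξ ≤ (8 * k + 16) * (8 * k + 6) * t) (hlam : lam ≤ (20 * (8 * k + 6) + 2) * q)
    (hW0 : 0 ≤ W) (hW : W ≤ (8 * k + 6) * t) (hL : L ≤ 4 * k * t)
    (hv : v ≤ (256 * k + 71) * q + u) :
    32 * ξ + 96 * lam * W + 132 * L + 36 * k ^ 2 * (8 * k + 16) + 8 * ξ * v ≤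
      (32 * (8 * k + 16) * (8 * k + 6) + 96 * (20 * (8 * k + 6) + 2) * (8 * k + 6) + 528 * k +
        36 * k ^ 2 * (8 * k + 16) + 8 * (8 * k + 16) * (8 * k + 6) * (256 * k + 71)) *
        t * q * (1 + u) := by
  have ht0 : 0 ≤ t := by linarith
  have htq : t ≤ t * q := by nlinarith
  have htq1 : 1 ≤ t * q := by nlinarith
  have a1 : 32 * ξ ≤ 32 * (8 * k + 16) * (8 * k + 6) * (t * q) := by
    calc 32 * ξ ≤ 32 * ((8 * k + 16) * (8 * k + 6) * t) := by linarith
      _ = 32 * (8 * k + 16) * (8 * k + 6) * t := by ring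
      _ ≤ _ := mul_le_mul_of_nonneg_left htq (by positivity)
  have a2 : 96 * lam * W ≤ 96 * (20 * (8 * k + 6) + 2) * (8 * k + 6) * (t * q) := by
    calc 96 * lam * W ≤ 96 * ((20 * (8 * k + 6) + 2) * q) * W :=
          mul_le_mul_of_nonneg_right (by linarith) hW0
      _ ≤ 96 * ((20 * (8 * k + 6) + 2) * q) * ((8 * k + 6) * t) :=
          mul_le_mul_of_nonneg_left hW (by positivity)
      _ = _ := by ring
  have a3 : 132 * L ≤ 528 * k * (t * q) := by
    calc 132 * L ≤ 528 * k * t := by linarith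
      _ ≤ _ := mul_le_mul_of_nonneg_left htq (by positivity)
  have a4 : 36 * k ^ 2 * (8 * k + 16) ≤ 36 * k ^ 2 * (8 * k + 16) * (t * q) :=
    le_mul_of_one_le_right (by positivity) htq1
  have a5 : 8 * ξ * v ≤ 8 * (8 * k + 16) * (8 * k + 6) * (256 * k + 71) * (t * q) * (1 + u) := by
    have hv' : v ≤ (256 * k + 71) * q * (1 + u) := by
      have : 0 ≤ ((256 * k + 71) * q - 1) * u :=
        mul_nonneg (by nlinarith) hu
      linarith
    calc 8 * ξ * v ≤ 8 * ξ * ((256 * k + 71) * q * (1 + u)) :=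
          mul_le_mul_of_nonneg_left hv' (by positivity)
      _ ≤ 8 * ((8 * k + 16) * (8 * k + 6) * t) * ((256 * k + 71) * q * (1 + u)) :=
          mul_le_mul_of_nonneg_right (by linarith) (by positivity)
      _ = _ := by ring
  have a6 : 0 ≤ (32 * (8 * k + 16) * (8 * k + 6) + 96 * (20 * (8 * k + 6) + 2) * (8 * k + 6) +
      528 * k + 36 * k ^ 2 * (8 * k + 16)) * (t * q) * u := by positivity
  linarith

/-- Local density forces `α ≤ 1`, so `s`, `d`, `1/δ`, `1/α` are all at most `z`, and every logarithm
in the bound is `O(log z)`. The factors `lam` and `log t` contribute one power of `log log z`. -/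
theorem separate_sampleTreeFamily_le_quasiLog {κ s d : ℕ} [NeZero s] [NeZero d] (hκ : 1 ≤ κ)
    {μ : PMF (Point s d)} {α τ γ δ : ℝ} (hα : 0 < α) (hτ : 0 < τ) (hγ : 0 < γ) (hδ : 0 < δ)
    (hδ1 : δ < 1) {x : Point s d} (hx : LocallyDense (κ * Nat.clog 2 d) μ α τ x)
    (y : Point s d) :
    (sampleTreeFamily (κ * Nat.clog 2 d) μ (sampleSize κ s d α) (((8 * κ + 16 : ℕ) : ℝ) *
      Real.log ((sampleSize κ s d α : ℝ) * s * d / δ)) γ).separate x y ≤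
      emd x y / γ * quasiLog (closeFactor κ) 1 ((s : ℝ) * d / (δ * α)) *
        (1 + Real.log ((τ + s) / emd x y + 1)) := by
  have hs1 : 1 ≤ s := Nat.pos_of_ne_zero (NeZero.ne s)
  have hd1 : 1 ≤ d := Nat.pos_of_ne_zero (NeZero.ne d)
  have hs : (1 : ℝ) ≤ s := by exact_mod_cast hs1
  have hd : (1 : ℝ) ≤ d := by exact_mod_cast hd1
  have hα1 := hx.le_one
  have hm2 : 2 ≤ sampleSize κ s d α := by rw [sampleSize]; omega
  have hξ1 := one_le_scale (κ := κ) hs1 hd1 hm2 hδ hδ1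
  set z : ℝ := max ((s : ℝ) * d / (δ * α)) 16 with hz
  have hz16 : 16 ≤ z := le_max_right _ _
  have hzle : (s : ℝ) * d / (δ * α) ≤ z := le_max_left _ _
  have hzle' : (s : ℝ) * d ≤ z * (δ * α) := (div_le_iff₀ (by positivity)).1 hzle
  have ht := one_le_log hz16
  have hq := one_le_log_log hz16
  have hδα : 0 < δ * α := by positivity
  have hsd : 1 ≤ (s : ℝ) * d := by nlinarith
  have hδα_le : δ * α ≤ α := by nlinarith
  have hδα_le' : δ * α ≤ δ := by nlinarith
  have hsz : (s : ℝ) ≤ z := by nlinarith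
  have hdz : (d : ℝ) ≤ z := by nlinarith
  have hsdα : (s : ℝ) * d / α ≤ z := by rw [div_le_iff₀ hα]; nlinarith
  have hδz : 1 / δ ≤ z := by rw [div_le_iff₀ hδ]; nlinarith
  have hαz : 1 / α ≤ z := by rw [div_le_iff₀ hα]; nlinarith
  have hlogs := Real.log_le_log (by linarith) hsz
  have hlogd := Real.log_le_log (by linarith) hdz
  have hlogδ := Real.log_le_log (by positivity) hδz
  have hlogα := Real.log_le_log (by positivity) hαz
  rw [one_div, Real.log_inv] at hlogδ hlogα
  have hlogm := log_sampleSize_le (κ := κ) hs1 hd1 hα hz16 hsdα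
  set m := sampleSize κ s d α with hm
  have hm0 : (0 : ℝ) < m := by exact_mod_cast (by omega : 0 < m)
  set t := Real.log z with htdef
  have hW : Real.log ((m : ℝ) * s * (d + 1)) ≤ (8 * κ + 6) * t := by
    have h1 : Real.log ((d : ℝ) + 1) ≤ t + Real.log 2 := by
      rw [htdef, ← Real.log_mul (by positivity) (by norm_num)]
      exact Real.log_le_log (by positivity) (by linarith)
    rw [Real.log_mul (by positivity) (by positivity), Real.log_mul (by positivity) (by positivity)]
    linarith [Real.log_two_lt_d9]
  have hW0 : 0 ≤ Real.log ((m : ℝ) * s * (d + 1)) := by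
    refine Real.log_nonneg ?_
    exact_mod_cast Nat.mul_pos (Nat.mul_pos (by omega : 0 < m) hs1) (Nat.succ_pos d)
  have hN : Real.log ((m : ℝ) * s * d / δ) ≤ (8 * κ + 6) * t := by
    rw [Real.log_div (by positivity) (by positivity), Real.log_mul (by positivity) (by positivity),
      Real.log_mul (by positivity) (by positivity)]
    linarith
  set ξ : ℝ := ((8 * κ + 16 : ℕ) : ℝ) * Real.log ((m : ℝ) * s * d / δ) with hξ
  have hξle : ξ ≤ (8 * (κ : ℝ) + 16) * (8 * κ + 6) * t := by
    rw [hξ, show ((8 * κ + 16 : ℕ) : ℝ) = 8 * (κ : ℝ) + 16 by push_cast; ring,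
      mul_assoc (8 * (κ : ℝ) + 16) _ t]
    exact mul_le_mul_of_nonneg_left hN (by positivity)
  have hLle : ((κ * Nat.clog 2 d : ℕ) : ℝ) ≤ 4 * κ * t := by
    have := mul_le_mul_of_nonneg_left (clog_le_log hd1 ht hlogd) (Nat.cast_nonneg (α := ℝ) κ)
    push_cast
    linarith
  obtain ⟨lam, hlam1, hlam2⟩ := exists_two_pow_ge (e := 8 * (κ : ℝ) + 6)
    (by linarith [Nat.cast_nonneg (α := ℝ) κ]) ht hq
  set B := Real.log (4 * s ^ 2 / α) with hB
  have hlog4 : Real.log 4 ≤ t := Real.log_le_log (by norm_num) (by linarith)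
  have hBle : B ≤ 4 * t := by
    rw [hB, Real.log_div (by positivity) (by positivity), Real.log_mul (by norm_num) (by positivity),
      Real.log_pow]
    push_cast
    linarith
  have hBge : 1 / 2 ≤ B := by
    refine half_le_log_two.trans (Real.log_le_log (by norm_num) ?_)
    rw [le_div_iff₀ hα]
    nlinarith
  have hmge : ((8 * κ : ℕ) : ℝ) * s * d / α ≤ m := by
    rw [hm, sampleSize]
    push_cast
    linarith [Nat.lt_floor_add_one (8 * (κ : ℝ) * s * d / α)]
  have hE := emd_nonneg x y
  have hmain := separate_le_of_sample_real_le hκ hs1 hm2 hδ hδ1 hγ hτ.le hBge μ x y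
    (by linarith : 4 * Real.log ((m : ℝ) * s * (d + 1)) ≤ 2 ^ lam) hξ
    (hx.sample_real_le hκ hs1 hα hτ hmge)
  have hu : 0 ≤ Real.log ((τ + s) / emd x y + 1) :=
    Real.log_nonneg (by have : 0 ≤ (τ + s) / emd x y := by positivity
                        linarith)
  have hv := log_one_add_sample_bound_le (Nat.cast_nonneg (α := ℝ) κ) (Nat.cast_nonneg s) hτ.le
    (Nat.cast_nonneg _) hLle (by linarith) hBle hE ht hq
  have harith := close_arith (Nat.cast_nonneg (α := ℝ) κ) hq ht hu (by linarith) hξle hlam2 hW0 hW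
    hLle hv
  refine hmain.trans ?_
  rw [quasiLog, pow_one, ← hz, ← htdef]
  rw [show ((8 * κ + 16 : ℕ) : ℝ) = 8 * (κ : ℝ) + 16 by push_cast; ring]
  calc _ ≤ emd x y * (closeFactor κ * t * Real.log t * (1 + Real.log ((τ + s) / emd x y + 1))) / γ :=
        div_le_div_of_nonneg_right (mul_le_mul_of_nonneg_left harith hE) hγ.le
    _ = _ := by ring

theorem mul_pow_self_mono {T T' : ℕ} (h : T ≤ T') {X : ℝ} (hX : 1 ≤ X) :
    (T : ℝ) * X ^ T ≤ T' * X ^ T' :=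
  mul_le_mul (by exact_mod_cast h) (pow_le_pow_right₀ hX h) (by positivity) (by positivity)

end

end

theorem mainTheorem6 (κ : ℕ) (hκ : 2 ≤ κ) :
    ∃ (C₀ C₁ : ℝ) (C₂ C₃ : ℕ) (m : ℕ → ℕ → ℝ → ℕ) (init query : Prog),
      ∀ (s d : ℕ) [NeZero s] [NeZero d] (μ : PMF (Point s d)) (α τ γ δ : ℝ),
        0 < α → 0 < τ → 0 < γ → 0 < δ → δ < 1 →
        let L : ℕ := κ * Nat.clog 2 d
        let ξ : ℝ := C₀ * Real.log ((m s d α : ℝ) * s * d / δ)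
        let H := sampleTreeFamily L μ (m s d α) ξ γ
        (∀ x y : Point s d, LocallyDense L μ α τ x →
          H.separate x y ≤ emd x y / γ * quasiLog C₁ C₂ ((s : ℝ) * d / (δ * α)) *
            (1 + Real.log ((τ + s) / emd x y + 1))) ∧
        (∀ x y : Point s d, H.collide x y ≤ Real.exp (-(emd x y / γ)) + δ) ∧
        (∀ (n : ℕ) (pts : Fin n → Point s d) (wt : Fin n → ℝ),
          (∀ i, 0 ≤ wt i) →
          (∀ p : Point s d, (μ p).toReal = ∑ i, if pts i = p then wt i else 0) →
          Maintains init query (inputMemory pts wt α τ γ δ) H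
            ((n : ℝ) * (C₃ * ((s : ℝ) * d / min α 1) ^ C₃))
            (C₃ * ((s : ℝ) * d) ^ C₃)) := by
  obtain ⟨T, hT⟩ := polyBounded_initTime κ
  obtain ⟨T', hT'⟩ := polyBounded_queryTime κ
  -- The power of `log log z` is `1`, and one exponent, the larger of the two, serves both time
  -- bounds.
  refine ⟨((8 * κ + 16 : ℕ) : ℝ), closeFactor κ, 1, max T T', sampleSize κ,
    initProg κ (8 * κ + 16), queryProg, ?_⟩
  intro s d _ _ μ α τ γ δ hα hτ hγ hδ hδ1 L ξ H
  refine ⟨fun x y hx => separate_sampleTreeFamily_le_quasiLog (by omega) hα hτ hγ hδ hδ1 hx y,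
    fun x y => collide_sampleTreeFamily_le (by rw [sampleSize]; omega) μ hγ hδ hδ1 x y,
    fun n pts wt hw hp => maintains_sampleTreeFamily (T := max T T') (T' := max T T')
      (fun p => (hT p).trans (mul_pow_self_mono (le_max_left _ _) p.one_le_scale))
      (fun p => (hT' p).trans (mul_pow_self_mono (le_max_right _ _) p.one_le_scale))
      hα hγ hδ hδ1 hw hp⟩
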